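/- **Definitions.** For a pair of positive weights $\mathbf w=(w_1,w_2)$ and $n\in\mathbb R$ let $\mathcal P_{\mathbf w}(n)$ be the space of real polynomials in $(x,y)$ all of whose monomials $x^iy^j$ satisfy $w_1i+w_2j\le n$. Let $\Omega\subset\mathbb R^2$ be a connected open set that coincides with the interior of its closure, let $\mathbf L f=\sum_{i,j}g^{ij}\partial_{ij}f+\sum_i b^i\partial_i f$ be an operator whose coefficients are continuous on $\Omega$ and for which $g=(g^{ij})$ is symmetric positive definite on $\Omega$, and let $\mu(dx)=\rho(x)\,dx$ be a probability measure on $\Omega$ with $\rho\ge0$ continuous on $\Omega$, such that the polynomials lie in $L^2(\Omega,\mu)$ and are dense in it. The triple $(\Omega,\mathbf L,\mu)$ is a *solution of the $\mathbf w$-DOP problem* if for every $n$ the space $\mathcal P_{\mathbf w}(n)$ has a $\mu$-orthogonal basis of eigenvectors of $\mathbf L$; it is a *solution of the $(1,\infty)$-DOP problem* if it is a solution of the $(1,w)$-DOP problem for some real $w>2$. A *$(1,\infty)$-admissible change of variables* is a map $\Phi(x,y)=(\alpha x+\beta,\ \gamma y+p(x))$ with $\alpha\gamma\ne0$ and $p$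 a real polynomial; it acts on triples by $\Omega\mapsto\Phi(\Omega)$, $\mathbf L\mapsto\big(f\mapsto \mathbf L(f\circ\Phi)\circ\Phi^{-1}\big)$, $\mu\mapsto\Phi_*\mu$. **Theorem.** A triple $(\Omega,\mathbf L,\mu)$, where $\mathbf L$ has the coefficients $g^{ij},b^i$ and $\mu=\rho\,dx$, is a solution of the $(1,\infty)$-DOP problem in $\mathbb R^2$ with $\Omega$ bounded if and only if $\mathbf L f=\frac1\rho\sum_{i,j}\partial_i(g^{ij}\rho\,\partial_jf)$ on $\Omega$ (that is, $\rho\, b^i=\sum_j\partial_j(g^{ij}\rho)$ for each $i$) and, after some $(1,\infty)$-admissible change of variables and multiplication of $g$ by some positive constant, $(\Omega,g,\rho)$ is one of the following, where $\rho$ is given without the normalizing constant $1/\int_\Omega\rho\,dx$. * **(B4)** For some integers $m,n\ge1$ and some real $c_{02}<0$, with $\Gamma=(1-x)^m(1+x)^n-y^2$: $$g=\begin{pmatrix}1-x^2&\tfrac12\big((n-m)-(n+m)x\big)y\\ \tfrac12\big((n-m)-(n+m)x\big)y&\tfrac14\big((n-m)-(n+m)x\big)^2(1-x)^{m-1}(1+x)^{n-1}-c_{02}\Gamma\end{pmatrix},$$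 $\Omega=\{\Gamma>0\}\cap\{x^2<1\}$, which is the only bounded connected component of $\mathbb R^2\setminus\{\Gamma=0\}$, and - if $m$ or $n$ is odd, $\rho=\Gamma^{p-1}$ with $p>\max\big(0,\tfrac12-\tfrac1n,\tfrac12-\tfrac1m\big)$; - if $m$ and $n$ are even, $\rho=\big((1-x)^{m/2}(1+x)^{n/2}+y\big)^{p-1}\big((1-x)^{m/2}(1+x)^{n/2}-y\big)^{q-1}$ with $p,q>0$ and $p+q>\max\big(1-\tfrac2n,1-\tfrac2m\big)$. * **(B5)** For some integer $n\ge1$ and some real $c_{02}\le0$, with $\Gamma=x\Gamma_2$ and $\Gamma_2=(1-x)^n-y^2$: $$g=\begin{pmatrix}x(1-x)&-\tfrac12nxy\\-\tfrac12nxy&\tfrac14n^2x(1-x)^{n-1}-c_{02}\Gamma_2\end{pmatrix},$$ $\Omega=\{\Gamma>0\}\cap\{0<x<1\}$, which is the only bounded connected component of $\mathbb R^2\setminus\{\Gamma=0\}$, and - if $n$ is odd, $\rho=x^{r-1}\Gamma_2^{p-1}$ with $r>0$ and $p>\max\big(0,\tfrac12-\tfrac1n\big)$; - if $n$ is even, $\rho=x^{r-1}\big((1-x)^{n/2}+y\big)^{p-1}\big((1-x)^{n/2}-y\big)^{q-1}$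 with $p,q,r>0$ and $p+q>1-\tfrac2n$. * **(Square)** $\Omega=(-1,1)^2$, $g=\operatorname{diag}\big(1-x^2,\,-c_{02}(1-y^2)\big)$ for some real $c_{02}<0$, and $\rho=(1-x)^{p-1}(1+x)^{q-1}(1-y)^{r-1}(1+y)^{s-1}$ with $p,q,r,s>0$. -/

import Mathlib

open MeasureTheory

noncomputable section

/-! ### Weighted diffusion orthogonal polynomial problem in `ℝ^d` -/

/-- The space of real polynomials of weighted degree at most `n` for the weights `w`
(it contains the zero polynomial for every `n`). -/
def weightedDegreeLE {d : ℕ} (w : Fin d → ℝ) (n : ℝ) :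
    Submodule ℝ (MvPolynomial (Fin d) ℝ) :=
  MvPolynomial.restrictSupport ℝ {k : Fin d →₀ ℕ | ∑ i, w i * (k i : ℝ) ≤ n}

/-- The operator `L = ∑ g^{ij} ∂_{ij} + ∑ b^i ∂_i`, applied to a polynomial and evaluated
at the point `z`. -/
def diffusionOp {d : ℕ} (g : (Fin d → ℝ) → Matrix (Fin d) (Fin d) ℝ)
    (b : (Fin d → ℝ) → Fin d → ℝ) (P : MvPolynomial (Fin d) ℝ) (z : Fin d → ℝ) : ℝ :=
  (∑ i, ∑ j, g z i j * MvPolynomial.eval z (MvPolynomial.pderiv i (MvPolynomial.pderiv j P))) +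
    ∑ i, b z i * MvPolynomial.eval z (MvPolynomial.pderiv i P)

/-- The measure `ρ(x) dx` on `Ω`. -/
def densityMeasure {d : ℕ} (Ω : Set (Fin d → ℝ)) (ρ : (Fin d → ℝ) → ℝ) :
    Measure (Fin d → ℝ) :=
  (volume.restrict Ω).withDensity fun z => ENNReal.ofReal (ρ z)

/-- `(Ω, L, μ)` with `L = ∑ g^{ij} ∂_{ij} + ∑ b^i ∂_i` and `μ(dx) = ρ(x) dx` is a solution of the
diffusion orthogonal polynomial problem with weights `w`. The functions `g`, `b`, `ρ` matter
only on `Ω`. -/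
structure IsDOPSolution {d : ℕ} (w : Fin d → ℝ) (Ω : Set (Fin d → ℝ))
    (g : (Fin d → ℝ) → Matrix (Fin d) (Fin d) ℝ) (b : (Fin d → ℝ) → Fin d → ℝ)
    (ρ : (Fin d → ℝ) → ℝ) : Prop where
  weights_pos : ∀ i, 0 < w i
  isOpen : IsOpen Ω
  isConnected : IsConnected Ω
  interior_closure : interior (closure Ω) = Ω
  continuousOn_cometric : ContinuousOn g Ω
  continuousOn_drift : ContinuousOn b Ω
  /-- ellipticity: the matrix `(g^{ij})` is symmetric and positive definite on `Ω` -/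
  elliptic : ∀ z ∈ Ω, (g z).PosDef
  continuousOn_density : ContinuousOn ρ Ω
  density_nonneg : ∀ z ∈ Ω, 0 ≤ ρ z
  isProbabilityMeasure : IsProbabilityMeasure (densityMeasure Ω ρ)
  /-- polynomials belong to `L²(Ω, μ)` and are dense in it -/
  memLp : ∀ P : MvPolynomial (Fin d) ℝ,
    MemLp (fun z => MvPolynomial.eval z P) 2 (densityMeasure Ω ρ)
  dense : ∀ f : (Fin d → ℝ) → ℝ, MemLp f 2 (densityMeasure Ω ρ) → ∀ ε : ENNReal, 0 < ε →
    ∃ P : MvPolynomial (Fin d) ℝ,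
      eLpNorm (fun z => f z - MvPolynomial.eval z P) 2 (densityMeasure Ω ρ) < ε
  /-- each space of polynomials of bounded weighted degree has a `μ`-orthogonal basis of
  eigenvectors of `L` -/
  eigenbasis : ∀ n : ℝ, ∃ (N : ℕ) (e : Module.Basis (Fin N) ℝ (weightedDegreeLE w n)),
    (∀ i j, i ≠ j → ∫ z, MvPolynomial.eval z (e i : MvPolynomial (Fin d) ℝ) *
        MvPolynomial.eval z (e j : MvPolynomial (Fin d) ℝ) ∂(densityMeasure Ω ρ) = 0) ∧
    ∀ i, ∃ θ : ℝ, ∀ z ∈ Ω, diffusionOp g b (e i : MvPolynomial (Fin d) ℝ) z =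
      θ * MvPolynomial.eval z (e i : MvPolynomial (Fin d) ℝ)

/-- Solutions in the plane for the weights `(1, ∞)`: solutions for the weights `(1, w)` for some
real `w > 2`. -/
def IsOneInftyDOPSolution (Ω : Set (Fin 2 → ℝ)) (g : (Fin 2 → ℝ) → Matrix (Fin 2) (Fin 2) ℝ)
    (b : (Fin 2 → ℝ) → Fin 2 → ℝ) (ρ : (Fin 2 → ℝ) → ℝ) : Prop :=
  ∃ w : ℝ, 2 < w ∧ IsDOPSolution ![1, w] Ω g b ρ

/-- `L` is the operator `f ↦ ρ⁻¹ ∑_{i,j} ∂_i (g^{ij} ρ ∂_j f)` on `Ω`, expressed through its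
first order coefficients: `ρ b^i = ∑_j ∂_j (g^{ij} ρ)`. -/
def HasDivergenceForm {d : ℕ} (Ω : Set (Fin d → ℝ))
    (g : (Fin d → ℝ) → Matrix (Fin d) (Fin d) ℝ) (b : (Fin d → ℝ) → Fin d → ℝ)
    (ρ : (Fin d → ℝ) → ℝ) : Prop :=
  ∀ z ∈ Ω, ∀ i, ρ z * b z i =
    ∑ j, fderiv ℝ (fun u : Fin d → ℝ => g u i j * ρ u) z (Pi.single j 1)

/-! ### Admissible changes of variables for the weights `(1, ∞)` -/

/-- The data of a change of variables `(x, y) ↦ (α x + β, γ y + p(x))`, `α γ ≠ 0`, with an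
arbitrary polynomial `p`. -/
structure AdmissibleChange where
  α : ℝ
  β : ℝ
  γ : ℝ
  p : Polynomial ℝ
  α_ne_zero : α ≠ 0
  γ_ne_zero : γ ≠ 0

namespace AdmissibleChange

/-- The bijection `(x, y) ↦ (α x + β, γ y + p(x))` of the plane. -/
def toEquiv (Φ : AdmissibleChange) : (Fin 2 → ℝ) ≃ (Fin 2 → ℝ) where
  toFun z := ![Φ.α * z 0 + Φ.β, Φ.γ * z 1 + Φ.p.eval (z 0)]
  invFun z := ![(z 0 - Φ.β) / Φ.α, (z 1 - Φ.p.eval ((z 0 - Φ.β) / Φ.α)) / Φ.γ]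
  left_inv z := by
    have h := Φ.α_ne_zero
    have h' := Φ.γ_ne_zero
    ext i
    fin_cases i <;> simp [h, h']
  right_inv z := by
    have h := Φ.α_ne_zero
    have h' := Φ.γ_ne_zero
    ext i
    fin_cases i <;> simp [mul_div_cancel₀, h, h']

/-- The Jacobian matrix of the change of variables. -/
def jacobian (Φ : AdmissibleChange) (z : Fin 2 → ℝ) : Matrix (Fin 2) (Fin 2) ℝ :=
  !![Φ.α, 0; Φ.p.derivative.eval (z 0), Φ.γ]

/-- The cometric of the operator `f ↦ L(f ∘ Φ) ∘ Φ⁻¹`, where `g` is the cometric of `L`. -/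
def pushCometric (Φ : AdmissibleChange) (g : (Fin 2 → ℝ) → Matrix (Fin 2) (Fin 2) ℝ)
    (z : Fin 2 → ℝ) : Matrix (Fin 2) (Fin 2) ℝ :=
  let u := Φ.toEquiv.symm z
  Φ.jacobian u * g u * (Φ.jacobian u).transpose

/-- The density of the image under `Φ` of the measure with density `ρ`. -/
def pushDensity (Φ : AdmissibleChange) (ρ : (Fin 2 → ℝ) → ℝ) (z : Fin 2 → ℝ) : ℝ :=
  ρ (Φ.toEquiv.symm z) / |Φ.α * Φ.γ|

end AdmissibleChange

/-! ### The model domains, cometrics and densities (`x = z 0`, `y = z 1`) -/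

/-- `U` is the only bounded connected component of the complement of `{Γ = 0}`. -/
def IsOnlyBoundedComponent (U : Set (Fin 2 → ℝ)) (Γ : (Fin 2 → ℝ) → ℝ) : Prop :=
  ∀ C : Set (Fin 2 → ℝ),
    ((∃ z, Γ z ≠ 0 ∧ C = connectedComponentIn {u | Γ u ≠ 0} z) ∧ Bornology.IsBounded C) ↔ C = U

/-- On `U`, `ρ` is the function `F` times the normalizing constant `1 / ∫_U F`. -/
def IsNormalizedDensity (U : Set (Fin 2 → ℝ)) (F ρ : (Fin 2 → ℝ) → ℝ) : Prop :=
  ∀ z ∈ U, ρ z = F z / ∫ u in U, F u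

/-- `Γ = (1-x)^m (1+x)^n - y²`. -/
def biangleGamma (m n : ℕ) (z : Fin 2 → ℝ) : ℝ :=
  (1 - z 0) ^ m * (1 + z 0) ^ n - z 1 ^ 2

/-- `{Γ > 0} ∩ {x² < 1}`. -/
def biangle (m n : ℕ) : Set (Fin 2 → ℝ) :=
  {z | 0 < biangleGamma m n z ∧ z 0 ^ 2 < 1}

/-- The cometric on the biangle; it is used for `m, n ≥ 1` only. -/
def biangleCometric (m n : ℕ) (c : ℝ) (z : Fin 2 → ℝ) : Matrix (Fin 2) (Fin 2) ℝ :=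
  !![1 - z 0 ^ 2, (1 / 2) * (((n : ℝ) - m) - ((n : ℝ) + m) * z 0) * z 1;
    (1 / 2) * (((n : ℝ) - m) - ((n : ℝ) + m) * z 0) * z 1,
    (1 / 4) * (((n : ℝ) - m) - ((n : ℝ) + m) * z 0) ^ 2 * (1 - z 0) ^ (m - 1) * (1 + z 0) ^ (n - 1)
      - c * biangleGamma m n z]

/-- The second factor `Γ₂ = (1-x)^n - y²`. -/
def triangleGamma₂ (n : ℕ) (z : Fin 2 → ℝ) : ℝ :=
  (1 - z 0) ^ n - z 1 ^ 2

/-- `Γ = x Γ₂`. -/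
def triangleGamma (n : ℕ) (z : Fin 2 → ℝ) : ℝ :=
  z 0 * triangleGamma₂ n z

/-- `{Γ > 0} ∩ {0 < x < 1}`. -/
def triangle (n : ℕ) : Set (Fin 2 → ℝ) :=
  {z | 0 < triangleGamma n z ∧ 0 < z 0 ∧ z 0 < 1}

/-- The cometric on the triangle; it is used for `n ≥ 1` only. -/
def triangleCometric (n : ℕ) (c : ℝ) (z : Fin 2 → ℝ) : Matrix (Fin 2) (Fin 2) ℝ :=
  !![z 0 * (1 - z 0), -(1 / 2) * (n : ℝ) * z 0 * z 1;
    -(1 / 2) * (n : ℝ) * z 0 * z 1,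
    (1 / 4) * (n : ℝ) ^ 2 * z 0 * (1 - z 0) ^ (n - 1) - c * triangleGamma₂ n z]

/-- The open square `(-1, 1)²`. -/
def square : Set (Fin 2 → ℝ) :=
  {z | z 0 ^ 2 < 1 ∧ z 1 ^ 2 < 1}

/-- The cometric `diag(1 - x², -c (1 - y²))` on the square. -/
def squareCometric (c : ℝ) (z : Fin 2 → ℝ) : Matrix (Fin 2) (Fin 2) ℝ :=
  !![1 - z 0 ^ 2, 0; 0, -c * (1 - z 1 ^ 2)]

/-- The density on the biangle, up to the normalizing constant, is one of the listed ones. -/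
def IsBiangleDensity (m n : ℕ) (ρ : (Fin 2 → ℝ) → ℝ) : Prop :=
  ((Odd m ∨ Odd n) ∧ ∃ p : ℝ,
      0 < p ∧ (1 / 2 : ℝ) - 1 / n < p ∧ (1 / 2 : ℝ) - 1 / m < p ∧
      IsNormalizedDensity (biangle m n) (fun z => biangleGamma m n z ^ (p - 1)) ρ) ∨
  (Even m ∧ Even n ∧ ∃ p q : ℝ,
      0 < p ∧ 0 < q ∧ (1 : ℝ) - 2 / n < p + q ∧ (1 : ℝ) - 2 / m < p + q ∧
      IsNormalizedDensity (biangle m n) (fun z =>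
        ((1 - z 0) ^ (m / 2) * (1 + z 0) ^ (n / 2) + z 1) ^ (p - 1) *
        ((1 - z 0) ^ (m / 2) * (1 + z 0) ^ (n / 2) - z 1) ^ (q - 1)) ρ)

/-- The density on the triangle, up to the normalizing constant, is one of the listed ones. -/
def IsTriangleDensity (n : ℕ) (ρ : (Fin 2 → ℝ) → ℝ) : Prop :=
  (Odd n ∧ ∃ p r : ℝ,
      0 < r ∧ 0 < p ∧ (1 / 2 : ℝ) - 1 / n < p ∧
      IsNormalizedDensity (triangle n) (fun z =>
        z 0 ^ (r - 1) * triangleGamma₂ n z ^ (p - 1)) ρ) ∨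
  (Even n ∧ ∃ p q r : ℝ,
      0 < p ∧ 0 < q ∧ 0 < r ∧ (1 : ℝ) - 2 / n < p + q ∧
      IsNormalizedDensity (triangle n) (fun z =>
        z 0 ^ (r - 1) * ((1 - z 0) ^ (n / 2) + z 1) ^ (p - 1) *
        ((1 - z 0) ^ (n / 2) - z 1) ^ (q - 1)) ρ)

/-- The density on the square is a normalized product of two Jacobi densities. -/
def IsSquareDensity (ρ : (Fin 2 → ℝ) → ℝ) : Prop :=
  ∃ p q r s : ℝ, 0 < p ∧ 0 < q ∧ 0 < r ∧ 0 < s ∧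
    IsNormalizedDensity square (fun z =>
      (1 - z 0) ^ (p - 1) * (1 + z 0) ^ (q - 1) *
      ((1 - z 1) ^ (r - 1) * (1 + z 1) ^ (s - 1))) ρ

end

namespace WeightedDOP

open Set Filter Topology

/-! ### Approximation of `C¹` test functions by polynomials -/

/-! The weights control the coefficients. Applying L to x, y, x², xy, y² gives b¹ = β(x), b² = c y +
d(x), g¹¹ = G(x), g¹² = l(x) y + r(x), g²² = a y² + p(x) y + q(x) with deg G ≤ 2 and deg l, deg β ≤
1; the bound w > 2 keeps y out of L(x²). Symmetry of L and L1 = 0 give ∫ (bⁱ P + Σ gⁱʲ ∂ⱼP) dμ = 0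
for every polynomial P (`integral_coordinate_eq_zero`). All information on μ is drawn from these
weak identities, because ρ is only continuous and nonnegative at the outset and nothing is known
about the boundary of Ω.

A one-dimensional principle is used twice: if ∫ (f β + f' G) dσ = 0 for all C¹ functions f, then G
vanishes at the endpoints of the support of σ (`eq_zero_at_left_endpoint`). For the x-marginal it
shows that Ω projects onto the interval between two simple roots of G (`exists_interval`). The field
∇x = G ∂ₓ + (l y + r) ∂_y is affine in y, so it has a first integral u = (y - t(x)) / s(x), where s
is a product of powers of the distances to the two ends. In the coordinates (x, u) the first weak
identity says that μ is the product of a Jacobi weight in x and a law σ of u (`exists_map_eq_prod`).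
The combination G ∇y - g¹² ∇x = (det g) ∂_y is vertical, which yields a Pearson equation on every
fibre, with leading coefficient det g, quadratic in y. By the endpoint principle det g = A(x) ((y -
t)² - s²) after recentring and rescaling, and σ is a Jacobi law (`exists_jacobi_of_pearson`). Hence
Ω is the strip |y - t| < s and ρ is explicit.

The rest of the classification is arithmetic. The coefficients of det g are polynomials, so t and s²
are rational; they solve linear equations whose leading coefficient G has simple roots, and
comparing pole orders shows that they are polynomials (`exists_polynomial_eq_of_ode`). A shear
removes t, and s² becomes a constant times (xr - x)^m (x - xl)^n. Unequal transverse exponents make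
s itself rational, so m and n are then even. At an end where the exponent of s is nonzero, the
x-exponent of the measure is determined. According to whether two, one or none of m, n are nonzero,
an affine normalization gives the biangle, the triangle or the square, and ellipticity becomes the
sign condition on c₀₂.

For the converse all models are written in the common form `IsGeneral`, and an affine change brings
them back to a shear of the original coordinates. Integration by parts in (x, u) has no boundary
terms, so L is symmetric on polynomials. Its coefficients are polynomials, and a sufficiently large
w makes every weighted degree space invariant. The spectral theorem then provides the eigenbases,
and Stone–Weierstrass on the compact closure of Ω the density of polynomials. -/

theorem exists_derivative_eq (q : Polynomial ℝ) : ∃ p : Polynomial ℝ, p.derivative = q := by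
  induction q using Polynomial.induction_on' with
  | add p q hp hq =>
    obtain ⟨p', rfl⟩ := hp
    obtain ⟨q', rfl⟩ := hq
    exact ⟨p' + q', by simp⟩
  | monomial n c =>
    refine ⟨Polynomial.monomial (n + 1) (c / (n + 1)), ?_⟩
    rw [Polynomial.derivative_monomial]
    congr 1
    push_cast
    field_simp

/-- Approximate f' uniformly and integrate, matching f at A; the mean value inequality bounds the
error of f by the length of the interval times that of f'. The tolerance ε / (1 + (B - A)) makes
both errors at most ε. -/
theorem exists_polynomial_C1_near {f f' : ℝ → ℝ} (hf : ∀ x, HasDerivAt f (f' x) x)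
    (hf' : Continuous f') (A B : ℝ) {ε : ℝ} (hε : 0 < ε) :
    ∃ p : Polynomial ℝ, ∀ x ∈ Icc A B,
      |f x - p.eval x| ≤ ε ∧ |f' x - p.derivative.eval x| ≤ ε := by
  rcases lt_or_ge B A with hBA | hAB
  · exact ⟨0, fun x hx => absurd (hx.1.trans hx.2) (not_le.mpr hBA)⟩
  have hd : 0 < 1 + (B - A) := by linarith
  obtain ⟨q, hq⟩ := exists_polynomial_near_of_continuousOn A B f' hf'.continuousOn
    (ε / (1 + (B - A))) (by positivity)
  obtain ⟨p0, rfl⟩ := exists_derivative_eq q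
  set p := p0 + Polynomial.C (f A - p0.eval A) with hp
  have hpd : p.derivative = p0.derivative := by simp [hp]
  have hle : ε / (1 + (B - A)) ≤ ε := div_le_self hε.le (by linarith)
  refine ⟨p, fun x hx => ⟨?_, ?_⟩⟩
  · have := (convex_Icc A B).norm_image_sub_le_of_norm_hasDerivWithin_le
      (f := fun x => f x - p.eval x) (f' := fun x => f' x - p.derivative.eval x)
      (C := ε / (1 + (B - A))) (x := A) (y := x)
      (fun y _ => ((hf y).sub (p.hasDerivAt y)).hasDerivWithinAt)
      (fun y hy => by
        rw [hpd, Real.norm_eq_abs, abs_sub_comm]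
        exact (hq y hy).le) (left_mem_Icc.2 hAB) hx
    have h0 : f A - p.eval A = 0 := by simp [hp]
    simp only [h0, sub_zero, Real.norm_eq_abs] at this
    refine this.trans ?_
    rw [abs_of_nonneg (by linarith [hx.1] : 0 ≤ x - A), div_mul_eq_mul_div, div_le_iff₀ hd]
    exact mul_le_mul_of_nonneg_left (by linarith [hx.2]) hε.le
  · rw [hpd, abs_sub_comm]
    exact (hq x hx).le.trans hle

theorem integrable_comp_mul {X : Type*} [MeasurableSpace X] {μ : Measure X} {ξ : X → ℝ}
    (hξ : Measurable ξ) {A B : ℝ} (hAB : ∀ᵐ x ∂μ, ξ x ∈ Icc A B) {v : X → ℝ}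
    (hv : Integrable v μ) {f : ℝ → ℝ} (hf : Continuous f) :
    Integrable (fun x => f (ξ x) * v x) μ := by
  obtain ⟨C, hC⟩ := (isCompact_Icc (a := A) (b := B)).exists_bound_of_continuousOn hf.continuousOn
  refine hv.bdd_mul (c := C) (hf.measurable.comp hξ).aestronglyMeasurable ?_
  filter_upwards [hAB] with x hx using hC _ hx

/-- The functional is continuous for the C¹ norm on [A, B], and polynomials are dense for that norm.
-/
theorem integral_C1_of_polynomial {X : Type*} [MeasurableSpace X] {μ : Measure X} {ξ : X → ℝ}
    (hξ : Measurable ξ) {A B : ℝ} (hAB : ∀ᵐ x ∂μ, ξ x ∈ Icc A B) {v₁ v₂ : X → ℝ}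
    (hv₁ : Integrable v₁ μ) (hv₂ : Integrable v₂ μ)
    (H : ∀ p : Polynomial ℝ, ∫ x, (p.eval (ξ x) * v₁ x + p.derivative.eval (ξ x) * v₂ x) ∂μ = 0)
    {f f' : ℝ → ℝ} (hf : ∀ x, HasDerivAt f (f' x) x) (hf' : Continuous f') :
    ∫ x, (f (ξ x) * v₁ x + f' (ξ x) * v₂ x) ∂μ = 0 := by
  have hfc : Continuous f := continuous_iff_continuousAt.2 fun x => (hf x).continuousAt
  set K := (∫ x, |v₁ x| ∂μ) + ∫ x, |v₂ x| ∂μ with hK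
  have hK0 : 0 ≤ K := add_nonneg (integral_nonneg fun _ => abs_nonneg _)
    (integral_nonneg fun _ => abs_nonneg _)
  have key : ∀ ε > 0, |∫ x, (f (ξ x) * v₁ x + f' (ξ x) * v₂ x) ∂μ| ≤ ε * K := by
    intro ε hε
    obtain ⟨p, hp⟩ := exists_polynomial_C1_near hf hf' A B hε
    have e : ∫ x, (f (ξ x) * v₁ x + f' (ξ x) * v₂ x) ∂μ =
        ∫ x, ((f (ξ x) - p.eval (ξ x)) * v₁ x + (f' (ξ x) - p.derivative.eval (ξ x)) * v₂ x) ∂μ := by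
      rw [← sub_zero (∫ x, (f (ξ x) * v₁ x + f' (ξ x) * v₂ x) ∂μ), ← H p, ← integral_sub]
      · congr 1; ext x; ring
      · exact (integrable_comp_mul hξ hAB hv₁ hfc).add (integrable_comp_mul hξ hAB hv₂ hf')
      · exact (integrable_comp_mul hξ hAB hv₁ p.continuous).add
          (integrable_comp_mul hξ hAB hv₂ p.derivative.continuous)
    rw [e, hK, ← integral_add hv₁.abs hv₂.abs, ← integral_const_mul]
    refine abs_integral_le_integral_abs.trans (integral_mono_ae ?_ ?_ ?_)
    · exact (((integrable_comp_mul hξ hAB hv₁ (hfc.sub p.continuous)).add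
        (integrable_comp_mul hξ hAB hv₂ (hf'.sub p.derivative.continuous)))).abs
    · exact (hv₁.abs.add hv₂.abs).const_mul _
    · filter_upwards [hAB] with x hx
      obtain ⟨h1, h2⟩ := hp _ hx
      refine (abs_add_le _ _).trans ?_
      rw [abs_mul, abs_mul, mul_add]
      gcongr
  have : |∫ x, (f (ξ x) * v₁ x + f' (ξ x) * v₂ x) ∂μ| ≤ 0 := by
    refine le_of_forall_pos_le_add fun δ hδ => ?_
    refine (key (δ / (K + 1)) (by positivity)).trans ?_
    rw [zero_add, div_mul_eq_mul_div, div_le_iff₀ (by positivity)]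
    nlinarith
  exact abs_eq_zero.1 (le_antisymm this (abs_nonneg _))

/-! ### Vanishing of the leading coefficient at the endpoints of the support -/

/-- Squaring makes the truncated linear function C¹, hence an admissible test function concentrated
near an endpoint. -/
theorem hasDerivAt_max_sq (c x : ℝ) :
    HasDerivAt (fun x => (max (c - x) 0) ^ 2) (-2 * max (c - x) 0) x := by
  rcases lt_trichotomy x c with h | h | h
  · have : HasDerivAt (fun x : ℝ => (c - x) ^ 2) (-2 * max (c - x) 0) x := by
      have h1 := ((hasDerivAt_id x).const_sub c).pow 2
      rw [max_eq_left (by linarith)]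
      exact h1.congr_deriv (by simp)
    refine this.congr_of_eventuallyEq ?_
    filter_upwards [Iio_mem_nhds h] with y hy
    rw [max_eq_left (by linarith [mem_Iio.1 hy])]
  · subst h
    rw [sub_self, max_self, mul_zero, hasDerivAt_iff_isLittleO]
    simp only [sub_self, max_self, smul_zero, sub_zero]
    have h2 : (fun y : ℝ => (y - x) ^ 2) =o[𝓝 x] fun y => y - x := by
      have := (Asymptotics.isLittleO_pow_id (𝕜 := ℝ) (n := 2) (by norm_num))
      have ht : Tendsto (fun y : ℝ => y - x) (𝓝 x) (𝓝 0) := by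
        have : Tendsto (fun y : ℝ => y - x) (𝓝 x) (𝓝 (x - x)) := tendsto_id.sub_const x
        simpa using this
      exact this.comp_tendsto ht
    refine Asymptotics.IsBigO.trans_isLittleO (Asymptotics.IsBigO.of_bound 1 ?_) h2
    filter_upwards with y
    have : max (x - y) 0 ≤ |y - x| := max_le (by rw [abs_sub_comm]; exact le_abs_self _) (abs_nonneg _)
    have h3 : 0 ≤ max (x - y) 0 := le_max_right _ _
    simp only [ne_eq, OfNat.ofNat_ne_zero, not_false_eq_true, zero_pow, sub_zero, norm_pow,
      Real.norm_eq_abs, one_mul, abs_of_nonneg h3]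
    gcongr
  · rw [max_eq_right (by linarith), mul_zero]
    refine (hasDerivAt_const x (0 : ℝ)).congr_of_eventuallyEq ?_
    filter_upwards [Ioi_mem_nhds h] with y hy
    rw [max_eq_right (by linarith [mem_Ioi.1 hy])]
    simp

/-- Test with f = -((c - x)₊)² for c slightly to the right of a. The integrand is (c - x)₊ (2 G - (c
- x)₊ β), which is positive on [a, c) if G(a) > 0; its integral being zero, σ would not charge [a,
c), against the choice of a. -/
theorem not_pos_at_left_endpoint {σ : Measure ℝ} [IsFiniteMeasure σ] {G β : ℝ → ℝ}
    (hG : Continuous G) (hβ : Continuous β) {a : ℝ} (ha : σ (Iio a) = 0)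
    (ha' : ∀ c > a, σ (Iio c) ≠ 0)
    (H : ∀ f f' : ℝ → ℝ, (∀ x, HasDerivAt f (f' x) x) → Continuous f' →
      ∫ x, (f x * β x + f' x * G x) ∂σ = 0) : ¬ 0 < G a := by
  intro hGa
  obtain ⟨δ, hδ, hδ'⟩ : ∃ δ > 0, ∀ x ∈ Icc a (a + δ), 0 < 2 * G x - δ * |β x| := by
    have h1 : Tendsto (fun z : ℝ × ℝ => 2 * G z.1 - z.2 * |β z.1|) (𝓝 (a, 0))
        (𝓝 (2 * G a - 0 * |β a|)) := by
      have : Continuous fun z : ℝ × ℝ => 2 * G z.1 - z.2 * |β z.1| := by fun_prop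
      exact this.tendsto (a, 0)
    have h2 := h1.eventually (lt_mem_nhds (show 0 < 2 * G a - 0 * |β a| by linarith))
    obtain ⟨e, he, h3⟩ := Metric.eventually_nhds_iff.1 h2
    refine ⟨e / 2, by positivity, fun x hx => ?_⟩
    refine h3 (y := (x, e / 2)) ?_
    rw [Prod.dist_eq, max_lt_iff, Real.dist_eq, Real.dist_eq, abs_lt, abs_lt]
    refine ⟨⟨by linarith [hx.1], by linarith [hx.2]⟩, by constructor <;> linarith⟩
  set c := a + δ with hc
  set F : ℝ → ℝ := fun x => max (c - x) 0 * (2 * G x - max (c - x) 0 * β x) with hF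
  have hFc : Continuous F := by fun_prop
  have hF0 : ∀ x, a ≤ x → 0 ≤ F x := fun x hx => by
    rcases le_or_gt c x with h | h
    · simp [hF, max_eq_right (sub_nonpos.2 h)]
    · have := hδ' x ⟨hx, h.le⟩
      have h2 : (c - x) * β x ≤ δ * |β x| :=
        (mul_le_mul_of_nonneg_left (le_abs_self _) (by linarith)).trans
          (mul_le_mul_of_nonneg_right (by linarith) (abs_nonneg _))
      simp only [hF, max_eq_left (sub_nonneg.2 h.le)]
      exact mul_nonneg (by linarith) (by linarith)
  have hFpos : ∀ x, a ≤ x → x < c → 0 < F x := fun x hx h => by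
    have := hδ' x ⟨hx, h.le⟩
    have h2 : (c - x) * β x ≤ δ * |β x| :=
        (mul_le_mul_of_nonneg_left (le_abs_self _) (by linarith)).trans
          (mul_le_mul_of_nonneg_right (by linarith) (abs_nonneg _))
    simp only [hF, max_eq_left (sub_nonneg.2 h.le)]
    exact mul_pos (by linarith) (by linarith)
  have hae : ∀ᵐ x ∂σ, a ≤ x := by
    rw [ae_iff]; convert ha using 2; ext x; simp
  have hint : Integrable F σ := by
    obtain ⟨C, hC⟩ := (isCompact_Icc (a := a) (b := c)).exists_bound_of_continuousOn
      hFc.continuousOn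
    refine Integrable.of_bound hFc.aestronglyMeasurable (max C 0) ?_
    filter_upwards [hae] with x hx
    rcases le_or_gt c x with h | h
    · simp [hF, max_eq_right (sub_nonpos.2 h)]
    · exact (hC x ⟨hx, h.le⟩).trans (le_max_left _ _)
  have h0 := H (fun x => -(max (c - x) 0) ^ 2) (fun x => -(-2 * max (c - x) 0))
    (fun x => (hasDerivAt_max_sq c x).neg) (by fun_prop)
  have h1 : ∫ x, F x ∂σ = 0 := by
    rw [← h0]; congr 1; ext x; simp only [hF]; ring
  have h2 := (integral_eq_zero_iff_of_nonneg_ae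
    (by filter_upwards [hae] with x hx using hF0 x hx) hint).1 h1
  refine ha' c (by linarith) ?_
  rw [← nonpos_iff_eq_zero]
  have h3 : ∀ᵐ x ∂σ, ¬ x < c := by
    filter_upwards [h2, hae] with x hx hx' hxc
    exact (hFpos x hx' hxc).ne' hx
  rw [ae_iff] at h3
  refine (measure_mono fun x hx => ?_).trans h3.le
  simpa using hx

theorem eq_zero_at_left_endpoint {σ : Measure ℝ} [IsFiniteMeasure σ] {G β : ℝ → ℝ}
    (hG : Continuous G) (hβ : Continuous β) {a : ℝ} (ha : σ (Iio a) = 0)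
    (ha' : ∀ c > a, σ (Iio c) ≠ 0)
    (H : ∀ f f' : ℝ → ℝ, (∀ x, HasDerivAt f (f' x) x) → Continuous f' →
      ∫ x, (f x * β x + f' x * G x) ∂σ = 0) : G a = 0 := by
  rcases lt_trichotomy (G a) 0 with h | h | h
  · exact absurd (neg_pos.2 h) (not_pos_at_left_endpoint hG.neg hβ.neg ha ha'
      fun f f' hf hf' => by
        rw [← neg_zero, ← H f f' hf hf', ← integral_neg]
        congr 1; ext x; simp; ring)
  · exact h
  · exact absurd h (not_pos_at_left_endpoint hG hβ ha ha' H)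

theorem eq_zero_at_right_endpoint {σ : Measure ℝ} [IsFiniteMeasure σ] {G β : ℝ → ℝ}
    (hG : Continuous G) (hβ : Continuous β) {b : ℝ} (hb : σ (Ioi b) = 0)
    (hb' : ∀ c < b, σ (Ioi c) ≠ 0)
    (H : ∀ f f' : ℝ → ℝ, (∀ x, HasDerivAt f (f' x) x) → Continuous f' →
      ∫ x, (f x * β x + f' x * G x) ∂σ = 0) : G b = 0 := by
  have hpre : ∀ c : ℝ, (fun x : ℝ => -x) ⁻¹' Iio c = Ioi (-c) := fun c => by
    ext x; simp
  -- Reflection reverses the sign of the derivative of a test function, hence the minus sign on `G`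
  -- and none on `β`.
  have := eq_zero_at_left_endpoint (σ := σ.map fun x => -x) (G := fun x => -G (-x))
    (β := fun x => β (-x)) (a := -b) (by fun_prop) (by fun_prop)
    (by rw [Measure.map_apply measurable_neg measurableSet_Iio, hpre]; simpa using hb)
    (fun c hc => by
      rw [Measure.map_apply measurable_neg measurableSet_Iio, hpre]
      exact hb' _ (by linarith))
    (fun f f' hf hf' => by
      have hfc : Continuous f := continuous_iff_continuousAt.2 fun x => (hf x).continuousAt
      rw [integral_map measurable_neg.aemeasurable
        (Continuous.aestronglyMeasurable (by fun_prop))]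
      rw [← H (fun x => f (-x)) (fun x => -f' (-x)) (fun x => by
        have := (hf (-x)).comp x (hasDerivAt_neg x)
        simpa using! this) (by fun_prop)]
      congr 1; ext x; simp)
  simpa using this

theorem exists_left_endpoint {σ : Measure ℝ} (hσ : σ ≠ 0) {A B : ℝ}
    (h : σ (Icc A B)ᶜ = 0) :
    ∃ a, A ≤ a ∧ σ (Iio a) = 0 ∧ ∀ c > a, σ (Iio c) ≠ 0 := by
  set s := {c : ℝ | σ (Iio c) = 0} with hs
  have hA : A ∈ s := measure_mono_null (fun x hx => by
    simp only [mem_compl_iff, mem_Icc, not_and_or, not_le]; exact Or.inl hx) h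
  have hbdd : ∀ c ∈ s, c ≤ B := by
    intro c hc
    by_contra! hBc
    refine hσ (Measure.measure_univ_eq_zero.1 (measure_mono_null (t := Iio c ∪ (Icc A B)ᶜ) ?_
      (measure_union_null hc h)))
    intro x _
    rcases lt_or_ge x c with h1 | h1
    · exact Or.inl h1
    · exact Or.inr fun h2 => by linarith [h2.2]
  refine ⟨sSup s, le_csSup ⟨B, hbdd⟩ hA, ?_, fun c hc h0 => ?_⟩
  · have : Iio (sSup s) ⊆ ⋃ n : ℕ, Iio (sSup s - 1 / (n + 1)) := by
      intro x hx
      obtain ⟨n, hn⟩ := exists_nat_one_div_lt (sub_pos.2 (mem_Iio.1 hx))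
      exact mem_iUnion.2 ⟨n, by simp only [mem_Iio]; linarith⟩
    refine measure_mono_null this (measure_iUnion_null fun n => ?_)
    obtain ⟨c, hc, hlt⟩ := exists_lt_of_lt_csSup ⟨A, hA⟩
      (show sSup s - 1 / ((n : ℝ) + 1) < sSup s by
        have : 0 < 1 / ((n : ℝ) + 1) := by positivity
        linarith)
    exact measure_mono_null (Iio_subset_Iio hlt.le) hc
  · exact absurd (le_csSup ⟨B, hbdd⟩ (show c ∈ s from h0)) (not_le.2 hc)

theorem exists_right_endpoint {σ : Measure ℝ} (hσ : σ ≠ 0) {A B : ℝ}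
    (h : σ (Icc A B)ᶜ = 0) :
    ∃ b, b ≤ B ∧ σ (Ioi b) = 0 ∧ ∀ c < b, σ (Ioi c) ≠ 0 := by
  have hpre : ∀ c : ℝ, (fun x : ℝ => -x) ⁻¹' Iio c = Ioi (-c) := fun c => by
    ext x; simp
  have hm : ∀ c, (σ.map fun x : ℝ => -x) (Iio c) = σ (Ioi (-c)) := fun c => by
    rw [Measure.map_apply measurable_neg measurableSet_Iio, hpre]
  obtain ⟨a, h1, h2, h3⟩ := exists_left_endpoint (σ := σ.map fun x => -x) (A := -B) (B := -A)
    (fun h0 => hσ (by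
      rw [Measure.map_eq_zero_iff measurable_neg.aemeasurable] at h0; exact h0))
    (by
      rw [Measure.map_apply measurable_neg measurableSet_Icc.compl]
      convert h using 2; ext x; simp)
  refine ⟨-a, by linarith, by rwa [← hm], fun c hc => ?_⟩
  have := h3 (-c) (by linarith)
  rwa [hm, neg_neg] at this

/-! ### Laws of product form -/

/-- `g` vanishes outside a compact subinterval of `(a, b)`. -/
def SuppIn (a b : ℝ) (g : ℝ → ℝ) : Prop :=
  ∃ α β, a < α ∧ α < β ∧ β < b ∧ ∀ x, x ∉ Icc α β → g x = 0

theorem SuppIn.mul_left {a b : ℝ} {g : ℝ → ℝ} (h : SuppIn a b g) (f : ℝ → ℝ) :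
    SuppIn a b fun x => f x * g x := by
  obtain ⟨α, β, h1, h2, h3, h4⟩ := h
  exact ⟨α, β, h1, h2, h3, fun x hx => by simp [h4 x hx]⟩

theorem SuppIn.exists_common {a b : ℝ} {g h : ℝ → ℝ} (hg : SuppIn a b g) (hh : SuppIn a b h) :
    ∃ α β, a < α ∧ α < β ∧ β < b ∧ ∀ x, x ∉ Icc α β → g x = 0 ∧ h x = 0 := by
  obtain ⟨α, β, h1, h2, h3, h4⟩ := hg
  obtain ⟨α', β', h1', h2', h3', h4'⟩ := hh
  refine ⟨min α α', max β β', lt_min h1 h1', ?_, max_lt h3 h3', fun x hx => ⟨?_, ?_⟩⟩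
  · exact (min_le_left _ _).trans_lt (h2.trans_le (le_max_left _ _))
  · exact h4 x fun h => hx ⟨(min_le_left _ _).trans h.1, h.2.trans (le_max_left _ _)⟩
  · exact h4' x fun h => hx ⟨(min_le_right _ _).trans h.1, h.2.trans (le_max_right _ _)⟩

theorem SuppIn.continuous_mul {a b : ℝ} {g f : ℝ → ℝ} (h : SuppIn a b g) (hg : Continuous g)
    (hf : ContinuousOn f (Ioo a b)) : Continuous fun x => f x * g x := by
  obtain ⟨α, β, h1, h2, h3, h4⟩ := h
  rw [continuous_iff_continuousAt]
  intro x
  by_cases hx : x ∈ Ioo a b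
  · exact (hf.continuousAt (isOpen_Ioo.mem_nhds hx)).mul hg.continuousAt
  · have hx' : x ∈ (Icc α β)ᶜ := fun h => hx ⟨h1.trans_le h.1, h.2.trans_lt h3⟩
    refine (continuousAt_const (y := (0 : ℝ))).congr ?_
    filter_upwards [isClosed_Icc.isOpen_compl.mem_nhds hx'] with y hy
    rw [h4 y hy, mul_zero]

theorem SuppIn.hasCompactSupport {a b : ℝ} {g : ℝ → ℝ} (h : SuppIn a b g) :
    HasCompactSupport g := by
  obtain ⟨α, β, -, -, -, h4⟩ := h
  exact HasCompactSupport.intro isCompact_Icc h4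

theorem SuppIn.exists_bound {a b : ℝ} {g : ℝ → ℝ} (h : SuppIn a b g) (hg : Continuous g) :
    ∃ C, ∀ x, |g x| ≤ C := by
  obtain ⟨C, hC⟩ := hg.bounded_above_of_compact_support h.hasCompactSupport
  exact ⟨C, hC⟩

/-- A continuous cutoff of the interval `(a, b)`. -/
def cutoff (a b : ℝ) (n : ℕ) (x : ℝ) : ℝ :=
  max 0 (min 1 ((n + 1) * min (x - a) (b - x) - 1))

theorem continuous_cutoff (a b : ℝ) (n : ℕ) : Continuous (cutoff a b n) := by
  unfold cutoff; fun_prop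

theorem cutoff_nonneg (a b : ℝ) (n : ℕ) (x : ℝ) : 0 ≤ cutoff a b n x := le_max_left _ _

theorem cutoff_le_one (a b : ℝ) (n : ℕ) (x : ℝ) : cutoff a b n x ≤ 1 :=
  max_le zero_le_one (min_le_left _ _)

theorem suppIn_cutoff {a b : ℝ} (hab : a < b) (n : ℕ) : SuppIn a b (cutoff a b n) := by
  have hn : (0 : ℝ) < n + 1 := by positivity
  -- The cutoff vanishes within distance 1 / (n + 1) of the ends; the bound (b - a) / 3 only keeps
  -- the compact interval nondegenerate for small n.
  set δ := min (1 / ((n : ℝ) + 1)) ((b - a) / 3) with hδ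
  have hδ0 : 0 < δ := lt_min (by positivity) (by linarith)
  have hδ3 : δ ≤ (b - a) / 3 := min_le_right _ _
  refine ⟨a + δ, b - δ, by linarith, by linarith, by linarith, fun x hx => ?_⟩
  have : min (x - a) (b - x) ≤ δ := by
    by_contra! h
    obtain ⟨h1, h2⟩ := lt_min_iff.1 h
    exact hx ⟨by linarith, by linarith⟩
  have h2 : (n + 1) * min (x - a) (b - x) ≤ 1 := by
    calc (n + 1) * min (x - a) (b - x) ≤ (n + 1) * (1 / ((n : ℝ) + 1)) :=
          mul_le_mul_of_nonneg_left (this.trans (min_le_left _ _)) hn.le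
      _ = 1 := by field_simp
  exact max_eq_left ((min_le_right _ _).trans (by linarith))

theorem tendsto_cutoff {a b x : ℝ} (hx : x ∈ Ioo a b) :
    Tendsto (fun n => cutoff a b n x) atTop (𝓝 1) := by
  have hm : 0 < min (x - a) (b - x) := lt_min (by linarith [hx.1]) (by linarith [hx.2])
  obtain ⟨N, hN⟩ := exists_nat_ge (2 / min (x - a) (b - x))
  refine tendsto_const_nhds.congr' ?_
  filter_upwards [eventually_ge_atTop N] with n hn
  have h1 : 2 ≤ ((n : ℝ) + 1) * min (x - a) (b - x) := by
    rw [div_le_iff₀ hm] at hN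
    refine hN.trans (mul_le_mul_of_nonneg_right ?_ hm.le)
    have : (N : ℝ) ≤ n := by exact_mod_cast hn
    linarith
  unfold cutoff
  rw [min_eq_left (by linarith), max_eq_right zero_le_one]

theorem exists_bump {a b : ℝ} (hab : a < b) :
    ∃ g₀ : ℝ → ℝ, Continuous g₀ ∧ SuppIn a b g₀ ∧ (∀ x, 0 ≤ g₀ x) ∧ ∫ x, g₀ x = 1 := by
  let φ : ContDiffBump ((a + b) / 2) := ⟨(b - a) / 8, (b - a) / 4, by linarith, by linarith⟩
  refine ⟨φ.normed volume, φ.continuous_normed, ⟨(a + b) / 2 - (b - a) / 4,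
    (a + b) / 2 + (b - a) / 4, by linarith, by linarith, by linarith, fun x hx => ?_⟩,
    φ.nonneg_normed, φ.integral_normed⟩
  have : x ∉ Function.support (φ.normed volume) := by
    rw [φ.support_normed_eq]
    intro h
    have hr : φ.rOut = (b - a) / 4 := rfl
    rw [Metric.mem_ball, Real.dist_eq, abs_lt, hr] at h
    exact hx ⟨by linarith [h.1], by linarith [h.2]⟩
  simpa using this

section Product

variable {X : Type*} [MeasurableSpace X] {μ : Measure X} {ξ : X → ℝ} {a b : ℝ}

theorem integrable_comp_mul_of_suppIn {v : X → ℝ} (hξ : Measurable ξ) (hv : Measurable v)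
    [IsFiniteMeasure μ]
    (hvb : ∀ α β, a < α → β < b → ∃ B, ∀ᵐ x ∂μ, ξ x ∈ Icc α β → |v x| ≤ B)
    {g : ℝ → ℝ} (hg : Continuous g) (hgs : SuppIn a b g) :
    Integrable (fun x => g (ξ x) * v x) μ := by
  obtain ⟨C, hC⟩ := hgs.exists_bound hg
  obtain ⟨α, β, h1, h2, h3, h4⟩ := hgs
  obtain ⟨B, hB⟩ := hvb α β h1 h3
  refine Integrable.of_bound ((hg.measurable.comp hξ).mul hv).aestronglyMeasurable (C * |B|) ?_
  filter_upwards [hB] with x hx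
  rw [Real.norm_eq_abs, abs_mul]
  by_cases h : ξ x ∈ Icc α β
  · exact mul_le_mul (hC _) ((hx h).trans (le_abs_self _)) (abs_nonneg _)
      ((abs_nonneg _).trans (hC 0))
  · rw [h4 _ h, abs_zero, zero_mul]
    exact mul_nonneg ((abs_nonneg _).trans (hC 0)) (abs_nonneg _)

/-- If the functional `h ↦ ∫ h(ξ) v dμ` kills derivatives, it is a multiple of the Lebesgue
integral. -/
theorem integral_comp_mul_eq_of_deriv {v : X → ℝ} (hξ : Measurable ξ) (hv : Measurable v)
    [IsFiniteMeasure μ]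
    (hvb : ∀ α β, a < α → β < b → ∃ B, ∀ᵐ x ∂μ, ξ x ∈ Icc α β → |v x| ≤ B)
    (H : ∀ f f' : ℝ → ℝ, (∀ x, HasDerivAt f (f' x) x) → Continuous f' → SuppIn a b f →
      SuppIn a b f' → ∫ x, f' (ξ x) * v x ∂μ = 0)
    {g₀ : ℝ → ℝ} (hg₀ : Continuous g₀) (hg₀s : SuppIn a b g₀) (hg₀1 : ∫ x, g₀ x = 1)
    {g : ℝ → ℝ} (hg : Continuous g) (hgs : SuppIn a b g) :
    ∫ x, g (ξ x) * v x ∂μ = (∫ x, g x) * ∫ x, g₀ (ξ x) * v x ∂μ := by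
  set c := ∫ x, g x with hc
  obtain ⟨α, β, h1, h2, h3, h4⟩ := hgs.exists_common hg₀s
  have hi : ∀ {g : ℝ → ℝ}, Continuous g → SuppIn a b g → Integrable g volume :=
    fun hg hgs => hg.integrable_of_hasCompactSupport hgs.hasCompactSupport
  -- Subtracting the multiple of the bump makes the total integral zero, so the primitive of `h` is
  -- again supported in a compact part of (a, b) and `h` is an admissible derivative.
  set h : ℝ → ℝ := fun x => g x - c * g₀ x with hh
  have hhc : Continuous h := by fun_prop
  have hh0 : ∀ x, x ∉ Icc α β → h x = 0 := fun x hx => by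
    simp [hh, (h4 x hx).1, (h4 x hx).2]
  have htot : ∫ x, h x = 0 := by
    rw [hh, integral_sub (hi hg hgs) ((hi hg₀ hg₀s).const_mul _), integral_const_mul, hg₀1,
      mul_one, sub_self]
  have key := H (fun y => ∫ x in (α - 1)..y, h x) h
    (fun x => intervalIntegral.integral_hasDerivAt_right (hhc.intervalIntegrable _ _)
      (hhc.stronglyMeasurableAtFilter _ _) hhc.continuousAt) hhc
    ⟨α, β, h1, h2, h3, fun y hy => by
      dsimp only
      rcases lt_or_ge y α with hyα | hyα
      · rw [intervalIntegral.integral_congr (g := fun _ => 0), intervalIntegral.integral_zero]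
        intro x hx
        refine hh0 x fun h => ?_
        have := (mem_uIcc.1 hx)
        rcases this with h' | h' <;> linarith [h.1]
      · have hyβ : β < y := by
          by_contra! hyβ
          exact hy ⟨hyα, hyβ⟩
        rw [intervalIntegral.integral_of_le (by linarith),
          setIntegral_eq_integral_of_forall_compl_eq_zero, htot]
        intro x hx
        exact hh0 x fun h => hx ⟨by linarith [h.1], h.2.trans hyβ.le⟩⟩
    ⟨α, β, h1, h2, h3, hh0⟩
  have e : ∫ x, h (ξ x) * v x ∂μ =
      (∫ x, g (ξ x) * v x ∂μ) - c * ∫ x, g₀ (ξ x) * v x ∂μ := by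
    rw [← integral_const_mul, ← integral_sub (integrable_comp_mul_of_suppIn hξ hv hvb hg hgs)
      ((integrable_comp_mul_of_suppIn hξ hv hvb hg₀ hg₀s).const_mul _)]
    congr 1; ext x; simp only [hh]; ring
  linarith

/-- Weak differential equation in the first coordinate, for all powers of the second one:
the joint law is a product. -/
theorem exists_map_eq_prod [IsFiniteMeasure μ] (hμ : μ ≠ 0) {u : X → ℝ} (hξ : Measurable ξ)
    (hu : Measurable u) (hab : a < b) (hξI : ∀ᵐ x ∂μ, ξ x ∈ Ioo a b)
    (hub : ∀ α β, a < α → β < b → ∃ B, ∀ᵐ x ∂μ, ξ x ∈ Icc α β → |u x| ≤ B)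
    {w : ℝ → ℝ} (hw : ContinuousOn w (Ioo a b)) (hw0 : ∀ x ∈ Ioo a b, 0 < w x)
    (H : ∀ (k : ℕ) (f f' : ℝ → ℝ), (∀ x, HasDerivAt f (f' x) x) → Continuous f' → SuppIn a b f →
      SuppIn a b f' → ∫ x, (w (ξ x))⁻¹ * f' (ξ x) * u x ^ k ∂μ = 0) :
    ∃ σ : Measure ℝ, IsFiniteMeasure σ ∧ σ ≠ 0 ∧ (∃ B, σ (Icc (-B) B)ᶜ = 0) ∧
      IntegrableOn w (Ioo a b) ∧
      μ.map (fun x => (ξ x, u x)) =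
        ((volume.restrict (Ioo a b)).withDensity fun x => ENNReal.ofReal (w x)).prod σ := by
  obtain ⟨g₀, hg₀, hg₀s, hg₀0, hg₀1⟩ := exists_bump hab
  have hwi : ContinuousOn (fun x => (w x)⁻¹) (Ioo a b) := hw.inv₀ fun x hx => (hw0 x hx).ne'
  have hdiv : ∀ {g : ℝ → ℝ}, Continuous g → SuppIn a b g →
      Continuous (fun x => (w x)⁻¹ * g x) ∧ SuppIn a b (fun x => (w x)⁻¹ * g x) :=
    fun hg hgs => ⟨hgs.continuous_mul hg hwi, hgs.mul_left _⟩
  -- replace the pair `(w⁻¹, u ^ k)` by a globally measurable function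
  set wi : ℝ → ℝ := (Ioo a b).indicator fun x => (w x)⁻¹ with hwi'
  have hwim : Measurable wi := by
    rw [hwi', ← Set.piecewise_eq_indicator]
    exact ContinuousOn.measurable_piecewise hwi continuousOn_const measurableSet_Ioo
  have hwig : ∀ {g : ℝ → ℝ}, SuppIn a b g → ∀ x, (w x)⁻¹ * g x = g x * wi x := by
    rintro g ⟨α, β, h1, h2, h3, h4⟩ x
    by_cases hx : x ∈ Ioo a b
    · rw [hwi', indicator_of_mem hx, mul_comm]
    · rw [h4 x fun h => hx ⟨h1.trans_le h.1, h.2.trans_lt h3⟩, mul_zero, zero_mul]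
  have hmul_pow : ∀ (k : ℕ) {g : ℝ → ℝ}, Continuous g → SuppIn a b g →
      ∫ x, (w (ξ x))⁻¹ * g (ξ x) * u x ^ k ∂μ =
        (∫ x, g x) * ∫ x, (w (ξ x))⁻¹ * g₀ (ξ x) * u x ^ k ∂μ := by
    intro k g hg hgs
    have := integral_comp_mul_eq_of_deriv (μ := μ) (v := fun x => wi (ξ x) * u x ^ k) hξ
      (hwim.comp hξ |>.mul (hu.pow_const k)) (fun α β hα hβ => by
        obtain ⟨B, hB⟩ := hub α β hα hβ
        obtain ⟨C, hC⟩ := (isCompact_Icc (a := α) (b := β)).exists_bound_of_continuousOn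
          (hwi.mono fun x hx => ⟨hα.trans_le hx.1, hx.2.trans_lt hβ⟩)
        refine ⟨|C| * |B| ^ k, ?_⟩
        filter_upwards [hB] with x hx hxI
        have hmem : ξ x ∈ Ioo a b := ⟨hα.trans_le hxI.1, hxI.2.trans_lt hβ⟩
        rw [abs_mul, abs_pow, hwi', indicator_of_mem hmem]
        exact mul_le_mul ((hC _ hxI).trans (le_abs_self _))
          (pow_le_pow_left₀ (abs_nonneg _) ((hx hxI).trans (le_abs_self _)) k)
          (pow_nonneg (abs_nonneg _) k) (abs_nonneg _))
      (fun f f' hf hf' hfs hfs' => by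
        rw [← H k f f' hf hf' hfs hfs']
        congr 1; ext x; rw [hwig hfs']; ring) hg₀ hg₀s hg₀1 hg hgs
    convert this using 2
    · ext x; rw [hwig hgs]; ring
    · congr 1; ext x; rw [hwig hg₀s]; ring
  -- From powers of u to continuous functions of u by Weierstrass approximation: over the common
  -- support of g and g₀ the variable u is bounded.
  have hmul' : ∀ {h : ℝ → ℝ}, Continuous h → ∀ {g : ℝ → ℝ}, Continuous g → SuppIn a b g →
      ∫ x, (w (ξ x))⁻¹ * g (ξ x) * h (u x) ∂μ =
        (∫ x, g x) * ∫ x, (w (ξ x))⁻¹ * g₀ (ξ x) * h (u x) ∂μ := by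
    intro h hh g hg hgs
    obtain ⟨α, β, h1, h2, h3, h4⟩ := hgs.exists_common hg₀s
    obtain ⟨B, hB⟩ := hub α β h1 h3
    have hint : ∀ {h : ℝ → ℝ}, Continuous h → ∀ {g : ℝ → ℝ}, Continuous g → SuppIn a b g →
        Integrable (fun x => (w (ξ x))⁻¹ * g (ξ x) * h (u x)) μ := by
      intro h hh g hg hgs
      refine integrable_comp_mul_of_suppIn hξ (hh.measurable.comp hu) (fun α β hα hβ => ?_)
        (hdiv hg hgs).1 (hdiv hg hgs).2
      obtain ⟨B, hB⟩ := hub α β hα hβ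
      obtain ⟨C, hC⟩ := (isCompact_Icc (a := -B) (b := B)).exists_bound_of_continuousOn
        hh.continuousOn
      exact ⟨C, by filter_upwards [hB] with x hx hxI using hC _ (abs_le.1 (hx hxI))⟩
    have hpoly : ∀ p : Polynomial ℝ, ∫ x, (w (ξ x))⁻¹ * g (ξ x) * p.eval (u x) ∂μ =
        (∫ x, g x) * ∫ x, (w (ξ x))⁻¹ * g₀ (ξ x) * p.eval (u x) ∂μ := by
      intro p
      induction p using Polynomial.induction_on' with
      | add p q hp hq =>
        simp only [Polynomial.eval_add, mul_add]
        rw [integral_add (hint p.continuous hg hgs) (hint q.continuous hg hgs),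
          integral_add (hint p.continuous hg₀ hg₀s) (hint q.continuous hg₀ hg₀s), hp, hq, mul_add]
      | monomial k c =>
        simp only [Polynomial.eval_monomial]
        have := hmul_pow k hg hgs
        calc ∫ x, (w (ξ x))⁻¹ * g (ξ x) * (c * u x ^ k) ∂μ
            = c * ∫ x, (w (ξ x))⁻¹ * g (ξ x) * u x ^ k ∂μ := by
              rw [← integral_const_mul]; congr 1; ext x; ring
          _ = (∫ x, g x) * (c * ∫ x, (w (ξ x))⁻¹ * g₀ (ξ x) * u x ^ k ∂μ) := by rw [this]; ring
          _ = _ := by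
              rw [← integral_const_mul c]; congr 2; ext x; ring
    set K := (∫ x, |(w (ξ x))⁻¹ * g (ξ x)| ∂μ) +
      |∫ x, g x| * ∫ x, |(w (ξ x))⁻¹ * g₀ (ξ x)| ∂μ with hK
    have hK0 : 0 ≤ K := by positivity
    have hint1 : ∀ {g : ℝ → ℝ}, Continuous g → SuppIn a b g →
        Integrable (fun x => (w (ξ x))⁻¹ * g (ξ x)) μ := fun hg hgs => by
      simpa using hint (h := fun _ => 1) continuous_const hg hgs
    have happ : ∀ ε > 0, |(∫ x, (w (ξ x))⁻¹ * g (ξ x) * h (u x) ∂μ) -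
        (∫ x, g x) * ∫ x, (w (ξ x))⁻¹ * g₀ (ξ x) * h (u x) ∂μ| ≤ ε * K := by
      intro ε hε
      obtain ⟨p, hp⟩ := exists_polynomial_near_of_continuousOn (-B) B h hh.continuousOn ε hε
      have hone : ∀ {g : ℝ → ℝ}, Continuous g → SuppIn a b g → (∀ x, x ∉ Icc α β → g x = 0) →
          |(∫ x, (w (ξ x))⁻¹ * g (ξ x) * h (u x) ∂μ) -
            ∫ x, (w (ξ x))⁻¹ * g (ξ x) * p.eval (u x) ∂μ| ≤
            ε * ∫ x, |(w (ξ x))⁻¹ * g (ξ x)| ∂μ := by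
        intro g hg hgs hg0
        rw [← integral_sub (hint hh hg hgs) (hint p.continuous hg hgs), ← integral_const_mul]
        refine abs_integral_le_integral_abs.trans (integral_mono_ae
          ((hint hh hg hgs).sub (hint p.continuous hg hgs)).abs
          ((hint1 hg hgs).abs.const_mul _) ?_)
        filter_upwards [hB] with x hx
        by_cases hxI : ξ x ∈ Icc α β
        · rw [← mul_sub, abs_mul, mul_comm ε, abs_sub_comm]
          exact mul_le_mul_of_nonneg_left (hp _ (abs_le.1 (hx hxI))).le (abs_nonneg _)
        · simp [hg0 _ hxI]
      have e1 := hone hg hgs fun x hx => (h4 x hx).1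
      have e2 := hone hg₀ hg₀s fun x hx => (h4 x hx).2
      rw [hpoly p] at e1
      have : (∫ x, (w (ξ x))⁻¹ * g (ξ x) * h (u x) ∂μ) -
          (∫ x, g x) * ∫ x, (w (ξ x))⁻¹ * g₀ (ξ x) * h (u x) ∂μ =
          ((∫ x, (w (ξ x))⁻¹ * g (ξ x) * h (u x) ∂μ) -
            (∫ x, g x) * ∫ x, (w (ξ x))⁻¹ * g₀ (ξ x) * p.eval (u x) ∂μ) -
          (∫ x, g x) * ((∫ x, (w (ξ x))⁻¹ * g₀ (ξ x) * h (u x) ∂μ) -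
            ∫ x, (w (ξ x))⁻¹ * g₀ (ξ x) * p.eval (u x) ∂μ) := by ring
      rw [this, hK, mul_add]
      refine (abs_sub _ _).trans (add_le_add e1 ?_)
      rw [abs_mul]
      calc |∫ x, g x| * _ ≤ |∫ x, g x| * _ := mul_le_mul_of_nonneg_left e2 (abs_nonneg _)
        _ = _ := by ring
    have : |(∫ x, (w (ξ x))⁻¹ * g (ξ x) * h (u x) ∂μ) -
        (∫ x, g x) * ∫ x, (w (ξ x))⁻¹ * g₀ (ξ x) * h (u x) ∂μ| ≤ 0 := by
      refine le_of_forall_pos_le_add fun δ hδ => ?_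
      refine (happ (δ / (K + 1)) (by positivity)).trans ?_
      rw [zero_add, div_mul_eq_mul_div, div_le_iff₀ (by positivity)]
      nlinarith
    exact sub_eq_zero.1 (abs_eq_zero.1 (le_antisymm this (abs_nonneg _)))
  -- the law of the second coordinate
  have hd₀ := hdiv hg₀ hg₀s
  have hd₀0 : ∀ x, 0 ≤ (w x)⁻¹ * g₀ x := fun x => by
    obtain ⟨α, β, h1, h2, h3, h4⟩ := hg₀s
    by_cases hx : x ∈ Icc α β
    · exact mul_nonneg (inv_nonneg.2 (hw0 x ⟨h1.trans_le hx.1, hx.2.trans_lt h3⟩).le) (hg₀0 x)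
    · rw [h4 x hx, mul_zero]
  have hdm : Measurable fun x => (w (ξ x))⁻¹ * g₀ (ξ x) := hd₀.1.measurable.comp hξ
  have hd₀int : Integrable (fun x => (w (ξ x))⁻¹ * g₀ (ξ x)) μ := by
    obtain ⟨C, hC⟩ := hd₀.2.exists_bound hd₀.1
    exact Integrable.of_bound hdm.aestronglyMeasurable C (ae_of_all _ fun x => hC _)
  -- The law of u under the measure weighted by w⁻¹ g₀ is the transverse factor, because ∫ g₀ = 1.
  set μ₀ := μ.withDensity fun x => ENNReal.ofReal ((w (ξ x))⁻¹ * g₀ (ξ x)) with hμ₀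
  have hfin₀ : IsFiniteMeasure μ₀ := isFiniteMeasure_withDensity_ofReal hd₀int.2
  set σ := μ₀.map u with hσ
  have hσint : ∀ {h : ℝ → ℝ}, Continuous h →
      ∫ t, h t ∂σ = ∫ x, (w (ξ x))⁻¹ * g₀ (ξ x) * h (u x) ∂μ := by
    intro h hh
    rw [hσ, integral_map hu.aemeasurable hh.aestronglyMeasurable, hμ₀,
      integral_withDensity_eq_integral_toReal_smul hdm.ennreal_ofReal (by simp)]
    congr 1; ext x
    rw [ENNReal.toReal_ofReal (hd₀0 _), smul_eq_mul]
  have hfinσ : IsFiniteMeasure σ := by rw [hσ]; infer_instance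
  set K := σ.real univ with hKdef
  have hK1 : ∫ x, (w (ξ x))⁻¹ * g₀ (ξ x) * 1 ∂μ = K := by
    have := hσint (h := fun _ => 1) continuous_const
    rw [← this]; simp [hKdef]
  -- With the test function w · f · cutoff the factor w⁻¹ cancels, and the proportionality becomes
  -- the product formula up to the cutoff.
  have hcut : ∀ f : BoundedContinuousFunction ℝ ℝ, ∀ h : BoundedContinuousFunction ℝ ℝ, ∀ n : ℕ,
      ∫ x, (cutoff a b n (ξ x) * f (ξ x)) * h (u x) ∂μ =
        (∫ x, w x * (f x * cutoff a b n x)) * ∫ t, h t ∂σ := by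
    intro f h n
    have hs := (suppIn_cutoff hab n).mul_left f
    have hc : Continuous fun x => f x * cutoff a b n x :=
      f.continuous.mul (continuous_cutoff a b n)
    have := hmul' h.continuous (hs.continuous_mul hc hw) (hs.mul_left w)
    rw [hσint h.continuous, ← this]
    refine integral_congr_ae ?_
    filter_upwards [hξI] with x hx
    have := (hw0 _ hx).ne'
    field_simp
  have hcutint : ∀ n, ∫ x, w x * cutoff a b n x = ∫ x in Ioo a b, w x * cutoff a b n x := by
    intro n
    obtain ⟨α, β, h1, h2, h3, h4⟩ := suppIn_cutoff hab n
    rw [setIntegral_eq_integral_of_forall_compl_eq_zero]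
    intro x hx
    rw [h4 x fun h => hx ⟨h1.trans_le h.1, h.2.trans_lt h3⟩, mul_zero]
  have hone : ∀ n, ∫ x, cutoff a b n (ξ x) ∂μ = (∫ x, w x * cutoff a b n x) * K := by
    intro n
    have := hcut 1 1 n
    simpa [hKdef] using this
  have hlim1 : Tendsto (fun n => ∫ x, cutoff a b n (ξ x) ∂μ) atTop (𝓝 (μ.real univ)) := by
    have : μ.real univ = ∫ x, (1 : ℝ) ∂μ := by simp
    rw [this]
    refine tendsto_integral_of_dominated_convergence (fun _ => 1)
      (fun n => ((continuous_cutoff a b n).measurable.comp hξ).aestronglyMeasurable)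
      (integrable_const _) (fun n => ae_of_all _ fun x => ?_) ?_
    · rw [Real.norm_eq_abs, abs_of_nonneg (cutoff_nonneg _ _ _ _)]
      exact cutoff_le_one _ _ _ _
    · filter_upwards [hξI] with x hx using tendsto_cutoff hx
  have hμpos : 0 < μ.real univ := by
    rw [Measure.real, ENNReal.toReal_pos_iff]
    exact ⟨pos_iff_ne_zero.2 (by simpa using hμ), measure_lt_top _ _⟩
  have hKpos : 0 < K := by
    rcases (measureReal_nonneg (μ := σ) (s := univ)).eq_or_lt with h | h
    · rw [← hKdef] at h
      simp only [← h, mul_zero] at hone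
      simp only [hone] at hlim1
      exact absurd (tendsto_nhds_unique hlim1 tendsto_const_nhds) hμpos.ne'
    · exact h
  have hcle : ∀ n, ∫ x, w x * cutoff a b n x ≤ μ.real univ / K := by
    intro n
    rw [le_div_iff₀ hKpos, ← hone n]
    have : μ.real univ = ∫ x, (1 : ℝ) ∂μ := by simp
    rw [this]
    refine integral_mono_of_nonneg (ae_of_all _ fun x => cutoff_nonneg _ _ _ _)
      (integrable_const _) (ae_of_all _ fun x => cutoff_le_one _ _ _ _)
  -- Fatou's lemma: the integrals of w against the cutoffs are bounded by the mass of μ divided by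
  -- K.
  have hwI : IntegrableOn w (Ioo a b) := by
    have hmeas : AEStronglyMeasurable w (volume.restrict (Ioo a b)) :=
      hw.aestronglyMeasurable measurableSet_Ioo
    refine ⟨hmeas, ?_⟩
    rw [hasFiniteIntegral_iff_ofReal (by
      filter_upwards [ae_restrict_mem measurableSet_Ioo] with x hx using (hw0 x hx).le)]
    have hF : ∫⁻ x in Ioo a b, ENNReal.ofReal (w x) ≤
        liminf (fun n => ∫⁻ x in Ioo a b, ENNReal.ofReal (w x * cutoff a b n x)) atTop := by
      refine le_trans (lintegral_mono_ae ?_) (lintegral_liminf_le' (fun n =>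
        (hmeas.aemeasurable.mul (continuous_cutoff a b n).measurable.aemeasurable).ennreal_ofReal))
      filter_upwards [ae_restrict_mem measurableSet_Ioo] with x hx
      have : Tendsto (fun n => ENNReal.ofReal (w x * cutoff a b n x)) atTop
          (𝓝 (ENNReal.ofReal (w x * 1))) :=
        (ENNReal.continuous_ofReal.tendsto _).comp ((tendsto_cutoff hx).const_mul _)
      rw [this.liminf_eq, mul_one]
    refine hF.trans_lt (lt_of_le_of_lt ?_ (ENNReal.ofReal_lt_top (r := μ.real univ / K)))
    refine liminf_le_of_frequently_le' (Frequently.of_forall fun n => ?_)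
    have hs := suppIn_cutoff hab n
    have hc := hs.continuous_mul (continuous_cutoff a b n) hw
    rw [← ofReal_integral_eq_lintegral_ofReal
      (hc.integrable_of_hasCompactSupport (hs.mul_left w).hasCompactSupport).integrableOn
      (by
        filter_upwards [ae_restrict_mem measurableSet_Ioo] with x hx
          using mul_nonneg (hw0 x hx).le (cutoff_nonneg _ _ _ _))]
    refine ENNReal.ofReal_le_ofReal ?_
    rw [← hcutint]
    exact hcle n
  refine ⟨σ, hfinσ, fun h => by simp [hKdef, h] at hKpos, ?_, hwI, ?_⟩
  · obtain ⟨α, β, h1, h2, h3, h4⟩ := hg₀s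
    obtain ⟨B, hB⟩ := hub α β h1 h3
    refine ⟨B, ?_⟩
    rw [hσ, Measure.map_apply hu measurableSet_Icc.compl, hμ₀,
      withDensity_apply _ (hu measurableSet_Icc.compl), ← nonpos_iff_eq_zero]
    rw [← lintegral_indicator (hu measurableSet_Icc.compl), nonpos_iff_eq_zero,
      lintegral_eq_zero_iff (hdm.ennreal_ofReal.indicator (hu measurableSet_Icc.compl))]
    filter_upwards [hB] with x hx
    by_cases hxI : ξ x ∈ Icc α β
    · rw [indicator_of_notMem]
      · rfl
      · exact fun h => h (abs_le.1 (hx hxI))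
    · simp [indicator, h4 _ hxI]
  · have hfinw : IsFiniteMeasure ((volume.restrict (Ioo a b)).withDensity
        fun x => ENNReal.ofReal (w x)) := isFiniteMeasure_withDensity_ofReal hwI.2
    have hfm : IsFiniteMeasure (μ.map fun x => (ξ x, u x)) := inferInstance
    have hpm : Measurable fun x => (ξ x, u x) := hξ.prodMk hu
    refine Measure.eq_prod_of_integral_mul_boundedContinuousFunction fun f h => ?_
    rw [integral_map hpm.aemeasurable (Continuous.aestronglyMeasurable (by fun_prop))]
    have hL : Tendsto (fun n => ∫ x, (cutoff a b n (ξ x) * f (ξ x)) * h (u x) ∂μ) atTop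
        (𝓝 (∫ x, f (ξ x) * h (u x) ∂μ)) := by
      refine tendsto_integral_of_dominated_convergence (fun _ => ‖f‖ * ‖h‖)
        (fun n => ((((continuous_cutoff a b n).measurable.mul f.continuous.measurable).comp
          hξ).mul (h.continuous.measurable.comp hu)).aestronglyMeasurable)
        (integrable_const _) (fun n => ae_of_all _ fun x => ?_) ?_
      · rw [norm_mul, norm_mul, Real.norm_eq_abs (cutoff _ _ _ _),
          abs_of_nonneg (cutoff_nonneg _ _ _ _)]
        refine mul_le_mul ?_ (h.norm_coe_le_norm _) (norm_nonneg _) (norm_nonneg _)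
        calc cutoff a b n (ξ x) * ‖f (ξ x)‖ ≤ 1 * ‖f (ξ x)‖ :=
              mul_le_mul_of_nonneg_right (cutoff_le_one _ _ _ _) (norm_nonneg _)
          _ ≤ ‖f‖ := by rw [one_mul]; exact f.norm_coe_le_norm _
      · filter_upwards [hξI] with x hx
        have := ((tendsto_cutoff hx).mul_const (f (ξ x))).mul_const (h (u x))
        simpa using this
    have hR : Tendsto (fun n => (∫ x, w x * (f x * cutoff a b n x)) * ∫ t, h t ∂σ) atTop
        (𝓝 ((∫ x in Ioo a b, w x * f x) * ∫ t, h t ∂σ)) := by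
      refine Tendsto.mul_const _ ?_
      have e : ∀ n, ∫ x, w x * (f x * cutoff a b n x) =
          ∫ x in Ioo a b, w x * (f x * cutoff a b n x) := by
        intro n
        obtain ⟨α, β, h1, h2, h3, h4⟩ := suppIn_cutoff hab n
        rw [setIntegral_eq_integral_of_forall_compl_eq_zero]
        intro x hx
        rw [h4 x fun h => hx ⟨h1.trans_le h.1, h.2.trans_lt h3⟩, mul_zero, mul_zero]
      simp only [e]
      have hmeas : AEStronglyMeasurable w (volume.restrict (Ioo a b)) := hwI.1
      refine tendsto_integral_of_dominated_convergence (fun x => |w x| * ‖f‖)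
        (fun n => hmeas.mul (f.continuous.mul (continuous_cutoff a b n)).aestronglyMeasurable)
        (hwI.abs.mul_const _) (fun n => ae_of_all _ fun x => ?_) ?_
      · rw [norm_mul, norm_mul, Real.norm_eq_abs (cutoff _ _ _ _), Real.norm_eq_abs (w x),
          abs_of_nonneg (cutoff_nonneg _ _ _ _)]
        refine mul_le_mul_of_nonneg_left ?_ (abs_nonneg _)
        calc ‖f x‖ * cutoff a b n x ≤ ‖f x‖ * 1 :=
              mul_le_mul_of_nonneg_left (cutoff_le_one _ _ _ _) (norm_nonneg _)
          _ ≤ ‖f‖ := by rw [mul_one]; exact f.norm_coe_le_norm _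
      · filter_upwards [ae_restrict_mem measurableSet_Ioo] with x hx
        have := ((tendsto_cutoff hx).const_mul (f x)).const_mul (w x)
        simpa using this
    have hfin := tendsto_nhds_unique (hL.congr fun n => hcut f h n) hR
    rw [hfin]
    congr 1
    rw [integral_withDensity_eq_integral_toReal_smul₀ hwI.1.aemeasurable.ennreal_ofReal (by simp)]
    refine integral_congr_ae ?_
    filter_upwards [ae_restrict_mem measurableSet_Ioo] with x hx
    rw [ENNReal.toReal_ofReal (hw0 x hx).le, smul_eq_mul]

end Product

/-! ### Jacobi weights -/

/-- The Jacobi weight `(b - x)^P (x - a)^Q`. -/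
noncomputable def jac (a b P Q x : ℝ) : ℝ := (b - x) ^ P * (x - a) ^ Q

variable {a b P Q x : ℝ}

theorem jac_pos (hx : x ∈ Ioo a b) : 0 < jac a b P Q x :=
  mul_pos (Real.rpow_pos_of_pos (sub_pos.2 hx.2) _) (Real.rpow_pos_of_pos (sub_pos.2 hx.1) _)

theorem hasDerivAt_jac (hx : x ∈ Ioo a b) :
    HasDerivAt (jac a b P Q) ((-P / (b - x) + Q / (x - a)) * jac a b P Q x) x := by
  have h1 : 0 < b - x := sub_pos.2 hx.2
  have h2 : 0 < x - a := sub_pos.2 hx.1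
  have e1 := ((hasDerivAt_id x).const_sub b).rpow_const (p := P) (Or.inl h1.ne')
  have e2 := ((hasDerivAt_id x).sub_const a).rpow_const (p := Q) (Or.inl h2.ne')
  refine (e1.mul e2).congr_deriv ?_
  simp only [id, jac]
  rw [Real.rpow_sub_one h1.ne', Real.rpow_sub_one h2.ne']
  field_simp

theorem continuousOn_jac : ContinuousOn (jac a b P Q) (Ioo a b) :=
  fun _ hx => (hasDerivAt_jac hx).continuousAt.continuousWithinAt

theorem jac_mul {P' Q' : ℝ} (hx : x ∈ Ioo a b) :
    jac a b P Q x * jac a b P' Q' x = jac a b (P + P') (Q + Q') x := by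
  unfold jac
  rw [Real.rpow_add (sub_pos.2 hx.2), Real.rpow_add (sub_pos.2 hx.1)]
  ring

theorem jac_one_one : jac a b 1 1 x = (b - x) * (x - a) := by simp [jac]

theorem jac_rpow (hx : x ∈ Ioo a b) (r : ℝ) :
    jac a b P Q x ^ r = jac a b (P * r) (Q * r) x := by
  unfold jac
  rw [Real.mul_rpow (Real.rpow_nonneg (sub_pos.2 hx.2).le _)
    (Real.rpow_nonneg (sub_pos.2 hx.1).le _), ← Real.rpow_mul (sub_pos.2 hx.2).le,
    ← Real.rpow_mul (sub_pos.2 hx.1).le]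

theorem integrableOn_rpow_sub_right {c : ℝ} (hc : c < b) :
    IntegrableOn (fun x => (b - x) ^ P) (Ioo c b) ↔ -1 < P := by
  rw [← intervalIntegral.integrableOn_Ioo_rpow_iff (s := P) (sub_pos.2 hc)]
  have := (volume.measurePreserving_sub_left b).integrableOn_comp_preimage
    (MeasurableEquiv.subLeft b).measurableEmbedding (f := fun x => x ^ P) (s := Ioo 0 (b - c))
  rw [← this]
  have e : (fun x => b - x) ⁻¹' Ioo 0 (b - c) = Ioo c b := by
    ext x; simp
  rw [e]
  rfl

theorem integrableOn_rpow_sub_left {c : ℝ} (hc : a < c) :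
    IntegrableOn (fun x => (x - a) ^ Q) (Ioo a c) ↔ -1 < Q := by
  rw [← intervalIntegral.integrableOn_Ioo_rpow_iff (s := Q) (sub_pos.2 hc)]
  have := (measurePreserving_sub_right volume a).integrableOn_comp_preimage
    (MeasurableEquiv.subRight a).measurableEmbedding (f := fun x => x ^ Q) (s := Ioo 0 (c - a))
  rw [← this]
  have e : (fun x => x - a) ⁻¹' Ioo 0 (c - a) = Ioo a c := by
    ext x; simp
  rw [e]
  rfl

theorem measurable_jac : Measurable (jac a b P Q) := by unfold jac; fun_prop

theorem integrableOn_jac_right {c : ℝ} (hac : a < c) (hcb : c < b) :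
    IntegrableOn (jac a b P Q) (Ioo c b) ↔ -1 < P := by
  rw [← integrableOn_rpow_sub_right (P := P) hcb]
  have hcont : ∀ R : ℝ, ContinuousOn (fun x => (x - a) ^ R) (Icc c b) := fun R x hx =>
    ((continuousAt_id.sub continuousAt_const).rpow_const
      (Or.inl (sub_pos.2 (hac.trans_le hx.1)).ne')).continuousWithinAt
  constructor
  · intro h
    have := h.mul_continuousOn_of_subset (hcont (-Q)) measurableSet_Ioo isCompact_Icc
      Ioo_subset_Icc_self
    refine this.congr_fun (fun x hx => ?_) measurableSet_Ioo
    have h2 : 0 < x - a := by linarith [hx.1]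
    simp only [jac]
    rw [mul_assoc, ← Real.rpow_add h2, add_neg_cancel, Real.rpow_zero, mul_one]
  · intro h
    exact h.mul_continuousOn_of_subset (hcont Q) measurableSet_Ioo isCompact_Icc
      Ioo_subset_Icc_self

theorem integrableOn_jac_left {c : ℝ} (hac : a < c) (hcb : c < b) :
    IntegrableOn (jac a b P Q) (Ioo a c) ↔ -1 < Q := by
  rw [← integrableOn_rpow_sub_left (Q := Q) hac]
  have hcont : ∀ R : ℝ, ContinuousOn (fun x => (b - x) ^ R) (Icc a c) := fun R x hx =>
    ((continuousAt_const.sub continuousAt_id).rpow_const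
      (Or.inl (sub_pos.2 (hx.2.trans_lt hcb)).ne')).continuousWithinAt
  constructor
  · intro h
    have := h.continuousOn_mul_of_subset (hcont (-P)) isCompact_Icc measurableSet_Ioo
      Ioo_subset_Icc_self
    refine this.congr_fun (fun x hx => ?_) measurableSet_Ioo
    have h2 : 0 < b - x := by linarith [hx.2]
    simp only [jac]
    rw [← mul_assoc, ← Real.rpow_add h2, neg_add_cancel, Real.rpow_zero, one_mul]
  · intro h
    exact h.continuousOn_mul_of_subset (hcont P) isCompact_Icc measurableSet_Ioo
      Ioo_subset_Icc_self

theorem integrableOn_jac_iff (hab : a < b) :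
    IntegrableOn (jac a b P Q) (Ioo a b) ↔ -1 < P ∧ -1 < Q := by
  obtain ⟨c, hac, hcb⟩ := exists_between hab
  rw [← integrableOn_jac_right (P := P) (Q := Q) hac hcb,
    ← integrableOn_jac_left (P := P) (Q := Q) hac hcb]
  refine ⟨fun h => ⟨h.mono_set (Ioo_subset_Ioo_left hac.le),
    h.mono_set (Ioo_subset_Ioo_right hcb.le)⟩, fun ⟨h1, h2⟩ => ?_⟩
  rw [← integrableOn_Icc_iff_integrableOn_Ioo] at h1 h2
  refine (h2.union h1).mono_set fun x hx => ?_
  rcases le_total x c with h | h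
  · exact Or.inl ⟨hx.1.le, h⟩
  · exact Or.inr ⟨h, hx.2.le⟩

theorem continuous_jac (hP : 0 ≤ P) (hQ : 0 ≤ Q) : Continuous (jac a b P Q) := by
  unfold jac
  exact ((continuous_const.sub continuous_id).rpow_const fun _ => Or.inr hP).mul
    ((continuous_id.sub continuous_const).rpow_const fun _ => Or.inr hQ)

/-! ### The operator on polynomials -/

section General

variable {d : ℕ} {w : Fin d → ℝ} {Ω : Set (Fin d → ℝ)}
  {g : (Fin d → ℝ) → Matrix (Fin d) (Fin d) ℝ} {b : (Fin d → ℝ) → Fin d → ℝ}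
  {ρ : (Fin d → ℝ) → ℝ}

theorem diffusionOp_add (P Q : MvPolynomial (Fin d) ℝ) (z : Fin d → ℝ) :
    diffusionOp g b (P + Q) z = diffusionOp g b P z + diffusionOp g b Q z := by
  simp only [diffusionOp, map_add, mul_add, Finset.sum_add_distrib]
  ring

theorem diffusionOp_smul (c : ℝ) (P : MvPolynomial (Fin d) ℝ) (z : Fin d → ℝ) :
    diffusionOp g b (c • P) z = c * diffusionOp g b P z := by
  simp only [diffusionOp, Derivation.map_smul, MvPolynomial.smul_eval, mul_add, Finset.mul_sum]
  congr 1
  · refine Finset.sum_congr rfl fun i _ => Finset.sum_congr rfl fun j _ => by ring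
  · refine Finset.sum_congr rfl fun i _ => by ring

/-- `diffusionOp` at a point as a linear map. -/
noncomputable def diffusionOpLin (g : (Fin d → ℝ) → Matrix (Fin d) (Fin d) ℝ)
    (b : (Fin d → ℝ) → Fin d → ℝ) (z : Fin d → ℝ) : MvPolynomial (Fin d) ℝ →ₗ[ℝ] ℝ where
  toFun P := diffusionOp g b P z
  map_add' P Q := diffusionOp_add P Q z
  map_smul' c P := diffusionOp_smul c P z

/-- Leibniz rule of a second-order operator. Its cross term is what allows the entries of g, and
later the integration by parts formula, to be extracted from the action of L on polynomials. -/
theorem diffusionOp_X_mul {z : Fin d → ℝ} (hg : ∀ i j, g z i j = g z j i) (i : Fin d)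
    (P : MvPolynomial (Fin d) ℝ) :
    diffusionOp g b (MvPolynomial.X i * P) z = z i * diffusionOp g b P z +
      b z i * MvPolynomial.eval z P +
      2 * ∑ j, g z i j * MvPolynomial.eval z (MvPolynomial.pderiv j P) := by
  have h1 : ∀ j, MvPolynomial.eval z (MvPolynomial.pderiv j (MvPolynomial.X i * P)) =
      (if j = i then MvPolynomial.eval z P else 0) +
        z i * MvPolynomial.eval z (MvPolynomial.pderiv j P) := by
    intro j
    rw [MvPolynomial.pderiv_mul, MvPolynomial.pderiv_X]
    by_cases h : j = i
    · subst h; simp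
    · simp [h, Ne.symm h]
  have h2 : ∀ k j, MvPolynomial.eval z
      (MvPolynomial.pderiv k (MvPolynomial.pderiv j (MvPolynomial.X i * P))) =
      (if j = i then MvPolynomial.eval z (MvPolynomial.pderiv k P) else 0) +
      (if k = i then MvPolynomial.eval z (MvPolynomial.pderiv j P) else 0) +
        z i * MvPolynomial.eval z (MvPolynomial.pderiv k (MvPolynomial.pderiv j P)) := by
    intro k j
    rw [MvPolynomial.pderiv_mul, MvPolynomial.pderiv_X, map_add, MvPolynomial.pderiv_mul,
      MvPolynomial.pderiv_mul, MvPolynomial.pderiv_X]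
    by_cases h : j = i <;> by_cases h' : k = i <;>
      simp [h, h', eq_comm (a := i)]; ring
  simp only [diffusionOp, h1, h2, mul_add, mul_ite, mul_zero, Finset.sum_add_distrib,
    Finset.sum_ite_eq', Finset.mem_univ, if_true]
  have e1 : ∑ x, ∑ x_1, (if x = i then
      g z x x_1 * MvPolynomial.eval z (MvPolynomial.pderiv x_1 P) else 0) =
      ∑ j, g z i j * MvPolynomial.eval z (MvPolynomial.pderiv j P) := by
    rw [Finset.sum_comm]; simp
  have e2 : ∑ x, g z x i * MvPolynomial.eval z (MvPolynomial.pderiv x P) =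
      ∑ j, g z i j * MvPolynomial.eval z (MvPolynomial.pderiv j P) :=
    Finset.sum_congr rfl fun j _ => by rw [hg]
  have e3 : ∑ x, ∑ x_1, g z x x_1 * (z i * MvPolynomial.eval z
      (MvPolynomial.pderiv x (MvPolynomial.pderiv x_1 P))) = z i * ∑ x, ∑ x_1, g z x x_1 *
      MvPolynomial.eval z (MvPolynomial.pderiv x (MvPolynomial.pderiv x_1 P)) := by
    simp only [Finset.mul_sum]
    exact Finset.sum_congr rfl fun _ _ => Finset.sum_congr rfl fun _ _ => by ring
  have e4 : ∑ x, b z x * (z i * MvPolynomial.eval z (MvPolynomial.pderiv x P)) =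
      z i * ∑ x, b z x * MvPolynomial.eval z (MvPolynomial.pderiv x P) := by
    simp only [Finset.mul_sum]
    exact Finset.sum_congr rfl fun _ _ => by ring
  rw [e1, e2, e3, e4]
  ring

theorem diffusionOp_one (z : Fin d → ℝ) : diffusionOp g b 1 z = 0 := by
  simp [diffusionOp]

theorem diffusionOp_X (z : Fin d → ℝ) (i : Fin d) :
    diffusionOp g b (MvPolynomial.X i) z = b z i := by
  simp only [diffusionOp, MvPolynomial.pderiv_X]
  simp [Pi.single_apply, apply_ite]

theorem mem_weightedDegreeLE {n : ℝ} {P : MvPolynomial (Fin d) ℝ} :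
    P ∈ weightedDegreeLE w n ↔ ∀ k ∈ P.support, ∑ i, w i * (k i : ℝ) ≤ n := by
  rw [weightedDegreeLE, MvPolynomial.mem_restrictSupport_iff]
  rfl

theorem exists_mem_weightedDegreeLE (w : Fin d → ℝ) (P : MvPolynomial (Fin d) ℝ) :
    ∃ n₀, ∀ n ≥ n₀, P ∈ weightedDegreeLE w n := by
  refine ⟨∑ k ∈ P.support, |∑ i, w i * (k i : ℝ)|, fun n hn =>
    mem_weightedDegreeLE.2 fun k hk => le_trans ?_ hn⟩
  exact (le_abs_self _).trans
    (Finset.single_le_sum (f := fun k : Fin d →₀ ℕ => |∑ i, w i * (k i : ℝ)|)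
      (fun _ _ => abs_nonneg _) hk)

theorem ae_mem_densityMeasure (hΩ : IsOpen Ω) : ∀ᵐ z ∂densityMeasure Ω ρ, z ∈ Ω :=
  (withDensity_absolutelyContinuous _ _).ae_le (ae_restrict_mem hΩ.measurableSet)

theorem integrable_eval (h : IsDOPSolution w Ω g b ρ) (P : MvPolynomial (Fin d) ℝ) :
    Integrable (fun z => MvPolynomial.eval z P) (densityMeasure Ω ρ) :=
  have := h.isProbabilityMeasure
  (h.memLp P).integrable (by norm_num)

/-- On each `weightedDegreeLE w n` the operator is represented by a symmetric endomorphism. -/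
theorem exists_endomorphism (h : IsDOPSolution w Ω g b ρ) (n : ℝ) :
    ∃ T : weightedDegreeLE w n →ₗ[ℝ] weightedDegreeLE w n,
      (∀ P : weightedDegreeLE w n, ∀ z ∈ Ω, diffusionOp g b (P : MvPolynomial (Fin d) ℝ) z =
        MvPolynomial.eval z (T P : MvPolynomial (Fin d) ℝ)) ∧
      ∀ P Q : weightedDegreeLE w n,
        ∫ z, MvPolynomial.eval z (P * T Q : MvPolynomial (Fin d) ℝ) ∂densityMeasure Ω ρ =
        ∫ z, MvPolynomial.eval z (T P * Q : MvPolynomial (Fin d) ℝ) ∂densityMeasure Ω ρ := by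
  obtain ⟨N, e, horth, heig⟩ := h.eigenbasis n
  choose θ hθ using heig
  set T : weightedDegreeLE w n →ₗ[ℝ] weightedDegreeLE w n :=
    e.constr ℝ fun i => θ i • e i with hT
  have hTe : ∀ i, T (e i) = θ i • e i := fun i => by rw [hT, Module.Basis.constr_basis]
  refine ⟨T, fun P z hz => ?_, fun P Q => ?_⟩
  · have : (diffusionOpLin g b z).comp (weightedDegreeLE w n).subtype =
        ((MvPolynomial.aeval z).toLinearMap.comp (weightedDegreeLE w n).subtype).comp T := by
      refine e.ext fun i => ?_
      simp only [LinearMap.comp_apply, hTe, map_smul]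
      exact (hθ i z hz).trans (by simp [MvPolynomial.aeval_eq_eval])
    have := LinearMap.congr_fun this P
    simpa [diffusionOpLin, MvPolynomial.aeval_eq_eval] using this
  · let B : MvPolynomial (Fin d) ℝ →ₗ[ℝ] ℝ :=
      { toFun := fun P => ∫ z, MvPolynomial.eval z P ∂densityMeasure Ω ρ
        map_add' := fun P Q => by
          simp only [map_add]
          exact integral_add (integrable_eval h P) (integrable_eval h Q)
        map_smul' := fun c P => by
          simp only [MvPolynomial.smul_eval, integral_const_mul, RingHom.id_apply, smul_eq_mul] }
    let M : weightedDegreeLE w n →ₗ[ℝ] weightedDegreeLE w n →ₗ[ℝ] ℝ :=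
      (((LinearMap.mul ℝ (MvPolynomial (Fin d) ℝ)).domRestrict₁₂ (weightedDegreeLE w n)
        (weightedDegreeLE w n))).compr₂ B
    have hMB : ∀ P Q : weightedDegreeLE w n, M P Q =
        ∫ z, MvPolynomial.eval z (P * Q : MvPolynomial (Fin d) ℝ) ∂densityMeasure Ω ρ :=
      fun P Q => rfl
    have key : M.compl₂ T = M.comp T := by
      refine LinearMap.ext_basis e e fun i j => ?_
      rw [LinearMap.compl₂_apply, LinearMap.comp_apply, hTe, hTe, map_smul, map_smul,
        LinearMap.smul_apply]
      by_cases hij : i = j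
      · rw [hij]
      · have : M (e i) (e j) = 0 := by
          rw [hMB]
          simpa using horth i j hij
        rw [this, smul_zero, smul_zero]
    have := LinearMap.congr_fun₂ key P Q
    rwa [LinearMap.compl₂_apply, LinearMap.comp_apply, hMB, hMB] at this

theorem exists_diffusionOp_eq_eval (h : IsDOPSolution w Ω g b ρ) {n : ℝ}
    {P : MvPolynomial (Fin d) ℝ} (hP : P ∈ weightedDegreeLE w n) :
    ∃ Q ∈ weightedDegreeLE w n, ∀ z ∈ Ω, diffusionOp g b P z = MvPolynomial.eval z Q := by
  obtain ⟨T, hT, -⟩ := exists_endomorphism h n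
  exact ⟨T ⟨P, hP⟩, (T ⟨P, hP⟩).2, hT ⟨P, hP⟩⟩

/-- Integrate L(xᵢ P) = xᵢ LP + bⁱ P + 2 Σ gⁱʲ ∂ⱼP. The left side has integral zero by symmetry and
L1 = 0, and ∫ xᵢ LP = ∫ P L xᵢ = ∫ bⁱ P. Neither differentiability of ρ nor a boundary condition
enters. -/
theorem integral_coordinate_eq_zero (h : IsDOPSolution w Ω g b ρ) (i : Fin d)
    (P : MvPolynomial (Fin d) ℝ) :
    ∫ z, (b z i * MvPolynomial.eval z P +
      ∑ j, g z i j * MvPolynomial.eval z (MvPolynomial.pderiv j P)) ∂densityMeasure Ω ρ = 0 := by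
  obtain ⟨n₁, h₁⟩ := exists_mem_weightedDegreeLE w P
  obtain ⟨n₂, h₂⟩ := exists_mem_weightedDegreeLE w (MvPolynomial.X i * P)
  obtain ⟨n₃, h₃⟩ := exists_mem_weightedDegreeLE w (MvPolynomial.X i : MvPolynomial (Fin d) ℝ)
  obtain ⟨n₄, h₄⟩ := exists_mem_weightedDegreeLE w (1 : MvPolynomial (Fin d) ℝ)
  set n := max (max n₁ n₂) (max n₃ n₄) with hn
  obtain ⟨T, hT, hsym⟩ := exists_endomorphism h n
  let p : weightedDegreeLE w n := ⟨P, h₁ n (by simp [hn])⟩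
  let xp : weightedDegreeLE w n := ⟨MvPolynomial.X i * P, h₂ n (by simp [hn])⟩
  let x : weightedDegreeLE w n := ⟨MvPolynomial.X i, h₃ n (by simp [hn])⟩
  let o : weightedDegreeLE w n := ⟨1, h₄ n (by simp [hn])⟩
  have hΩ := ae_mem_densityMeasure (ρ := ρ) h.isOpen
  have hx : ∀ z ∈ Ω, MvPolynomial.eval z (T x : MvPolynomial (Fin d) ℝ) = b z i := fun z hz => by
    rw [← hT x z hz, diffusionOp_X]
  have hxp : ∀ z ∈ Ω, MvPolynomial.eval z (T xp : MvPolynomial (Fin d) ℝ) =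
      z i * MvPolynomial.eval z (T p : MvPolynomial (Fin d) ℝ) + b z i * MvPolynomial.eval z P +
      2 * ∑ j, g z i j * MvPolynomial.eval z (MvPolynomial.pderiv j P) := fun z hz => by
    rw [← hT xp z hz, ← hT p z hz, diffusionOp_X_mul]
    exact fun i j => by simpa using (h.elliptic z hz).isHermitian.apply j i
  have e1 : ∫ z, MvPolynomial.eval z (T xp : MvPolynomial (Fin d) ℝ) ∂densityMeasure Ω ρ = 0 := by
    have := hsym o xp
    simp only [o, one_mul] at this
    rw [this]
    refine integral_eq_zero_of_ae ?_
    filter_upwards [hΩ] with z hz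
    have : MvPolynomial.eval z (T o : MvPolynomial (Fin d) ℝ) = 0 := by
      rw [← hT o z hz, diffusionOp_one]
    simp [o] at this
    simp [this]
  have e2 := hsym x p
  have key : ∀ᵐ z ∂densityMeasure Ω ρ, 2 * (b z i * MvPolynomial.eval z P +
      ∑ j, g z i j * MvPolynomial.eval z (MvPolynomial.pderiv j P)) =
      MvPolynomial.eval z (T xp : MvPolynomial (Fin d) ℝ) -
      (MvPolynomial.eval z (x * T p : MvPolynomial (Fin d) ℝ) -
        MvPolynomial.eval z (T x * p : MvPolynomial (Fin d) ℝ)) := by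
    filter_upwards [hΩ] with z hz
    rw [map_mul, map_mul, hx z hz, hxp z hz]
    simp only [x, p, MvPolynomial.eval_X]
    ring
  have := integral_congr_ae key
  have e3 := integral_sub (integrable_eval h (x * T p : MvPolynomial (Fin d) ℝ))
    (integrable_eval h (T x * p : MvPolynomial (Fin d) ℝ))
  have e4 : Integrable (fun z => MvPolynomial.eval z (x * T p : MvPolynomial (Fin d) ℝ) -
      MvPolynomial.eval z (T x * p : MvPolynomial (Fin d) ℝ)) (densityMeasure Ω ρ) :=
    (integrable_eval h _).sub (integrable_eval h _)
  have e5 := integral_sub (integrable_eval h (T xp : MvPolynomial (Fin d) ℝ)) e4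
  rw [integral_const_mul, e5, e3, e1, e2] at this
  linarith

end General

/-! ### Shape of the coefficients in the plane -/

/-- The monomials are grouped by their power of y. The condition n < K w excludes y^K, and n < k w +
N + 1 expresses that the integral x-degree of the coefficient of y^k is at most N. -/
theorem exists_eval_eq_sum {w n : ℝ} {Q : MvPolynomial (Fin 2) ℝ}
    (hQ : Q ∈ weightedDegreeLE ![1, w] n) (K : ℕ) (hw : 0 < w) (hK : n < K * w) :
    ∃ f : ℕ → Polynomial ℝ, (∀ z : Fin 2 → ℝ, MvPolynomial.eval z Q =
        ∑ k ∈ Finset.range K, (f k).eval (z 0) * z 1 ^ k) ∧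
      ∀ k N : ℕ, n < k * w + N + 1 → (f k).natDegree ≤ N := by
  rw [mem_weightedDegreeLE] at hQ
  simp only [Fin.sum_univ_two, Matrix.cons_val_zero, Matrix.cons_val_one, one_mul] at hQ
  refine ⟨fun k => ∑ m ∈ Q.support with m 1 = k, Polynomial.monomial (m 0) (Q.coeff m),
    fun z => ?_, fun k N hN => ?_⟩
  · rw [MvPolynomial.eval_eq']
    simp only [Fin.prod_univ_two, Polynomial.eval_finsetSum, Polynomial.eval_monomial,
      Finset.sum_mul]
    rw [← Finset.sum_fiberwise_of_maps_to (g := fun m : Fin 2 →₀ ℕ => m 1)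
      (t := Finset.range K)]
    · refine Finset.sum_congr rfl fun k _ => Finset.sum_congr rfl fun m hm => ?_
      rw [(Finset.mem_filter.1 hm).2]; ring
    · intro m hm
      rw [Finset.mem_range]
      have h1 := hQ m hm
      have h2 : (m 1 : ℝ) * w < K * w := by
        have : (0 : ℝ) ≤ m 0 := Nat.cast_nonneg _
        linarith
      exact_mod_cast lt_of_mul_lt_mul_right h2 hw.le
  · refine Polynomial.natDegree_sum_le_of_forall_le _ _ fun m hm => ?_
    refine (Polynomial.natDegree_monomial_le _).trans ?_
    obtain ⟨hm1, rfl⟩ := Finset.mem_filter.1 hm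
    have h1 := hQ m hm1
    have : (m 0 : ℝ) < N + 1 := by linarith
    exact Nat.lt_succ_iff.1 (by exact_mod_cast this)

theorem X_pow_mul_X_pow_mem {w n : ℝ} (i j : ℕ) (h : i + w * j ≤ n) :
    (MvPolynomial.X 0 ^ i * MvPolynomial.X 1 ^ j : MvPolynomial (Fin 2) ℝ) ∈
      weightedDegreeLE ![1, w] n := by
  have : (MvPolynomial.X 0 ^ i * MvPolynomial.X 1 ^ j : MvPolynomial (Fin 2) ℝ) =
      MvPolynomial.monomial (Finsupp.single 0 i + Finsupp.single 1 j) 1 := by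
    rw [MvPolynomial.X_pow_eq_monomial, MvPolynomial.X_pow_eq_monomial, MvPolynomial.monomial_mul,
      one_mul]
  rw [this, mem_weightedDegreeLE]
  intro k hk
  have hk' := Finset.mem_singleton.1 (MvPolynomial.support_monomial_subset hk)
  subst hk'
  simpa [Fin.sum_univ_two] using h

/-- Explicit form of a bounded solution: the coefficients are polynomials of the form forced by
the weights, and `L` is symmetric against the test functions `f(x) y^k`. -/
structure PlaneSolution (Ω : Set (Fin 2 → ℝ)) (g : (Fin 2 → ℝ) → Matrix (Fin 2) (Fin 2) ℝ)
    (b : (Fin 2 → ℝ) → Fin 2 → ℝ) (ρ : (Fin 2 → ℝ) → ℝ) (G l r p q β d : Polynomial ℝ)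
    (a c : ℝ) : Prop where
  isOpen : IsOpen Ω
  isConnected : IsConnected Ω
  interior_closure : interior (closure Ω) = Ω
  isBounded : Bornology.IsBounded Ω
  elliptic : ∀ z ∈ Ω, (g z).PosDef
  continuousOn_density : ContinuousOn ρ Ω
  density_nonneg : ∀ z ∈ Ω, 0 ≤ ρ z
  isProbabilityMeasure : IsProbabilityMeasure (densityMeasure Ω ρ)
  natDegree_G : G.natDegree ≤ 2
  natDegree_l : l.natDegree ≤ 1
  natDegree_β : β.natDegree ≤ 1
  g00 : ∀ z ∈ Ω, g z 0 0 = G.eval (z 0)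
  g01 : ∀ z ∈ Ω, g z 0 1 = l.eval (z 0) * z 1 + r.eval (z 0)
  g10 : ∀ z ∈ Ω, g z 1 0 = l.eval (z 0) * z 1 + r.eval (z 0)
  g11 : ∀ z ∈ Ω, g z 1 1 = a * z 1 ^ 2 + p.eval (z 0) * z 1 + q.eval (z 0)
  b0 : ∀ z ∈ Ω, b z 0 = β.eval (z 0)
  b1 : ∀ z ∈ Ω, b z 1 = c * z 1 + d.eval (z 0)
  weak0 : ∀ (f f' : ℝ → ℝ) (k : ℕ), (∀ x, HasDerivAt f (f' x) x) → Continuous f' →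
    ∫ z, (f (z 0) * (β.eval (z 0) * z 1 ^ k +
        k * (l.eval (z 0) * z 1 + r.eval (z 0)) * z 1 ^ (k - 1)) +
      f' (z 0) * (G.eval (z 0) * z 1 ^ k)) ∂densityMeasure Ω ρ = 0
  weak1 : ∀ (f f' : ℝ → ℝ) (k : ℕ), (∀ x, HasDerivAt f (f' x) x) → Continuous f' →
    ∫ z, (f (z 0) * ((c * z 1 + d.eval (z 0)) * z 1 ^ k +
        k * (a * z 1 ^ 2 + p.eval (z 0) * z 1 + q.eval (z 0)) * z 1 ^ (k - 1)) +
      f' (z 0) * ((l.eval (z 0) * z 1 + r.eval (z 0)) * z 1 ^ k)) ∂densityMeasure Ω ρ = 0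

theorem integrable_of_continuous_of_isBounded {Ω : Set (Fin 2 → ℝ)} {ρ : (Fin 2 → ℝ) → ℝ}
    (hΩ : IsOpen Ω) (hb : Bornology.IsBounded Ω) (hρ : IsFiniteMeasure (densityMeasure Ω ρ))
    {F : (Fin 2 → ℝ) → ℝ} (hF : Continuous F) : Integrable F (densityMeasure Ω ρ) := by
  obtain ⟨C, hC⟩ := (hb.isCompact_closure).exists_bound_of_continuousOn hF.continuousOn
  refine Integrable.of_bound hF.aestronglyMeasurable C ?_
  filter_upwards [ae_mem_densityMeasure hΩ] with z hz using hC z (subset_closure hz)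

theorem exists_Icc_of_isBounded {Ω : Set (Fin 2 → ℝ)} (hb : Bornology.IsBounded Ω) :
    ∃ R, ∀ z ∈ Ω, ∀ i, |z i| ≤ R := by
  obtain ⟨R, hR⟩ := hb.exists_norm_le
  exact ⟨R, fun z hz i => (norm_le_pi_norm z i).trans (hR z hz)⟩

theorem natDegree_zero_eval {f : Polynomial ℝ} (h : f.natDegree ≤ 0) (x : ℝ) :
    f.eval x = f.coeff 0 := by
  rw [Polynomial.eq_C_of_natDegree_le_zero h]; simp

theorem pderiv_aeval_X_mul_pow (f : Polynomial ℝ) (k : ℕ) (z : Fin 2 → ℝ) :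
    MvPolynomial.eval z (Polynomial.aeval (MvPolynomial.X 0) f * MvPolynomial.X 1 ^ k) =
      f.eval (z 0) * z 1 ^ k ∧
    MvPolynomial.eval z (MvPolynomial.pderiv 0
      (Polynomial.aeval (MvPolynomial.X 0) f * MvPolynomial.X 1 ^ k)) =
      f.derivative.eval (z 0) * z 1 ^ k ∧
    MvPolynomial.eval z (MvPolynomial.pderiv 1
      (Polynomial.aeval (MvPolynomial.X 0) f * MvPolynomial.X 1 ^ k)) =
      f.eval (z 0) * (k * z 1 ^ (k - 1)) := by
  have he : ∀ f : Polynomial ℝ, MvPolynomial.eval z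
      (Polynomial.aeval (MvPolynomial.X 0) f : MvPolynomial (Fin 2) ℝ) = f.eval (z 0) := by
    intro f
    rw [Polynomial.aeval_def, Polynomial.hom_eval₂]
    have hC : (MvPolynomial.eval z).comp MvPolynomial.C = RingHom.id ℝ := by ext; simp
    simp [Polynomial.eval₂_eq_eval_map, MvPolynomial.algebraMap_eq, hC]
  refine ⟨by simp [he], ?_, ?_⟩
  · rw [MvPolynomial.pderiv_mul, Derivation.map_aeval]
    simp [he, MvPolynomial.pderiv_X]
  · rw [MvPolynomial.pderiv_mul, Derivation.map_aeval]
    simp [he, MvPolynomial.pderiv_X]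

/-- The entry gⁱʲ is half of L(xᵢxⱼ) - xᵢ L xⱼ - xⱼ L xᵢ. Since L preserves weighted degree, L x and
L x² have degree at most 2 < w and do not contain y; L y and L(xy) are at most affine in y, and L y²
is quadratic in y with a constant leading coefficient. The weak identities for polynomials extend to
f(x) y^k by C¹ approximation in x. -/
theorem IsOneInftyDOPSolution.exists_planeSolution {Ω : Set (Fin 2 → ℝ)}
    {g : (Fin 2 → ℝ) → Matrix (Fin 2) (Fin 2) ℝ} {b : (Fin 2 → ℝ) → Fin 2 → ℝ}
    {ρ : (Fin 2 → ℝ) → ℝ} (h : IsOneInftyDOPSolution Ω g b ρ) (hb : Bornology.IsBounded Ω) :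
    ∃ (G l r p q β d : Polynomial ℝ) (a c : ℝ), PlaneSolution Ω g b ρ G l r p q β d a c := by
  obtain ⟨w, hw, h⟩ := h
  have hw0 : 0 < w := by linarith
  have hsymm : ∀ z ∈ Ω, ∀ i j, g z i j = g z j i := fun z hz i j => by
    simpa using (h.elliptic z hz).isHermitian.apply j i
  -- images of the monomials of low degree
  have hx : ∃ β : Polynomial ℝ, β.natDegree ≤ 1 ∧ ∀ z ∈ Ω, b z 0 = β.eval (z 0) := by
    have hm : (MvPolynomial.X 0 : MvPolynomial (Fin 2) ℝ) ∈ weightedDegreeLE ![1, w] 1 := by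
      simpa using X_pow_mul_X_pow_mem (w := w) (n := 1) 1 0 (by norm_num)
    obtain ⟨Q, hQ, hQ'⟩ := exists_diffusionOp_eq_eval h hm
    obtain ⟨f, hf, hf'⟩ := exists_eval_eq_sum hQ 1 hw0 (by norm_num; linarith)
    refine ⟨f 0, hf' 0 1 (by norm_num), fun z hz => ?_⟩
    rw [← diffusionOp_X (g := g) (b := b) z 0, hQ' z hz, hf]
    simp
  have hy : ∃ (d : Polynomial ℝ) (c : ℝ), ∀ z ∈ Ω, b z 1 = c * z 1 + d.eval (z 0) := by
    have hm : (MvPolynomial.X 1 : MvPolynomial (Fin 2) ℝ) ∈ weightedDegreeLE ![1, w] w := by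
      simpa using X_pow_mul_X_pow_mem (w := w) (n := w) 0 1 (by norm_num)
    obtain ⟨Q, hQ, hQ'⟩ := exists_diffusionOp_eq_eval h hm
    obtain ⟨f, hf, hf'⟩ := exists_eval_eq_sum hQ 2 hw0 (by norm_num; linarith)
    refine ⟨f 0, (f 1).coeff 0, fun z hz => ?_⟩
    rw [← diffusionOp_X (g := g) (b := b) z 1, hQ' z hz, hf,
      ← natDegree_zero_eval (hf' 1 0 (by norm_num)) (z 0)]
    simp [Finset.sum_range_succ]; ring
  obtain ⟨β, hβ, hb0⟩ := hx
  obtain ⟨d, c, hb1⟩ := hy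
  have hXX : ∀ i j : Fin 2, ∀ z ∈ Ω,
      diffusionOp g b (MvPolynomial.X i * MvPolynomial.X j) z =
      z i * b z j + z j * b z i + 2 * g z i j := by
    intro i j z hz
    rw [diffusionOp_X_mul (hsymm z hz), diffusionOp_X]
    simp [MvPolynomial.pderiv_X, Pi.single_apply, apply_ite]
    ring
  have hxx : ∃ G : Polynomial ℝ, G.natDegree ≤ 2 ∧ ∀ z ∈ Ω, g z 0 0 = G.eval (z 0) := by
    have hm : (MvPolynomial.X 0 * MvPolynomial.X 0 : MvPolynomial (Fin 2) ℝ) ∈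
        weightedDegreeLE ![1, w] 2 := by
      simpa [sq] using X_pow_mul_X_pow_mem (w := w) (n := 2) 2 0 (by norm_num)
    obtain ⟨Q, hQ, hQ'⟩ := exists_diffusionOp_eq_eval h hm
    obtain ⟨f, hf, hf'⟩ := exists_eval_eq_sum hQ 1 hw0 (by norm_num; linarith)
    refine ⟨Polynomial.C (1 / 2) * (f 0 - Polynomial.C 2 * (Polynomial.X * β)), ?_, fun z hz => ?_⟩
    · refine (Polynomial.natDegree_C_mul_le _ _).trans ?_
      refine (Polynomial.natDegree_sub_le _ _).trans (max_le (hf' 0 2 (by norm_num)) ?_)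
      refine (Polynomial.natDegree_C_mul_le _ _).trans ?_
      exact Polynomial.natDegree_mul_le.trans (by rw [Polynomial.natDegree_X]; omega)
    · have := hXX 0 0 z hz
      rw [hQ' z hz, hf, hb0 z hz] at this
      simp at this
      simp; linarith
  have hxy : ∃ l r : Polynomial ℝ, l.natDegree ≤ 1 ∧ ∀ z ∈ Ω,
      g z 0 1 = l.eval (z 0) * z 1 + r.eval (z 0) := by
    have hm : (MvPolynomial.X 0 * MvPolynomial.X 1 : MvPolynomial (Fin 2) ℝ) ∈
        weightedDegreeLE ![1, w] (1 + w) := by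
      simpa using X_pow_mul_X_pow_mem (w := w) (n := 1 + w) 1 1 (by norm_num)
    obtain ⟨Q, hQ, hQ'⟩ := exists_diffusionOp_eq_eval h hm
    obtain ⟨f, hf, hf'⟩ := exists_eval_eq_sum hQ 2 hw0 (by norm_num; linarith)
    refine ⟨Polynomial.C (1 / 2) * (f 1 - (Polynomial.X * Polynomial.C c + β)),
      Polynomial.C (1 / 2) * (f 0 - Polynomial.X * d), ?_, fun z hz => ?_⟩
    · refine (Polynomial.natDegree_C_mul_le _ _).trans ?_
      refine (Polynomial.natDegree_sub_le _ _).trans (max_le (hf' 1 1 (by norm_num; linarith)) ?_)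
      refine (Polynomial.natDegree_add_le _ _).trans (max_le ?_ hβ)
      exact Polynomial.natDegree_mul_le.trans (by simp)
    · have := hXX 0 1 z hz
      rw [hQ' z hz, hf, hb0 z hz, hb1 z hz] at this
      simp [Finset.sum_range_succ] at this
      simp; linarith
  have hyy : ∃ (p q : Polynomial ℝ) (a : ℝ), ∀ z ∈ Ω,
      g z 1 1 = a * z 1 ^ 2 + p.eval (z 0) * z 1 + q.eval (z 0) := by
    have hm : (MvPolynomial.X 1 * MvPolynomial.X 1 : MvPolynomial (Fin 2) ℝ) ∈
        weightedDegreeLE ![1, w] (2 * w) := by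
      simpa [sq] using X_pow_mul_X_pow_mem (w := w) (n := 2 * w) 0 2 (by norm_num; linarith)
    obtain ⟨Q, hQ, hQ'⟩ := exists_diffusionOp_eq_eval h hm
    obtain ⟨f, hf, hf'⟩ := exists_eval_eq_sum hQ 3 hw0 (by norm_num; linarith)
    refine ⟨Polynomial.C (1 / 2) * (f 1 - Polynomial.C 2 * d), Polynomial.C (1 / 2) * f 0,
      1 / 2 * ((f 2).coeff 0 - 2 * c), fun z hz => ?_⟩
    have := hXX 1 1 z hz
    rw [hQ' z hz, hf, hb1 z hz] at this
    simp only [Finset.sum_range_succ, natDegree_zero_eval (hf' 2 0 (by norm_num)) (z 0)]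
      at this
    simp at this
    simp; linarith
  obtain ⟨G, hG, hg00⟩ := hxx
  obtain ⟨l, r, hl, hg01⟩ := hxy
  obtain ⟨p, q, a, hg11⟩ := hyy
  have hg10 : ∀ z ∈ Ω, g z 1 0 = l.eval (z 0) * z 1 + r.eval (z 0) := fun z hz => by
    rw [hsymm z hz, hg01 z hz]
  have hprob := h.isProbabilityMeasure
  obtain ⟨R, hR⟩ := exists_Icc_of_isBounded hb
  have hae := ae_mem_densityMeasure (ρ := ρ) h.isOpen
  have hRae : ∀ᵐ z ∂densityMeasure Ω ρ, z 0 ∈ Icc (-R) R := by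
    filter_upwards [hae] with z hz using abs_le.1 (hR z hz 0)
  refine ⟨G, l, r, p, q, β, d, a, c, h.isOpen, h.isConnected, h.interior_closure, hb, h.elliptic,
    h.continuousOn_density, h.density_nonneg, hprob, hG, hl, hβ, hg00, hg01, hg10, hg11, hb0, hb1,
    fun f f' k hf hf' => ?_, fun f f' k hf hf' => ?_⟩
  · refine integral_C1_of_polynomial (measurable_pi_apply 0) hRae
      (integrable_of_continuous_of_isBounded h.isOpen hb inferInstance (by fun_prop))
      (integrable_of_continuous_of_isBounded h.isOpen hb inferInstance (by fun_prop))
      (fun P => ?_) hf hf'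
    rw [← integral_coordinate_eq_zero h 0
      (Polynomial.aeval (MvPolynomial.X 0) P * MvPolynomial.X 1 ^ k)]
    refine integral_congr_ae ?_
    filter_upwards [hae] with z hz
    obtain ⟨e1, e2, e3⟩ := pderiv_aeval_X_mul_pow P k z
    rw [Fin.sum_univ_two, e1, e2, e3, hb0 z hz, hg00 z hz, hg01 z hz]
    ring
  · refine integral_C1_of_polynomial (measurable_pi_apply 0) hRae
      (integrable_of_continuous_of_isBounded h.isOpen hb inferInstance (by fun_prop))
      (integrable_of_continuous_of_isBounded h.isOpen hb inferInstance (by fun_prop))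
      (fun P => ?_) hf hf'
    rw [← integral_coordinate_eq_zero h 1
      (Polynomial.aeval (MvPolynomial.X 0) P * MvPolynomial.X 1 ^ k)]
    refine integral_congr_ae ?_
    filter_upwards [hae] with z hz
    obtain ⟨e1, e2, e3⟩ := pderiv_aeval_X_mul_pow P k z
    rw [Fin.sum_univ_two, e1, e2, e3, hb1 z hz, hg10 z hz, hg11 z hz]
    ring

/-! ### The base interval and the transported coordinate -/

theorem eval_of_natDegree_le_two {f : Polynomial ℝ} (h : f.natDegree ≤ 2) (x : ℝ) :
    f.eval x = f.coeff 0 + f.coeff 1 * x + f.coeff 2 * x ^ 2 := by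
  rw [Polynomial.eval_eq_sum_range' (Nat.lt_succ_of_le h)]
  simp [Finset.sum_range_succ]

theorem eval_of_natDegree_le_one {f : Polynomial ℝ} (h : f.natDegree ≤ 1) (x : ℝ) :
    f.eval x = f.coeff 0 + f.coeff 1 * x := by
  rw [Polynomial.eval_eq_sum_range' (Nat.lt_succ_of_le h)]
  simp [Finset.sum_range_succ]

theorem affine_eq_interpolation {f : Polynomial ℝ} (h : f.natDegree ≤ 1) {a b κ : ℝ} (hab : a < b)
    (hκ : 0 < κ) (x : ℝ) :
    f.eval x = κ * (f.eval a / (κ * (b - a)) * (b - x) - -f.eval b / (κ * (b - a)) * (x - a)) := by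
  simp only [eval_of_natDegree_le_one h]
  have : b - a ≠ 0 := (sub_pos.2 hab).ne'
  field_simp
  ring

theorem SuppIn.add {a b : ℝ} {g h : ℝ → ℝ} (hg : SuppIn a b g) (hh : SuppIn a b h) :
    SuppIn a b fun x => g x + h x := by
  obtain ⟨α, β, h1, h2, h3, h4⟩ := hg.exists_common hh
  exact ⟨α, β, h1, h2, h3, fun x hx => by simp [h4 x hx]⟩

/-- A factor that is differentiable only inside (a, b) still gives a C¹ test function on the whole
line, because f vanishes near the ends. This admits weights that are singular at the ends. -/
theorem SuppIn.hasDerivAt_mul {a b : ℝ} {f f' h h' : ℝ → ℝ} (hfs : SuppIn a b f)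
    (hfs' : SuppIn a b f') (hf : ∀ x, HasDerivAt f (f' x) x) (hf' : Continuous f')
    (hh : ∀ x ∈ Ioo a b, HasDerivAt h (h' x) x) (hh' : ContinuousOn h' (Ioo a b)) :
    (∀ x, HasDerivAt (fun x => h x * f x) (h' x * f x + h x * f' x) x) ∧
      Continuous (fun x => h' x * f x + h x * f' x) ∧ SuppIn a b (fun x => h x * f x) ∧
      SuppIn a b (fun x => h' x * f x + h x * f' x) := by
  have hfc : Continuous f := continuous_iff_continuousAt.2 fun x => (hf x).continuousAt
  have hhc : ContinuousOn h (Ioo a b) := fun x hx => (hh x hx).continuousAt.continuousWithinAt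
  refine ⟨fun x => ?_, (hfs.continuous_mul hfc hh').add (hfs'.continuous_mul hf' hhc),
    hfs.mul_left h, (hfs.mul_left h').add (hfs'.mul_left h)⟩
  by_cases hx : x ∈ Ioo a b
  · exact (hh x hx).mul (hf x)
  · obtain ⟨α, β, h1, h2, h3, h4⟩ := hfs.exists_common hfs'
    have hx' : x ∈ (Icc α β)ᶜ := fun h => hx ⟨h1.trans_le h.1, h.2.trans_lt h3⟩
    rw [(h4 x hx').1, (h4 x hx').2, mul_zero, mul_zero, add_zero]
    refine (hasDerivAt_const x (0 : ℝ)).congr_of_eventuallyEq ?_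
    filter_upwards [isClosed_Icc.isOpen_compl.mem_nhds hx'] with y hy
    rw [(h4 y hy).1, mul_zero]

/-- Variation of constants: t = s ∫ f / s, extended by zero outside (a, b) to keep it measurable. -/
theorem exists_transport {a b : ℝ} {A f : ℝ → ℝ} (hab : a < b) 
    (hf : ContinuousOn f (Ioo a b)) {s : ℝ → ℝ} (hs0 : ∀ x ∈ Ioo a b, s x ≠ 0)
    (hs : ∀ x ∈ Ioo a b, HasDerivAt s (A x * s x) x) :
    ∃ t : ℝ → ℝ, Measurable t ∧ ∀ x ∈ Ioo a b, HasDerivAt t (A x * t x + f x) x := by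
  obtain ⟨c, hc⟩ := exists_between hab
  have hsc : ContinuousOn s (Ioo a b) := fun x hx => (hs x hx).continuousAt.continuousWithinAt
  have hk : ContinuousOn (fun x => f x / s x) (Ioo a b) := hf.div hsc hs0
  set T : ℝ → ℝ := fun x => ∫ y in c..x, f y / s y with hT
  have hTd : ∀ x ∈ Ioo a b, HasDerivAt T (f x / s x) x := by
    intro x hx
    refine intervalIntegral.integral_hasDerivAt_right ?_ ?_ ?_
    · refine (hk.mono ?_).intervalIntegrable
      intro y hy
      rcases mem_uIcc.1 hy with h | h
      · exact ⟨hc.1.trans_le h.1, h.2.trans_lt hx.2⟩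
      · exact ⟨hx.1.trans_le h.1, h.2.trans_lt hc.2⟩
    · exact hk.stronglyMeasurableAtFilter isOpen_Ioo x hx
    · exact hk.continuousAt (isOpen_Ioo.mem_nhds hx)
  have hd : ∀ x ∈ Ioo a b, HasDerivAt (fun x => s x * T x) (A x * (s x * T x) + f x) x := by
    intro x hx
    refine ((hs x hx).mul (hTd x hx)).congr_deriv ?_
    have := hs0 x hx
    field_simp
  have hcont : ContinuousOn (fun x => s x * T x) (Ioo a b) :=
    fun x hx => (hd x hx).continuousAt.continuousWithinAt
  classical
  refine ⟨(Ioo a b).piecewise (fun x => s x * T x) (fun _ => 0),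
    hcont.measurable_piecewise continuousOn_const measurableSet_Ioo, fun x hx => ?_⟩
  rw [piecewise_eq_of_mem _ _ _ hx]
  refine (hd x hx).congr_of_eventuallyEq ?_
  filter_upwards [isOpen_Ioo.mem_nhds hx] with y hy
  exact piecewise_eq_of_mem _ _ _ hy

namespace PlaneSolution

variable {Ω : Set (Fin 2 → ℝ)} {g : (Fin 2 → ℝ) → Matrix (Fin 2) (Fin 2) ℝ}
    {b : (Fin 2 → ℝ) → Fin 2 → ℝ} {ρ : (Fin 2 → ℝ) → ℝ} {G l r p q β d : Polynomial ℝ}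
    {a c : ℝ}

theorem G_pos (S : PlaneSolution Ω g b ρ G l r p q β d a c) {z : Fin 2 → ℝ} (hz : z ∈ Ω) :
    0 < G.eval (z 0) := by
  rw [← S.g00 z hz]
  exact (S.elliptic z hz).diag_pos

/-- The test functions f(x) alone give a one-dimensional identity for the x-marginal, so G vanishes
at both endpoints of its support. Ellipticity makes G positive on the projection of Ω, which is an
interval by connectedness; it therefore cannot cross these zeros, and it reaches up to them because
the marginal does. -/
theorem exists_interval (S : PlaneSolution Ω g b ρ G l r p q β d a c) :
    ∃ xl xr κ : ℝ, xl < xr ∧ 0 < κ ∧ (∀ x, G.eval x = κ * ((xr - x) * (x - xl))) ∧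
      (fun z : Fin 2 → ℝ => z 0) '' Ω = Ioo xl xr := by
  have hprob := S.isProbabilityMeasure
  have hm : Measurable fun z : Fin 2 → ℝ => z 0 := measurable_pi_apply 0
  set ν := (densityMeasure Ω ρ).map fun z => z 0 with hν
  have hνprob : IsProbabilityMeasure ν := Measure.isProbabilityMeasure_map hm.aemeasurable
  set J := (fun z : Fin 2 → ℝ => z 0) '' Ω with hJ
  have hae := ae_mem_densityMeasure (ρ := ρ) S.isOpen
  have hnull : ∀ s : Set ℝ, MeasurableSet s → (∀ x ∈ J, x ∉ s) → ν s = 0 := by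
    intro s hs h
    rw [hν, Measure.map_apply hm hs]
    rw [ae_iff] at hae
    exact measure_mono_null (fun z hz hzΩ => h _ ⟨z, hzΩ, rfl⟩ hz) hae
  obtain ⟨R, hR⟩ := exists_Icc_of_isBounded S.isBounded
  have hsupp : ν (Icc (-R) R)ᶜ = 0 := hnull _ measurableSet_Icc.compl (by
    rintro _ ⟨z, hz, rfl⟩ h
    exact h (abs_le.1 (hR z hz 0)))
  have hν0 : ν ≠ 0 := IsProbabilityMeasure.ne_zero ν
  have hid : ∀ f f' : ℝ → ℝ, (∀ x, HasDerivAt f (f' x) x) → Continuous f' →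
      ∫ x, (f x * β.eval x + f' x * G.eval x) ∂ν = 0 := by
    intro f f' hf hf'
    have hfc : Continuous f := continuous_iff_continuousAt.2 fun x => (hf x).continuousAt
    rw [hν, integral_map hm.aemeasurable (Continuous.aestronglyMeasurable (by fun_prop)),
      ← S.weak0 f f' 0 hf hf']
    simp
  obtain ⟨xl, -, hl0, hl⟩ := exists_left_endpoint hν0 hsupp
  obtain ⟨xr, -, hr0, hr⟩ := exists_right_endpoint hν0 hsupp
  have hGl := eq_zero_at_left_endpoint G.continuous β.continuous hl0 hl hid
  have hGr := eq_zero_at_right_endpoint G.continuous β.continuous hr0 hr hid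
  have hGJ : ∀ x ∈ J, 0 < G.eval x := by rintro _ ⟨z, hz, rfl⟩; exact S.G_pos hz
  have hlJ : xl ∉ J := fun h => (hGJ _ h).ne' hGl
  have hrJ : xr ∉ J := fun h => (hGJ _ h).ne' hGr
  have hconn : OrdConnected J := (S.isConnected.isPreconnected.image _
    (continuous_apply 0).continuousOn).ordConnected
  have hexl : ∀ c > xl, ∃ x ∈ J, x < c := by
    intro c hc
    by_contra! h
    exact hl c hc (hnull _ measurableSet_Iio fun x hx => not_lt.2 (h x hx))
  have hexr : ∀ c < xr, ∃ x ∈ J, c < x := by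
    intro c hc
    by_contra! h
    exact hr c hc (hnull _ measurableSet_Ioi fun x hx => not_lt.2 (h x hx))
  -- points of the interval inside the support
  obtain ⟨x₁, hx₁J, hx₁⟩ : ∃ x ∈ J, xl ≤ x ∧ x ≤ xr := by
    by_contra! h
    have : ν univ = 0 := by
      refine measure_mono_null (t := Iio xl ∪ Ioi xr ∪ Icc xl xr) ?_ (measure_union_null
        (measure_union_null hl0 hr0) (hnull _ measurableSet_Icc fun x hx hx' =>
          (h x hx hx'.1).not_ge hx'.2))
      intro x _
      rcases lt_or_ge x xl with h1 | h1
      · exact Or.inl (Or.inl h1)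
      · rcases lt_or_ge xr x with h2 | h2
        · exact Or.inl (Or.inr h2)
        · exact Or.inr ⟨h1, h2⟩
    exact hν0 (Measure.measure_univ_eq_zero.1 this)
  have hlt1 : xl < x₁ := lt_of_le_of_ne hx₁.1 fun h => hlJ (h ▸ hx₁J)
  have hlt2 : x₁ < xr := lt_of_le_of_ne hx₁.2 fun h => hrJ (h ▸ hx₁J)
  have hJe : J = Ioo xl xr := by
    refine Subset.antisymm (fun x hx => ⟨?_, ?_⟩) fun x hx => ?_
    · by_contra! h
      exact hlJ (hconn.out hx hx₁J ⟨h, hlt1.le⟩)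
    · by_contra! h
      exact hrJ (hconn.out hx₁J hx ⟨hlt2.le, h⟩)
    · obtain ⟨u, hu, hux⟩ := hexl x hx.1
      obtain ⟨v, hv, hxv⟩ := hexr x hx.2
      exact hconn.out hu hv ⟨hux.le, hxv.le⟩
  have hG := fun x => eval_of_natDegree_le_two S.natDegree_G x
  have hc1 : G.coeff 1 = -G.coeff 2 * (xl + xr) := by
    have h1 := hG xl
    have h2 := hG xr
    rw [hGl] at h1
    rw [hGr] at h2
    have h3 : (xr - xl) * (G.coeff 1 + G.coeff 2 * (xl + xr)) = 0 := by linear_combination h1 - h2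
    rcases mul_eq_zero.1 h3 with h | h
    · linarith
    · linarith
  have hform : ∀ x, G.eval x = -G.coeff 2 * ((xr - x) * (x - xl)) := by
    intro x
    have h1 := hG xl
    rw [hGl] at h1
    have := hG x
    rw [hc1] at this h1
    rw [this]
    linear_combination -h1
  refine ⟨xl, xr, -G.coeff 2, hlt1.trans hlt2, ?_, hform, hJe⟩
  have h1 := hGJ x₁ hx₁J
  rw [hform] at h1
  exact pos_of_mul_pos_left h1 (mul_pos (by linarith) (by linarith)).le

/-- In the coordinates `(x, u)` with `y = s(x) u + t(x)`, where `u` is a first integral of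
`∇x = g^{00} ∂_x + g^{01} ∂_y`, the measure is a product. -/
theorem exists_product_law (S : PlaneSolution Ω g b ρ G l r p q β d a c) :
    ∃ (xl xr κ e₁ e₂ M N : ℝ) (t : ℝ → ℝ) (σ : Measure ℝ), xl < xr ∧ 0 < κ ∧
      (∀ x, G.eval x = κ * ((xr - x) * (x - xl))) ∧
      (∀ x, l.eval x = κ * (e₂ * (xr - x) - e₁ * (x - xl))) ∧
      (∀ x, β.eval x = κ * ((N + 1) * (xr - x) - (M + 1) * (x - xl))) ∧
      (fun z : Fin 2 → ℝ => z 0) '' Ω = Ioo xl xr ∧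
      Measurable t ∧
      (∀ x ∈ Ioo xl xr, HasDerivAt t ((l.eval x * t x + r.eval x) / G.eval x) x) ∧
      IntegrableOn (jac xl xr M N) (Ioo xl xr) ∧
      IsFiniteMeasure σ ∧ σ ≠ 0 ∧ (∃ B, σ (Icc (-B) B)ᶜ = 0) ∧
      (densityMeasure Ω ρ).map (fun z => (z 0, (z 1 - t (z 0)) / jac xl xr e₁ e₂ (z 0))) =
        ((volume.restrict (Ioo xl xr)).withDensity
          fun x => ENNReal.ofReal (jac xl xr M N x)).prod σ := by
  obtain ⟨xl, xr, κ, hlr, hκ, hG, hproj⟩ := S.exists_interval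
  have hGpos : ∀ x ∈ Ioo xl xr, 0 < G.eval x := fun x hx => by
    rw [hG]
    exact mul_pos hκ (mul_pos (sub_pos.2 hx.2) (sub_pos.2 hx.1))
  have hprob := S.isProbabilityMeasure
  have hae := ae_mem_densityMeasure (ρ := ρ) S.isOpen
  have hl := fun x => affine_eq_interpolation S.natDegree_l hlr hκ x
  have hβ := fun x => affine_eq_interpolation S.natDegree_β hlr hκ x
  -- The exponents are read off from the partial fractions of l / G and β / G, so that s' = (l / G)
  -- s and (G w)' = β w.
  set e₁ := -l.eval xr / (κ * (xr - xl)) with he₁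
  set e₂ := l.eval xl / (κ * (xr - xl)) with he₂
  set M := -β.eval xr / (κ * (xr - xl)) - 1 with hM
  set N := β.eval xl / (κ * (xr - xl)) - 1 with hN
  have hβ' : ∀ x, β.eval x = κ * ((N + 1) * (xr - x) - (M + 1) * (x - xl)) := fun x => by
    rw [hM, hN, sub_add_cancel, sub_add_cancel]
    exact hβ x
  set s := jac xl xr e₁ e₂ with hs
  set w := jac xl xr M N with hw
  have hs0 : ∀ x ∈ Ioo xl xr, 0 < s x := fun x hx => jac_pos hx
  have hw0 : ∀ x ∈ Ioo xl xr, 0 < w x := fun x hx => jac_pos hx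
  have hsd : ∀ x ∈ Ioo xl xr, HasDerivAt s (l.eval x / G.eval x * s x) x := fun x hx => by
    refine (hasDerivAt_jac hx).congr_deriv ?_
    rw [hl x, hG]
    have h1 := (sub_pos.2 hx.1).ne'
    have h2 := (sub_pos.2 hx.2).ne'
    simp only [hs]
    field_simp
    ring
  have hGc : ContinuousOn (fun x => G.eval x) (Ioo xl xr) := G.continuous.continuousOn
  have hwd : ∀ x ∈ Ioo xl xr,
      HasDerivAt w ((β.eval x - G.derivative.eval x) / G.eval x * w x) x := fun x hx => by
    refine (hasDerivAt_jac hx).congr_deriv ?_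
    have hG' : G.derivative.eval x = κ * (xr + xl - 2 * x) := by
      have h1 : HasDerivAt (fun x => G.eval x) (κ * (xr + xl - 2 * x)) x := by
        have h2 : HasDerivAt (fun x => κ * ((xr - x) * (x - xl)))
            (κ * (-1 * (x - xl) + (xr - x) * 1)) x :=
          ((((hasDerivAt_id x).const_sub xr)).mul ((hasDerivAt_id x).sub_const xl)).const_mul κ
        rw [← funext hG] at h2
        exact h2.congr_deriv (by ring)
      exact (G.hasDerivAt x).unique h1
    rw [hG', hβ', hG]
    have h1 := (sub_pos.2 hx.1).ne'
    have h2 := (sub_pos.2 hx.2).ne'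
    simp only [hw]
    field_simp
    ring
  obtain ⟨t, htm, ht⟩ := exists_transport hlr (A := fun x => l.eval x / G.eval x)
    (f := fun x => r.eval x / G.eval x)
    (r.continuous.continuousOn.div hGc fun x hx => (hGpos x hx).ne')
    (fun x hx => (hs0 x hx).ne') hsd
  have ht' : ∀ x ∈ Ioo xl xr, HasDerivAt t ((l.eval x * t x + r.eval x) / G.eval x) x :=
    fun x hx => (ht x hx).congr_deriv (by ring)
  have hsc : ContinuousOn s (Ioo xl xr) := continuousOn_jac
  have htc : ContinuousOn t (Ioo xl xr) := fun x hx => (ht x hx).continuousAt.continuousWithinAt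
  set u : (Fin 2 → ℝ) → ℝ := fun z => (z 1 - t (z 0)) / s (z 0) with hu
  have hum : Measurable u := ((measurable_pi_apply 1).sub (htm.comp (measurable_pi_apply 0))).div
    (measurable_jac.comp (measurable_pi_apply 0))
  obtain ⟨R, hR⟩ := exists_Icc_of_isBounded S.isBounded
  have hub : ∀ α β, xl < α → β < xr →
      ∃ B, ∀ᵐ z ∂densityMeasure Ω ρ, z 0 ∈ Icc α β → |u z| ≤ B := by
    intro α β hα hβ
    have hsub : Icc α β ⊆ Ioo xl xr := fun x hx => ⟨hα.trans_le hx.1, hx.2.trans_lt hβ⟩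
    obtain ⟨C₁, hC₁⟩ := (isCompact_Icc (a := α) (b := β)).exists_bound_of_continuousOn
      (htc.mono hsub)
    obtain ⟨C₂, hC₂⟩ := (isCompact_Icc (a := α) (b := β)).exists_bound_of_continuousOn
      ((hsc.mono hsub).inv₀ fun x hx => (hs0 x (hsub hx)).ne')
    refine ⟨(R + C₁) * C₂, ?_⟩
    filter_upwards [hae] with z hz hzI
    rw [hu]
    simp only [div_eq_mul_inv]
    rw [abs_mul]
    refine mul_le_mul ((abs_sub _ _).trans (add_le_add (hR z hz 1) (hC₁ _ hzI))) (hC₂ _ hzI)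
      (abs_nonneg _) ?_
    exact add_nonneg ((abs_nonneg _).trans (hR z hz 1)) ((norm_nonneg _).trans (hC₁ _ hzI))
  have hint : ∀ (k : ℕ) {F : ℝ → ℝ} {v : (Fin 2 → ℝ) → ℝ}, Continuous F → SuppIn xl xr F →
      Continuous v → Integrable (fun z => F (z 0) * (v z * u z ^ k)) (densityMeasure Ω ρ) := by
    intro k F v hF hFs hv
    refine integrable_comp_mul_of_suppIn (a := xl) (b := xr) (measurable_pi_apply 0)
      (hv.measurable.mul (hum.pow_const k)) (fun α β hα hβ => ?_) hF hFs
    obtain ⟨B, hB⟩ := hub α β hα hβ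
    obtain ⟨C, hC⟩ := (S.isBounded.isCompact_closure).exists_bound_of_continuousOn hv.continuousOn
    refine ⟨C * B ^ k, ?_⟩
    filter_upwards [hB, hae] with z hz hzΩ hzI
    change |v z * u z ^ k| ≤ C * B ^ k
    rw [abs_mul, abs_pow]
    exact mul_le_mul (hC z (subset_closure hzΩ)) (pow_le_pow_left₀ (abs_nonneg _) (hz hzI) k)
      (pow_nonneg (abs_nonneg _) k) ((norm_nonneg _).trans (hC z (subset_closure hzΩ)))
  -- the weak equation for the test functions `F(x) y^j u^k`
  have hweak : ∀ (k j : ℕ) (F F' : ℝ → ℝ), (∀ x, HasDerivAt F (F' x) x) → Continuous F' →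
      SuppIn xl xr F → SuppIn xl xr F' →
      ∫ z, (F (z 0) * ((β.eval (z 0) * z 1 ^ j +
        j * (l.eval (z 0) * z 1 + r.eval (z 0)) * z 1 ^ (j - 1)) * u z ^ k) +
      F' (z 0) * (G.eval (z 0) * z 1 ^ j * u z ^ k)) ∂densityMeasure Ω ρ = 0 := by
    intro k
    induction k with
    | zero =>
      intro j F F' hF hF' _ _
      simpa using S.weak0 F F' j hF hF'
    -- One factor u = (y - t) / s is expanded, which reduces to the exponents j + 1 and j of y with
    -- new functions of x. No derivative of u ^ k ever appears, since u is constant along ∇x.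
    | succ k ih =>
      intro j F F' hF hF' hFs hFs'
      have hi : ∀ x ∈ Ioo xl xr, HasDerivAt (fun x => (s x)⁻¹)
          (-(l.eval x / G.eval x) * (s x)⁻¹) x := fun x hx => by
        refine ((hsd x hx).inv (hs0 x hx).ne').congr_deriv ?_
        have := (hs0 x hx).ne'
        field_simp
      have hti : ∀ x ∈ Ioo xl xr, HasDerivAt (fun x => -(t x * (s x)⁻¹))
          (-(r.eval x / G.eval x * (s x)⁻¹)) x := fun x hx => by
        refine ((ht x hx).mul (hi x hx)).neg.congr_deriv ?_
        ring
      have hsic : ContinuousOn (fun x => (s x)⁻¹) (Ioo xl xr) :=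
        hsc.inv₀ fun x hx => (hs0 x hx).ne'
      obtain ⟨a1, a2, a3, a4⟩ := hFs.hasDerivAt_mul hFs' hF hF' hi
        ((((l.continuous.continuousOn.div hGc fun x hx => (hGpos x hx).ne')).neg).mul hsic)
      obtain ⟨c1, c2, c3, c4⟩ := hFs.hasDerivAt_mul hFs' hF hF' hti
        ((((r.continuous.continuousOn.div hGc fun x hx => (hGpos x hx).ne')).mul hsic).neg)
      have h1 := ih (j + 1) _ _ a1 a2 a3 a4
      have h2 := ih j _ _ c1 c2 c3 c4
      have ac : Continuous fun x => (s x)⁻¹ * F x :=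
        continuous_iff_continuousAt.2 fun x => (a1 x).continuousAt
      have cc : Continuous fun x => -(t x * (s x)⁻¹) * F x :=
        continuous_iff_continuousAt.2 fun x => (c1 x).continuousAt
      have i1 := (hint k ac a3 (v := fun z => β.eval (z 0) * z 1 ^ (j + 1) +
        (j + 1 : ℕ) * (l.eval (z 0) * z 1 + r.eval (z 0)) * z 1 ^ (j + 1 - 1))
        (by fun_prop)).add (hint k a2 a4 (v := fun z => G.eval (z 0) * z 1 ^ (j + 1))
        (by fun_prop))
      have i2 := (hint k cc c3 (v := fun z => β.eval (z 0) * z 1 ^ j +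
        j * (l.eval (z 0) * z 1 + r.eval (z 0)) * z 1 ^ (j - 1))
        (by fun_prop)).add (hint k c2 c4 (v := fun z => G.eval (z 0) * z 1 ^ j)
        (by fun_prop))
      have h3 := integral_add i1 i2
      simp only [Pi.add_apply] at h3
      rw [h1, h2, add_zero] at h3
      rw [← h3]
      refine integral_congr_ae ?_
      filter_upwards [hae] with z hz
      have hzI : z 0 ∈ Ioo xl xr := hproj ▸ mem_image_of_mem _ hz
      have g1 := (hGpos _ hzI).ne'
      have g2 := (hs0 _ hzI).ne'
      -- The truncated exponent `j - 1` is harmless at `j = 0`, both sides carrying the factor `j`.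
      have hjj : (j : ℝ) * z 1 ^ j = j * z 1 ^ (j - 1) * z 1 := by
        rcases j with _ | j
        · simp
        · simp [pow_succ, mul_assoc]
      have huz : z 1 = s (z 0) * u z + t (z 0) := by
        simp only [hu]; field_simp; ring
      have hpw : u z ^ (k + 1) = (s (z 0))⁻¹ * (z 1 - t (z 0)) * u z ^ k := by
        rw [pow_succ]; simp only [hu]; field_simp
      rw [hpw]
      simp only [Nat.add_sub_cancel]
      push_cast
      generalize u z ^ k = U
      field_simp
      linear_combination (-(l.eval (z 0) * z 1 + r.eval (z 0)) * U * F (z 0)) * hjj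
  obtain ⟨σ, h1, h2, h3, h4, h5⟩ := exists_map_eq_prod (μ := densityMeasure Ω ρ)
    (IsProbabilityMeasure.ne_zero _) (measurable_pi_apply 0) hum hlr
    (by filter_upwards [hae] with z hz using hproj ▸ mem_image_of_mem _ hz) hub
    (w := w) continuousOn_jac hw0 (fun k f f' hf hf' hfs hfs' => by
      -- For F = f / (G w) the identity (G w)' = β w gives β F + G F' = f' / w, which is the form
      -- required by `exists_map_eq_prod`.
      have hi : ∀ x ∈ Ioo xl xr, HasDerivAt (fun x => (G.eval x * w x)⁻¹)
          (-(β.eval x / G.eval x) * (G.eval x * w x)⁻¹) x := fun x hx => by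
        have g1 := (hGpos _ hx).ne'
        have g2 := (hw0 _ hx).ne'
        refine (((G.hasDerivAt x).mul (hwd x hx)).inv (mul_ne_zero g1 g2)).congr_deriv ?_
        simp only [Pi.mul_apply]
        field_simp
        ring
      have hic : ContinuousOn (fun x => (G.eval x * w x)⁻¹) (Ioo xl xr) :=
        fun x hx => (hi x hx).continuousAt.continuousWithinAt
      obtain ⟨a1, a2, a3, a4⟩ := hfs.hasDerivAt_mul hfs' hf hf' hi
        (((β.continuous.continuousOn.div hGc fun x hx => (hGpos x hx).ne').neg).mul hic)
      rw [← hweak k 0 _ _ a1 a2 a3 a4]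
      refine integral_congr_ae ?_
      filter_upwards [hae] with z hz
      have hzI : z 0 ∈ Ioo xl xr := hproj ▸ mem_image_of_mem _ hz
      have g1 := (hGpos _ hzI).ne'
      have g2 := (hw0 _ hzI).ne'
      simp only [pow_zero, Nat.cast_zero, zero_mul, add_zero, mul_one]
      field_simp
      ring)
  exact ⟨xl, xr, κ, e₁, e₂, M, N, t, σ, hlr, hκ, hG, hl, hβ', hproj, htm, ht', h4, h1, h2, h3, h5⟩

end PlaneSolution

/-! ### Pearson's equation on the vertical fibres -/

/-- The determinant of the cometric. -/
noncomputable def detFun (G l r p q : Polynomial ℝ) (a x y : ℝ) : ℝ :=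
  G.eval x * (a * y ^ 2 + p.eval x * y + q.eval x) - (l.eval x * y + r.eval x) ^ 2

/-- The right-hand side of the Pearson equation `∂_y (det g · ρ) = e ρ` on the vertical fibres. -/
noncomputable def fibreFun (G l r β d : Polynomial ℝ) (c x y : ℝ) : ℝ :=
  (c * y + d.eval x) * G.eval x - β.eval x * (l.eval x * y + r.eval x) +
    (l.eval x * y + r.eval x) * G.derivative.eval x -
    G.eval x * (l.derivative.eval x * y + r.derivative.eval x) -
    (l.eval x * y + r.eval x) * l.eval x

@[fun_prop]
theorem Continuous.detFun {X : Type*} [TopologicalSpace X] {G l r p q : Polynomial ℝ} {a : ℝ}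
    {f h : X → ℝ} (hf : Continuous f) (hh : Continuous h) :
    Continuous fun x => detFun G l r p q a (f x) (h x) := by
  unfold WeightedDOP.detFun; fun_prop

@[fun_prop]
theorem Continuous.fibreFun {X : Type*} [TopologicalSpace X] {G l r β d : Polynomial ℝ} {c : ℝ}
    {f h : X → ℝ} (hf : Continuous f) (hh : Continuous h) :
    Continuous fun x => fibreFun G l r β d c (f x) (h x) := by
  unfold WeightedDOP.fibreFun; fun_prop

theorem eqOn_zero_of_integral_eq_zero {a b : ℝ} {f : ℝ → ℝ} (hf : ContinuousOn f (Ioo a b))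
    (H : ∀ F F' : ℝ → ℝ, (∀ x, HasDerivAt F (F' x) x) → Continuous F' → SuppIn a b F →
      ∫ x in Ioo a b, F x * f x = 0) : ∀ x ∈ Ioo a b, f x = 0 := by
  have h1 : ∀ᵐ x ∂(volume : Measure ℝ), x ∈ Ioo a b → f x = 0 := by
    refine isOpen_Ioo.ae_eq_zero_of_integral_contDiff_smul_eq_zero
      (hf.locallyIntegrableOn measurableSet_Ioo) fun F hF hFc hFs => ?_
    have hd : ContDiff ℝ 1 F := hF.of_le (by exact_mod_cast le_top)
    by_cases hne : (tsupport F).Nonempty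
    · have hs : SuppIn a b F := by
        have h1 := hFs (hFc.isCompact.sInf_mem hne)
        have h2 := hFs (hFc.isCompact.sSup_mem hne)
        have h3 : sInf (tsupport F) ≤ sSup (tsupport F) :=
          csInf_le hFc.isCompact.bddBelow (hFc.isCompact.sSup_mem hne)
        refine ⟨(a + sInf (tsupport F)) / 2, (b + sSup (tsupport F)) / 2, by linarith [h1.1],
          by linarith [h1.1, h2.2], by linarith [h2.2], fun x hx => ?_⟩
        by_contra hne0
        have hx' : x ∈ tsupport F := subset_closure hne0
        exact hx ⟨by linarith [csInf_le hFc.isCompact.bddBelow hx', h1.1],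
          by linarith [le_csSup hFc.isCompact.bddAbove hx', h2.2]⟩
      have := H F (deriv F) (fun x => (hd.differentiable (by norm_num) x).hasDerivAt)
        (hd.continuous_deriv le_rfl) hs
      rw [setIntegral_eq_integral_of_forall_compl_eq_zero] at this
      · exact this
      · intro x hx
        rw [image_eq_zero_of_notMem_tsupport fun h => hx (hFs h), zero_mul]
    · have hz : ∀ x, F x = 0 := fun x =>
        image_eq_zero_of_notMem_tsupport fun h => hne ⟨x, h⟩
      simp [hz]
  have h2 : f =ᵐ[volume.restrict (Ioo a b)] fun _ => 0 :=
    (ae_restrict_iff' measurableSet_Ioo).2 h1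
  exact Measure.eqOn_open_of_ae_eq h2 isOpen_Ioo hf continuousOn_const

theorem continuousOn_integral_comp {I : Set ℝ} (hI : IsOpen I) {σ : Measure ℝ} [IsFiniteMeasure σ]
    {B : ℝ} (hσ : σ.restrict (Icc (-B) B) = σ) {V : ℝ → ℝ → ℝ}
    (hV : Continuous fun z : ℝ × ℝ => V z.1 z.2) {s t : ℝ → ℝ} (hs : ContinuousOn s I)
    (ht : ContinuousOn t I) : ContinuousOn (fun x => ∫ u, V x (s x * u + t x) ∂σ) I := by
  rw [continuousOn_iff_continuous_domRestrict] at hs ht ⊢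
  have h1 : Continuous fun z : I × ℝ => V z.1 (s z.1 * z.2 + t z.1) :=
    hV.comp ((continuous_subtype_val.comp continuous_fst).prodMk
      (((hs.comp continuous_fst).mul continuous_snd).add (ht.comp continuous_fst)))
  have := hI.locallyCompactSpace
  rw [← hσ]
  exact continuous_parametric_integral_of_continuous
    (f := fun (x : I) (u : ℝ) => V x (s x * u + t x)) h1 isCompact_Icc

/-- Disintegrate in (x, u): the arbitrary factor F(x) localizes the identity in x. The fibre
integral is continuous in x, since σ is compactly supported and does not depend on x, so it vanishes
for every x and not merely for almost every one. -/
theorem integral_fibre_eq_zero_of_map_eq_prod {μ : Measure (Fin 2 → ℝ)} {xl xr : ℝ}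
    (hI : ∀ᵐ z ∂μ, z 0 ∈ Ioo xl xr) {s t w : ℝ → ℝ} {σ : Measure ℝ}
    [IsFiniteMeasure σ] (hsm : Measurable s) (htm : Measurable t) (hwm : Measurable w)
    (hs : ContinuousOn s (Ioo xl xr)) (ht : ContinuousOn t (Ioo xl xr))
    (hw : ContinuousOn w (Ioo xl xr))
    (hs0 : ∀ x ∈ Ioo xl xr, 0 < s x) (hw0 : ∀ x ∈ Ioo xl xr, 0 < w x)
    (hwI : IntegrableOn w (Ioo xl xr)) {B : ℝ} (hσr : σ.restrict (Icc (-B) B) = σ)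
    (hmap : μ.map (fun z => (z 0, (z 1 - t (z 0)) / s (z 0))) =
        ((volume.restrict (Ioo xl xr)).withDensity fun x => ENNReal.ofReal (w x)).prod σ)
    {V : ℝ → ℝ → ℝ} (hVc : Continuous fun z : ℝ × ℝ => V z.1 z.2)
    (hVi : ∀ F : ℝ → ℝ, Continuous F → Integrable (fun z : Fin 2 → ℝ => F (z 0) * V (z 0) (z 1)) μ)
    (hV0 : ∀ F F' : ℝ → ℝ, (∀ x, HasDerivAt F (F' x) x) → Continuous F' →
      ∫ z, F (z 0) * V (z 0) (z 1) ∂μ = 0)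
    {x : ℝ} (hx : x ∈ Ioo xl xr) : ∫ u, V x (s x * u + t x) ∂σ = 0 := by
  have hm : Measurable fun z : Fin 2 → ℝ => (z 0, (z 1 - t (z 0)) / s (z 0)) := by
    have h0 : Measurable fun z : Fin 2 → ℝ => z 0 := measurable_pi_apply 0
    have h1 : Measurable fun z : Fin 2 → ℝ => z 1 := measurable_pi_apply 1
    exact h0.prodMk ((h1.sub (htm.comp h0)).div (hsm.comp h0))
  have hKw : ∀ x ∈ Ioo xl xr, w x * ∫ u, V x (s x * u + t x) ∂σ = 0 := by
    refine eqOn_zero_of_integral_eq_zero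
      (hw.mul (continuousOn_integral_comp isOpen_Ioo hσr hVc hs ht)) fun F F' hF hF' _ => ?_
    have hFc : Continuous F := continuous_iff_continuousAt.2 fun x => (hF x).continuousAt
    have h0 := hV0 F F' hF hF'
    set H : ℝ × ℝ → ℝ := fun z => F z.1 * V z.1 (s z.1 * z.2 + t z.1) with hH
    have hHm : Measurable H := by
      have hpair : Measurable fun z : ℝ × ℝ => (z.1, s z.1 * z.2 + t z.1) :=
        measurable_fst.prodMk (((hsm.comp measurable_fst).mul measurable_snd).add
          (htm.comp measurable_fst))
      exact (hFc.measurable.comp measurable_fst).mul (hVc.measurable.comp hpair)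
    have hcomp : (fun z : Fin 2 → ℝ => H (z 0, (z 1 - t (z 0)) / s (z 0))) =ᵐ[μ]
        fun z => F (z 0) * V (z 0) (z 1) := by
      filter_upwards [hI] with z hzI
      have := (hs0 _ hzI).ne'
      simp only [hH]
      congr 2
      field_simp
      ring
    have hHi : Integrable H (μ.map (fun z => (z 0, (z 1 - t (z 0)) / s (z 0)))) := by
      rw [integrable_map_measure hHm.aestronglyMeasurable hm.aemeasurable]
      exact (hVi F hFc).congr hcomp.symm
    have h1 : ∫ z, H z ∂(μ.map (fun z => (z 0, (z 1 - t (z 0)) / s (z 0)))) = 0 := by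
      rw [integral_map hm.aemeasurable hHm.aestronglyMeasurable, integral_congr_ae hcomp]
      exact h0
    have hfin : IsFiniteMeasure ((volume.restrict (Ioo xl xr)).withDensity
      fun x => ENNReal.ofReal (w x)) := isFiniteMeasure_withDensity_ofReal hwI.2
    rw [hmap] at h1 hHi
    rw [integral_prod _ hHi, integral_withDensity_eq_integral_toReal_smul
      hwm.ennreal_ofReal (by simp)] at h1
    rw [← h1]
    refine setIntegral_congr_fun measurableSet_Ioo fun x hx => ?_
    simp only [hH]
    rw [integral_const_mul, ENNReal.toReal_ofReal (hw0 x hx).le, smul_eq_mul]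
    ring
  exact (mul_eq_zero.1 (hKw x hx)).resolve_left (hw0 x hx).ne'

namespace PlaneSolution

variable {Ω : Set (Fin 2 → ℝ)} {g : (Fin 2 → ℝ) → Matrix (Fin 2) (Fin 2) ℝ}
    {b : (Fin 2 → ℝ) → Fin 2 → ℝ} {ρ : (Fin 2 → ℝ) → ℝ} {G l r p q β d : Polynomial ℝ}
    {a c : ℝ}

theorem det_pos (S : PlaneSolution Ω g b ρ G l r p q β d a c) {z : Fin 2 → ℝ} (hz : z ∈ Ω) :
    0 < detFun G l r p q a (z 0) (z 1) := by
  have := (S.elliptic z hz).det_pos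
  rw [Matrix.det_fin_two, S.g00 z hz, S.g01 z hz, S.g10 z hz, S.g11 z hz] at this
  unfold detFun
  linarith

/-- Along G ∇y - g¹² ∇x = (det g) ∂_y there is no x-derivative. Accordingly the second identity is
tested with G F y^k and the first with l F y^(k+1) and r F y^k; in the difference all terms
containing F' cancel. -/
theorem integral_fibre_eq_zero (S : PlaneSolution Ω g b ρ G l r p q β d a c) (k : ℕ)
    {F F' : ℝ → ℝ} (hF : ∀ x, HasDerivAt F (F' x) x) (hF' : Continuous F') :
    ∫ z, F (z 0) * (fibreFun G l r β d c (z 0) (z 1) * z 1 ^ k +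
      detFun G l r p q a (z 0) (z 1) * (k * z 1 ^ (k - 1))) ∂densityMeasure Ω ρ = 0 := by
  have hprob := S.isProbabilityMeasure
  have hFc : Continuous F := continuous_iff_continuousAt.2 fun x => (hF x).continuousAt
  have h1 := S.weak1 (fun x => G.eval x * F x) (fun x => G.derivative.eval x * F x + G.eval x * F' x)
    k (fun x => (G.hasDerivAt x).mul (hF x)) (by fun_prop)
  have h2 := S.weak0 (fun x => l.eval x * F x) (fun x => l.derivative.eval x * F x + l.eval x * F' x)
    (k + 1) (fun x => (l.hasDerivAt x).mul (hF x)) (by fun_prop)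
  have h3 := S.weak0 (fun x => r.eval x * F x) (fun x => r.derivative.eval x * F x + r.eval x * F' x)
    k (fun x => (r.hasDerivAt x).mul (hF x)) (by fun_prop)
  have hi : ∀ {f : (Fin 2 → ℝ) → ℝ}, Continuous f → Integrable f (densityMeasure Ω ρ) :=
    fun hf => integrable_of_continuous_of_isBounded S.isOpen S.isBounded inferInstance hf
  have e : ∀ u v w : ℝ, u = 0 → v = 0 → w = 0 → u - v - w = 0 := by
    rintro _ _ _ rfl rfl rfl; simp
  have h4 := e _ _ _ h1 h2 h3
  rw [← integral_sub (hi (by fun_prop)) (hi (by fun_prop)),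
    ← integral_sub (hi (by fun_prop)) (hi (by fun_prop))] at h4
  rw [← h4]
  refine integral_congr_ae (ae_of_all _ fun z => ?_)
  simp only [detFun, fibreFun, Nat.add_sub_cancel]
  have hjj : (k : ℝ) * z 1 ^ k = k * z 1 ^ (k - 1) * z 1 := by
    rcases k with _ | j
    · simp
    · simp [pow_succ, mul_assoc]
  push_cast
  rw [pow_succ]
  linear_combination (l.eval (z 0) * (l.eval (z 0) * z 1 + r.eval (z 0)) * F (z 0)) * hjj

theorem fibre_identity (S : PlaneSolution Ω g b ρ G l r p q β d a c) {xl xr : ℝ}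
    (hproj : (fun z : Fin 2 → ℝ => z 0) '' Ω = Ioo xl xr) {s t w : ℝ → ℝ} {σ : Measure ℝ}
    [IsFiniteMeasure σ] (hsm : Measurable s) (htm : Measurable t) (hwm : Measurable w)
    (hs : ContinuousOn s (Ioo xl xr)) (ht : ContinuousOn t (Ioo xl xr))
    (hw : ContinuousOn w (Ioo xl xr))
    (hs0 : ∀ x ∈ Ioo xl xr, 0 < s x) (hw0 : ∀ x ∈ Ioo xl xr, 0 < w x)
    (hwI : IntegrableOn w (Ioo xl xr)) (hσ : ∃ B, σ (Icc (-B) B)ᶜ = 0)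
    (hmap : (densityMeasure Ω ρ).map (fun z => (z 0, (z 1 - t (z 0)) / s (z 0))) =
        ((volume.restrict (Ioo xl xr)).withDensity fun x => ENNReal.ofReal (w x)).prod σ)
    {x : ℝ} (hx : x ∈ Ioo xl xr) (P : Polynomial ℝ) :
    ∫ u, (P.eval (s x * u + t x) * fibreFun G l r β d c x (s x * u + t x) +
      P.derivative.eval (s x * u + t x) * detFun G l r p q a x (s x * u + t x)) ∂σ = 0 := by
  have hprob := S.isProbabilityMeasure
  obtain ⟨B, hB⟩ := hσ
  have hσr : σ.restrict (Icc (-B) B) = σ := Measure.restrict_eq_self_of_ae_mem (by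
    rw [ae_iff]; exact hB)
  have hintσ : ∀ {f : ℝ → ℝ}, Continuous f → Integrable f σ := fun hf => by
    rw [← hσr]; exact hf.continuousOn.integrableOn_compact isCompact_Icc
  have hI : ∀ᵐ z ∂densityMeasure Ω ρ, z 0 ∈ Ioo xl xr := by
    filter_upwards [ae_mem_densityMeasure S.isOpen] with z hz using hproj ▸ mem_image_of_mem _ hz
  have hmono : ∀ k : ℕ,
      ∫ u, (fibreFun G l r β d c x (s x * u + t x) * (s x * u + t x) ^ k +
        detFun G l r p q a x (s x * u + t x) * (k * (s x * u + t x) ^ (k - 1))) ∂σ = 0 := by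
    intro k
    refine integral_fibre_eq_zero_of_map_eq_prod hI hsm htm hwm hs ht hw hs0 hw0 hwI hσr hmap
      (V := fun x y => fibreFun G l r β d c x y * y ^ k +
        detFun G l r p q a x y * (k * y ^ (k - 1))) (by fun_prop) (fun F hF => ?_)
      (fun F F' hF hF' => S.integral_fibre_eq_zero k hF hF') hx
    exact integrable_of_continuous_of_isBounded S.isOpen S.isBounded inferInstance (by fun_prop)
  induction P using Polynomial.induction_on' with
  | add P Q hP hQ =>
    rw [← add_zero (0 : ℝ)]
    nth_rw 1 [← hP]
    rw [← hQ, ← integral_add (hintσ (by fun_prop)) (hintσ (by fun_prop))]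
    congr 1; ext u; simp; ring
  | monomial k C =>
    have := hmono k
    rw [← mul_zero C, ← this, ← integral_const_mul]
    congr 1; ext u
    simp only [Polynomial.eval_monomial, Polynomial.derivative_monomial]
    ring

end PlaneSolution

theorem integral_comp_affine_eq_zero {σ : Measure ℝ} [IsFiniteMeasure σ] {B : ℝ}
    (hB : σ (Icc (-B) B)ᶜ = 0) {s t : ℝ} (hs : s ≠ 0) {E D : ℝ → ℝ} (hE : Continuous E)
    (hD : Continuous D)
    (H : ∀ P : Polynomial ℝ, ∫ u, (P.eval (s * u + t) * E (s * u + t) +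
      P.derivative.eval (s * u + t) * D (s * u + t)) ∂σ = 0)
    {f f' : ℝ → ℝ} (hf : ∀ x, HasDerivAt f (f' x) x) (hf' : Continuous f') :
    ∫ u, (f u * E (s * u + t) + f' u * (D (s * u + t) / s)) ∂σ = 0 := by
  have hσr : σ.restrict (Icc (-B) B) = σ := Measure.restrict_eq_self_of_ae_mem (by
    rw [ae_iff]; exact hB)
  have hint : ∀ {f : ℝ → ℝ}, Continuous f → Integrable f σ := fun hf => by
    rw [← hσr]; exact hf.continuousOn.integrableOn_compact isCompact_Icc
  refine integral_C1_of_polynomial measurable_id (A := -B) (B := B) (by rw [ae_iff]; exact hB)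
    (hint (by fun_prop)) (hint (by fun_prop)) (fun p => ?_) hf hf'
  rw [← H (p.comp (Polynomial.C s⁻¹ * Polynomial.X - Polynomial.C (s⁻¹ * t)))]
  congr 1
  ext u
  have : s⁻¹ * (s * u + t) - s⁻¹ * t = u := by field_simp; ring
  simp only [Polynomial.eval_comp, Polynomial.derivative_comp, Polynomial.eval_sub,
    Polynomial.eval_mul, Polynomial.eval_C, Polynomial.eval_X, this, Polynomial.derivative_sub,
    Polynomial.derivative_mul, Polynomial.derivative_C, Polynomial.derivative_X]
  simp
  field_simp

theorem quadratic_eq_of_roots {α β γ y₁ y₂ : ℝ} (h : y₁ ≠ y₂)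
    (h₁ : α * y₁ ^ 2 + β * y₁ + γ = 0) (h₂ : α * y₂ ^ 2 + β * y₂ + γ = 0) (y : ℝ) :
    α * y ^ 2 + β * y + γ = α * ((y - y₁) * (y - y₂)) := by
  have h3 : (y₁ - y₂) * (α * (y₁ + y₂) + β) = 0 := by linear_combination h₁ - h₂
  have h4 := (mul_eq_zero.1 h3).resolve_left (sub_ne_zero.2 h)
  linear_combination h₁ + (y - y₁) * h4

namespace PlaneSolution

variable {Ω : Set (Fin 2 → ℝ)} {g : (Fin 2 → ℝ) → Matrix (Fin 2) (Fin 2) ℝ}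
    {b : (Fin 2 → ℝ) → Fin 2 → ℝ} {ρ : (Fin 2 → ℝ) → ℝ} {G l r p q β d : Polynomial ℝ}
    {a c : ℝ}

/-- Normal form of the determinant of the cometric and of the domain on the vertical fibres. -/
theorem exists_normalized_law (S : PlaneSolution Ω g b ρ G l r p q β d a c) :
    ∃ (xl xr κ e₁ e₂ M N lam : ℝ) (t : ℝ → ℝ) (σ : Measure ℝ), xl < xr ∧ 0 < κ ∧ 0 < lam ∧
      (∀ x, G.eval x = κ * ((xr - x) * (x - xl))) ∧
      (∀ x, l.eval x = κ * (e₂ * (xr - x) - e₁ * (x - xl))) ∧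
      (∀ x, β.eval x = κ * ((N + 1) * (xr - x) - (M + 1) * (x - xl))) ∧
      (fun z : Fin 2 → ℝ => z 0) '' Ω = Ioo xl xr ∧
      Measurable t ∧
      (∀ x ∈ Ioo xl xr, HasDerivAt t ((l.eval x * t x + r.eval x) / G.eval x) x) ∧
      IntegrableOn (jac xl xr M N) (Ioo xl xr) ∧
      IsFiniteMeasure σ ∧ σ ≠ 0 ∧ σ (Ioo (-1) 1)ᶜ = 0 ∧
      (densityMeasure Ω ρ).map
          (fun z => (z 0, (z 1 - t (z 0)) / (lam * jac xl xr e₁ e₂ (z 0)))) =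
        ((volume.restrict (Ioo xl xr)).withDensity
          fun x => ENNReal.ofReal (jac xl xr M N x)).prod σ ∧
      (∀ x ∈ Ioo xl xr, a * G.eval x - l.eval x ^ 2 < 0) ∧
      (∀ x ∈ Ioo xl xr, ∀ y, detFun G l r p q a x y =
        (a * G.eval x - l.eval x ^ 2) * ((y - t x) ^ 2 - (lam * jac xl xr e₁ e₂ x) ^ 2)) ∧
      (∀ z ∈ Ω, |z 1 - t (z 0)| < lam * jac xl xr e₁ e₂ (z 0)) ∧
      (∀ x ∈ Ioo xl xr, ∀ f f' : ℝ → ℝ, (∀ u, HasDerivAt f (f' u) u) → Continuous f' →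
        ∫ u, (f u * fibreFun G l r β d c x (lam * jac xl xr e₁ e₂ x * u + t x) +
          f' u * ((a * G.eval x - l.eval x ^ 2) * (lam * jac xl xr e₁ e₂ x) * (u ^ 2 - 1))) ∂σ
          = 0) := by
  obtain ⟨xl, xr, κ, e₁, e₂, M, N, t, σ, hlr, hκ, hG, hl, hβ, hproj, htm, ht, hwI, hσf, hσ0,
    ⟨B, hB⟩, hmap⟩ := S.exists_product_law
  set s := jac xl xr e₁ e₂ with hs
  set w := jac xl xr M N with hw
  have hprob := S.isProbabilityMeasure
  have hs0 : ∀ x ∈ Ioo xl xr, 0 < s x := fun x hx => jac_pos hx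
  have hw0 : ∀ x ∈ Ioo xl xr, 0 < w x := fun x hx => jac_pos hx
  have hsm : Measurable s := measurable_jac
  have hwm : Measurable w := measurable_jac
  have hsc : ContinuousOn s (Ioo xl xr) := continuousOn_jac
  have htc : ContinuousOn t (Ioo xl xr) := fun x hx => (ht x hx).continuousAt.continuousWithinAt
  have hae : ∀ᵐ z ∂densityMeasure Ω ρ, z ∈ Ω := ae_mem_densityMeasure S.isOpen
  have hΩI : ∀ z ∈ Ω, z 0 ∈ Ioo xl xr := fun z hz => hproj ▸ mem_image_of_mem _ hz
  set ν := (volume.restrict (Ioo xl xr)).withDensity fun x => ENNReal.ofReal (w x) with hν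
  set U : (Fin 2 → ℝ) → ℝ := fun z => (z 1 - t (z 0)) / s (z 0) with hU
  have hUm : Measurable fun z : Fin 2 → ℝ => (z 0, U z) := by
    have h0 : Measurable fun z : Fin 2 → ℝ => z 0 := measurable_pi_apply 0
    have h1 : Measurable fun z : Fin 2 → ℝ => z 1 := measurable_pi_apply 1
    exact h0.prodMk ((h1.sub (htm.comp h0)).div (hsm.comp h0))
  have hUz : ∀ z ∈ Ω, z 1 = s (z 0) * U z + t (z 0) := fun z hz => by
    have := (hs0 _ (hΩI z hz)).ne'
    simp only [hU]; field_simp; ring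
  have hfib : ∀ x ∈ Ioo xl xr, ∀ f f' : ℝ → ℝ, (∀ u, HasDerivAt f (f' u) u) → Continuous f' →
      ∫ u, (f u * fibreFun G l r β d c x (s x * u + t x) +
        f' u * (detFun G l r p q a x (s x * u + t x) / s x)) ∂σ = 0 := fun x hx f f' hf hf' =>
    integral_comp_affine_eq_zero hB (hs0 x hx).ne'
      (E := fibreFun G l r β d c x) (D := detFun G l r p q a x) (by fun_prop) (by fun_prop)
      (S.fibre_identity hproj hsm htm hwm hsc htc continuousOn_jac hs0 hw0 hwI ⟨B, hB⟩ hmap hx)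
      hf hf'
  -- The endpoints of σ do not depend on x. The endpoint principle on each fibre therefore gives the
  -- two roots of the determinant, for all x at once.
  obtain ⟨u₁, -, h10, h1⟩ := exists_left_endpoint hσ0 hB
  obtain ⟨u₂, -, h20, h2⟩ := exists_right_endpoint hσ0 hB
  have hdet1 : ∀ x ∈ Ioo xl xr, detFun G l r p q a x (s x * u₁ + t x) = 0 := fun x hx => by
    have := eq_zero_at_left_endpoint (by fun_prop) (by fun_prop) h10 h1 (hfib x hx)
    simpa [(hs0 x hx).ne'] using this
  have hdet2 : ∀ x ∈ Ioo xl xr, detFun G l r p q a x (s x * u₂ + t x) = 0 := fun x hx => by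
    have := eq_zero_at_right_endpoint (by fun_prop) (by fun_prop) h20 h2 (hfib x hx)
    simpa [(hs0 x hx).ne'] using this
  have hσI : ∀ᵐ u ∂σ, u ∈ Icc u₁ u₂ := by
    rw [ae_iff]
    refine measure_mono_null (t := Iio u₁ ∪ Ioi u₂) (fun u hu => ?_) (measure_union_null h10 h20)
    by_contra h
    simp only [mem_union, mem_Iio, mem_Ioi, not_or, not_lt] at h
    exact hu ⟨h.1, h.2⟩
  have hμI : ∀ᵐ z ∂densityMeasure Ω ρ, U z ∈ Icc u₁ u₂ := by
    have h3 : ∀ᵐ y ∂(ν.prod σ), y.2 ∈ Icc u₁ u₂ := Measure.quasiMeasurePreserving_snd.ae hσI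
    rw [← hmap] at h3
    exact ae_of_ae_map hUm.aemeasurable h3
  have hne : (ae (densityMeasure Ω ρ)).NeBot := ae_neBot.2 (IsProbabilityMeasure.ne_zero _)
  -- If the endpoints coincided, the determinant would vanish at a point of Ω.
  have hu : u₁ < u₂ := by
    by_contra! hle
    obtain ⟨z, hz, hzI⟩ := (hae.and hμI).exists
    have : U z = u₁ := le_antisymm (hzI.2.trans hle) hzI.1
    have h3 := S.det_pos hz
    rw [hUz z hz, this, hdet1 _ (hΩI z hz)] at h3
    exact lt_irrefl _ h3
  have hroot : ∀ x ∈ Ioo xl xr, ∀ y, detFun G l r p q a x y =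
      (a * G.eval x - l.eval x ^ 2) * ((y - (s x * u₁ + t x)) * (y - (s x * u₂ + t x))) := by
    intro x hx y
    have e : ∀ y, detFun G l r p q a x y = (a * G.eval x - l.eval x ^ 2) * y ^ 2 +
        (G.eval x * p.eval x - 2 * l.eval x * r.eval x) * y +
        (G.eval x * q.eval x - r.eval x ^ 2) := fun y => by unfold detFun; ring
    have h3 := hdet1 x hx
    have h4 := hdet2 x hx
    rw [e] at h3 h4 ⊢
    refine quadratic_eq_of_roots (fun h => ?_) h3 h4 y
    exact hu.ne (mul_left_cancel₀ (hs0 x hx).ne' (add_right_cancel h))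
  have hdetU : ∀ z ∈ Ω, 0 < (a * G.eval (z 0) - l.eval (z 0) ^ 2) * ((U z - u₁) * (U z - u₂)) := by
    intro z hz
    have h3 := S.det_pos hz
    rw [hroot _ (hΩI z hz), hUz z hz] at h3
    have h4 := hs0 _ (hΩI z hz)
    exact (mul_pos_iff_of_pos_left (pow_pos h4 2)).1 (h3.trans_eq (by ring))
  have hA0 : ∀ x ∈ Ioo xl xr, a * G.eval x - l.eval x ^ 2 ≠ 0 := by
    intro x hx h0
    rw [← hproj] at hx
    obtain ⟨z, hz, rfl⟩ := hx
    have := hdetU z hz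
    simp only at h0
    rw [h0, zero_mul] at this
    exact lt_irrefl _ this
  -- The leading coefficient has no zero, hence constant sign. A positive sign would put Ω outside
  -- the two roots, whereas almost every point has u between them.
  have hAneg : ∀ x ∈ Ioo xl xr, a * G.eval x - l.eval x ^ 2 < 0 := by
    by_contra! hpos
    obtain ⟨x₀, hx₀, hx₀'⟩ := hpos
    have hpos' : ∀ x ∈ Ioo xl xr, 0 < a * G.eval x - l.eval x ^ 2 := by
      intro x hx
      by_contra! hle
      obtain ⟨y, hy, hy0⟩ := isPreconnected_Ioo.intermediate_value hx hx₀
        (f := fun x => a * G.eval x - l.eval x ^ 2) (by fun_prop) ⟨hle, hx₀'⟩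
      exact hA0 y hy hy0
    obtain ⟨z, hz, hzI⟩ := (hae.and hμI).exists
    have h3 := hdetU z hz
    have h4 := pos_of_mul_pos_right h3 (hpos' _ (hΩI z hz)).le
    nlinarith [hzI.1, hzI.2]
  have hΩU : ∀ z ∈ Ω, U z ∈ Ioo u₁ u₂ := by
    intro z hz
    have h3 := hdetU z hz
    have h5 := hAneg _ (hΩI z hz)
    have h4 : (U z - u₁) * (U z - u₂) < 0 := by
      by_contra! h6
      exact absurd h3 (not_lt.2 (mul_nonpos_of_nonpos_of_nonneg h5.le h6))
    constructor
    · by_contra! h6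
      nlinarith
    · by_contra! h6
      nlinarith
  have hσIoo : σ (Ioo u₁ u₂)ᶜ = 0 := by
    have h3 : (ν.prod σ) (univ ×ˢ (Ioo u₁ u₂)ᶜ) = 0 := by
      rw [← hmap, Measure.map_apply hUm (MeasurableSet.univ.prod measurableSet_Ioo.compl)]
      refine measure_mono_null (t := Ωᶜ) (fun z hz hzΩ => ?_) (by
        have := hae; rw [ae_iff] at this; exact this)
      exact hz.2 (hΩU z hzΩ)
    rw [Measure.prod_prod, mul_eq_zero] at h3
    refine h3.resolve_left fun h4 => ?_
    have h5 : ν = 0 := Measure.measure_univ_eq_zero.1 h4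
    rw [h5, Measure.zero_prod, Measure.map_eq_zero_iff hUm.aemeasurable] at hmap
    exact IsProbabilityMeasure.ne_zero (densityMeasure Ω ρ) hmap
  -- The interval (u₁, u₂) is moved to (-1, 1). Replacing t by t + m s preserves its equation, since
  -- s solves the homogeneous one.
  set h := (u₂ - u₁) / 2 with hh
  set m := (u₁ + u₂) / 2 with hm
  have hh0 : 0 < h := by simp only [hh]; linarith
  have e1 : u₁ = m - h := by simp only [hh, hm]; ring
  have e2 : u₂ = m + h := by simp only [hh, hm]; ring
  set ψ : ℝ → ℝ := fun u => (u - m) / h with hψ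
  have hψm : Measurable ψ := by fun_prop
  have hψI : ∀ u, ψ u ∈ Ioo (-1) 1 ↔ u ∈ Ioo u₁ u₂ := fun u => by
    simp only [hψ, mem_Ioo, lt_div_iff₀ hh0, div_lt_iff₀ hh0, e1, e2]
    constructor <;> rintro ⟨_, _⟩ <;> constructor <;> linarith
  have hsol : ∀ x ∈ Ioo xl xr, HasDerivAt s (l.eval x / G.eval x * s x) x := fun x hx => by
    refine (hasDerivAt_jac hx).congr_deriv ?_
    rw [hl x, hG]
    have h1 := (sub_pos.2 hx.1).ne'
    have h2 := (sub_pos.2 hx.2).ne'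
    simp only [hs]
    field_simp
    ring
  refine ⟨xl, xr, κ, e₁, e₂, M, N, h, fun x => t x + m * s x, σ.map ψ, hlr, hκ, hh0, hG, hl, hβ,
    hproj, htm.add (measurable_const.mul hsm), fun x hx => ?_, hwI, inferInstance, ?_, ?_, ?_,
    hAneg, fun x hx y => ?_, fun z hz => ?_, fun x hx f f' hf hf' => ?_⟩
  · refine ((ht x hx).add ((hsol x hx).const_mul m)).congr_deriv ?_
    ring
  · rwa [Ne, Measure.map_eq_zero_iff hψm.aemeasurable]
  · rw [Measure.map_apply hψm measurableSet_Ioo.compl, preimage_compl]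
    convert hσIoo using 3
    ext u; exact hψI u
  · have h3 : (densityMeasure Ω ρ).map
        (fun z => (z 0, (z 1 - (t (z 0) + m * s (z 0))) / (h * s (z 0)))) =
        (densityMeasure Ω ρ).map (Prod.map id ψ ∘ fun z => (z 0, U z)) := by
      refine Measure.map_congr ?_
      filter_upwards [hae] with z hz
      have := (hs0 _ (hΩI z hz)).ne'
      simp only [Function.comp, Prod.map, id, hψ, hU, Prod.mk.injEq, true_and]
      field_simp
      ring
    rw [h3, ← Measure.map_map (measurable_id.prodMap hψm) hUm, hmap,
      ← Measure.map_prod_map _ _ measurable_id hψm, Measure.map_id]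
  · rw [hroot x hx, e1, e2]
    ring
  · have h3 := hΩU z hz
    have h4 := hs0 _ (hΩI z hz)
    rw [e1, e2] at h3
    have h5 : z 1 - (t (z 0) + m * s (z 0)) = s (z 0) * (U z - m) := by
      rw [hUz z hz]; ring
    rw [h5, abs_mul, abs_of_pos h4, mul_comm]
    refine mul_lt_mul_of_pos_right ?_ h4
    rw [abs_lt]
    constructor <;> linarith [h3.1, h3.2]
  · have hc : Continuous f := continuous_iff_continuousAt.2 fun x => (hf x).continuousAt
    rw [integral_map hψm.aemeasurable (Continuous.aestronglyMeasurable (by fun_prop))]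
    have h3 := hfib x hx (fun u => f (ψ u)) (fun u => f' (ψ u) * (1 / h))
      (fun u => (hf (ψ u)).comp u (((hasDerivAt_id u).sub_const m).div_const h))
      (by simp only [hψ]; fun_prop)
    rw [← h3]
    congr 1
    ext u
    have h4 := (hs0 x hx).ne'
    have h5 : h * s x * ψ u + (t x + m * s x) = s x * u + t x := by
      simp only [hψ]; field_simp; ring
    rw [h5, hroot x hx, e1, e2]
    congr 1
    simp only [hψ]
    field_simp
    ring

end PlaneSolution

/-- A vanishing integral confines σ to the zero set of the affine function. Unless both coefficients
vanish this set has at most one point, which is σ-null by absolute continuity. -/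
theorem eq_zero_of_integral_affine_sq {σ : Measure ℝ} (hσ0 : σ ≠ 0) (hσ : σ ≪ volume)
    {e₀ e₁ : ℝ} (hint : Integrable (fun u => (e₀ + e₁ * u) * (e₀ + e₁ * u)) σ)
    (h : ∫ u, (e₀ + e₁ * u) * (e₀ + e₁ * u) ∂σ = 0) : e₀ = 0 ∧ e₁ = 0 := by
  by_contra hne
  rw [integral_eq_zero_iff_of_nonneg (fun u => mul_self_nonneg _) hint] at h
  have hz : σ {u | e₀ + e₁ * u = 0} = 0 := hσ (by
    refine Set.Subsingleton.measure_zero (fun u hu v hv => ?_) _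
    simp only [mem_ofPred_eq] at hu hv
    have h1 : e₁ * (u - v) = 0 := by linear_combination hu - hv
    rcases mul_eq_zero.1 h1 with h2 | h2
    · exact absurd ⟨by rw [h2] at hu; linarith, h2⟩ hne
    · linarith)
  have h1 : ∀ᵐ u ∂σ, False := by
    filter_upwards [h, measure_eq_zero_iff_ae_notMem.1 hz] with u h2 h3
    exact h3 (mul_self_eq_zero.1 h2)
  have := ae_neBot.2 hσ0
  exact (Filter.eventually_false_iff_eq_bot.1 h1 ▸ this).ne rfl

/-- Pearson's equation on `(-1, 1)` characterizes the Jacobi weights. -/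
theorem exists_jacobi_of_pearson {σ : Measure ℝ} [IsFiniteMeasure σ] (hσ0 : σ ≠ 0)
    (hσ : σ (Ioo (-1) 1)ᶜ = 0) (p q : ℝ)
    (H : ∀ f f' : ℝ → ℝ, (∀ u, HasDerivAt f (f' u) u) → Continuous f' →
      ∫ u, (f u * ((p - q) - (p + q) * u) + f' u * (1 - u ^ 2)) ∂σ = 0) :
    0 < p ∧ 0 < q ∧ ∃ C : ENNReal, C ≠ 0 ∧ C ≠ ⊤ ∧
      σ = C • (volume.restrict (Ioo (-1) 1)).withDensity
        fun u => ENNReal.ofReal (jac (-1) 1 (q - 1) (p - 1) u) := by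
  have hσI : ∀ᵐ u ∂σ, u ∈ Ioo (-1 : ℝ) 1 := by rw [ae_iff]; exact hσ
  -- The product theorem is used with second coordinate identically 0, so only the power `k = 0`
  -- carries information.
  obtain ⟨τ, hτf, hτ0, -, hint, hmap⟩ := exists_map_eq_prod (μ := σ) hσ0 measurable_id
    (measurable_const (a := (0 : ℝ))) (by norm_num : (-1 : ℝ) < 1) hσI
    (fun α β _ _ => ⟨0, by simp⟩)
    (w := jac (-1) 1 (q - 1) (p - 1)) continuousOn_jac (fun x hx => jac_pos hx)
    (fun k f f' hf hf' hfs hfs' => by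
      rcases Nat.eq_zero_or_pos k with rfl | hk
      swap
      · simp [hk.ne']
      -- Integrating factor: with F = f (1 - u)^(-q) (1 + u)^(-p) the terms without f' cancel in
      -- Pearson's equation, and f' divided by the Jacobi weight remains.
      obtain ⟨a1, a2, a3, a4⟩ := hfs.hasDerivAt_mul hfs' hf hf'
        (fun x hx => hasDerivAt_jac (P := -q) (Q := -p) hx)
        (((continuousOn_const.div (continuousOn_const.sub continuousOn_id)
          fun x hx => (sub_pos.2 hx.2).ne').add (continuousOn_const.div
          (continuousOn_id.sub continuousOn_const) fun x hx => (sub_pos.2 hx.1).ne')).mul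
          continuousOn_jac)
      rw [← H _ _ a1 a2]
      refine integral_congr_ae ?_
      filter_upwards [hσI] with u hu
      have h1 := (sub_pos.2 hu.1).ne'
      have h2 := (sub_pos.2 hu.2).ne'
      have e1 : jac (-1) 1 (q - 1) (p - 1) u * jac (-1) 1 (-q) (-p) u * ((1 - u) * (u - -1)) = 1 := by
        rw [← jac_one_one, jac_mul hu, jac_mul hu,
          show q - 1 + -q + 1 = 0 by ring, show p - 1 + -p + 1 = 0 by ring]
        simp [jac]
      have h3 := (jac_pos (P := q - 1) (Q := p - 1) hu).ne'
      simp only [id, pow_zero, mul_one]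
      have e2 : (jac (-1) 1 (q - 1) (p - 1) u)⁻¹ =
          jac (-1) 1 (-q) (-p) u * ((1 - u) * (u - -1)) := by
        exact inv_eq_of_mul_eq_one_right (by rw [← mul_assoc]; exact e1)
      rw [e2]
      field_simp
      ring)
  rw [integrableOn_jac_iff (by norm_num)] at hint
  refine ⟨by linarith [hint.2], by linarith [hint.1], τ univ, ?_, measure_ne_top _ _, ?_⟩
  · exact fun h => hτ0 (Measure.measure_univ_eq_zero.1 h)
  · have h := congrArg Measure.fst hmap
    rw [Measure.fst, Measure.fst, Measure.map_fst_prod, Measure.map_map measurable_fst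
      (by fun_prop)] at h
    exact Measure.map_id.symm.trans h

namespace PlaneSolution

variable {Ω : Set (Fin 2 → ℝ)} {g : (Fin 2 → ℝ) → Matrix (Fin 2) (Fin 2) ℝ}
    {b : (Fin 2 → ℝ) → Fin 2 → ℝ} {ρ : (Fin 2 → ℝ) → ℝ} {G l r p q β d : Polynomial ℝ}
    {a c : ℝ}

/-- Pearson's equation for the transverse part of the measure. -/
theorem exists_pearson_law (S : PlaneSolution Ω g b ρ G l r p q β d a c) :
    ∃ (xl xr κ e₁ e₂ M N lam p' q' : ℝ) (t : ℝ → ℝ) (C : ENNReal),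
      xl < xr ∧ 0 < κ ∧ 0 < lam ∧ 0 < p' ∧ 0 < q' ∧ C ≠ 0 ∧ C ≠ ⊤ ∧
      (∀ x, G.eval x = κ * ((xr - x) * (x - xl))) ∧
      (∀ x, l.eval x = κ * (e₂ * (xr - x) - e₁ * (x - xl))) ∧
      (∀ x, β.eval x = κ * ((N + 1) * (xr - x) - (M + 1) * (x - xl))) ∧
      (fun z : Fin 2 → ℝ => z 0) '' Ω = Ioo xl xr ∧
      Measurable t ∧
      (∀ x ∈ Ioo xl xr, HasDerivAt t ((l.eval x * t x + r.eval x) / G.eval x) x) ∧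
      IntegrableOn (jac xl xr M N) (Ioo xl xr) ∧
      (densityMeasure Ω ρ).map
          (fun z => (z 0, (z 1 - t (z 0)) / (lam * jac xl xr e₁ e₂ (z 0)))) =
        ((volume.restrict (Ioo xl xr)).withDensity
          fun x => ENNReal.ofReal (jac xl xr M N x)).prod
        (C • (volume.restrict (Ioo (-1) 1)).withDensity
          fun u => ENNReal.ofReal (jac (-1) 1 (q' - 1) (p' - 1) u)) ∧
      (∀ x ∈ Ioo xl xr, a * G.eval x - l.eval x ^ 2 < 0) ∧
      (∀ x ∈ Ioo xl xr, ∀ y, detFun G l r p q a x y =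
        (a * G.eval x - l.eval x ^ 2) * ((y - t x) ^ 2 - (lam * jac xl xr e₁ e₂ x) ^ 2)) ∧
      (∀ z ∈ Ω, |z 1 - t (z 0)| < lam * jac xl xr e₁ e₂ (z 0)) ∧
      (∀ x ∈ Ioo xl xr, ∀ y, fibreFun G l r β d c x y = -(a * G.eval x - l.eval x ^ 2) *
        ((p' - q') * (lam * jac xl xr e₁ e₂ x) - (p' + q') * (y - t x))) := by
  obtain ⟨xl, xr, κ, e₁, e₂, M, N, lam, t, σ, hlr, hκ, hlam, hG, hl, hβ, hproj, htm, ht, hwI, hσf,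
    hσ0, hσI, hmap, hA, hdet, hΩ, hfib⟩ := S.exists_normalized_law
  obtain ⟨x₀, hx₀⟩ := exists_between hlr
  set s : ℝ → ℝ := fun x => lam * jac xl xr e₁ e₂ x with hs
  have hs0 : ∀ x ∈ Ioo xl xr, 0 < s x := fun x hx => mul_pos hlam (jac_pos hx)
  set A : ℝ → ℝ := fun x => a * G.eval x - l.eval x ^ 2 with hAdef
  obtain ⟨E₀, E₁, hE⟩ : ∃ E₀ E₁ : ℝ → ℝ, ∀ x y, fibreFun G l r β d c x y = E₀ x + E₁ x * y :=
    ⟨fun x => d.eval x * G.eval x - β.eval x * r.eval x + r.eval x * G.derivative.eval x -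
      G.eval x * r.derivative.eval x - r.eval x * l.eval x,
      fun x => c * G.eval x - β.eval x * l.eval x + l.eval x * G.derivative.eval x -
      G.eval x * l.derivative.eval x - l.eval x * l.eval x, fun x y => by unfold fibreFun; ring⟩
  set δ₀ : ℝ → ℝ := fun x => (E₀ x + E₁ x * t x) / (-(A x) * s x) with hδ₀
  set δ₁ : ℝ → ℝ := fun x => E₁ x / (-(A x)) with hδ₁
  have hpear : ∀ x ∈ Ioo xl xr, ∀ f f' : ℝ → ℝ, (∀ u, HasDerivAt f (f' u) u) → Continuous f' →
      ∫ u, (f u * (δ₀ x + δ₁ x * u) + f' u * (1 - u ^ 2)) ∂σ = 0 := by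
    intro x hx f f' hf hf'
    have h1 := hfib x hx f f' hf hf'
    have hA0 : -(A x) ≠ 0 := (neg_pos.2 (hA x hx)).ne'
    have hs1 := (hs0 x hx).ne'
    rw [← mul_zero ((-(A x) * s x)⁻¹), ← h1, ← integral_const_mul]
    congr 1
    ext u
    rw [hE]
    change _ = (-(A x) * s x)⁻¹ * (f u * (E₀ x + E₁ x * (s x * u + t x)) +
      f' u * (A x * s x * (u ^ 2 - 1)))
    simp only [hδ₀, hδ₁]
    have hA1 : A x ≠ 0 := fun h => hA0 (by rw [h, neg_zero])
    field_simp
    ring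
  have hσr : σ.restrict (Icc (-1) 1) = σ := Measure.restrict_eq_self_of_ae_mem (by
    rw [ae_iff]
    exact measure_mono_null (fun u hu hu' => hu (Ioo_subset_Icc_self hu')) hσI)
  have hint : ∀ {f : ℝ → ℝ}, Continuous f → Integrable f σ := fun hf => by
    rw [← hσr]; exact hf.continuousOn.integrableOn_compact isCompact_Icc
  set p' := (δ₀ x₀ - δ₁ x₀) / 2 with hp'
  set q' := (-δ₀ x₀ - δ₁ x₀) / 2 with hq'
  have ed0 : p' - q' = δ₀ x₀ := by simp only [hp', hq']; ring
  have ed1 : -(p' + q') = δ₁ x₀ := by simp only [hp', hq']; ring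
  obtain ⟨hp0, hq0, C, hC0, hCt, hσe⟩ := exists_jacobi_of_pearson hσ0 hσI p' q'
    (fun f f' hf hf' => by
      have := hpear x₀ hx₀ f f' hf hf'
      rw [← ed0, ← ed1] at this
      rw [← this]; congr 1; ext u; ring)
  have hσv : σ ≪ volume := by
    rw [hσe]
    exact (Measure.smul_absolutelyContinuous.trans (withDensity_absolutelyContinuous _ _)).trans
      Measure.restrict_le_self.absolutelyContinuous
  refine ⟨xl, xr, κ, e₁, e₂, M, N, lam, p', q', t, C, hlr, hκ, hlam, hp0, hq0, hC0, hCt, hG, hl,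
    hβ, hproj, htm, ht, hwI, by rw [← hσe]; exact hmap, hA, hdet, hΩ, fun x hx y => ?_⟩
  -- The same σ satisfies the equations for x and for x₀. Subtracting them, with the affine
  -- difference of the two drifts as test function, kills the f' terms and shows that the drift is
  -- independent of x.
  have hf : ∀ u : ℝ, HasDerivAt (fun u => (δ₀ x - δ₀ x₀) + (δ₁ x - δ₁ x₀) * u)
      (δ₁ x - δ₁ x₀) u := fun u => by
    simpa using ((hasDerivAt_id u).const_mul (δ₁ x - δ₁ x₀)).const_add (δ₀ x - δ₀ x₀)
  have h1 := hpear x hx _ _ hf continuous_const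
  have h2 := hpear x₀ hx₀ _ _ hf continuous_const
  have h3 : ∫ u, ((δ₀ x - δ₀ x₀) + (δ₁ x - δ₁ x₀) * u) *
      ((δ₀ x - δ₀ x₀) + (δ₁ x - δ₁ x₀) * u) ∂σ = 0 := by
    rw [← sub_self (0 : ℝ)]
    nth_rw 1 [← h1]
    rw [← h2, ← integral_sub (hint (by fun_prop)) (hint (by fun_prop))]
    congr 1; ext u; ring
  obtain ⟨h4, h5⟩ := eq_zero_of_integral_affine_sq hσ0 hσv (hint (by fun_prop)) h3
  have hA0 : A x ≠ 0 := (hA x hx).ne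
  have hs1 := (hs0 x hx).ne'
  have h6 : δ₀ x = p' - q' := by linarith
  have h7 : δ₁ x = -(p' + q') := by linarith
  have h8 : E₁ x = -(A x) * δ₁ x := by simp only [hδ₁]; field_simp
  have h9 : E₀ x + E₁ x * t x = -(A x) * s x * δ₀ x := by simp only [hδ₀]; field_simp
  rw [hE]
  change _ = -(A x) * ((p' - q') * s x - (p' + q') * (y - t x))
  rw [h6] at h9
  rw [h7] at h8
  linear_combination h9 + (y - t x) * h8

end PlaneSolution

/-! ### Strips and the measures they carry -/

/-- The open region `t(x) - s(x) < y < t(x) + s(x)`, `a < x < b`. -/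
def strip (a b : ℝ) (s t : ℝ → ℝ) : Set (Fin 2 → ℝ) :=
  {z | z 0 ∈ Ioo a b ∧ |z 1 - t (z 0)| < s (z 0)}

/-- The parametrization `(x, u) ↦ (x, s(x) u + t(x))`. -/
def stripMap (s t : ℝ → ℝ) (z : ℝ × ℝ) : Fin 2 → ℝ := ![z.1, s z.1 * z.2 + t z.1]

variable {a b : ℝ} {s t w W : ℝ → ℝ}

theorem measurable_stripMap (hs : Measurable s) (ht : Measurable t) :
    Measurable (stripMap s t) := by
  refine measurable_pi_iff.2 fun i => ?_
  fin_cases i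
  · exact measurable_fst
  · exact ((hs.comp measurable_fst).mul measurable_snd).add (ht.comp measurable_fst)

theorem measurableSet_strip (hs : Measurable s) (ht : Measurable t) :
    MeasurableSet (strip a b s t) := by
  have h0 : Measurable fun z : Fin 2 → ℝ => z 0 := measurable_pi_apply 0
  have h1 : Measurable fun z : Fin 2 → ℝ => z 1 := measurable_pi_apply 1
  exact (h0 measurableSet_Ioo).inter (measurableSet_lt (h1.sub (ht.comp h0)).abs (hs.comp h0))

theorem isOpen_strip (hs : ContinuousOn s (Ioo a b)) (ht : ContinuousOn t (Ioo a b)) :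
    IsOpen (strip a b s t) := by
  have h0 : Continuous fun z : Fin 2 → ℝ => z 0 := continuous_apply 0
  have hm : MapsTo (fun z : Fin 2 → ℝ => z 0) ((fun z => z 0) ⁻¹' Ioo a b) (Ioo a b) :=
    fun z hz => hz
  have h1 : ContinuousOn (fun z : Fin 2 → ℝ => s (z 0) - |z 1 - t (z 0)|)
      ((fun z => z 0) ⁻¹' Ioo a b) :=
    (hs.comp h0.continuousOn hm).sub
      (((continuous_apply 1).continuousOn.sub (ht.comp h0.continuousOn hm)).abs)
  have := h1.isOpen_inter_preimage (isOpen_Ioo.preimage h0) (isOpen_Ioi (a := (0 : ℝ)))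
  convert this using 1
  ext z
  simp [strip]

theorem lintegral_Ioo_affine {m h : ℝ} (hh : 0 < h) (F : ℝ → ENNReal) :
    ∫⁻ y in {y | |y - m| < h}, F y = ∫⁻ u in Ioo (-1) 1, ENNReal.ofReal h * F (h * u + m) := by
  have himg : (fun u : ℝ => h * u + m) '' Ioo (-1) 1 = {y | |y - m| < h} := by
    ext y
    simp only [mem_image, mem_Ioo, mem_ofPred_eq, abs_lt]
    constructor
    · rintro ⟨u, ⟨h1, h2⟩, rfl⟩
      constructor <;> nlinarith
    · rintro ⟨h1, h2⟩
      refine ⟨(y - m) / h, ⟨?_, ?_⟩, by field_simp; ring⟩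
      · rw [lt_div_iff₀ hh]; linarith
      · rw [div_lt_iff₀ hh]; linarith
  rw [← himg, lintegral_image_eq_lintegral_abs_deriv_mul measurableSet_Ioo
    (f' := fun _ => h) (fun u _ => by
      simpa using (((hasDerivAt_id u).const_mul h).add_const m).hasDerivWithinAt)
    (fun u _ v _ huv => mul_left_cancel₀ hh.ne' (add_right_cancel huv))]
  rw [abs_of_pos hh]

theorem lintegral_strip (hs : Measurable s) (ht : Measurable t) (hs0 : ∀ x ∈ Ioo a b, 0 < s x)
    {F : (Fin 2 → ℝ) → ENNReal} (hF : Measurable F) :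
    ∫⁻ z in strip a b s t, F z =
      ∫⁻ x in Ioo a b, ∫⁻ u in Ioo (-1) 1, ENNReal.ofReal (s x) * F (stripMap s t (x, u)) := by
  have hms := measurableSet_strip (a := a) (b := b) hs ht
  rw [← lintegral_indicator hms,
    ← (volume_preserving_finTwoArrow ℝ).symm.lintegral_comp (hF.indicator hms),
    Measure.volume_eq_prod, lintegral_prod
      (fun z : ℝ × ℝ => (strip a b s t).indicator F (MeasurableEquiv.finTwoArrow.symm z))
      ((hF.indicator hms).comp
      (MeasurableEquiv.finTwoArrow (α := ℝ)).symm.measurable).aemeasurable,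
    ← lintegral_indicator measurableSet_Ioo]
  congr 1
  ext x
  by_cases hx : x ∈ Ioo a b
  · rw [indicator_of_mem hx]
    simp only [stripMap]
    rw [← lintegral_Ioo_affine (m := t x) (hs0 x hx) (fun y => F ![x, y]), ← lintegral_indicator]
    · congr 1
      ext y
      have h1 : (MeasurableEquiv.finTwoArrow (α := ℝ)).symm (x, y) = ![x, y] := rfl
      rw [h1]
      by_cases hy : |y - t x| < s x
      · rw [indicator_of_mem, indicator_of_mem]
        · exact hy
        · exact ⟨hx, hy⟩
      · rw [indicator_of_notMem, indicator_of_notMem]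
        · exact hy
        · exact fun h => hy h.2
    · exact measurableSet_lt (measurable_id.sub_const _).abs measurable_const
  · rw [indicator_of_notMem hx]
    convert lintegral_zero with y
    rw [indicator_of_notMem]
    exact fun h => hx h.1

/-- The Jacobian of (x, u) ↦ (x, s(x) u + t(x)) is s(x), which cancels the division by s in the
density. -/
theorem densityMeasure_strip (hs : Measurable s) (ht : Measurable t)
    (hs0 : ∀ x ∈ Ioo a b, 0 < s x) (hw : Measurable w) (hw0 : ∀ x ∈ Ioo a b, 0 ≤ w x)
    (hW : Measurable W) {ρ : (Fin 2 → ℝ) → ℝ}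
    (hρ : ∀ z ∈ strip a b s t, ρ z = w (z 0) * W ((z 1 - t (z 0)) / s (z 0)) / s (z 0)) :
    densityMeasure (strip a b s t) ρ =
      (((volume.restrict (Ioo a b)).withDensity fun x => ENNReal.ofReal (w x)).prod
        ((volume.restrict (Ioo (-1) 1)).withDensity fun u => ENNReal.ofReal (W u))).map
        (stripMap s t) := by
  have h0 : Measurable fun z : Fin 2 → ℝ => z 0 := measurable_pi_apply 0
  have h1 : Measurable fun z : Fin 2 → ℝ => z 1 := measurable_pi_apply 1
  have hTm := measurable_stripMap hs ht
  have hms := measurableSet_strip (a := a) (b := b) hs ht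
  set ρ' : (Fin 2 → ℝ) → ℝ := fun z => w (z 0) * W ((z 1 - t (z 0)) / s (z 0)) / s (z 0) with hρ'
  have hρm : Measurable ρ' := ((hw.comp h0).mul (hW.comp ((h1.sub (ht.comp h0)).div
    (hs.comp h0)))).div (hs.comp h0)
  have e1 : densityMeasure (strip a b s t) ρ = densityMeasure (strip a b s t) ρ' := by
    refine withDensity_congr_ae ?_
    filter_upwards [ae_restrict_mem hms] with z hz
    rw [hρ z hz]
  rw [e1]
  ext E hE
  rw [densityMeasure, withDensity_apply _ hE, Measure.map_apply hTm hE,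
    Measure.prod_apply (hTm hE), ← lintegral_indicator hE]
  rw [lintegral_strip hs ht hs0 (hρm.ennreal_ofReal.indicator hE)]
  rw [lintegral_withDensity_eq_lintegral_mul _ hw.ennreal_ofReal
    (measurable_measure_prodMk_left (hTm hE))]
  refine setLIntegral_congr_fun measurableSet_Ioo fun x hx => ?_
  have hsx := hs0 x hx
  have hEx : MeasurableSet (Prod.mk x ⁻¹' (stripMap s t ⁻¹' E)) :=
    measurable_prodMk_left (hTm hE)
  simp only [Pi.mul_apply]
  rw [withDensity_apply _ hEx, ← lintegral_indicator hEx,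
    ← lintegral_const_mul _ (hW.ennreal_ofReal.indicator hEx)]
  congr 1
  ext u
  by_cases hu : stripMap s t (x, u) ∈ E
  · rw [indicator_of_mem hu, indicator_of_mem (show u ∈ Prod.mk x ⁻¹' (stripMap s t ⁻¹' E) from hu),
      ← ENNReal.ofReal_mul hsx.le, ← ENNReal.ofReal_mul (hw0 x hx)]
    congr 1
    simp only [hρ', stripMap, Matrix.cons_val_zero, Matrix.cons_val_one]
    rw [show (s x * u + t x - t x) / s x = u by field_simp; ring]
    field_simp
  · rw [indicator_of_notMem hu,
      indicator_of_notMem (show u ∉ Prod.mk x ⁻¹' (stripMap s t ⁻¹' E) from hu)]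
    simp

/-- The law of (x, u) identifies μ with a measure of positive density on the strip, so an open part
of the strip off the closure of Ω would have positive mass. Thus Ω is dense in the strip, and
regularity of Ω as the interior of its closure gives equality. The two densities agree almost
everywhere, hence everywhere by continuity. -/
theorem eq_strip_of_map_eq_prod {Ω : Set (Fin 2 → ℝ)} {ρ : (Fin 2 → ℝ) → ℝ} (hΩ : IsOpen Ω)
    (hΩc : interior (closure Ω) = Ω) (hρ : ContinuousOn ρ Ω) (hρ0 : ∀ z ∈ Ω, 0 ≤ ρ z)
    (hprob : IsProbabilityMeasure (densityMeasure Ω ρ)) (hs : Measurable s) (ht : Measurable t)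
    (hsc : ContinuousOn s (Ioo a b)) (htc : ContinuousOn t (Ioo a b))
    (hs0 : ∀ x ∈ Ioo a b, 0 < s x) (hw : Measurable w) (hwc : ContinuousOn w (Ioo a b))
    (hw0 : ∀ x ∈ Ioo a b, 0 < w x) (hW : Measurable W) (hWc : ContinuousOn W (Ioo (-1) 1))
    (hW0 : ∀ u ∈ Ioo (-1) 1, 0 < W u) (hsub : Ω ⊆ strip a b s t)
    (hmap : (densityMeasure Ω ρ).map (fun z => (z 0, (z 1 - t (z 0)) / s (z 0))) =
      ((volume.restrict (Ioo a b)).withDensity fun x => ENNReal.ofReal (w x)).prod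
        ((volume.restrict (Ioo (-1) 1)).withDensity fun u => ENNReal.ofReal (W u))) :
    Ω = strip a b s t ∧ ∀ z ∈ Ω, ρ z = w (z 0) * W ((z 1 - t (z 0)) / s (z 0)) / s (z 0) := by
  have h0 : Measurable fun z : Fin 2 → ℝ => z 0 := measurable_pi_apply 0
  have h1 : Measurable fun z : Fin 2 → ℝ => z 1 := measurable_pi_apply 1
  have hTm := measurable_stripMap hs ht
  have hms := measurableSet_strip (a := a) (b := b) hs ht
  set ρ' : (Fin 2 → ℝ) → ℝ := fun z => w (z 0) * W ((z 1 - t (z 0)) / s (z 0)) / s (z 0) with hρ'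
  have hρm : Measurable ρ' := ((hw.comp h0).mul (hW.comp ((h1.sub (ht.comp h0)).div
    (hs.comp h0)))).div (hs.comp h0)
  have hu : ∀ z ∈ strip a b s t, (z 1 - t (z 0)) / s (z 0) ∈ Ioo (-1 : ℝ) 1 := fun z hz => by
    have h2 := hs0 _ hz.1
    have h3 := abs_lt.1 hz.2
    rw [mem_Ioo, lt_div_iff₀ h2, div_lt_iff₀ h2]
    constructor <;> linarith [h3.1, h3.2]
  have hρ'0 : ∀ z ∈ strip a b s t, 0 < ρ' z := fun z hz =>
    div_pos (mul_pos (hw0 _ hz.1) (hW0 _ (hu z hz))) (hs0 _ hz.1)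
  have hae := ae_mem_densityMeasure (ρ := ρ) hΩ
  have hUm : Measurable fun z : Fin 2 → ℝ => (z 0, (z 1 - t (z 0)) / s (z 0)) :=
    h0.prodMk ((h1.sub (ht.comp h0)).div (hs.comp h0))
  have hμ : densityMeasure Ω ρ = densityMeasure (strip a b s t) ρ' := by
    rw [densityMeasure_strip hs ht hs0 hw (fun x hx => (hw0 x hx).le) hW (ρ := ρ') fun z _ => rfl,
      ← hmap, Measure.map_map hTm hUm]
    conv_lhs => rw [← Measure.map_id (μ := densityMeasure Ω ρ)]
    refine Measure.map_congr ?_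
    filter_upwards [hae] with z hz
    have := (hs0 _ (hsub hz).1).ne'
    ext i
    fin_cases i
    · rfl
    · simp only [stripMap, Function.comp, id]
      simp
      field_simp
      ring
  have hopen := isOpen_strip hsc htc
  have hcl : strip a b s t ⊆ closure Ω := by
    intro z hz
    by_contra hzc
    have hV : IsOpen (strip a b s t ∩ (closure Ω)ᶜ) := hopen.inter isClosed_closure.isOpen_compl
    have h2 : densityMeasure Ω ρ (strip a b s t ∩ (closure Ω)ᶜ) = 0 := by
      refine measure_mono_null (t := Ωᶜ) (fun x hx hx' => hx.2 (subset_closure hx')) ?_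
      rw [ae_iff] at hae
      exact hae
    rw [hμ, densityMeasure, withDensity_apply _ hV.measurableSet,
      Measure.restrict_restrict hV.measurableSet,
      inter_right_comm, inter_self, lintegral_eq_zero_iff hρm.ennreal_ofReal] at h2
    have h3 : ∀ᵐ x ∂(volume.restrict (strip a b s t ∩ (closure Ω)ᶜ)), False := by
      filter_upwards [h2, ae_restrict_mem hV.measurableSet] with x hx hx'
      exact absurd hx (ENNReal.ofReal_pos.2 (hρ'0 x hx'.1)).ne'
    have h4 : volume (strip a b s t ∩ (closure Ω)ᶜ) = 0 := by
      rw [← Measure.restrict_eq_zero]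
      by_contra h5
      have := ae_neBot.2 h5
      exact (Filter.eventually_false_iff_eq_bot.1 h3 ▸ this).ne rfl
    have h4 := (hV.measure_eq_zero_iff volume).1 h4
    exact notMem_empty z (h4.subset ⟨hz, hzc⟩)
  have hΩe : Ω = strip a b s t :=
    hsub.antisymm (hΩc ▸ interior_maximal hcl hopen)
  refine ⟨hΩe, ?_⟩
  have hρae : ρ =ᵐ[volume.restrict Ω] ρ' := by
    have h2 : (fun z => ENNReal.ofReal (ρ z)) =ᵐ[volume.restrict Ω]
        fun z => ENNReal.ofReal (ρ' z) := by
      rw [← withDensity_eq_iff (hρ.aemeasurable hΩ.measurableSet).ennreal_ofReal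
        hρm.ennreal_ofReal.aemeasurable]
      · nth_rw 2 [hΩe]
        exact hμ
      · have h3 := measure_ne_top (densityMeasure Ω ρ) univ
        rwa [densityMeasure, withDensity_apply _ MeasurableSet.univ, Measure.restrict_univ] at h3
    filter_upwards [h2, ae_restrict_mem hΩ.measurableSet] with z hz hzΩ
    exact (ENNReal.ofReal_eq_ofReal_iff (hρ0 z hzΩ) (hρ'0 z (hsub hzΩ)).le).1 hz
  refine Measure.eqOn_open_of_ae_eq hρae hΩ hρ ?_
  have hc0 : ContinuousOn (fun z : Fin 2 → ℝ => z 0) Ω := (continuous_apply 0).continuousOn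
  have hm : MapsTo (fun z : Fin 2 → ℝ => z 0) Ω (Ioo a b) := fun z hz => (hsub hz).1
  have hsΩ := hsc.comp hc0 hm
  have hs0Ω : ∀ z ∈ Ω, s (z 0) ≠ 0 := fun z hz => (hs0 _ (hsub hz).1).ne'
  exact ((hwc.comp hc0 hm).mul (hWc.comp (((continuous_apply 1).continuousOn.sub
    (htc.comp hc0 hm)).div hsΩ hs0Ω) fun z hz => hu z (hsub hz))).div hsΩ hs0Ω

/-! ### Partial derivatives and the divergence of the cometric -/

/-- `F` is differentiable at `z` with partial derivatives `fx`, `fy`. -/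
def HasPartialsAt (F : (Fin 2 → ℝ) → ℝ) (fx fy : ℝ) (z : Fin 2 → ℝ) : Prop :=
  HasFDerivAt F (fx • ContinuousLinearMap.proj (R := ℝ) (φ := fun _ : Fin 2 => ℝ) 0 +
    fy • ContinuousLinearMap.proj (R := ℝ) (φ := fun _ : Fin 2 => ℝ) 1) z

namespace HasPartialsAt

variable {F H : (Fin 2 → ℝ) → ℝ} {fx fy hx hy : ℝ} {z : Fin 2 → ℝ}

theorem fderiv_single_zero (h : HasPartialsAt F fx fy z) :
    fderiv ℝ F z (Pi.single 0 1) = fx := by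
  rw [HasFDerivAt.fderiv h]; simp

theorem fderiv_single_one (h : HasPartialsAt F fx fy z) :
    fderiv ℝ F z (Pi.single 1 1) = fy := by
  rw [HasFDerivAt.fderiv h]; simp

theorem congr_partials (h : HasPartialsAt F fx fy z) (h1 : fx = hx) (h2 : fy = hy) :
    HasPartialsAt F hx hy z := h1 ▸ h2 ▸ h

theorem congr_of_eqOn {Ω : Set (Fin 2 → ℝ)} (h : HasPartialsAt F fx fy z) (hΩ : IsOpen Ω)
    (hz : z ∈ Ω) (he : ∀ u ∈ Ω, H u = F u) : HasPartialsAt H fx fy z :=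
  HasFDerivAt.congr_of_eventuallyEq h
    (Filter.eventuallyEq_of_mem (hΩ.mem_nhds hz) fun u hu => he u hu)

theorem coord_zero {f : ℝ → ℝ} {f' : ℝ} (h : HasDerivAt f f' (z 0)) :
    HasPartialsAt (fun z => f (z 0)) f' 0 z := by
  have h1 := h.comp_hasFDerivAt z
    (ContinuousLinearMap.proj (R := ℝ) (φ := fun _ : Fin 2 => ℝ) 0).hasFDerivAt
  unfold HasPartialsAt
  rw [zero_smul, add_zero]
  exact h1

theorem coord_one : HasPartialsAt (fun z => z 1) 0 1 z := by
  unfold HasPartialsAt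
  rw [zero_smul, zero_add, one_smul]
  exact (ContinuousLinearMap.proj (R := ℝ) (φ := fun _ : Fin 2 => ℝ) 1).hasFDerivAt

theorem add (h₁ : HasPartialsAt F fx fy z) (h₂ : HasPartialsAt H hx hy z) :
    HasPartialsAt (fun z => F z + H z) (fx + hx) (fy + hy) z := by
  refine (HasFDerivAt.add h₁ h₂).congr_fderiv ?_
  ext v; simp; ring

theorem mul (h₁ : HasPartialsAt F fx fy z) (h₂ : HasPartialsAt H hx hy z) :
    HasPartialsAt (fun z => F z * H z) (fx * H z + F z * hx) (fy * H z + F z * hy) z := by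
  refine (HasFDerivAt.mul h₁ h₂).congr_fderiv ?_
  ext v; simp; ring

theorem comp {f : ℝ → ℝ} {f' : ℝ} (h : HasDerivAt f f' (F z)) (h₁ : HasPartialsAt F fx fy z) :
    HasPartialsAt (fun z => f (F z)) (f' * fx) (f' * fy) z := by
  refine (h.comp_hasFDerivAt z h₁).congr_fderiv ?_
  ext v; simp; ring

end HasPartialsAt

theorem mem_Ioo_of_mem_strip {a b : ℝ} {s t : ℝ → ℝ} (hs0 : ∀ x ∈ Ioo a b, 0 < s x)
    {z : Fin 2 → ℝ} (hz : z ∈ strip a b s t) :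
    (z 1 - t (z 0)) / s (z 0) ∈ Ioo (-1 : ℝ) 1 := by
  have h2 := hs0 _ hz.1
  have h3 := abs_lt.1 hz.2
  rw [mem_Ioo, lt_div_iff₀ h2, div_lt_iff₀ h2]
  constructor <;> linarith [h3.1, h3.2]

/-- The divergence `∑_j ∂_j (g^{ij} ρ)` of a cometric on a strip, for a density adapted to it. -/
theorem sum_fderiv_strip {a b : ℝ} {s t w : ℝ → ℝ} {g : (Fin 2 → ℝ) → Matrix (Fin 2) (Fin 2) ℝ}
    {ρ : (Fin 2 → ℝ) → ℝ} {G l r p q β : Polynomial ℝ} {A p' q' C : ℝ}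
    (hG : ∀ x ∈ Ioo a b, 0 < G.eval x) (hs0 : ∀ x ∈ Ioo a b, 0 < s x)
    (hs : ∀ x ∈ Ioo a b, HasDerivAt s (l.eval x / G.eval x * s x) x)
    (ht : ∀ x ∈ Ioo a b, HasDerivAt t ((l.eval x * t x + r.eval x) / G.eval x) x)
    (hw : ∀ x ∈ Ioo a b, HasDerivAt w ((β.eval x - G.derivative.eval x) / G.eval x * w x) x)
    (g00 : ∀ z ∈ strip a b s t, g z 0 0 = G.eval (z 0))
    (g01 : ∀ z ∈ strip a b s t, g z 0 1 = l.eval (z 0) * z 1 + r.eval (z 0))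
    (g10 : ∀ z ∈ strip a b s t, g z 1 0 = l.eval (z 0) * z 1 + r.eval (z 0))
    (g11 : ∀ z ∈ strip a b s t, g z 1 1 = A * z 1 ^ 2 + p.eval (z 0) * z 1 + q.eval (z 0))
    (hρ : ∀ z ∈ strip a b s t, ρ z = C * (w (z 0) *
      jac (-1) 1 (q' - 1) (p' - 1) ((z 1 - t (z 0)) / s (z 0)) / s (z 0)))
    (hdet : ∀ x ∈ Ioo a b, ∀ y, detFun G l r p q A x y =
        (A * G.eval x - l.eval x ^ 2) * ((y - t x) ^ 2 - s x ^ 2))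
    {z : Fin 2 → ℝ} (hz : z ∈ strip a b s t) :
    ∑ j, fderiv ℝ (fun u : Fin 2 → ℝ => g u 0 j * ρ u) z (Pi.single j 1) = ρ z * β.eval (z 0) ∧
    G.eval (z 0) * ∑ j, fderiv ℝ (fun u : Fin 2 → ℝ => g u 1 j * ρ u) z (Pi.single j 1) =
      ρ z * ((β.eval (z 0) - G.derivative.eval (z 0) + l.eval (z 0)) *
          (l.eval (z 0) * z 1 + r.eval (z 0)) +
        G.eval (z 0) * (l.derivative.eval (z 0) * z 1 + r.derivative.eval (z 0)) -
        (A * G.eval (z 0) - l.eval (z 0) ^ 2) *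
          ((p' - q') * s (z 0) - (p' + q') * (z 1 - t (z 0)))) := by
  have hopen : IsOpen (strip a b s t) := isOpen_strip
    (fun x hx => (hs x hx).continuousAt.continuousWithinAt)
    fun x hx => (ht x hx).continuousAt.continuousWithinAt
  set x := z 0 with hx
  set y := z 1 with hy
  have hxI : x ∈ Ioo a b := hz.1
  have hGx := (hG x hxI).ne'
  have hsx := (hs0 x hxI).ne'
  set u := (y - t x) / s x with hu
  have huI : u ∈ Ioo (-1 : ℝ) 1 := mem_Ioo_of_mem_strip hs0 hz
  have h1u := (sub_pos.2 huI.1).ne'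
  have h2u := (sub_pos.2 huI.2).ne'
  have hyu : y = s x * u + t x := by simp only [hu]; field_simp; ring
  -- partial derivatives of the building blocks
  have P1 : HasPartialsAt (fun z => z 1) 0 1 z := HasPartialsAt.coord_one
  have Psi : HasPartialsAt (fun z => (s (z 0))⁻¹) (-(l.eval x / G.eval x) * (s x)⁻¹) 0 z :=
    HasPartialsAt.coord_zero (f := fun x => (s x)⁻¹) (((hs x hxI).inv hsx).congr_deriv (by
      field_simp))
  have Pt : HasPartialsAt (fun z => -t (z 0)) (-((l.eval x * t x + r.eval x) / G.eval x)) 0 z :=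
    HasPartialsAt.coord_zero (f := fun x => -t x) (ht x hxI).neg
  have Pw : HasPartialsAt (fun z => w (z 0))
      ((β.eval x - G.derivative.eval x) / G.eval x * w x) 0 z :=
    HasPartialsAt.coord_zero (hw x hxI)
  have Pu : HasPartialsAt (fun z => (z 1 + -t (z 0)) * (s (z 0))⁻¹)
      (-((l.eval x * y + r.eval x) / G.eval x * (s x)⁻¹)) (s x)⁻¹ z := by
    refine ((P1.add Pt).mul Psi).congr_partials ?_ ?_
    · simp only [← hx, ← hy]; field_simp; ring
    · ring
  have hue : (z 1 + -t (z 0)) * (s (z 0))⁻¹ = u := by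
    simp only [hu, ← hx, ← hy, div_eq_mul_inv, sub_eq_add_neg]
  set ω := -(q' - 1) / (1 - u) + (p' - 1) / (u - -1) with hω
  set J := jac (-1) 1 (q' - 1) (p' - 1) with hJ
  have PJ : HasPartialsAt (fun z => J ((z 1 + -t (z 0)) * (s (z 0))⁻¹))
      (ω * J u * -((l.eval x * y + r.eval x) / G.eval x * (s x)⁻¹)) (ω * J u * (s x)⁻¹) z :=
    HasPartialsAt.comp (by rw [hue]; exact hasDerivAt_jac huI) Pu
  have hρz : ρ z = C * (w x * J u / s x) := hρ z hz
  have Pρ : HasPartialsAt ρ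
      (ρ z * ((β.eval x - G.derivative.eval x - l.eval x) / G.eval x -
        ω * (l.eval x * y + r.eval x) / G.eval x * (s x)⁻¹)) (ρ z * (ω * (s x)⁻¹)) z := by
    have h := ((Pw.mul PJ).mul Psi)
    have hC : HasPartialsAt (fun _ => C) 0 0 z := HasPartialsAt.coord_zero (hasDerivAt_const _ C)
    refine ((hC.mul h).congr_of_eqOn (H := ρ) hopen hz fun v hv => ?_).congr_partials ?_ ?_
    · rw [hρ v hv, div_eq_mul_inv, div_eq_mul_inv, sub_eq_add_neg]
    · rw [hρz, hue]
      simp only [← hx]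
      field_simp
      ring
    · rw [hρz, hue]
      simp only [← hx]
      field_simp
      ring
  have PG : HasPartialsAt (fun z => G.eval (z 0)) (G.derivative.eval x) 0 z :=
    HasPartialsAt.coord_zero (G.hasDerivAt x)
  have Pg : HasPartialsAt (fun z => l.eval (z 0) * z 1 + r.eval (z 0))
      (l.derivative.eval x * y + r.derivative.eval x) (l.eval x) z :=
    (((HasPartialsAt.coord_zero (l.hasDerivAt x)).mul P1).add
      (HasPartialsAt.coord_zero (r.hasDerivAt x))).congr_partials
        (by simp only [← hy]; ring) (by simp only [← hx]; ring)
  have Pq : HasPartialsAt (fun z => A * (z 1 * z 1) + p.eval (z 0) * z 1 + q.eval (z 0))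
      (p.derivative.eval x * y + q.derivative.eval x) (2 * A * y + p.eval x) z :=
    ((((HasPartialsAt.coord_zero (hasDerivAt_const _ A)).mul (P1.mul P1)).add
      ((HasPartialsAt.coord_zero (p.hasDerivAt x)).mul P1)).add
      (HasPartialsAt.coord_zero (q.hasDerivAt x))).congr_partials
        (by simp only [← hy]; ring) (by simp only [← hx, ← hy]; ring)
  have D00 := (PG.mul Pρ).congr_of_eqOn (H := fun u => g u 0 0 * ρ u) hopen hz
    fun v hv => by rw [g00 v hv]
  have D01 := (Pg.mul Pρ).congr_of_eqOn (H := fun u => g u 0 1 * ρ u) hopen hz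
    fun v hv => by rw [g01 v hv]
  have D10 := (Pg.mul Pρ).congr_of_eqOn (H := fun u => g u 1 0 * ρ u) hopen hz
    fun v hv => by rw [g10 v hv]
  have D11 := (Pq.mul Pρ).congr_of_eqOn (H := fun u => g u 1 1 * ρ u) hopen hz
    fun v hv => by rw [g11 v hv]; ring
  rw [Fin.sum_univ_two, Fin.sum_univ_two, D00.fderiv_single_zero, D01.fderiv_single_one,
    D10.fderiv_single_zero, D11.fderiv_single_one]
  simp only [← hx, ← hy]
  constructor
  · field_simp
    ring
  · have hd : ∀ v, detFun G l r p q A x v = (A * G.eval x - l.eval x ^ 2) * v ^ 2 +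
        (G.eval x * p.eval x - 2 * l.eval x * r.eval x) * v +
        (G.eval x * q.eval x - r.eval x ^ 2) := fun v => by unfold detFun; ring
    have h0 := hdet x hxI 0
    have h1 := hdet x hxI 1
    have hy' := hdet x hxI y
    rw [hd] at h0 h1 hy'
    -- The linear coefficient of the determinant in y, from its values at y = 0 and y = 1.
    have hB : G.eval x * p.eval x - 2 * l.eval x * r.eval x =
        -2 * (A * G.eval x - l.eval x ^ 2) * t x := by linear_combination h1 - h0
    -- The logarithmic derivative of the transverse Jacobi weight has simple poles at u = ±1, which
    -- the factor (y - t)² - s² of the determinant cancels.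
    have hω' : ω * (s x)⁻¹ * ((y - t x) ^ 2 - s x ^ 2) = s x * ((q' - p') + (p' + q' - 2) * u) := by
      rw [show y - t x = s x * u by rw [hyu]; ring]
      simp only [hω]
      have e1 : u - -1 = 1 + u := by ring
      rw [e1] at h1u ⊢
      field_simp
      ring
    have hyu' : s x * u = y - t x := by rw [hyu]; ring
    have hdet' := hdet x hxI y
    unfold detFun at hdet'
    have key : G.eval x * (2 * A * y + p.eval x) - 2 * l.eval x * (l.eval x * y + r.eval x) =
        2 * (A * G.eval x - l.eval x ^ 2) * (y - t x) := by linear_combination hB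
    have e2 : G.eval x * ((β.eval x - G.derivative.eval x - l.eval x) / G.eval x -
        ω * (l.eval x * y + r.eval x) / G.eval x * (s x)⁻¹) =
        β.eval x - G.derivative.eval x - l.eval x - ω * (l.eval x * y + r.eval x) * (s x)⁻¹ := by
      field_simp
    have e3 : s x * ((q' - p') + (p' + q' - 2) * u) =
        (q' - p') * s x + (p' + q' - 2) * (y - t x) := by rw [← hyu']; ring
    rw [e3] at hω'
    linear_combination (l.eval x * y + r.eval x) * ρ z * e2 + ρ z * key +
      ρ z * ω * (s x)⁻¹ * hdet' + ρ z * (A * G.eval x - l.eval x ^ 2) * hω'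

/-! ### Solutions on strips with explicit densities -/

/-- A solution on a strip: in the coordinates `(x, u)`, `y = s(x) u + t(x)` with
`s = lam (xr - x)^{e₁} (x - xl)^{e₂}`, the measure is a product of two Jacobi measures. -/
structure StripSolution (Ω : Set (Fin 2 → ℝ)) (g : (Fin 2 → ℝ) → Matrix (Fin 2) (Fin 2) ℝ)
    (b : (Fin 2 → ℝ) → Fin 2 → ℝ) (ρ : (Fin 2 → ℝ) → ℝ) (G l r p q β d : Polynomial ℝ)
    (a c xl xr κ e₁ e₂ M N lam p' q' C : ℝ) (t : ℝ → ℝ) : Prop where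
  lt : xl < xr
  κ_pos : 0 < κ
  lam_pos : 0 < lam
  p_pos : 0 < p'
  q_pos : 0 < q'
  C_pos : 0 < C
  M_gt : -1 < M
  N_gt : -1 < N
  G_eq : ∀ x, G.eval x = κ * ((xr - x) * (x - xl))
  l_eq : ∀ x, l.eval x = κ * (e₂ * (xr - x) - e₁ * (x - xl))
  β_eq : ∀ x, β.eval x = κ * ((N + 1) * (xr - x) - (M + 1) * (x - xl))
  measurable_t : Measurable t
  hasDerivAt_t : ∀ x ∈ Ioo xl xr, HasDerivAt t ((l.eval x * t x + r.eval x) / G.eval x) x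
  eq_strip : Ω = strip xl xr (fun x => lam * jac xl xr e₁ e₂ x) t
  g00 : ∀ z ∈ Ω, g z 0 0 = G.eval (z 0)
  g01 : ∀ z ∈ Ω, g z 0 1 = l.eval (z 0) * z 1 + r.eval (z 0)
  g10 : ∀ z ∈ Ω, g z 1 0 = l.eval (z 0) * z 1 + r.eval (z 0)
  g11 : ∀ z ∈ Ω, g z 1 1 = a * z 1 ^ 2 + p.eval (z 0) * z 1 + q.eval (z 0)
  b0 : ∀ z ∈ Ω, b z 0 = β.eval (z 0)
  b1 : ∀ z ∈ Ω, b z 1 = c * z 1 + d.eval (z 0)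
  leadingCoeff_neg : ∀ x ∈ Ioo xl xr, a * G.eval x - l.eval x ^ 2 < 0
  det_eq : ∀ x ∈ Ioo xl xr, ∀ y, detFun G l r p q a x y =
    (a * G.eval x - l.eval x ^ 2) * ((y - t x) ^ 2 - (lam * jac xl xr e₁ e₂ x) ^ 2)
  fibre_eq : ∀ x ∈ Ioo xl xr, ∀ y, fibreFun G l r β d c x y = -(a * G.eval x - l.eval x ^ 2) *
    ((p' - q') * (lam * jac xl xr e₁ e₂ x) - (p' + q') * (y - t x))
  density_eq : ∀ z ∈ Ω, ρ z = C * (jac xl xr M N (z 0) *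
    jac (-1) 1 (q' - 1) (p' - 1) ((z 1 - t (z 0)) / (lam * jac xl xr e₁ e₂ (z 0))) /
      (lam * jac xl xr e₁ e₂ (z 0)))

theorem PlaneSolution.exists_stripSolution {Ω : Set (Fin 2 → ℝ)}
    {g : (Fin 2 → ℝ) → Matrix (Fin 2) (Fin 2) ℝ}
    {b : (Fin 2 → ℝ) → Fin 2 → ℝ} {ρ : (Fin 2 → ℝ) → ℝ} {G l r p q β d : Polynomial ℝ} {a c : ℝ}
    (S : PlaneSolution Ω g b ρ G l r p q β d a c) :
    ∃ (xl xr κ e₁ e₂ M N lam p' q' C : ℝ) (t : ℝ → ℝ),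
      StripSolution Ω g b ρ G l r p q β d a c xl xr κ e₁ e₂ M N lam p' q' C t := by
  obtain ⟨xl, xr, κ, e₁, e₂, M, N, lam, p', q', t, C, hlr, hκ, hlam, hp, hq, hC0, hCt, hG, hl, hβ,
    hproj, htm, ht, hwI, hmap, hA, hdet, hΩ, hfib⟩ := S.exists_pearson_law
  have hC : 0 < C.toReal := ENNReal.toReal_pos hC0 hCt
  have hMN := (integrableOn_jac_iff hlr).1 hwI
  have hW : (C • (volume.restrict (Ioo (-1 : ℝ) 1)).withDensity
        fun u => ENNReal.ofReal (jac (-1) 1 (q' - 1) (p' - 1) u)) =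
      (volume.restrict (Ioo (-1 : ℝ) 1)).withDensity
        fun u => ENNReal.ofReal (C.toReal * jac (-1) 1 (q' - 1) (p' - 1) u) := by
    rw [← withDensity_smul _ measurable_jac.ennreal_ofReal]
    congr 1
    ext u
    rw [ENNReal.ofReal_mul hC.le, ENNReal.ofReal_toReal hCt]
    rfl
  rw [hW] at hmap
  have hsub : Ω ⊆ strip xl xr (fun x => lam * jac xl xr e₁ e₂ x) t := fun z hz =>
    ⟨hproj ▸ mem_image_of_mem _ hz, hΩ z hz⟩
  obtain ⟨h1, h2⟩ := eq_strip_of_map_eq_prod S.isOpen S.interior_closure S.continuousOn_density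
    S.density_nonneg S.isProbabilityMeasure (measurable_const.mul measurable_jac) htm
    (continuousOn_const.mul continuousOn_jac)
    (fun x hx => (ht x hx).continuousAt.continuousWithinAt)
    (fun x hx => mul_pos hlam (jac_pos hx)) measurable_jac continuousOn_jac
    (fun x hx => jac_pos hx) (measurable_const.mul measurable_jac)
    (continuousOn_const.mul continuousOn_jac) (fun x hx => mul_pos hC (jac_pos hx)) hsub hmap
  exact ⟨xl, xr, κ, e₁, e₂, M, N, lam, p', q', C.toReal, t,
    { lt := hlr, κ_pos := hκ, lam_pos := hlam, p_pos := hp, q_pos := hq, C_pos := hC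
      M_gt := hMN.1, N_gt := hMN.2, G_eq := hG, l_eq := hl, β_eq := hβ, measurable_t := htm
      hasDerivAt_t := ht, eq_strip := h1, g00 := S.g00, g01 := S.g01, g10 := S.g10, g11 := S.g11
      b0 := S.b0, b1 := S.b1, leadingCoeff_neg := hA, det_eq := hdet, fibre_eq := hfib
      density_eq := fun z hz => (h2 z hz).trans (by simp only [Pi.mul_apply]; ring) }⟩

theorem derivative_eval_of_eq {G : Polynomial ℝ} {κ xl xr : ℝ}
    (hG : ∀ x, G.eval x = κ * ((xr - x) * (x - xl))) (x : ℝ) :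
    G.derivative.eval x = κ * (xr + xl - 2 * x) := by
  have h1 : HasDerivAt (fun x => G.eval x) (κ * (xr + xl - 2 * x)) x := by
    have h2 : HasDerivAt (fun x => κ * ((xr - x) * (x - xl)))
        (κ * (-1 * (x - xl) + (xr - x) * 1)) x :=
      ((((hasDerivAt_id x).const_sub xr)).mul ((hasDerivAt_id x).sub_const xl)).const_mul κ
    rw [← funext hG] at h2
    exact h2.congr_deriv (by ring)
  exact (G.hasDerivAt x).unique h1

namespace StripSolution

variable {Ω : Set (Fin 2 → ℝ)} {g : (Fin 2 → ℝ) → Matrix (Fin 2) (Fin 2) ℝ}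
    {b : (Fin 2 → ℝ) → Fin 2 → ℝ} {ρ : (Fin 2 → ℝ) → ℝ} {G l r p q β d : Polynomial ℝ}
    {a c xl xr κ e₁ e₂ M N lam p' q' C : ℝ} {t : ℝ → ℝ}

theorem G_pos (S : StripSolution Ω g b ρ G l r p q β d a c xl xr κ e₁ e₂ M N lam p' q' C t)
    {x : ℝ} (hx : x ∈ Ioo xl xr) : 0 < G.eval x := by
  rw [S.G_eq]
  exact mul_pos S.κ_pos (mul_pos (sub_pos.2 hx.2) (sub_pos.2 hx.1))

theorem hasDerivAt_s (S : StripSolution Ω g b ρ G l r p q β d a c xl xr κ e₁ e₂ M N lam p' q' C t)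
    {x : ℝ} (hx : x ∈ Ioo xl xr) : HasDerivAt (fun x => lam * jac xl xr e₁ e₂ x)
      (l.eval x / G.eval x * (lam * jac xl xr e₁ e₂ x)) x := by
  refine ((hasDerivAt_jac hx).const_mul lam).congr_deriv ?_
  rw [S.l_eq x, S.G_eq]
  have h1 := (sub_pos.2 hx.1).ne'
  have h2 := (sub_pos.2 hx.2).ne'
  have h3 := S.κ_pos.ne'
  field_simp
  ring

theorem hasDerivAt_w (S : StripSolution Ω g b ρ G l r p q β d a c xl xr κ e₁ e₂ M N lam p' q' C t)
    {x : ℝ} (hx : x ∈ Ioo xl xr) : HasDerivAt (jac xl xr M N)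
      ((β.eval x - G.derivative.eval x) / G.eval x * jac xl xr M N x) x := by
  refine (hasDerivAt_jac hx).congr_deriv ?_
  rw [S.β_eq x, S.G_eq, derivative_eval_of_eq S.G_eq]
  have h1 := (sub_pos.2 hx.1).ne'
  have h2 := (sub_pos.2 hx.2).ne'
  have h3 := S.κ_pos.ne'
  field_simp
  ring

/-- With the explicit density ρ is differentiable on Ω. The first component of the divergence is
then the equation (G w)' = β w, and the second, multiplied by G, is the fibre equation. -/
theorem hasDivergenceForm
    (S : StripSolution Ω g b ρ G l r p q β d a c xl xr κ e₁ e₂ M N lam p' q' C t) :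
    HasDivergenceForm Ω g b ρ := by
  intro z hz
  have hΩ := S.eq_strip
  have hz' := hz
  rw [hΩ] at hz'
  obtain ⟨h1, h2⟩ := sum_fderiv_strip (fun x hx => S.G_pos hx)
    (fun x hx => mul_pos S.lam_pos (jac_pos hx)) (fun x hx => S.hasDerivAt_s hx) S.hasDerivAt_t
    (fun x hx => S.hasDerivAt_w hx) (hΩ ▸ S.g00) (hΩ ▸ S.g01) (hΩ ▸ S.g10) (hΩ ▸ S.g11)
    (hΩ ▸ S.density_eq) S.det_eq hz'
  intro i
  fin_cases i
  · exact (S.b0 z hz ▸ h1).symm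
  · have hG := (S.G_pos hz'.1).ne'
    refine mul_left_cancel₀ hG (Eq.trans ?_ h2.symm)
    have h3 := S.fibre_eq _ hz'.1 (z 1)
    unfold fibreFun at h3
    simp only [Fin.mk_one, S.b1 z hz]
    linear_combination ρ z * h3

end StripSolution

/-! ### Rationality of the centre and of the width of the strip -/

theorem polynomial_eq_of_eqOn_Ioo {a b : ℝ} (hab : a < b) {P Q : Polynomial ℝ}
    (h : ∀ x ∈ Ioo a b, P.eval x = Q.eval x) : P = Q :=
  Polynomial.eq_of_infinite_eval_eq P Q ((Ioo_infinite hab).mono h)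

/-- A rational solution `R / A` of `G t' = k t + r` is a polynomial when `G` has simple roots and
`k` vanishes at the common roots of `A` and `G`. -/
theorem exists_polynomial_eq_of_ode {a b : ℝ} (hab : a < b) {G k r A R : Polynomial ℝ} {t : ℝ → ℝ}
    (hGs : IsCoprime G G.derivative) (hG : ∀ x ∈ Ioo a b, G.eval x ≠ 0)
    (hA : ∀ x ∈ Ioo a b, A.eval x ≠ 0) (hR : ∀ x ∈ Ioo a b, A.eval x * t x = R.eval x)
    (ht : ∀ x ∈ Ioo a b, HasDerivAt t ((k.eval x * t x + r.eval x) / G.eval x) x)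
    (hk : ∀ f, Irreducible f → f ∣ A → f ∣ G → f ∣ k) :
    ∃ T : Polynomial ℝ, ∀ x ∈ Ioo a b, t x = T.eval x := by
  obtain ⟨x₀, hx₀⟩ := exists_between hab
  have hA0 : A ≠ 0 := fun h => hA x₀ hx₀ (by rw [h, Polynomial.eval_zero])
  obtain ⟨h, A₁, R₁, hcop, eA, eR⟩ : ∃ h A₁ R₁ : Polynomial ℝ, IsCoprime A₁ R₁ ∧ A = h * A₁ ∧
      R = h * R₁ := by
    classical
    let _ : GCDMonoid (Polynomial ℝ) := EuclideanDomain.gcdMonoid _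
    exact ⟨GCDMonoid.gcd R A, A / GCDMonoid.gcd R A, R / GCDMonoid.gcd R A,
      (isCoprime_div_gcd_div_gcd hA0).symm,
      (EuclideanDomain.mul_div_cancel' (gcd_ne_zero_of_right hA0) (gcd_dvd_right _ _)).symm,
      (EuclideanDomain.mul_div_cancel' (gcd_ne_zero_of_right hA0) (gcd_dvd_left _ _)).symm⟩
  have hA₁ : ∀ x ∈ Ioo a b, A₁.eval x * t x = R₁.eval x := fun x hx => by
    have h1 := hR x hx
    have h2 := hA x hx
    rw [eA, Polynomial.eval_mul] at h1 h2
    rw [eR, Polynomial.eval_mul] at h1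
    exact mul_left_cancel₀ (left_ne_zero_of_mul h2) (by linear_combination h1)
  have hA₁0 : A₁ ≠ 0 := fun h => hA0 (by rw [eA, h, mul_zero])
  have hid : G * (A₁ * R₁.derivative - A₁.derivative * R₁) = A₁ * k * R₁ + A₁ ^ 2 * r := by
    refine polynomial_eq_of_eqOn_Ioo hab fun x hx => ?_
    have h1 : HasDerivAt (fun x => A₁.eval x * t x) (R₁.derivative.eval x) x :=
      (R₁.hasDerivAt x).congr_of_eventuallyEq
        (Filter.eventuallyEq_of_mem (isOpen_Ioo.mem_nhds hx) hA₁)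
    have h2 := ((A₁.hasDerivAt x).mul (ht x hx)).unique h1
    have h3 := hA₁ x hx
    have h4 := hG x hx
    simp only [Polynomial.eval_mul, Polynomial.eval_sub, Polynomial.eval_add, Polynomial.eval_pow]
    have h5 : G.eval x * R₁.derivative.eval x = G.eval x * A₁.derivative.eval x * t x +
        A₁.eval x * (k.eval x * t x + r.eval x) := by
      rw [← h2]; field_simp
    rw [← h3]
    linear_combination A₁.eval x * h5
  by_cases hu : IsUnit A₁
  · obtain ⟨c, hc, hcA⟩ := Polynomial.isUnit_iff.1 hu
    refine ⟨Polynomial.C c⁻¹ * R₁, fun x hx => ?_⟩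
    have h1 := hA₁ x hx
    rw [← hcA, Polynomial.eval_C] at h1
    rw [Polynomial.eval_mul, Polynomial.eval_C, ← h1, inv_mul_cancel_left₀ hc.ne_zero]
  -- Compare orders at an irreducible factor `f` of the reduced denominator, of exact multiplicity j
  -- + 1. A first comparison gives f ∣ G, hence f ∣ k by assumption; after cancelling one factor f,
  -- a second comparison gives f² ∣ G, which contradicts the coprimality of G and G'.
  exfalso
  obtain ⟨f, hf, hfA⟩ := WfDvdMonoid.exists_irreducible_factor hu hA₁0
  have hfp : Prime f := hf.prime
  have hfR : ¬ f ∣ R₁ := fun h => hf.not_isUnit (hcop.isUnit_of_dvd' hfA h)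
  have hfd : ¬ f ∣ f.derivative := fun h => hf.not_isUnit (hf.separable.isUnit_of_dvd' dvd_rfl h)
  obtain ⟨n, A₂, hA₂, eA₁⟩ := WfDvdMonoid.max_power_factor hA₁0 hf
  obtain ⟨j, rfl⟩ : ∃ j, n = j + 1 := by
    refine Nat.exists_eq_succ_of_ne_zero fun h => hA₂ ?_
    rw [h, pow_zero, one_mul] at eA₁
    rwa [← eA₁]
  have hfj : ¬ f ∣ (Polynomial.C ((j : ℝ) + 1)) := fun h =>
    hf.not_isUnit (isUnit_of_dvd_unit h (Polynomial.isUnit_C.2 (by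
      rw [isUnit_iff_ne_zero]; positivity)))
  have hprod : ¬ f ∣ Polynomial.C ((j : ℝ) + 1) * f.derivative * A₂ * R₁ := fun h =>
    (hfp.dvd_or_dvd h).elim (fun h => (hfp.dvd_or_dvd h).elim
      (fun h => (hfp.dvd_or_dvd h).elim hfj hfd) hA₂) hfR
  have hd : A₁.derivative = f ^ j * (Polynomial.C ((j : ℝ) + 1) * f.derivative * A₂ +
      f * A₂.derivative) := by
    rw [eA₁, Polynomial.derivative_mul, Polynomial.derivative_pow_succ]
    ring
  have hid1 : G * (f * A₂ * R₁.derivative - (Polynomial.C ((j : ℝ) + 1) * f.derivative * A₂ +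
      f * A₂.derivative) * R₁) = f * A₂ * k * R₁ + f ^ (j + 2) * A₂ ^ 2 * r := by
    refine mul_left_cancel₀ (pow_ne_zero j hf.ne_zero) ?_
    rw [hd] at hid
    rw [eA₁] at hid
    linear_combination hid
  have hfG : f ∣ G := by
    refine (hfp.dvd_or_dvd (b := Polynomial.C ((j : ℝ) + 1) * f.derivative * A₂ * R₁)
      ⟨G * (A₂ * R₁.derivative - A₂.derivative * R₁) - A₂ * k * R₁ - f ^ (j + 1) * A₂ ^ 2 * r,
        ?_⟩).resolve_right hprod
    linear_combination -hid1
  obtain ⟨k₁, rfl⟩ := hk f hf (eA ▸ dvd_mul_of_dvd_right hfA h) hfG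
  obtain ⟨G₁, rfl⟩ := hfG
  have hid2 : G₁ * (f * A₂ * R₁.derivative - (Polynomial.C ((j : ℝ) + 1) * f.derivative * A₂ +
      f * A₂.derivative) * R₁) = f * A₂ * k₁ * R₁ + f ^ (j + 1) * A₂ ^ 2 * r := by
    refine mul_left_cancel₀ hf.ne_zero ?_
    linear_combination hid1
  have hfG₁ : f ∣ G₁ := by
    refine (hfp.dvd_or_dvd (b := Polynomial.C ((j : ℝ) + 1) * f.derivative * A₂ * R₁)
      ⟨G₁ * (A₂ * R₁.derivative - A₂.derivative * R₁) - A₂ * k₁ * R₁ - f ^ j * A₂ ^ 2 * r,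
        ?_⟩).resolve_right hprod
    linear_combination -hid2
  refine hf.not_isUnit (hGs.isUnit_of_dvd' (dvd_mul_right f G₁) ?_)
  rw [Polynomial.derivative_mul]
  exact dvd_add (dvd_mul_of_dvd_right hfG₁ _) (dvd_mul_right _ _)

/-- The residue of S' / S = k / G at a is the multiplicity of the root a of S. -/
theorem eval_eq_rootMultiplicity_mul {S G H k : Polynomial ℝ} {a : ℝ} (hS : S ≠ 0)
    (hG : G = (Polynomial.X - Polynomial.C a) * H) (h : G * S.derivative = k * S) :
    k.eval a = S.rootMultiplicity a * H.eval a := by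
  obtain ⟨U, hU, hUd⟩ := Polynomial.exists_eq_pow_rootMultiplicity_mul_and_not_dvd S hS a
  set n := S.rootMultiplicity a with hn
  set L : Polynomial ℝ := Polynomial.X - Polynomial.C a with hL
  have hL0 : L ≠ 0 := Polynomial.X_sub_C_ne_zero a
  have hUa : U.eval a ≠ 0 := fun h0 => hUd (Polynomial.dvd_iff_isRoot.2 h0)
  have hd : L * S.derivative = L ^ n * (Polynomial.C (n : ℝ) * U + L * U.derivative) := by
    rw [hU, Polynomial.derivative_mul, hL, Polynomial.derivative_X_sub_C_pow, ← hL]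
    rcases n with _ | j
    · simp
    · simp only [Nat.add_sub_cancel]; push_cast; ring
  have h1 : H * (Polynomial.C (n : ℝ) * U + L * U.derivative) = k * U := by
    refine mul_left_cancel₀ (pow_ne_zero n hL0) ?_
    rw [hG] at h
    nth_rw 2 [hU] at h
    linear_combination h - H * hd
  have h2 := congrArg (Polynomial.eval a) h1
  simp only [hL, Polynomial.eval_mul, Polynomial.eval_add, Polynomial.eval_C, Polynomial.eval_sub,
    Polynomial.eval_X, sub_self, zero_mul, add_zero] at h2
  exact mul_right_cancel₀ hUa (by linear_combination -h2)

theorem even_rootMultiplicity_of_sq_eq {A S Z : Polynomial ℝ} (hA : A ≠ 0) (hS : S ≠ 0)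
    (h : Z ^ 2 = A ^ 2 * S) (a : ℝ) : Even (S.rootMultiplicity a) := by
  have hAS : A ^ 2 * S ≠ 0 := mul_ne_zero (pow_ne_zero 2 hA) hS
  have h1 := congrArg (Polynomial.rootMultiplicity a) h
  rw [Polynomial.rootMultiplicity_mul hAS, pow_two, pow_two, Polynomial.rootMultiplicity_mul,
    Polynomial.rootMultiplicity_mul (mul_ne_zero hA hA)] at h1
  · refine ⟨Z.rootMultiplicity a - A.rootMultiplicity a, by omega⟩
  · rw [← pow_two, h]; exact hAS

/-- The Bézout relation is (G')² + 4 κ G = κ² (xr - xl)². -/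
theorem isCoprime_derivative_of_eq {G : Polynomial ℝ} {κ xl xr : ℝ} (hκ : κ ≠ 0) (hlr : xl ≠ xr)
    (hG : ∀ x, G.eval x = κ * ((xr - x) * (x - xl))) : IsCoprime G G.derivative := by
  have hne : κ ^ 2 * (xr - xl) ^ 2 ≠ 0 :=
    mul_ne_zero (pow_ne_zero 2 hκ) (pow_ne_zero 2 (sub_ne_zero.2 hlr.symm))
  refine ⟨Polynomial.C (4 * κ / (κ ^ 2 * (xr - xl) ^ 2)),
    Polynomial.C (1 / (κ ^ 2 * (xr - xl) ^ 2)) * G.derivative, Polynomial.funext fun x => ?_⟩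
  simp only [Polynomial.eval_add, Polynomial.eval_mul, Polynomial.eval_C, Polynomial.eval_one,
    derivative_eval_of_eq hG, hG]
  field_simp
  ring

/-! ### The common form of the models -/

/-- Half the logarithmic derivative of `(b - x)^m (x - a)^n`, multiplied by `(b - x) (x - a)`. -/
noncomputable def halfSlope (a b : ℝ) (m n : ℕ) (x : ℝ) : ℝ := (n * (b - x) - m * (x - a)) / 2

/-- The common form of the models: after the change of variables `Φ`, the domain is
`y² < lam² (b - x)^m (x - a)^n`, `a < x < b`. -/
structure IsGeneral (Φ : AdmissibleChange) (Ω : Set (Fin 2 → ℝ))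
    (g : (Fin 2 → ℝ) → Matrix (Fin 2) (Fin 2) ℝ) (ρ : (Fin 2 → ℝ) → ℝ) (κ a b lam : ℝ) (m n : ℕ)
    (c P Q p q C : ℝ) : Prop where
  lt : a < b
  κ_pos : 0 < κ
  lam_pos : 0 < lam
  p_pos : 0 < p
  q_pos : 0 < q
  C_pos : 0 < C
  -- Integration over a vertical fibre contributes the half-width to the power p + q - 1; these are
  -- the resulting integrability conditions at b and at a.
  P_gt : -1 < P + m / 2 * (p + q - 1)
  Q_gt : -1 < Q + n / 2 * (p + q - 1)
  -- A free power of b - x is allowed only if the boundary contains a vertical segment at x = b,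
  -- that is, if m = 0; similarly at a.
  P_eq : m ≠ 0 → P = 0
  Q_eq : n ≠ 0 → Q = 0
  parity : p = q ∨ Even m ∧ Even n
  c_lt : ∀ x ∈ Ioo a b, c * ((b - x) * (x - a)) < halfSlope a b m n x ^ 2
  image_eq : Φ.toEquiv '' Ω = strip a b (fun x => lam * jac a b (m / 2) (n / 2) x) fun _ => 0
  cometric_eq : ∀ z ∈ strip a b (fun x => lam * jac a b (m / 2) (n / 2) x) fun _ => 0,
    Φ.pushCometric g z = κ • !![(b - z 0) * (z 0 - a), halfSlope a b m n (z 0) * z 1;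
      halfSlope a b m n (z 0) * z 1,
      (lam * jac a b (m / 2) (n / 2) (z 0)) ^ 2 * halfSlope a b m n (z 0) ^ 2 /
        ((b - z 0) * (z 0 - a)) - c * ((lam * jac a b (m / 2) (n / 2) (z 0)) ^ 2 - z 1 ^ 2)]
  density_eq : ∀ z ∈ strip a b (fun x => lam * jac a b (m / 2) (n / 2) x) fun _ => 0,
    Φ.pushDensity ρ z = C * (jac a b P Q (z 0) *
      ((lam * jac a b (m / 2) (n / 2) (z 0) + z 1) ^ (p - 1) *
        (lam * jac a b (m / 2) (n / 2) (z 0) - z 1) ^ (q - 1)))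

/-- The product density in the coordinates `(x, u)`, in terms of `(x, y)`. -/
theorem jac_mul_jac_div {a b lam e₁ e₂ M N p q x y : ℝ} (hlam : 0 < lam) (hx : x ∈ Ioo a b)
    (hy : |y| < lam * jac a b e₁ e₂ x) :
    jac a b M N x * jac (-1) 1 (q - 1) (p - 1) (y / (lam * jac a b e₁ e₂ x)) /
        (lam * jac a b e₁ e₂ x) =
      lam ^ (-(p + q - 1)) * (jac a b (M - e₁ * (p + q - 1)) (N - e₂ * (p + q - 1)) x *
        ((lam * jac a b e₁ e₂ x + y) ^ (p - 1) * (lam * jac a b e₁ e₂ x - y) ^ (q - 1))) := by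
  have hj := jac_pos (P := e₁) (Q := e₂) hx
  set s := lam * jac a b e₁ e₂ x with hs
  have hs0 : 0 < s := mul_pos hlam hj
  have h1 := abs_lt.1 hy
  have e1 : 1 - y / s = (s - y) / s := by field_simp
  have e2 : y / s - -1 = (s + y) / s := by field_simp; ring
  have e3 : jac a b (M - e₁ * (p + q - 1)) (N - e₂ * (p + q - 1)) x =
      jac a b M N x * (s ^ (-(p + q - 1)) * lam ^ (p + q - 1)) := by
    rw [hs, Real.mul_rpow hlam.le hj.le, jac_rpow hx, mul_right_comm, ← Real.rpow_add hlam,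
      neg_add_cancel, Real.rpow_zero, one_mul, jac_mul hx]
    congr 1 <;> ring
  have e4 : lam ^ (-(p + q - 1)) * lam ^ (p + q - 1) = 1 := by
    rw [← Real.rpow_add hlam, neg_add_cancel, Real.rpow_zero]
  have e5 : s ^ (-(p + q - 1)) * (s ^ (p - 1) * s ^ (q - 1)) * s = 1 := by
    rw [← Real.rpow_add hs0, ← Real.rpow_add hs0, ← Real.rpow_add_one hs0.ne',
      show -(p + q - 1) + (p - 1 + (q - 1)) + 1 = 0 by ring, Real.rpow_zero]
  rw [e3]
  unfold jac at *
  rw [e1, e2, Real.div_rpow (by linarith) hs0.le, Real.div_rpow (by linarith) hs0.le]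
  have h2 := (Real.rpow_pos_of_pos hs0 (p - 1)).ne'
  have h3 := (Real.rpow_pos_of_pos hs0 (q - 1)).ne'
  rw [div_mul_div_comm, mul_div_assoc', div_div, div_eq_iff (by positivity)]
  linear_combination (-((b - x) ^ M * (x - a) ^ N * ((s - y) ^ (q - 1) * (s + y) ^ (p - 1)))) *
    (e4 + lam ^ (-(p + q - 1)) * lam ^ (p + q - 1) * e5)

theorem matrix_two_eq_smul {κ a b c d a' b' c' d' : ℝ} (ha : a = κ * a') (hb : b = κ * b')
    (hc : c = κ * c') (hd : d = κ * d') : !![a, b; c, d] = κ • !![a', b'; c', d'] := by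
  subst ha hb hc hd
  ext i j
  fin_cases i <;> fin_cases j <;> rfl

theorem _root_.AdmissibleChange.symm_zero (Φ : AdmissibleChange) (z : Fin 2 → ℝ) :
    Φ.toEquiv.symm z 0 = (z 0 - Φ.β) / Φ.α := rfl

theorem _root_.AdmissibleChange.symm_one (Φ : AdmissibleChange) (z : Fin 2 → ℝ) :
    Φ.toEquiv.symm z 1 = (z 1 - Φ.p.eval ((z 0 - Φ.β) / Φ.α)) / Φ.γ := rfl

theorem _root_.AdmissibleChange.pushCometric_eq (Φ : AdmissibleChange)
    (g : (Fin 2 → ℝ) → Matrix (Fin 2) (Fin 2) ℝ) {z u : Fin 2 → ℝ} (hu : Φ.toEquiv.symm z = u) :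
    Φ.pushCometric g z =
      !![Φ.α ^ 2 * g u 0 0, Φ.α * (Φ.p.derivative.eval (u 0) * g u 0 0 + Φ.γ * g u 0 1);
        Φ.α * (Φ.p.derivative.eval (u 0) * g u 0 0 + Φ.γ * g u 1 0),
        Φ.p.derivative.eval (u 0) ^ 2 * g u 0 0 +
          Φ.p.derivative.eval (u 0) * Φ.γ * (g u 0 1 + g u 1 0) + Φ.γ ^ 2 * g u 1 1] := by
  simp only [AdmissibleChange.pushCometric, hu, AdmissibleChange.jacobian]
  ext i j
  fin_cases i <;> fin_cases j <;>
    simp [Matrix.mul_apply, Fin.sum_univ_two, Matrix.transpose_apply, Matrix.vecMul,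
      dotProduct] <;> try ring

/-- The shear `(x, y) ↦ (x, y - T(x))`. -/
noncomputable def shear (T : Polynomial ℝ) : AdmissibleChange where
  α := 1
  β := 0
  γ := 1
  p := -T
  α_ne_zero := one_ne_zero
  γ_ne_zero := one_ne_zero

namespace StripSolution

variable {Ω : Set (Fin 2 → ℝ)} {g : (Fin 2 → ℝ) → Matrix (Fin 2) (Fin 2) ℝ}
    {b : (Fin 2 → ℝ) → Fin 2 → ℝ} {ρ : (Fin 2 → ℝ) → ℝ} {G l r p q β d : Polynomial ℝ}
    {a c xl xr κ e₁ e₂ M N lam p' q' C : ℝ} {t : ℝ → ℝ}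

/-- The determinant has centre t, so its linear coefficient exhibits t as a quotient with
denominator a G - l². An irreducible common factor of this denominator and of G divides l², hence l,
as `exists_polynomial_eq_of_ode` requires. -/
theorem exists_polynomial_center
    (S : StripSolution Ω g b ρ G l r p q β d a c xl xr κ e₁ e₂ M N lam p' q' C t) :
    ∃ T : Polynomial ℝ, ∀ x ∈ Ioo xl xr, t x = T.eval x := by
  refine exists_polynomial_eq_of_ode S.lt (isCoprime_derivative_of_eq S.κ_pos.ne' S.lt.ne S.G_eq)
    (fun x hx => (S.G_pos hx).ne') (A := Polynomial.C a * G - l ^ 2)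
    (R := Polynomial.C (-1 / 2) * (G * p - Polynomial.C 2 * l * r))
    (fun x hx => by simpa using (S.leadingCoeff_neg x hx).ne) (fun x hx => ?_) S.hasDerivAt_t
    fun f hf h1 h2 => ?_
  · have h0 := S.det_eq x hx 0
    have h1 := S.det_eq x hx 1
    unfold detFun at h0 h1
    simp
    linear_combination (1 / 2) * h1 - (1 / 2) * h0
  · refine hf.prime.dvd_of_dvd_pow (n := 2) ?_
    have := dvd_sub (h2.mul_left (Polynomial.C a)) h1
    rwa [sub_sub_cancel] at this

/-- Once t is polynomial, the constant term of the determinant makes s² rational with the same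
denominator, and G (s²)' = 2 l s² is again an equation of the type treated above. -/
theorem exists_polynomial_sq
    (S : StripSolution Ω g b ρ G l r p q β d a c xl xr κ e₁ e₂ M N lam p' q' C t) :
    ∃ Q : Polynomial ℝ, ∀ x ∈ Ioo xl xr, (lam * jac xl xr e₁ e₂ x) ^ 2 = Q.eval x := by
  obtain ⟨T, hT⟩ := S.exists_polynomial_center
  refine exists_polynomial_eq_of_ode S.lt (isCoprime_derivative_of_eq S.κ_pos.ne' S.lt.ne S.G_eq)
    (fun x hx => (S.G_pos hx).ne') (A := Polynomial.C a * G - l ^ 2)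
    (R := (Polynomial.C a * G - l ^ 2) * T ^ 2 - (G * q - r ^ 2))
    (k := Polynomial.C 2 * l) (r := 0)
    (fun x hx => by simpa using (S.leadingCoeff_neg x hx).ne) (fun x hx => ?_)
    (fun x hx => ?_) fun f hf h1 h2 => ?_
  · have h0 := S.det_eq x hx 0
    unfold detFun at h0
    rw [hT x hx] at h0
    simp
    linear_combination h0
  · refine ((S.hasDerivAt_s hx).pow 2).congr_deriv ?_
    simp
    ring
  · refine Dvd.dvd.mul_left (hf.prime.dvd_of_dvd_pow (n := 2) ?_) _
    have := dvd_sub (h2.mul_left (Polynomial.C a)) h1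
    rwa [sub_sub_cancel] at this

/-- The root multiplicities of the polynomial s² at the two ends are 2 e₁ and 2 e₂. If p' ≠ q', the
fibre equation at the centre y = t expresses (a G - l²) s as a polynomial; then s² is the square of
a rational function and its multiplicities are even. -/
theorem exists_exponents
    (S : StripSolution Ω g b ρ G l r p q β d a c xl xr κ e₁ e₂ M N lam p' q' C t) :
    ∃ m n : ℕ, e₁ = m / 2 ∧ e₂ = n / 2 ∧ (p' = q' ∨ Even m ∧ Even n) := by
  obtain ⟨T, hT⟩ := S.exists_polynomial_center
  obtain ⟨Q, hQ⟩ := S.exists_polynomial_sq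
  have hD : xr - xl ≠ 0 := sub_ne_zero.2 S.lt.ne'
  have hκ := S.κ_pos.ne'
  have hs0 : ∀ x ∈ Ioo xl xr, 0 < lam * jac xl xr e₁ e₂ x := fun x hx =>
    mul_pos S.lam_pos (jac_pos hx)
  obtain ⟨x₀, hx₀⟩ := exists_between S.lt
  have hQ0 : Q ≠ 0 := fun h => by
    have h1 := hQ x₀ hx₀
    rw [h, Polynomial.eval_zero] at h1
    exact (pow_pos (hs0 x₀ hx₀) 2).ne' h1
  have hode : G * Q.derivative = Polynomial.C 2 * l * Q := by
    refine polynomial_eq_of_eqOn_Ioo S.lt fun x hx => ?_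
    have h1 := ((S.hasDerivAt_s hx).pow 2).unique ((Q.hasDerivAt x).congr_of_eventuallyEq
      (Filter.eventuallyEq_of_mem (isOpen_Ioo.mem_nhds hx) hQ))
    have h2 := (S.G_pos hx).ne'
    simp only [Polynomial.eval_mul, Polynomial.eval_C]
    rw [← h1, ← hQ x hx]
    simp
    field_simp
  have h1 := eval_eq_rootMultiplicity_mul (a := xl) hQ0
    (H := Polynomial.C κ * (Polynomial.C xr - Polynomial.X)) (Polynomial.funext fun x => by
      rw [S.G_eq]; simp; ring) hode
  have h2 := eval_eq_rootMultiplicity_mul (a := xr) hQ0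
    (H := -Polynomial.C κ * (Polynomial.X - Polynomial.C xl)) (Polynomial.funext fun x => by
      rw [S.G_eq]; simp; ring) hode
  rw [Polynomial.eval_mul, Polynomial.eval_C, S.l_eq] at h1 h2
  simp at h1 h2
  refine ⟨Q.rootMultiplicity xr, Q.rootMultiplicity xl, ?_, ?_, ?_⟩
  · refine mul_left_cancel₀ (mul_ne_zero hκ hD) ?_
    linear_combination (1 / 2) * h2
  · refine mul_left_cancel₀ (mul_ne_zero hκ hD) ?_
    linear_combination (1 / 2) * h1
  by_cases hpq : p' = q'
  · exact Or.inl hpq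
  right
  have hpq' : p' - q' ≠ 0 := sub_ne_zero.2 hpq
  set A : Polynomial ℝ := Polynomial.C a * G - l ^ 2 with hA
  have hA0 : A ≠ 0 := fun h => by
    have h3 := S.leadingCoeff_neg x₀ hx₀
    have h4 := congrArg (Polynomial.eval x₀) h
    simp [hA] at h4
    exact h3.ne h4
  set F : Polynomial ℝ := (Polynomial.C c * T + d) * G - β * (l * T + r) +
    (l * T + r) * G.derivative - G * (l.derivative * T + r.derivative) - (l * T + r) * l with hF
  have hZ : ∀ x ∈ Ioo xl xr, (Polynomial.C (-1 / (p' - q')) * F).eval x =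
      A.eval x * (lam * jac xl xr e₁ e₂ x) := by
    intro x hx
    have h3 := S.fibre_eq x hx (T.eval x)
    rw [hT x hx] at h3
    unfold fibreFun at h3
    simp [hF, hA]
    rw [h3]
    field_simp
    ring
  have hsq : (Polynomial.C (-1 / (p' - q')) * F) ^ 2 = A ^ 2 * Q := by
    refine polynomial_eq_of_eqOn_Ioo S.lt fun x hx => ?_
    rw [Polynomial.eval_pow, hZ x hx, Polynomial.eval_mul, Polynomial.eval_pow, ← hQ x hx]
    ring
  exact ⟨even_rootMultiplicity_of_sq_eq hA0 hQ0 hsq _, even_rootMultiplicity_of_sq_eq hA0 hQ0 hsq _⟩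

/-- The exponents of the measure in `x` are determined by the transverse ones when the domain
has a vertex or a cusp at the corresponding end. -/
theorem exponents_eq
    (S : StripSolution Ω g b ρ G l r p q β d a c xl xr κ e₁ e₂ M N lam p' q' C t) :
    (e₁ ≠ 0 → M = e₁ * (p' + q' - 1)) ∧ (e₂ ≠ 0 → N = e₂ * (p' + q' - 1)) := by
  have hD : xr - xl ≠ 0 := sub_ne_zero.2 S.lt.ne'
  have hκ := S.κ_pos.ne'
  -- Coefficient of y in the fibre equation. It is a polynomial identity, so it may be evaluated at
  -- the ends, where only the terms without a factor G survive.
  have hid : Polynomial.C c * G - β * l + l * G.derivative - G * l.derivative - l ^ 2 =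
      Polynomial.C (p' + q') * (Polynomial.C a * G - l ^ 2) := by
    refine polynomial_eq_of_eqOn_Ioo S.lt fun x hx => ?_
    have h0 := S.fibre_eq x hx 0
    have h1 := S.fibre_eq x hx 1
    unfold fibreFun at h0 h1
    simp
    linear_combination h1 - h0
  have hx : ∀ x, c * G.eval x - β.eval x * l.eval x + l.eval x * G.derivative.eval x -
      G.eval x * l.derivative.eval x - l.eval x ^ 2 =
      (p' + q') * (a * G.eval x - l.eval x ^ 2) := fun x => by
    simpa using congrArg (Polynomial.eval x) hid
  constructor
  · intro he
    have h1 := hx xr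
    rw [derivative_eval_of_eq S.G_eq, S.G_eq, S.l_eq, S.β_eq] at h1
    refine mul_left_cancel₀ (mul_ne_zero (pow_ne_zero 2 (mul_ne_zero hκ hD)) he) ?_
    linear_combination -h1
  · intro he
    have h1 := hx xl
    rw [derivative_eval_of_eq S.G_eq, S.G_eq, S.l_eq, S.β_eq] at h1
    refine mul_left_cancel₀ (mul_ne_zero (pow_ne_zero 2 (mul_ne_zero hκ hD)) he) ?_
    linear_combination -h1

theorem exists_isGeneral
    (S : StripSolution Ω g b ρ G l r p q β d a c xl xr κ e₁ e₂ M N lam p' q' C t) :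
    ∃ (T : Polynomial ℝ) (m n : ℕ) (P Q C' : ℝ),
      IsGeneral (shear T) Ω g ρ κ xl xr lam m n (a / κ) P Q p' q' C' := by
  obtain ⟨T, hT⟩ := S.exists_polynomial_center
  obtain ⟨m, n, rfl, rfl, hpar⟩ := S.exists_exponents
  obtain ⟨hM, hN⟩ := S.exponents_eq
  have hκ := S.κ_pos.ne'
  have hl : ∀ x, l.eval x = κ * halfSlope xl xr m n x := fun x => by
    rw [S.l_eq]; unfold halfSlope; ring
  have hmem : ∀ z, z ∈ strip xl xr (fun x => lam * jac xl xr (m / 2) (n / 2) x) (fun _ => 0) →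
      (shear T).toEquiv.symm z ∈ Ω := by
    intro z hz
    rw [S.eq_strip]
    refine ⟨?_, ?_⟩
    · simpa [AdmissibleChange.toEquiv, shear] using hz.1
    · have h1 := hz.2
      have h2 := hT _ hz.1
      simp [AdmissibleChange.toEquiv, shear, h2] at h1 ⊢
      exact h1
  have himg : (shear T).toEquiv '' Ω =
      strip xl xr (fun x => lam * jac xl xr (m / 2) (n / 2) x) fun _ => 0 := by
    refine Subset.antisymm ?_ fun z hz => ⟨_, hmem z hz, by simp⟩
    rintro _ ⟨z, hz, rfl⟩
    rw [S.eq_strip] at hz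
    have h2 := hT _ hz.1
    refine ⟨?_, ?_⟩
    · simpa [AdmissibleChange.toEquiv, shear] using hz.1
    · have h1 := hz.2
      simp [AdmissibleChange.toEquiv, shear, h2, sub_eq_add_neg] at h1 ⊢
      exact h1
  refine ⟨T, m, n, M - m / 2 * (p' + q' - 1), N - n / 2 * (p' + q' - 1),
    C * lam ^ (-(p' + q' - 1)),
    { lt := S.lt, κ_pos := S.κ_pos, lam_pos := S.lam_pos, p_pos := S.p_pos, q_pos := S.q_pos
      C_pos := mul_pos S.C_pos (Real.rpow_pos_of_pos S.lam_pos _)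
      P_gt := by have := S.M_gt; linarith
      Q_gt := by have := S.N_gt; linarith
      P_eq := fun h => sub_eq_zero.2 (hM (by positivity))
      Q_eq := fun h => sub_eq_zero.2 (hN (by positivity))
      parity := hpar
      image_eq := himg
      c_lt := fun x hx => ?_
      cometric_eq := fun z hz => ?_
      density_eq := fun z hz => ?_ }⟩
  · have h1 := S.leadingCoeff_neg x hx
    rw [S.G_eq, hl] at h1
    have h2 : κ ^ 2 * (a / κ * ((xr - x) * (x - xl))) < κ ^ 2 * halfSlope xl xr m n x ^ 2 := by
      have : κ ^ 2 * (a / κ * ((xr - x) * (x - xl))) = a * (κ * ((xr - x) * (x - xl))) := by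
        field_simp
      rw [this]
      linarith
    exact lt_of_mul_lt_mul_left h2 (sq_nonneg κ)
  · have hzΩ := hmem z hz
    have hx : (shear T).toEquiv.symm z 0 = z 0 := by simp [AdmissibleChange.toEquiv, shear]
    have hy : (shear T).toEquiv.symm z 1 = z 1 + T.eval (z 0) := by
      simp [AdmissibleChange.toEquiv, shear]
    have hxr := (sub_pos.2 hz.1.2).ne'
    have hxl := (sub_pos.2 hz.1.1).ne'
    -- The equation of the centre, G T' = l T + r, says that the shear removes the part of the mixed
    -- coefficient that is independent of y.
    have hode : G.eval (z 0) * T.derivative.eval (z 0) =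
        l.eval (z 0) * T.eval (z 0) + r.eval (z 0) := by
      have h1 := ((T.hasDerivAt (z 0)).congr_of_eventuallyEq
        (Filter.eventuallyEq_of_mem (isOpen_Ioo.mem_nhds hz.1) hT)).unique (S.hasDerivAt_t _ hz.1)
      rw [h1, ← hT _ hz.1]
      have := (S.G_pos hz.1).ne'
      field_simp
    have hdet := S.det_eq _ hz.1 (z 1 + T.eval (z 0))
    unfold detFun at hdet
    rw [hT _ hz.1] at hdet
    rw [hl] at hdet hode
    rw [S.G_eq] at hdet hode
    have g00 := S.g00 _ hzΩ
    have g01 := S.g01 _ hzΩ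
    have g10 := S.g10 _ hzΩ
    have g11 := S.g11 _ hzΩ
    rw [hx, S.G_eq] at g00
    rw [hx, hy, hl] at g01 g10
    rw [hx, hy] at g11
    rw [(shear T).pushCometric_eq g rfl]
    have hp : (shear T).p.derivative.eval ((shear T).toEquiv.symm z 0) =
        -T.derivative.eval (z 0) := by rw [hx]; simp [shear]
    rw [hp, g00, g01, g10, g11]
    simp only [shear]
    refine matrix_two_eq_smul (by ring) (by linear_combination -hode)
      (by linear_combination -hode) ?_
    generalize lam * jac xl xr (m / 2) (n / 2) (z 0) = s at hdet ⊢
    generalize halfSlope xl xr m n (z 0) = h at hdet hode ⊢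
    refine mul_left_cancel₀ (mul_ne_zero hκ (mul_ne_zero hxr hxl)) ?_
    have e : κ * ((xr - z 0) * (z 0 - xl)) * (κ * (s ^ 2 * h ^ 2 / ((xr - z 0) * (z 0 - xl)) -
        a / κ * (s ^ 2 - z 1 ^ 2))) =
        κ ^ 2 * s ^ 2 * h ^ 2 - a * (κ * ((xr - z 0) * (z 0 - xl))) * (s ^ 2 - z 1 ^ 2) := by
      field_simp
    rw [e]
    linear_combination hdet + (κ * ((xr - z 0) * (z 0 - xl)) * T.derivative.eval (z 0) -
      κ * h * T.eval (z 0) - r.eval (z 0) - 2 * κ * h * z 1) * hode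
  · have hzΩ := hmem z hz
    have hx : (shear T).toEquiv.symm z 0 = z 0 := by simp [AdmissibleChange.toEquiv, shear]
    have hy : (shear T).toEquiv.symm z 1 = z 1 + T.eval (z 0) := by
      simp [AdmissibleChange.toEquiv, shear]
    have hz2 := hz.2
    rw [sub_zero] at hz2
    simp only [AdmissibleChange.pushDensity]
    rw [S.density_eq _ hzΩ, hx, hy, hT _ hz.1, add_sub_cancel_right,
      jac_mul_jac_div S.lam_pos hz.1 hz2]
    simp [shear]
    ring

end StripSolution

/-! ### Affine changes of variables for the common form -/

/-- The change of variables `Φ` followed by `(x, y) ↦ (α x + β, γ y)`. -/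
noncomputable def _root_.AdmissibleChange.diag (Φ : AdmissibleChange) {α : ℝ} (β : ℝ) {γ : ℝ}
    (hα : α ≠ 0) (hγ : γ ≠ 0) : AdmissibleChange where
  α := α * Φ.α
  β := α * Φ.β + β
  γ := γ * Φ.γ
  p := Polynomial.C γ * Φ.p
  α_ne_zero := mul_ne_zero hα Φ.α_ne_zero
  γ_ne_zero := mul_ne_zero hγ Φ.γ_ne_zero

theorem matrix_two_congr {a b c d a' b' c' d' : ℝ} (ha : a = a') (hb : b = b')
    (hc : c = c') (hd : d = d') : !![a, b; c, d] = !![a', b'; c', d'] := by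
  rw [ha, hb, hc, hd]

section Diag

variable {Φ : AdmissibleChange} {α β γ : ℝ} {hα : α ≠ 0} {hγ : γ ≠ 0} {z : Fin 2 → ℝ}

theorem diag_symm :
    (Φ.diag β hα hγ).toEquiv.symm z = Φ.toEquiv.symm ![(z 0 - β) / α, z 1 / γ] := by
  have h1 := Φ.α_ne_zero
  have h2 := Φ.γ_ne_zero
  have hx : (z 0 - (α * Φ.β + β)) / (α * Φ.α) = ((z 0 - β) / α - Φ.β) / Φ.α := by
    field_simp; ring
  ext i
  fin_cases i
  · simp only [Fin.zero_eta, AdmissibleChange.symm_zero, AdmissibleChange.diag, hx,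
      Matrix.cons_val_zero]
  · simp only [Fin.mk_one, AdmissibleChange.symm_one, AdmissibleChange.diag, hx,
      Matrix.cons_val_zero, Matrix.cons_val_one, Polynomial.eval_mul, Polynomial.eval_C]
    field_simp

theorem mem_diag_image {Ω : Set (Fin 2 → ℝ)} :
    z ∈ (Φ.diag β hα hγ).toEquiv '' Ω ↔ ![(z 0 - β) / α, z 1 / γ] ∈ Φ.toEquiv '' Ω := by
  rw [Equiv.image_eq_preimage_symm, Equiv.image_eq_preimage_symm, mem_preimage, mem_preimage,
    diag_symm]

theorem diag_pushCometric {g : (Fin 2 → ℝ) → Matrix (Fin 2) (Fin 2) ℝ} {κ a b c d : ℝ}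
    (h : Φ.pushCometric g ![(z 0 - β) / α, z 1 / γ] = κ • !![a, b; c, d]) :
    (Φ.diag β hα hγ).pushCometric g z =
      κ • !![α ^ 2 * a, α * γ * b; α * γ * c, γ ^ 2 * d] := by
  rw [AdmissibleChange.pushCometric_eq Φ g rfl] at h
  rw [AdmissibleChange.pushCometric_eq _ g diag_symm]
  set u := Φ.toEquiv.symm ![(z 0 - β) / α, z 1 / γ]
  have e00 := congrFun (congrFun h 0) 0
  have e01 := congrFun (congrFun h 0) 1
  have e10 := congrFun (congrFun h 1) 0
  have e11 := congrFun (congrFun h 1) 1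
  simp at e00 e01 e10 e11
  simp only [AdmissibleChange.diag, Polynomial.derivative_mul, Polynomial.derivative_C, zero_mul,
    zero_add, Polynomial.eval_mul, Polynomial.eval_C]
  refine matrix_two_eq_smul ?_ ?_ ?_ ?_
  · linear_combination α ^ 2 * e00
  · linear_combination α * γ * e01
  · linear_combination α * γ * e10
  · linear_combination γ ^ 2 * e11

theorem diag_pushDensity {ρ : (Fin 2 → ℝ) → ℝ} :
    (Φ.diag β hα hγ).pushDensity ρ z =
      Φ.pushDensity ρ ![(z 0 - β) / α, z 1 / γ] / |α * γ| := by
  simp only [AdmissibleChange.pushDensity, diag_symm]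
  simp only [AdmissibleChange.diag]
  rw [div_div, ← abs_mul]
  congr 2
  ring

variable {Ω : Set (Fin 2 → ℝ)} {g : (Fin 2 → ℝ) → Matrix (Fin 2) (Fin 2) ℝ}
  {ρ : (Fin 2 → ℝ) → ℝ} {κ a b lam : ℝ} {m n : ℕ} {c P Q p q C : ℝ}

/-- A single verification for dilations and for both reflections. The hypotheses `hI`, `hs`, `hG`,
`hl`, `hd` record how the base interval, the half-width, the leading coefficient, the slope and the
density transform; κ and c are invariant. -/
theorem IsGeneral.diag_aux (h : IsGeneral Φ Ω g ρ κ a b lam m n c P Q p q C) {a' b' lam' : ℝ}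
    {m' n' : ℕ} {P' Q' p' q' k : ℝ} (hlt : a' < b') (hlam : 0 < lam') (hp : 0 < p') (hq : 0 < q')
    (hk : 0 < k) (hP : -1 < P' + m' / 2 * (p' + q' - 1)) (hQ : -1 < Q' + n' / 2 * (p' + q' - 1))
    (hP0 : m' ≠ 0 → P' = 0) (hQ0 : n' ≠ 0 → Q' = 0) (hpar : p' = q' ∨ Even m' ∧ Even n')
    (hI : ∀ x, x ∈ Ioo a' b' ↔ (x - β) / α ∈ Ioo a b)
    (hs : ∀ x ∈ Ioo a' b', lam' * jac a' b' (m' / 2) (n' / 2) x =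
      |γ| * (lam * jac a b (m / 2) (n / 2) ((x - β) / α)))
    (hG : ∀ x, (b' - x) * (x - a') = α ^ 2 * ((b - (x - β) / α) * ((x - β) / α - a)))
    (hl : ∀ x, halfSlope a' b' m' n' x = α * halfSlope a b m n ((x - β) / α))
    (hd : ∀ x ∈ Ioo a' b', ∀ y, |y| < |γ| * (lam * jac a b (m / 2) (n / 2) ((x - β) / α)) →
      jac a' b' P' Q' x * ((|γ| * (lam * jac a b (m / 2) (n / 2) ((x - β) / α)) + y) ^ (p' - 1) *
        (|γ| * (lam * jac a b (m / 2) (n / 2) ((x - β) / α)) - y) ^ (q' - 1)) =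
      k * (jac a b P Q ((x - β) / α) *
        ((lam * jac a b (m / 2) (n / 2) ((x - β) / α) + y / γ) ^ (p - 1) *
        (lam * jac a b (m / 2) (n / 2) ((x - β) / α) - y / γ) ^ (q - 1)))) :
    ∃ C', IsGeneral (Φ.diag β hα hγ) Ω g ρ κ a' b' lam' m' n' c P' Q' p' q' C' := by
  have hγ0 : 0 < |γ| := abs_pos.2 hγ
  have hmem : ∀ z, z ∈ strip a' b' (fun x => lam' * jac a' b' (m' / 2) (n' / 2) x) (fun _ => 0) ↔
      ![(z 0 - β) / α, z 1 / γ] ∈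
        strip a b (fun x => lam * jac a b (m / 2) (n / 2) x) (fun _ => 0) := by
    intro z
    simp only [strip, mem_ofPred_eq, Matrix.cons_val_zero, Matrix.cons_val_one, sub_zero, ← hI]
    refine and_congr_right fun hx => ?_
    rw [hs _ hx, abs_div, div_lt_iff₀ hγ0, mul_comm]
  refine ⟨C / k / |α * γ|, hlt, h.κ_pos, hlam, hp, hq, ?_, hP, hQ, hP0, hQ0, hpar, ?_, ?_, ?_, ?_⟩
  · exact div_pos (div_pos h.C_pos hk) (abs_pos.2 (mul_ne_zero hα hγ))
  · intro x hx
    rw [hG, hl, mul_pow, mul_left_comm]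
    exact mul_lt_mul_of_pos_left (h.c_lt _ ((hI x).1 hx)) (by positivity)
  · ext z
    rw [mem_diag_image, h.image_eq, hmem]
  · intro z hz
    have h1 := (hmem z).1 hz
    rw [diag_pushCometric (h.cometric_eq _ h1)]
    simp only [Matrix.cons_val_zero, Matrix.cons_val_one]
    rw [hs _ hz.1, hG, hl]
    have h2 := (sub_pos.2 h1.1.2).ne'
    have h3 := (sub_pos.2 h1.1.1).ne'
    simp only [Matrix.cons_val_zero] at h2 h3
    congr 1
    refine matrix_two_congr rfl ?_ ?_ ?_
    · field_simp
    · field_simp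
    · rw [mul_pow |γ|, sq_abs]
      generalize lam * jac a b (m / 2) (n / 2) ((z 0 - β) / α) = s
      generalize halfSlope a b m n ((z 0 - β) / α) = e
      generalize b - (z 0 - β) / α = B at *
      generalize (z 0 - β) / α - a = A at *
      field_simp
  · intro z hz
    have h1 := (hmem z).1 hz
    rw [diag_pushDensity, h.density_eq _ h1]
    simp only [Matrix.cons_val_zero, Matrix.cons_val_one]
    have hy : |z 1| < lam' * jac a' b' (m' / 2) (n' / 2) (z 0) := by
      simpa only [sub_zero] using hz.2
    rw [hs _ hz.1] at hy
    rw [hs _ hz.1, hd _ hz.1 _ hy]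
    have h2 := hk.ne'
    field_simp

/-- The weight (b - x)^(m/2) (x - a)^(n/2) is homogeneous of degree m/2 + n/2 under dilations, hence
the power of α in the new half-width constant. -/
theorem IsGeneral.diag_pos (h : IsGeneral Φ Ω g ρ κ a b lam m n c P Q p q C) (β : ℝ) (hα : 0 < α)
    (hγ : 0 < γ) :
    ∃ C', IsGeneral (Φ.diag β hα.ne' hγ.ne') Ω g ρ κ (α * a + β) (α * b + β)
      (γ * lam * α ^ (-((m : ℝ) / 2 + n / 2))) m n c P Q p q C' := by
  have hj : ∀ (R T : ℝ) {x}, x ∈ Ioo (α * a + β) (α * b + β) →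
      jac (α * a + β) (α * b + β) R T x = α ^ (R + T) * jac a b R T ((x - β) / α) := by
    intro R T x hx
    have e1 : α * b + β - x = α * (b - (x - β) / α) := by field_simp; ring
    have e2 : x - (α * a + β) = α * ((x - β) / α - a) := by field_simp; ring
    have h1 : 0 ≤ b - (x - β) / α := by
      have := sub_pos.2 hx.2; rw [e1] at this; exact (pos_of_mul_pos_right this hα.le).le
    have h2 : 0 ≤ (x - β) / α - a := by
      have := sub_pos.2 hx.1; rw [e2] at this; exact (pos_of_mul_pos_right this hα.le).le
    unfold jac
    rw [e1, e2, Real.mul_rpow hα.le h1, Real.mul_rpow hα.le h2, Real.rpow_add hα]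
    ring
  refine h.diag_aux (k := α ^ (P + Q) * γ ^ (p + q - 2)) ?_ ?_ h.p_pos h.q_pos ?_ h.P_gt h.Q_gt h.P_eq
    h.Q_eq h.parity (fun x => ?_) (fun x hx => ?_) (fun x => ?_) (fun x => ?_) (fun x hx y hy => ?_)
  · have := h.lt; gcongr
  · have := h.lam_pos; positivity
  · positivity
  · rw [mem_Ioo, mem_Ioo, lt_div_iff₀ hα, div_lt_iff₀ hα]
    constructor <;> rintro ⟨_, _⟩ <;> constructor <;> linarith
  · rw [hj _ _ hx, abs_of_pos hγ]
    have : α ^ (-((m : ℝ) / 2 + n / 2)) * α ^ ((m : ℝ) / 2 + n / 2) = 1 := by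
      rw [← Real.rpow_add hα, neg_add_cancel, Real.rpow_zero]
    linear_combination (γ * lam * jac a b (m / 2) (n / 2) ((x - β) / α)) * this
  · field_simp; ring
  · unfold halfSlope; field_simp; ring
  · rw [hj _ _ hx]
    rw [abs_of_pos hγ] at hy ⊢
    set s := lam * jac a b (m / 2) (n / 2) ((x - β) / α)
    have h1 := abs_lt.1 hy
    have e1 : γ * s + y = γ * (s + y / γ) := by field_simp
    have e2 : γ * s - y = γ * (s - y / γ) := by field_simp
    have h2 : 0 ≤ s + y / γ := by
      have : 0 < γ * (s + y / γ) := by rw [← e1]; linarith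
      exact (pos_of_mul_pos_right this hγ.le).le
    have h3 : 0 ≤ s - y / γ := by
      have : 0 < γ * (s - y / γ) := by rw [← e2]; linarith
      exact (pos_of_mul_pos_right this hγ.le).le
    rw [e1, e2, Real.mul_rpow hγ.le h2, Real.mul_rpow hγ.le h3,
      show p + q - 2 = p - 1 + (q - 1) by ring, Real.rpow_add hγ]
    ring

theorem IsGeneral.reflect_x (h : IsGeneral Φ Ω g ρ κ a b lam m n c P Q p q C) :
    ∃ C', IsGeneral (Φ.diag (α := -1) 0 (γ := 1) (by norm_num) one_ne_zero) Ω g ρ κ (-b) (-a) lam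
      n m c Q P p q C' := by
  have hj : ∀ (R T x : ℝ), jac (-b) (-a) T R x = jac a b R T ((x - 0) / -1) := by
    intro R T x
    unfold jac
    rw [mul_comm, show (x - 0) / -1 = -x by ring, sub_neg_eq_add, sub_neg_eq_add]
    congr 2 <;> ring
  refine h.diag_aux (k := 1) ?_ h.lam_pos h.p_pos h.q_pos one_pos h.Q_gt h.P_gt h.Q_eq
    h.P_eq (h.parity.imp_right And.symm) (fun x => ?_) (fun x hx => ?_) (fun x => ?_)
    (fun x => ?_) (fun x hx y hy => ?_)
  · have := h.lt; linarith
  · rw [show (x - 0) / -1 = -x by ring, mem_Ioo, mem_Ioo]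
    constructor <;> rintro ⟨_, _⟩ <;> constructor <;> linarith
  · rw [hj, abs_one, one_mul]
  · ring
  · unfold halfSlope; ring
  · rw [hj, abs_one, one_mul, one_mul, div_one]

theorem IsGeneral.reflect_y (h : IsGeneral Φ Ω g ρ κ a b lam m n c P Q p q C) :
    ∃ C', IsGeneral (Φ.diag (α := 1) 0 (γ := -1) one_ne_zero (by norm_num)) Ω g ρ κ a b lam
      m n c P Q q p C' := by
  have e : ∀ x : ℝ, (x - 0) / 1 = x := fun x => by ring
  refine h.diag_aux (k := 1) h.lt h.lam_pos h.q_pos h.p_pos one_pos ?_ ?_ h.P_eq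
    h.Q_eq (h.parity.imp_left Eq.symm) (fun x => ?_) (fun x hx => ?_) (fun x => ?_)
    (fun x => ?_) (fun x hx y hy => ?_)
  · rw [add_comm q]; exact h.P_gt
  · rw [add_comm q]; exact h.Q_gt
  · rw [e]
  · rw [e, abs_neg, abs_one, one_mul]
  · rw [e]; ring
  · rw [e]; ring
  · rw [e, abs_neg, abs_one, one_mul, one_mul, div_neg, div_one, sub_neg_eq_add, ← sub_eq_add_neg]
    ring

end Diag

section Strip

variable {a b : ℝ} {s t : ℝ → ℝ}

/-! ### Topology of strips and change of variables for densities -/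

theorem strip_eq_image (hs0 : ∀ x ∈ Ioo a b, 0 < s x) :
    strip a b s t = stripMap s t '' Ioo a b ×ˢ Ioo (-1) 1 := by
  ext z
  constructor
  · intro hz
    refine ⟨(z 0, (z 1 - t (z 0)) / s (z 0)), ⟨hz.1, mem_Ioo_of_mem_strip hs0 hz⟩, ?_⟩
    have := (hs0 _ hz.1).ne'
    ext i
    fin_cases i
    · rfl
    · simp only [stripMap, Fin.mk_one, Matrix.cons_val_one, Matrix.cons_val_zero]
      field_simp
      ring
  · rintro ⟨⟨x, u⟩, ⟨hx, hu⟩, rfl⟩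
    refine ⟨hx, ?_⟩
    have h1 := hs0 x hx
    simp only [stripMap, Matrix.cons_val_one, Matrix.cons_val_zero, add_sub_cancel_right]
    rw [abs_mul, abs_of_pos h1]
    exact mul_lt_of_lt_one_right h1 (abs_lt.2 hu)

theorem isConnected_strip (hab : a < b) (hs : ContinuousOn s (Ioo a b))
    (ht : ContinuousOn t (Ioo a b)) (hs0 : ∀ x ∈ Ioo a b, 0 < s x) :
    IsConnected (strip a b s t) := by
  rw [strip_eq_image hs0]
  refine ((isConnected_Ioo hab).prod (isConnected_Ioo (by norm_num))).image _ ?_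
  have hm : MapsTo Prod.fst (Ioo a b ×ˢ Ioo (-1 : ℝ) 1) (Ioo a b) := fun z hz => hz.1
  refine continuousOn_pi.2 fun i => ?_
  fin_cases i
  · exact continuous_fst.continuousOn
  · exact ((hs.comp continuous_fst.continuousOn hm).mul continuous_snd.continuousOn).add
      (ht.comp continuous_fst.continuousOn hm)

theorem isBounded_strip (hs : ContinuousOn s (Icc a b)) (ht : ContinuousOn t (Icc a b)) :
    Bornology.IsBounded (strip a b s t) := by
  obtain ⟨C₁, h₁⟩ := isCompact_Icc.exists_bound_of_continuousOn hs
  obtain ⟨C₂, h₂⟩ := isCompact_Icc.exists_bound_of_continuousOn ht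
  refine isBounded_iff_forall_norm_le.2 ⟨max (max |a| |b|) (C₁ + C₂), fun z hz => ?_⟩
  refine (pi_norm_le_iff_of_nonempty _).2 fun i => ?_
  have hx := Ioo_subset_Icc_self hz.1
  fin_cases i
  · exact (abs_le_max_abs_abs hx.1 hx.2).trans (le_max_left _ _)
  · refine le_trans ?_ (le_max_right _ _)
    have h3 := (le_abs_self _).trans (h₁ _ hx)
    have h4 : |t (z 0)| ≤ C₂ := h₂ _ hx
    have h5 := hz.2
    have h6 : |z 1| ≤ |z 1 - t (z 0)| + |t (z 0)| := by
      simpa using abs_add_le (z 1 - t (z 0)) (t (z 0))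
    change |z 1| ≤ C₁ + C₂
    linarith

theorem closure_strip_subset (hs : Continuous s) (ht : Continuous t) :
    closure (strip a b s t) ⊆ {z | z 0 ∈ Icc a b ∧ |z 1 - t (z 0)| ≤ s (z 0)} := by
  refine closure_minimal (fun z hz => ⟨Ioo_subset_Icc_self hz.1, hz.2.le⟩) ?_
  have h0 : Continuous fun z : Fin 2 → ℝ => z 0 := continuous_apply 0
  have h1 : Continuous fun z : Fin 2 → ℝ => z 1 := continuous_apply 1
  exact (isClosed_Icc.preimage h0).inter
    (isClosed_le (h1.sub (ht.comp h0)).abs (hs.comp h0))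

/-- Passing to the closure can at worst make the inequalities nonstrict. An interior point of the
closure can be moved a little both ways along each axis, and this restores the strict inequalities.
-/
theorem interior_closure_strip (hs : Continuous s) (ht : Continuous t) :
    interior (closure (strip a b s t)) = strip a b s t := by
  refine Subset.antisymm (fun z hz => ?_)
    (interior_maximal subset_closure (isOpen_strip hs.continuousOn ht.continuousOn))
  have hz0 := closure_strip_subset hs ht (interior_subset hz)
  -- small displacements stay in the closure
  have key : ∀ v : Fin 2 → ℝ, ∃ ε : ℝ, 0 < ε ∧ z + ε • v ∈ closure (strip a b s t) ∧
      z - ε • v ∈ closure (strip a b s t) := by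
    intro v
    have h1 : Tendsto (fun ε : ℝ => z + ε • v) (𝓝 0) (𝓝 z) := by
      have : Continuous fun ε : ℝ => z + ε • v := by fun_prop
      simpa using this.tendsto 0
    have h2 : Tendsto (fun ε : ℝ => z - ε • v) (𝓝 0) (𝓝 z) := by
      have : Continuous fun ε : ℝ => z - ε • v := by fun_prop
      simpa using this.tendsto 0
    have h3 := (h1.eventually (mem_interior_iff_mem_nhds.1 hz)).and
      (h2.eventually (mem_interior_iff_mem_nhds.1 hz))
    obtain ⟨ε, hε, hpos⟩ := ((h3.filter_mono nhdsWithin_le_nhds).and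
      (self_mem_nhdsWithin : Ioi (0 : ℝ) ∈ 𝓝[>] 0)).exists
    exact ⟨ε, hpos, hε⟩
  obtain ⟨ε, hε, h1, h2⟩ := key ![1, 0]
  obtain ⟨δ, hδ, h3, h4⟩ := key ![0, 1]
  have h1 := (closure_strip_subset hs ht h1).1
  have h2 := (closure_strip_subset hs ht h2).1
  have h3 := (closure_strip_subset hs ht h3).2
  have h4 := (closure_strip_subset hs ht h4).2
  simp at h1 h2 h3 h4
  refine ⟨⟨by linarith [h2.1], by linarith [h1.2]⟩, ?_⟩
  have h5 := abs_le.1 h3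
  have h6 := abs_le.1 h4
  rw [abs_lt]
  constructor <;> linarith [h5.2, h6.1]

end Strip

section Push

variable (Φ : AdmissibleChange)

theorem hasFDerivAt_change (z : Fin 2 → ℝ) :
    HasFDerivAt Φ.toEquiv (LinearMap.toContinuousLinearMap (Matrix.toLin' (Φ.jacobian z))) z := by
  rw [hasFDerivAt_pi']
  intro i
  have h0 : HasDerivAt (fun x => Φ.α * x + Φ.β) Φ.α (z 0) := by
    simpa using ((hasDerivAt_id (z 0)).const_mul Φ.α).add_const Φ.β
  have h1 : HasPartialsAt (fun z => Φ.γ * z 1 + Φ.p.eval (z 0)) (Φ.p.derivative.eval (z 0)) Φ.γ z :=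
    (((HasPartialsAt.coord_zero (hasDerivAt_const (z 0) Φ.γ)).mul HasPartialsAt.coord_one).add
      (HasPartialsAt.coord_zero (Φ.p.hasDerivAt (z 0)))).congr_partials (by ring) (by ring)
  fin_cases i
  · refine HasFDerivAt.congr_fderiv (HasPartialsAt.coord_zero h0) ?_
    ext v
    simp [AdmissibleChange.jacobian, dotProduct]
  · refine HasFDerivAt.congr_fderiv h1 ?_
    ext v
    simp [AdmissibleChange.jacobian, dotProduct]

/-- The Jacobian matrix is triangular with constant determinant αγ, which the denominator of
`pushDensity` compensates. -/
theorem densityMeasure_image_univ {Ω : Set (Fin 2 → ℝ)} (hΩ : MeasurableSet Ω)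
    (ρ : (Fin 2 → ℝ) → ℝ) :
    densityMeasure (Φ.toEquiv '' Ω) (Φ.pushDensity ρ) univ = densityMeasure Ω ρ univ := by
  have hne : 0 < |Φ.α * Φ.γ| := abs_pos.2 (mul_ne_zero Φ.α_ne_zero Φ.γ_ne_zero)
  rw [densityMeasure, densityMeasure, withDensity_apply _ MeasurableSet.univ,
    withDensity_apply _ MeasurableSet.univ, Measure.restrict_univ, Measure.restrict_univ,
    lintegral_image_eq_lintegral_abs_det_fderiv_mul volume hΩ
      (fun z _ => (hasFDerivAt_change Φ z).hasFDerivWithinAt) Φ.toEquiv.injective.injOn]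
  refine lintegral_congr fun z => ?_
  rw [LinearMap.det_toContinuousLinearMap, LinearMap.det_toLin', ← ENNReal.ofReal_mul (abs_nonneg _)]
  congr 1
  have hd : (Φ.jacobian z).det = Φ.α * Φ.γ := by
    simp [AdmissibleChange.jacobian, Matrix.det_fin_two]
  rw [hd, AdmissibleChange.pushDensity, Equiv.symm_apply_apply]
  field_simp

theorem continuous_change : Continuous Φ.toEquiv :=
  continuous_iff_continuousAt.2 fun z => (hasFDerivAt_change Φ z).continuousAt

end Push

theorem isNormalizedDensity_of_eq {U : Set (Fin 2 → ℝ)} {F ρ : (Fin 2 → ℝ) → ℝ} {C : ℝ}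
    (hU : MeasurableSet U) (hF : Measurable F) (hF0 : ∀ z ∈ U, 0 ≤ F z) (hC : 0 < C)
    (h : ∀ z ∈ U, ρ z = C * F z) (hmass : densityMeasure U ρ univ = 1) :
    IsNormalizedDensity U F ρ := by
  have h1 : ∫ u in U, F u = C⁻¹ := by
    rw [densityMeasure, withDensity_apply _ MeasurableSet.univ, Measure.restrict_univ] at hmass
    have h2 : ∫⁻ z in U, ENNReal.ofReal (ρ z) =
        ENNReal.ofReal C * ∫⁻ z in U, ENNReal.ofReal (F z) := by
      rw [← lintegral_const_mul _ hF.ennreal_ofReal]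
      refine setLIntegral_congr_fun hU fun z hz => ?_
      simp only [h z hz]
      rw [ENNReal.ofReal_mul hC.le]
    rw [integral_eq_lintegral_of_nonneg_ae
      ((ae_restrict_iff' hU).2 (ae_of_all _ hF0)) hF.aestronglyMeasurable]
    have h3 : ∫⁻ z in U, ENNReal.ofReal (F z) = (ENNReal.ofReal C)⁻¹ := by
      rw [h2] at hmass
      exact ENNReal.eq_inv_of_mul_eq_one_left (by rw [mul_comm]; exact hmass)
    rw [h3, ENNReal.toReal_inv, ENNReal.toReal_ofReal hC.le]
  intro z hz
  rw [h1, h z hz, div_inv_eq_mul, mul_comm]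

theorem densityMeasure_univ_of_isNormalizedDensity {U : Set (Fin 2 → ℝ)}
    {F ρ : (Fin 2 → ℝ) → ℝ} (hU : MeasurableSet U) (hF : Measurable F) (hF0 : ∀ z ∈ U, 0 ≤ F z)
    (h0 : ∫⁻ z in U, ENNReal.ofReal (F z) ≠ 0) (h1 : ∫⁻ z in U, ENNReal.ofReal (F z) ≠ ⊤)
    (h : IsNormalizedDensity U F ρ) :
    0 < ∫ u in U, F u ∧ densityMeasure U ρ univ = 1 := by
  have e : ∫ u in U, F u = (∫⁻ z in U, ENNReal.ofReal (F z)).toReal :=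
    integral_eq_lintegral_of_nonneg_ae
      ((ae_restrict_iff' hU).2 (ae_of_all _ hF0)) hF.aestronglyMeasurable
  have hpos : 0 < ∫ u in U, F u := by rw [e]; exact ENNReal.toReal_pos h0 h1
  refine ⟨hpos, ?_⟩
  rw [densityMeasure, withDensity_apply _ MeasurableSet.univ, Measure.restrict_univ]
  have h2 : ∫⁻ z in U, ENNReal.ofReal (ρ z) =
      ENNReal.ofReal (∫ u in U, F u)⁻¹ * ∫⁻ z in U, ENNReal.ofReal (F z) := by
    rw [← lintegral_const_mul _ hF.ennreal_ofReal]
    refine setLIntegral_congr_fun hU fun z hz => ?_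
    simp only [h z hz]
    rw [← ENNReal.ofReal_mul (inv_pos.2 hpos).le, div_eq_inv_mul]
  rw [h2, ENNReal.ofReal_inv_of_pos hpos, e, ENNReal.ofReal_toReal h1]
  exact ENNReal.inv_mul_cancel h0 h1

/-- The set U is connected, open and relatively closed in {Γ ≠ 0}, hence a component. Any other
point of {Γ ≠ 0} is the origin of a ray on which Γ does not vanish, so its component is unbounded.
-/
theorem isOnlyBoundedComponent_of_rays {U : Set (Fin 2 → ℝ)} {Γ : (Fin 2 → ℝ) → ℝ}
    (hU : IsOpen U) (hUc : IsConnected U) (hUb : Bornology.IsBounded U) (hΓU : ∀ z ∈ U, Γ z ≠ 0)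
    (hcl : ∀ z ∈ closure U, Γ z ≠ 0 → z ∈ U)
    (hray : ∀ z ∉ U, Γ z ≠ 0 → ∃ v : Fin 2 → ℝ, v ≠ 0 ∧ ∀ r : ℝ, 0 ≤ r → Γ (z + r • v) ≠ 0) :
    IsOnlyBoundedComponent U Γ := by
  have hcomp : ∀ z ∈ U, connectedComponentIn {u | Γ u ≠ 0} z = U := by
    intro z hz
    refine Subset.antisymm ?_ (hUc.isPreconnected.subset_connectedComponentIn hz hΓU)
    refine isPreconnected_connectedComponentIn.subset_of_closure_inter_subset hU
      ⟨z, mem_connectedComponentIn (hΓU z hz), hz⟩ fun u hu => hcl u hu.1 ?_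
    exact connectedComponentIn_subset _ _ hu.2
  intro C
  constructor
  · rintro ⟨⟨z, hz, rfl⟩, hb⟩
    by_cases hzU : z ∈ U
    · exact hcomp z hzU
    exfalso
    obtain ⟨v, hv, hr⟩ := hray z hzU hz
    set R := (fun r : ℝ => z + r • v) '' Ici 0 with hR
    have hRp : IsPreconnected R :=
      isPreconnected_Ici.image _ (by fun_prop)
    have hzR : z ∈ R := ⟨0, by simp, by simp⟩
    have hRs : R ⊆ connectedComponentIn {u | Γ u ≠ 0} z :=
      hRp.subset_connectedComponentIn hzR (by rintro _ ⟨r, hr0, rfl⟩; exact hr r hr0)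
    obtain ⟨B, hB⟩ := isBounded_iff_forall_norm_le.1 (hb.subset hRs)
    have hv' : 0 < ‖v‖ := norm_pos_iff.2 hv
    have hB0 : 0 ≤ B := (norm_nonneg z).trans (hB z hzR)
    have h1 := hB (z + ((2 * B + 1) / ‖v‖) • v) ⟨_, by simp only [mem_Ici]; positivity, rfl⟩
    have h2 := hB z hzR
    have h3 : ‖((2 * B + 1) / ‖v‖) • v‖ = 2 * B + 1 := by
      rw [norm_smul, Real.norm_of_nonneg (by positivity)]; field_simp
    have h4 : ‖((2 * B + 1) / ‖v‖) • v‖ ≤ ‖z + ((2 * B + 1) / ‖v‖) • v‖ + ‖z‖ := by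
      simpa using norm_sub_le (z + ((2 * B + 1) / ‖v‖) • v) z
    linarith
  · rintro rfl
    obtain ⟨z, hz⟩ := hUc.nonempty
    exact ⟨⟨z, hΓU z hz, (hcomp z hz).symm⟩, hUb⟩

/-! ### Comparison of the models with the common form -/

section Normalize

variable {Φ : AdmissibleChange} {Ω : Set (Fin 2 → ℝ)}
  {g : (Fin 2 → ℝ) → Matrix (Fin 2) (Fin 2) ℝ}
  {ρ : (Fin 2 → ℝ) → ℝ} {κ a b lam : ℝ} {m n : ℕ} {c P Q p q C : ℝ}

theorem IsGeneral.normalize (h : IsGeneral Φ Ω g ρ κ a b lam m n c P Q p q C) {a' b' : ℝ}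
    (hab : a' < b') : ∃ Φ' C', IsGeneral Φ' Ω g ρ κ a' b' 1 m n c P Q p q C' := by
  have h1 : 0 < b - a := sub_pos.2 h.lt
  have hα : 0 < (b' - a') / (b - a) := div_pos (sub_pos.2 hab) h1
  set α := (b' - a') / (b - a) with hαd
  have hl := h.lam_pos
  -- The vertical scale is chosen so that the new half-width constant is 1.
  have hγ : 0 < (lam * α ^ (-((m : ℝ) / 2 + n / 2)))⁻¹ := by positivity
  obtain ⟨C', h'⟩ := h.diag_pos (a' - α * a) hα hγ
  have e1 : α * a + (a' - α * a) = a' := by ring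
  have e2 : α * b + (a' - α * a) = b' := by
    rw [hαd]; field_simp; ring
  have e3 : (lam * α ^ (-((m : ℝ) / 2 + n / 2)))⁻¹ * lam * α ^ (-((m : ℝ) / 2 + n / 2)) = 1 := by
    rw [mul_assoc]
    exact inv_mul_cancel₀ (by positivity)
  rw [e1, e2, e3] at h'
  exact ⟨_, C', h'⟩

theorem eq_shear (h1 : Φ.α = 1) (h2 : Φ.β = 0) (h3 : Φ.γ = 1) : Φ = shear (-Φ.p) := by
  obtain ⟨α, β, γ, p, hα, hγ⟩ := Φ
  simp only at h1 h2 h3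
  subst h1 h2 h3
  simp [shear]

/-- Reflections make the two linear coefficients of Φ positive, and a diagonal change inverts the
affine part of Φ, which leaves a shear. The original triple can then be treated as a strip in its
own coordinates, with no need to transport the DOP property under Φ. -/
theorem IsGeneral.exists_shear (h : IsGeneral Φ Ω g ρ κ a b lam m n c P Q p q C) :
    ∃ (T : Polynomial ℝ) (a b lam : ℝ) (m n : ℕ) (P Q p q C : ℝ),
      IsGeneral (shear T) Ω g ρ κ a b lam m n c P Q p q C := by
  have key : ∀ (Φ : AdmissibleChange) (a b lam : ℝ) (m n : ℕ) (P Q p q C : ℝ), 0 < Φ.α → 0 < Φ.γ →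
      IsGeneral Φ Ω g ρ κ a b lam m n c P Q p q C →
      ∃ (T : Polynomial ℝ) (a b lam : ℝ) (m n : ℕ) (P Q p q C : ℝ),
      IsGeneral (shear T) Ω g ρ κ a b lam m n c P Q p q C := by
    intro Φ a b lam m n P Q p q C hα hγ h
    obtain ⟨C', h'⟩ := h.diag_pos (-(Φ.β / Φ.α)) (inv_pos.2 hα) (inv_pos.2 hγ)
    rw [eq_shear (Φ := Φ.diag _ _ _) (inv_mul_cancel₀ hα.ne') (by
      simp only [AdmissibleChange.diag]; field_simp; ring) (inv_mul_cancel₀ hγ.ne')] at h'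
    exact ⟨_, _, _, _, _, _, _, _, _, _, _, h'⟩
  have key2 : ∀ (Φ : AdmissibleChange) (a b lam : ℝ) (m n : ℕ) (P Q p q C : ℝ), 0 < Φ.α →
      IsGeneral Φ Ω g ρ κ a b lam m n c P Q p q C →
      ∃ (T : Polynomial ℝ) (a b lam : ℝ) (m n : ℕ) (P Q p q C : ℝ),
      IsGeneral (shear T) Ω g ρ κ a b lam m n c P Q p q C := by
    intro Φ a b lam m n P Q p q C hα h
    rcases lt_or_gt_of_ne Φ.γ_ne_zero with hγ | hγ
    · obtain ⟨C', h'⟩ := h.reflect_y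
      exact key _ _ _ _ _ _ _ _ _ _ _ (by simpa [AdmissibleChange.diag] using hα)
        (by simpa [AdmissibleChange.diag] using hγ) h'
    · exact key _ _ _ _ _ _ _ _ _ _ _ hα hγ h
  rcases lt_or_gt_of_ne Φ.α_ne_zero with hα | hα
  · obtain ⟨C', h'⟩ := h.reflect_x
    exact key2 _ _ _ _ _ _ _ _ _ _ _ (by simpa [AdmissibleChange.diag] using hα) h'
  · exact key2 _ _ _ _ _ _ _ _ _ _ _ hα h

end Normalize

/-- The cometric of the common form. -/
noncomputable def generalCometric (a b : ℝ) (m n : ℕ) (c : ℝ) (z : Fin 2 → ℝ) :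
    Matrix (Fin 2) (Fin 2) ℝ :=
  !![(b - z 0) * (z 0 - a), halfSlope a b m n (z 0) * z 1;
      halfSlope a b m n (z 0) * z 1,
      (1 * jac a b (m / 2) (n / 2) (z 0)) ^ 2 * halfSlope a b m n (z 0) ^ 2 /
        ((b - z 0) * (z 0 - a)) - c * ((1 * jac a b (m / 2) (n / 2) (z 0)) ^ 2 - z 1 ^ 2)]

/-- The density of the common form. -/
noncomputable def generalDensity (a b lam : ℝ) (m n : ℕ) (P Q p q : ℝ) (z : Fin 2 → ℝ) : ℝ :=
  jac a b P Q (z 0) * ((lam * jac a b (m / 2) (n / 2) (z 0) + z 1) ^ (p - 1) *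
    (lam * jac a b (m / 2) (n / 2) (z 0) - z 1) ^ (q - 1))

section Density

variable {a b lam : ℝ} {m n : ℕ} {P Q p q : ℝ}

theorem measurable_generalDensity : Measurable (generalDensity a b lam m n P Q p q) := by
  have h0 : Measurable fun z : Fin 2 → ℝ => z 0 := measurable_pi_apply 0
  have h1 : Measurable fun z : Fin 2 → ℝ => z 1 := measurable_pi_apply 1
  have hs : Measurable fun z : Fin 2 → ℝ => lam * jac a b (m / 2) (n / 2) (z 0) :=
    measurable_const.mul (measurable_jac.comp h0)
  exact (measurable_jac.comp h0).mul (((hs.add h1).pow_const _).mul ((hs.sub h1).pow_const _))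

theorem generalDensity_pos {z : Fin 2 → ℝ}
    (hz : z ∈ strip a b (fun x => lam * jac a b (m / 2) (n / 2) x) fun _ => 0) :
    0 < generalDensity a b lam m n P Q p q z := by
  have h1 := hz.2
  rw [sub_zero] at h1
  have h2 := abs_lt.1 h1
  exact mul_pos (jac_pos hz.1) (mul_pos (Real.rpow_pos_of_pos (by linarith) _)
    (Real.rpow_pos_of_pos (by linarith) _))

/-- In (x, u) the density is a product of two Jacobi weights, so finiteness is that of two beta
integrals. The integral is nonzero because the density is positive on a nonempty open set. -/
theorem lintegral_generalDensity (hab : a < b) (hlam : 0 < lam) (hp : 0 < p) (hq : 0 < q)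
    (hP : -1 < P + m / 2 * (p + q - 1)) (hQ : -1 < Q + n / 2 * (p + q - 1)) :
    ∫⁻ z in strip a b (fun x => lam * jac a b (m / 2) (n / 2) x) fun _ => 0,
      ENNReal.ofReal (generalDensity a b lam m n P Q p q z) ≠ ⊤ ∧
    ∫⁻ z in strip a b (fun x => lam * jac a b (m / 2) (n / 2) x) fun _ => 0,
      ENNReal.ofReal (generalDensity a b lam m n P Q p q z) ≠ 0 := by
  have hsm : Measurable fun x => lam * jac a b (m / 2) (n / 2) x :=
    measurable_const.mul measurable_jac
  have hms := measurableSet_strip (a := a) (b := b) hsm (measurable_const (a := (0 : ℝ)))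
  set k := lam ^ (-(p + q - 1)) with hk
  have hk0 : 0 < k := Real.rpow_pos_of_pos hlam _
  constructor
  · have h := densityMeasure_strip (a := a) (b := b) hsm (measurable_const (a := (0 : ℝ)))
      (fun x hx => mul_pos hlam (jac_pos hx))
      (measurable_jac (P := P + m / 2 * (p + q - 1)) (Q := Q + n / 2 * (p + q - 1)))
      (fun x hx => (jac_pos hx).le) (measurable_jac (a := -1) (b := 1) (P := q - 1) (Q := p - 1))
      (ρ := fun z => k * generalDensity a b lam m n P Q p q z) (fun z hz => by
        have h1 := hz.2
        rw [sub_zero] at h1 ⊢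
        rw [jac_mul_jac_div hlam hz.1 h1, add_sub_cancel_right, add_sub_cancel_right]
        rfl)
    have hfin1 : IsFiniteMeasure ((volume.restrict (Ioo a b)).withDensity fun x =>
        ENNReal.ofReal (jac a b (P + m / 2 * (p + q - 1)) (Q + n / 2 * (p + q - 1)) x)) :=
      isFiniteMeasure_withDensity_ofReal ((integrableOn_jac_iff hab).2 ⟨hP, hQ⟩).2
    have hfin2 : IsFiniteMeasure ((volume.restrict (Ioo (-1 : ℝ) 1)).withDensity fun x =>
        ENNReal.ofReal (jac (-1) 1 (q - 1) (p - 1) x)) :=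
      isFiniteMeasure_withDensity_ofReal
        ((integrableOn_jac_iff (by norm_num)).2 ⟨by linarith, by linarith⟩).2
    have hfin : IsFiniteMeasure (densityMeasure (strip a b
        (fun x => lam * jac a b (m / 2) (n / 2) x) fun _ => 0)
        fun z => k * generalDensity a b lam m n P Q p q z) := by rw [h]; infer_instance
    have h2 := measure_ne_top (densityMeasure (strip a b (fun x => lam * jac a b (m / 2) (n / 2) x)
      fun _ => 0) fun z => k * generalDensity a b lam m n P Q p q z) univ
    rw [densityMeasure, withDensity_apply _ MeasurableSet.univ, Measure.restrict_univ] at h2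
    simp_rw [ENNReal.ofReal_mul hk0.le] at h2
    rw [lintegral_const_mul _ measurable_generalDensity.ennreal_ofReal] at h2
    exact fun h3 => h2 (by rw [h3, ENNReal.mul_top (ENNReal.ofReal_pos.2 hk0).ne'])
  · rw [Ne, lintegral_eq_zero_iff measurable_generalDensity.ennreal_ofReal]
    intro h
    have h1 : ∀ᵐ z ∂volume.restrict (strip a b (fun x => lam * jac a b (m / 2) (n / 2) x)
        fun _ => 0), False := by
      filter_upwards [h, ae_restrict_mem hms] with z hz hz'
      exact absurd hz (ENNReal.ofReal_pos.2 (generalDensity_pos hz')).ne'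
    have hopen := isOpen_strip (a := a) (b := b) (s := fun x => lam * jac a b (m / 2) (n / 2) x)
      (t := fun _ => 0) (continuousOn_const.mul continuousOn_jac) continuousOn_const
    have hne := (isConnected_strip hab (s := fun x => lam * jac a b (m / 2) (n / 2) x)
      (t := fun _ => 0) (continuousOn_const.mul continuousOn_jac) continuousOn_const
      fun x hx => mul_pos hlam (jac_pos hx)).nonempty
    have h2 : volume (strip a b (fun x => lam * jac a b (m / 2) (n / 2) x) fun _ => 0) = 0 := by
      rw [← Measure.restrict_eq_zero]
      by_contra h5
      have := ae_neBot.2 h5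
      exact (Filter.eventually_false_iff_eq_bot.1 h1 ▸ this).ne rfl
    exact hne.ne_empty ((hopen.measure_eq_zero_iff volume).1 h2)

theorem jac_half_sq {x : ℝ} (hx : x ∈ Ioo a b) :
    jac a b (m / 2) (n / 2) x ^ 2 = (b - x) ^ m * (x - a) ^ n := by
  have h : ∀ (y : ℝ) (k : ℕ), 0 < y → (y ^ ((k : ℝ) / 2)) ^ 2 = y ^ k := fun y k hy => by
    rw [← Real.rpow_natCast, ← Real.rpow_mul hy.le, ← Real.rpow_natCast y k]
    congr 1; push_cast; ring
  unfold jac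
  rw [mul_pow, h _ _ (sub_pos.2 hx.2), h _ _ (sub_pos.2 hx.1)]

theorem jac_half_of_even (hm : Even m) (hn : Even n) (x : ℝ) :
    jac a b (m / 2) (n / 2) x = (b - x) ^ (m / 2) * (x - a) ^ (n / 2) := by
  obtain ⟨k, rfl⟩ := hm
  obtain ⟨j, rfl⟩ := hn
  unfold jac
  rw [← Real.rpow_natCast, ← Real.rpow_natCast]
  congr 2
  · rw [show (k + k) / 2 = k by omega]; push_cast; ring
  · rw [show (j + j) / 2 = j by omega]; push_cast; ring

theorem mem_strip_iff {z : Fin 2 → ℝ} :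
    z ∈ strip a b (fun x => 1 * jac a b (m / 2) (n / 2) x) (fun _ => 0) ↔
      z 0 ∈ Ioo a b ∧ z 1 ^ 2 < (b - z 0) ^ m * (z 0 - a) ^ n := by
  refine and_congr_right fun hx => ?_
  simp only [sub_zero, one_mul]
  rw [← jac_half_sq hx, sq_lt_sq, abs_of_pos (jac_pos hx)]

theorem generalDensity_of_eq {z : Fin 2 → ℝ}
    (hz : z ∈ strip a b (fun x => 1 * jac a b (m / 2) (n / 2) x) (fun _ => 0)) :
    generalDensity a b 1 m n P Q p p z =
      jac a b P Q (z 0) * ((b - z 0) ^ m * (z 0 - a) ^ n - z 1 ^ 2) ^ (p - 1) := by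
  have h1 := hz.2
  simp only [sub_zero, one_mul] at h1
  have h2 := abs_lt.1 h1
  rw [generalDensity, one_mul, ← Real.mul_rpow (by linarith) (by linarith), ← jac_half_sq hz.1]
  congr 2
  ring

theorem generalDensity_of_even (hm : Even m) (hn : Even n) (z : Fin 2 → ℝ) :
    generalDensity a b 1 m n P Q p q z =
      jac a b P Q (z 0) * (((b - z 0) ^ (m / 2) * (z 0 - a) ^ (n / 2) + z 1) ^ (p - 1) *
        ((b - z 0) ^ (m / 2) * (z 0 - a) ^ (n / 2) - z 1) ^ (q - 1)) := by
  rw [generalDensity, one_mul, jac_half_of_even hm hn]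

theorem exponent_lt_iff {k : ℕ} (hk : k ≠ 0) (σ : ℝ) :
    -1 < 0 + (k : ℝ) / 2 * (σ - 1) ↔ 1 - 2 / (k : ℝ) < σ := by
  have h : (0 : ℝ) < k := by positivity
  rw [sub_lt_comm, lt_div_iff₀ h]
  constructor <;> intro h <;> linarith

end Density

theorem biangle_eq_strip (m n : ℕ) :
    biangle m n = strip (-1) 1 (fun x => 1 * jac (-1) 1 (m / 2) (n / 2) x) fun _ => 0 := by
  ext z
  rw [mem_strip_iff, biangle, mem_ofPred_eq, biangleGamma, and_comm, sub_neg_eq_add, mem_Ioo,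
    ← abs_lt, sq_lt_one_iff_abs_lt_one, sub_pos, add_comm (z 0)]

theorem triangle_eq_strip (n : ℕ) :
    triangle n = strip 0 1 (fun x => 1 * jac 0 1 (n / 2) ((0 : ℕ) / 2) x) fun _ => 0 := by
  ext z
  rw [mem_strip_iff, triangle, mem_ofPred_eq, triangleGamma, triangleGamma₂, and_comm, mem_Ioo]
  refine and_congr_right fun h => ?_
  rw [mul_pos_iff_of_pos_left h.1, pow_zero, mul_one, sub_pos]

theorem square_eq_strip :
    square = strip (-1) 1 (fun x => 1 * jac (-1) 1 ((0 : ℕ) / 2) ((0 : ℕ) / 2) x) fun _ => 0 := by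
  ext z
  rw [mem_strip_iff, square, mem_ofPred_eq, mem_Ioo, ← abs_lt, sq_lt_one_iff_abs_lt_one, pow_zero,
    pow_zero, mul_one]

theorem generalCometric_biangle {m n : ℕ} (hm : m ≠ 0) (hn : n ≠ 0) (c : ℝ) {z : Fin 2 → ℝ}
    (hz : z 0 ∈ Ioo (-1 : ℝ) 1) : generalCometric (-1) 1 m n c z = biangleCometric m n c z := by
  obtain ⟨j, rfl⟩ := Nat.exists_eq_succ_of_ne_zero hm
  obtain ⟨k, rfl⟩ := Nat.exists_eq_succ_of_ne_zero hn
  have h1 := (sub_pos.2 hz.1).ne'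
  have h2 := (sub_pos.2 hz.2).ne'
  rw [sub_neg_eq_add] at h1
  unfold generalCometric biangleCometric biangleGamma
  rw [one_mul, jac_half_sq hz, sub_neg_eq_add]
  refine matrix_two_congr (by ring) (by unfold halfSlope; push_cast; ring)
    (by unfold halfSlope; push_cast; ring) ?_
  simp only [Nat.succ_eq_add_one, Nat.add_sub_cancel]
  unfold halfSlope
  field_simp
  push_cast
  ring

theorem generalCometric_triangle {n : ℕ} (hn : n ≠ 0) (c : ℝ) {z : Fin 2 → ℝ}
    (hz : z 0 ∈ Ioo (0 : ℝ) 1) : generalCometric 0 1 n 0 c z = triangleCometric n c z := by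
  obtain ⟨k, rfl⟩ := Nat.exists_eq_succ_of_ne_zero hn
  have h1 := (sub_pos.2 hz.1).ne'
  have h2 := (sub_pos.2 hz.2).ne'
  rw [sub_zero] at h1
  unfold generalCometric triangleCometric triangleGamma₂
  rw [one_mul, jac_half_sq hz]
  refine matrix_two_congr (by ring) (by unfold halfSlope; push_cast; ring)
    (by unfold halfSlope; push_cast; ring) ?_
  simp only [Nat.succ_eq_add_one, Nat.add_sub_cancel]
  unfold halfSlope
  field_simp
  push_cast
  ring

theorem generalCometric_square (c : ℝ) {z : Fin 2 → ℝ}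
    (hz : z 0 ∈ Ioo (-1 : ℝ) 1) : generalCometric (-1) 1 0 0 c z = squareCometric c z := by
  unfold generalCometric squareCometric
  rw [one_mul, jac_half_sq hz]
  refine matrix_two_congr (by ring) (by unfold halfSlope; push_cast; ring)
    (by unfold halfSlope; push_cast; ring) ?_
  unfold halfSlope
  push_cast
  ring

/-! ### The model domains are bounded components -/

theorem even_pow_le_pow {k : ℕ} (hk : Even k) {x y : ℝ} (h : |x| ≤ |y|) : x ^ k ≤ y ^ k := by
  rw [← hk.pow_abs x, ← hk.pow_abs y]
  exact pow_le_pow_left₀ (abs_nonneg _) h k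

section Components

variable {a b : ℝ} {m n : ℕ}

theorem isOpen_halfPower_strip :
    IsOpen (strip a b (fun x => 1 * jac a b (m / 2) (n / 2) x) fun _ => 0) :=
  isOpen_strip (continuousOn_const.mul continuousOn_jac) continuousOn_const

theorem isConnected_halfPower_strip (hab : a < b) :
    IsConnected (strip a b (fun x => 1 * jac a b (m / 2) (n / 2) x) fun _ => 0) :=
  isConnected_strip hab (continuousOn_const.mul continuousOn_jac) continuousOn_const
    fun _ hx => mul_pos one_pos (jac_pos hx)

theorem isBounded_halfPower_strip :
    Bornology.IsBounded (strip a b (fun x => 1 * jac a b (m / 2) (n / 2) x) fun _ => 0) :=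
  isBounded_strip (continuous_const.mul (continuous_jac (by positivity)
    (by positivity))).continuousOn continuousOn_const

/-- Rays outside the biangle: where Γ < 0, move vertically away from the x-axis and Γ decreases.
Where Γ > 0 and |x| > 1, positivity of (1 - x)^m (1 + x)^n forces the exponent of the negative
factor to be even, and Γ does not decrease along the outward horizontal ray. -/
theorem isOnlyBoundedComponent_biangle (hm : m ≠ 0) (hn : n ≠ 0) :
    IsOnlyBoundedComponent (biangle m n) (biangleGamma m n) := by
  have h0 : Continuous fun z : Fin 2 → ℝ => z 0 := continuous_apply 0
  have hΓ : Continuous (biangleGamma m n) := by unfold biangleGamma; fun_prop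
  -- on the vertical lines `x = ± 1` the function is nonpositive
  have hline : ∀ z : Fin 2 → ℝ, 0 < biangleGamma m n z → z 0 ^ 2 ≠ 1 := by
    intro z hz h
    rcases (sq_eq_sq_iff_eq_or_eq_neg.1 (h.trans (one_pow 2).symm)) with h | h <;>
    · simp [biangleGamma, h, hm, hn] at hz
      nlinarith [sq_nonneg (z 1)]
  refine isOnlyBoundedComponent_of_rays ?_ ?_ ?_ (fun z hz => hz.1.ne') (fun z hz hz0 => ?_)
    fun z hz hz0 => ?_
  · rw [biangle_eq_strip]; exact isOpen_halfPower_strip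
  · rw [biangle_eq_strip]; exact isConnected_halfPower_strip (by norm_num)
  · rw [biangle_eq_strip]; exact isBounded_halfPower_strip
  · have h1 : closure (biangle m n) ⊆ {z | 0 ≤ biangleGamma m n z ∧ z 0 ^ 2 ≤ 1} :=
      closure_minimal (fun z hz => ⟨hz.1.le, hz.2.le⟩)
        ((isClosed_le continuous_const hΓ).inter (isClosed_le (h0.pow 2) continuous_const))
    have h2 := h1 hz
    have h3 := lt_of_le_of_ne h2.1 hz0.symm
    exact ⟨h3, lt_of_le_of_ne h2.2 (hline z h3)⟩
  rcases lt_or_gt_of_ne hz0 with hneg | hpos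
  · rcases le_total 0 (z 1) with hy | hy
    · refine ⟨![0, 1], fun h => by simpa using congrFun h 1, fun r hr => ne_of_lt ?_⟩
      refine lt_of_le_of_lt ?_ hneg
      simp [biangleGamma]
      nlinarith
    · refine ⟨![0, -1], fun h => by simpa using congrFun h 1, fun r hr => ne_of_lt ?_⟩
      refine lt_of_le_of_lt ?_ hneg
      simp [biangleGamma]
      nlinarith
  · have h1 : ¬ z 0 ^ 2 < 1 := fun h => hz ⟨hpos, h⟩
    have h2 := lt_of_le_of_ne (not_lt.1 h1) (hline z hpos).symm
    rw [one_lt_sq_iff_one_lt_abs, lt_abs] at h2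
    have hpr : 0 < (1 - z 0) ^ m * (1 + z 0) ^ n := by
      unfold biangleGamma at hpos
      nlinarith [sq_nonneg (z 1)]
    rcases h2 with h2 | h2
    · have hm' : Even m := by
        by_contra ho
        have h3 := (Nat.not_even_iff_odd.1 ho).pow_neg (by linarith : 1 - z 0 < 0)
        have h4 : 0 < (1 + z 0) ^ n := pow_pos (by linarith) n
        nlinarith
      refine ⟨![1, 0], fun h => by simpa using congrFun h 0, fun r hr => ne_of_gt ?_⟩
      refine lt_of_lt_of_le hpos ?_
      simp [biangleGamma]
      refine mul_le_mul (even_pow_le_pow hm' ?_) (pow_le_pow_left₀ (by linarith) (by linarith) n)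
        (pow_nonneg (by linarith) n) (hm'.pow_nonneg _)
      rw [abs_of_nonpos (by linarith), abs_of_nonpos (by linarith)]
      linarith
    · have hn' : Even n := by
        by_contra ho
        have h3 := (Nat.not_even_iff_odd.1 ho).pow_neg (by linarith : 1 + z 0 < 0)
        have h4 : 0 < (1 - z 0) ^ m := pow_pos (by linarith) m
        nlinarith
      refine ⟨![-1, 0], fun h => by simpa using congrFun h 0, fun r hr => ne_of_gt ?_⟩
      refine lt_of_lt_of_le hpos ?_
      simp [biangleGamma]
      refine mul_le_mul (pow_le_pow_left₀ (by linarith) (by linarith) m) (even_pow_le_pow hn' ?_)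
        (hn'.pow_nonneg _) (pow_nonneg (by linarith) m)
      rw [abs_of_nonpos (by linarith), abs_of_nonpos (by linarith)]
      linarith

/-- As for the biangle, with Γ₂ in place of Γ and rays that avoid x = 0: vertical where Γ₂ < 0, to
the left where x < 0, to the right where x > 1, in which last case n must be even. -/
theorem isOnlyBoundedComponent_triangle (hn : n ≠ 0) :
    IsOnlyBoundedComponent (triangle n) (triangleGamma n) := by
  have h0 : Continuous fun z : Fin 2 → ℝ => z 0 := continuous_apply 0
  have hΓ : Continuous (triangleGamma n) := by unfold triangleGamma triangleGamma₂; fun_prop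
  have hline : ∀ z : Fin 2 → ℝ, 0 < triangleGamma n z → z 0 ≠ 0 ∧ z 0 ≠ 1 := by
    intro z hz
    constructor <;> intro h <;> simp [triangleGamma, triangleGamma₂, h, hn] at hz
    nlinarith [sq_nonneg (z 1)]
  refine isOnlyBoundedComponent_of_rays ?_ ?_ ?_ (fun z hz => hz.1.ne') (fun z hz hz0 => ?_)
    fun z hz hz0 => ?_
  · rw [triangle_eq_strip]; exact isOpen_halfPower_strip
  · rw [triangle_eq_strip]; exact isConnected_halfPower_strip (by norm_num)
  · rw [triangle_eq_strip]; exact isBounded_halfPower_strip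
  · have h1 : closure (triangle n) ⊆ {z | 0 ≤ triangleGamma n z ∧ 0 ≤ z 0 ∧ z 0 ≤ 1} :=
      closure_minimal (fun z hz => ⟨hz.1.le, hz.2.1.le, hz.2.2.le⟩)
        ((isClosed_le continuous_const hΓ).inter ((isClosed_le continuous_const
          h0).inter (isClosed_le h0 continuous_const)))
    have h2 := h1 hz
    have h3 := lt_of_le_of_ne h2.1 hz0.symm
    have h4 := hline z h3
    exact ⟨h3, lt_of_le_of_ne h2.2.1 h4.1.symm, lt_of_le_of_ne h2.2.2 h4.2⟩
  have hx0 : z 0 ≠ 0 := left_ne_zero_of_mul hz0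
  rcases lt_or_gt_of_ne (right_ne_zero_of_mul hz0) with hneg | hpos
  · rcases le_total 0 (z 1) with hy | hy
    · refine ⟨![0, 1], fun h => by simpa using congrFun h 1, fun r hr => mul_ne_zero (by simpa)
        (ne_of_lt ?_)⟩
      refine lt_of_le_of_lt ?_ hneg
      simp [triangleGamma₂]
      nlinarith
    · refine ⟨![0, -1], fun h => by simpa using congrFun h 1, fun r hr => mul_ne_zero (by simpa)
        (ne_of_lt ?_)⟩
      refine lt_of_le_of_lt ?_ hneg
      simp [triangleGamma₂]
      nlinarith
  · have hpr : 0 < (1 - z 0) ^ n := by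
      unfold triangleGamma₂ at hpos
      nlinarith [sq_nonneg (z 1)]
    rcases lt_or_gt_of_ne hx0 with hx | hx
    · refine ⟨![-1, 0], fun h => by simpa using congrFun h 0, fun r hr => mul_ne_zero ?_
        (ne_of_gt ?_)⟩
      · simp
        linarith
      refine lt_of_lt_of_le hpos ?_
      simp [triangleGamma₂]
      exact pow_le_pow_left₀ (by linarith) (by linarith) n
    · have h1 : ¬ z 0 < 1 := fun h => hz ⟨mul_pos hx hpos, hx, h⟩
      have h2 : z 0 ≠ 1 := fun h => by simp [h, hn] at hpr
      have h3 : 1 < z 0 := lt_of_le_of_ne (not_lt.1 h1) h2.symm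
      have hn' : Even n := by
        by_contra ho
        exact absurd hpr (not_lt.2 ((Nat.not_even_iff_odd.1 ho).pow_neg
          (by linarith : 1 - z 0 < 0)).le)
      refine ⟨![1, 0], fun h => by simpa using congrFun h 0, fun r hr => mul_ne_zero ?_
        (ne_of_gt ?_)⟩
      · simp
        linarith
      refine lt_of_lt_of_le hpos ?_
      simp [triangleGamma₂]
      refine even_pow_le_pow hn' ?_
      rw [abs_of_nonpos (by linarith), abs_of_nonpos (by linarith)]
      linarith

end Components

/-! ### Passage between the models and the common form -/

section Models

variable {Φ : AdmissibleChange} {Ω : Set (Fin 2 → ℝ)}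
  {g : (Fin 2 → ℝ) → Matrix (Fin 2) (Fin 2) ℝ} {F : (Fin 2 → ℝ) → ℝ}
  {ρ : (Fin 2 → ℝ) → ℝ} {κ a b : ℝ} {m n : ℕ} {c P Q p q C : ℝ}

theorem IsGeneral.isNormalizedDensity (h : IsGeneral Φ Ω g ρ κ a b 1 m n c P Q p q C)
    (hΩ : MeasurableSet Ω) (hmass : densityMeasure Ω ρ univ = 1) (hF : Measurable F)
    (hFS : ∀ z ∈ strip a b (fun x => 1 * jac a b (m / 2) (n / 2) x) fun _ => 0,
      F z = generalDensity a b 1 m n P Q p q z) :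
    IsNormalizedDensity (strip a b (fun x => 1 * jac a b (m / 2) (n / 2) x) fun _ => 0) F
      (Φ.pushDensity ρ) := by
  refine isNormalizedDensity_of_eq isOpen_halfPower_strip.measurableSet hF
    (fun z hz => ?_) h.C_pos (fun z hz => ?_) ?_
  · rw [hFS z hz]; exact (generalDensity_pos hz).le
  · rw [hFS z hz, h.density_eq z hz]; rfl
  · rw [← h.image_eq, densityMeasure_image_univ Φ hΩ, hmass]

theorem isGeneral_of_isNormalizedDensity (hab : a < b) (hκ : 0 < κ) (hp : 0 < p) (hq : 0 < q)
    (hP : -1 < P + m / 2 * (p + q - 1)) (hQ : -1 < Q + n / 2 * (p + q - 1))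
    (hP0 : m ≠ 0 → P = 0) (hQ0 : n ≠ 0 → Q = 0) (hpar : p = q ∨ Even m ∧ Even n)
    (hc : ∀ x ∈ Ioo a b, c * ((b - x) * (x - a)) < halfSlope a b m n x ^ 2)
    (himage : Φ.toEquiv '' Ω = strip a b (fun x => 1 * jac a b (m / 2) (n / 2) x) fun _ => 0)
    (hg : ∀ z ∈ strip a b (fun x => 1 * jac a b (m / 2) (n / 2) x) fun _ => 0,
      Φ.pushCometric g z = κ • generalCometric a b m n c z)
    (hF : Measurable F)
    (hFS : ∀ z ∈ strip a b (fun x => 1 * jac a b (m / 2) (n / 2) x) fun _ => 0,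
      F z = generalDensity a b 1 m n P Q p q z)
    (hρ : IsNormalizedDensity (strip a b (fun x => 1 * jac a b (m / 2) (n / 2) x) fun _ => 0) F
      (Φ.pushDensity ρ)) :
    ∃ C, IsGeneral Φ Ω g ρ κ a b 1 m n c P Q p q C ∧ densityMeasure Ω ρ univ = 1 := by
  have hS := (isOpen_halfPower_strip (a := a) (b := b) (m := m) (n := n)).measurableSet
  have hΩ : MeasurableSet Ω := by
    rw [← Φ.toEquiv.injective.preimage_image Ω, himage]
    exact (isOpen_halfPower_strip.preimage (continuous_change Φ)).measurableSet
  have e : ∫⁻ z in strip a b (fun x => 1 * jac a b (m / 2) (n / 2) x) fun _ => 0,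
      ENNReal.ofReal (F z) = ∫⁻ z in strip a b (fun x => 1 * jac a b (m / 2) (n / 2) x)
      fun _ => 0, ENNReal.ofReal (generalDensity a b 1 m n P Q p q z) :=
    setLIntegral_congr_fun hS fun z hz => by simp only [hFS z hz]
  have h1 := lintegral_generalDensity hab one_pos hp hq hP hQ
  rw [← e] at h1
  obtain ⟨h2, h3⟩ := densityMeasure_univ_of_isNormalizedDensity hS hF
    (fun z hz => by rw [hFS z hz]; exact (generalDensity_pos hz).le) h1.2 h1.1 hρ
  refine ⟨(∫ u in strip a b (fun x => 1 * jac a b (m / 2) (n / 2) x) fun _ => 0, F u)⁻¹,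
    ⟨hab, hκ, one_pos, hp, hq, inv_pos.2 h2, hP, hQ, hP0, hQ0, hpar, hc, himage, hg,
      fun z hz => ?_⟩, ?_⟩
  · rw [hρ z hz, hFS z hz, div_eq_inv_mul]; rfl
  · rw [← densityMeasure_image_univ Φ hΩ, himage, h3]

/-- The slope vanishes at the interior point (n - m) / (n + m), where the inequality forces c < 0.
-/
theorem biangle_c_lt {m n : ℕ} (hm : m ≠ 0) (hn : n ≠ 0) :
    (∀ x ∈ Ioo (-1 : ℝ) 1, c * ((1 - x) * (x - -1)) < halfSlope (-1) 1 m n x ^ 2) ↔ c < 0 := by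
  have hm' : (0 : ℝ) < m := by positivity
  have hn' : (0 : ℝ) < n := by positivity
  constructor
  · intro h
    set x : ℝ := (n - m) / (n + m)
    have h1 : x ∈ Ioo (-1 : ℝ) 1 :=
      ⟨by rw [lt_div_iff₀ (by positivity)]; linarith, by rw [div_lt_iff₀ (by positivity)]; linarith⟩
    have h2 : halfSlope (-1) 1 m n x = 0 := by
      simp only [halfSlope, x]; field_simp; ring
    have h3 := h x h1
    rw [h2] at h3
    have h4 : 0 < (1 - x) * (x - -1) := mul_pos (by linarith [h1.2]) (by linarith [h1.1])
    by_contra hc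
    nlinarith [mul_nonneg (not_lt.1 hc) h4.le]
  · intro hc x hx
    have h4 : 0 < (1 - x) * (x - -1) := mul_pos (by linarith [hx.2]) (by linarith [hx.1])
    nlinarith [mul_pos_of_neg_of_neg hc (neg_neg_of_pos h4), sq_nonneg (halfSlope (-1) 1 m n x)]

/-- Here the slope is -n x / 2 and vanishes only at the excluded end x = 0, so that the value c = 0
remains admissible. -/
theorem triangle_c_lt {n : ℕ} (hn : n ≠ 0) :
    (∀ x ∈ Ioo (0 : ℝ) 1, c * ((1 - x) * (x - 0)) < halfSlope 0 1 n 0 x ^ 2) ↔ c ≤ 0 := by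
  have hn' : (1 : ℝ) ≤ n := by exact_mod_cast Nat.one_le_iff_ne_zero.2 hn
  have e : ∀ x : ℝ, halfSlope 0 1 n 0 x = -(n * x / 2) := fun x => by
    simp only [halfSlope]; push_cast; ring
  constructor
  · intro h
    by_contra hc
    rw [not_le] at hc
    -- For this x one has n² x² / 4 ≤ c x / 4 < c x / 2 ≤ c x (1 - x), against the strict
    -- inequality.
    set x : ℝ := min (1 / 2) (c / n ^ 2)
    have hx0 : 0 < x := lt_min (by norm_num) (by positivity)
    have hx1 : x ≤ 1 / 2 := min_le_left _ _
    have hx2 : x * n ^ 2 ≤ c := (le_div_iff₀ (by positivity)).1 (min_le_right _ _)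
    have h1 := h x ⟨hx0, by linarith⟩
    rw [e, neg_sq] at h1
    nlinarith [mul_le_mul_of_nonneg_right hx2 hx0.le, mul_pos hc hx0,
      mul_le_mul_of_nonneg_left hx1 (mul_pos hc hx0).le]
  · intro hc x hx
    have h4 : 0 < (1 - x) * (x - 0) := mul_pos (by linarith [hx.2]) (by linarith [hx.1])
    have h5 : 0 < (n * x / 2) ^ 2 := by have := hx.1; positivity
    rw [e, neg_sq]
    nlinarith [mul_nonneg_of_nonpos_of_nonpos hc (neg_nonpos.2 h4.le)]

theorem square_c_lt :
    (∀ x ∈ Ioo (-1 : ℝ) 1, c * ((1 - x) * (x - -1)) < halfSlope (-1) 1 0 0 x ^ 2) ↔ c < 0 := by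
  have e : ∀ x : ℝ, halfSlope (-1) 1 0 0 x = 0 := fun x => by
    simp only [halfSlope]; push_cast; ring
  simp only [e]
  constructor
  · intro h
    have := h 0 ⟨by norm_num, by norm_num⟩
    norm_num at this
    exact this
  · intro hc x hx
    have h4 : 0 < (1 - x) * (x - -1) := mul_pos (by linarith [hx.2]) (by linarith [hx.1])
    nlinarith [mul_pos_of_neg_of_neg hc (neg_neg_of_pos h4)]

theorem biangle_density_odd {m n : ℕ} {z : Fin 2 → ℝ}
    (hz : z ∈ strip (-1) 1 (fun x => 1 * jac (-1) 1 (m / 2) (n / 2) x) fun _ => 0) :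
    biangleGamma m n z ^ (p - 1) = generalDensity (-1) 1 1 m n 0 0 p p z := by
  rw [generalDensity_of_eq hz, biangleGamma, jac, Real.rpow_zero, Real.rpow_zero, one_mul, one_mul,
    sub_neg_eq_add, add_comm (z 0)]

theorem biangle_density_even {m n : ℕ} (hm : Even m) (hn : Even n) (z : Fin 2 → ℝ) :
    ((1 - z 0) ^ (m / 2) * (1 + z 0) ^ (n / 2) + z 1) ^ (p - 1) *
        ((1 - z 0) ^ (m / 2) * (1 + z 0) ^ (n / 2) - z 1) ^ (q - 1) =
      generalDensity (-1) 1 1 m n 0 0 p q z := by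
  rw [generalDensity_of_even hm hn, jac, Real.rpow_zero, Real.rpow_zero, one_mul, one_mul,
    sub_neg_eq_add, add_comm (z 0)]

theorem triangle_density_odd {n : ℕ} {z : Fin 2 → ℝ}
    (hz : z ∈ strip 0 1 (fun x => 1 * jac 0 1 (n / 2) ((0 : ℕ) / 2) x) fun _ => 0) :
    z 0 ^ Q * triangleGamma₂ n z ^ (p - 1) = generalDensity 0 1 1 n 0 0 Q p p z := by
  rw [generalDensity_of_eq hz, triangleGamma₂, jac, Real.rpow_zero, one_mul, sub_zero, pow_zero,
    mul_one]

theorem triangle_density_even {n : ℕ} (hn : Even n) (z : Fin 2 → ℝ) :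
    z 0 ^ Q * ((1 - z 0) ^ (n / 2) + z 1) ^ (p - 1) * ((1 - z 0) ^ (n / 2) - z 1) ^ (q - 1) =
      generalDensity 0 1 1 n 0 0 Q p q z := by
  rw [generalDensity_of_even hn Even.zero, jac, Real.rpow_zero, one_mul, sub_zero, Nat.zero_div,
    pow_zero, mul_one, mul_assoc]

theorem square_density (z : Fin 2 → ℝ) :
    (1 - z 0) ^ P * (1 + z 0) ^ Q * ((1 - z 1) ^ (q - 1) * (1 + z 1) ^ (p - 1)) =
      generalDensity (-1) 1 1 0 0 P Q p q z := by
  rw [generalDensity_of_even Even.zero Even.zero, jac, Nat.zero_div, pow_zero, pow_zero, mul_one,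
    sub_neg_eq_add, add_comm (z 0), mul_comm ((1 - z 1) ^ (q - 1))]

theorem measurable_biangleGamma (m n : ℕ) : Measurable (biangleGamma m n) :=
  Continuous.measurable (by unfold biangleGamma; fun_prop)

theorem measurable_triangleGamma₂ (n : ℕ) : Measurable (triangleGamma₂ n) :=
  Continuous.measurable (by unfold triangleGamma₂; fun_prop)

/-- The triple is, after the change of variables `Φ` and a rescaling of the cometric, one of the
models. -/
def IsModel (Φ : AdmissibleChange) (κ : ℝ) (Ω : Set (Fin 2 → ℝ))
    (g : (Fin 2 → ℝ) → Matrix (Fin 2) (Fin 2) ℝ) (ρ : (Fin 2 → ℝ) → ℝ) : Prop :=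
  (∃ (m n : ℕ) (c : ℝ), 1 ≤ m ∧ 1 ≤ n ∧ c < 0 ∧
      Φ.toEquiv '' Ω = biangle m n ∧
      IsOnlyBoundedComponent (biangle m n) (biangleGamma m n) ∧
      (∀ z ∈ biangle m n, Φ.pushCometric g z = κ • biangleCometric m n c z) ∧
      IsBiangleDensity m n (Φ.pushDensity ρ)) ∨
    (∃ (n : ℕ) (c : ℝ), 1 ≤ n ∧ c ≤ 0 ∧
      Φ.toEquiv '' Ω = triangle n ∧
      IsOnlyBoundedComponent (triangle n) (triangleGamma n) ∧
      (∀ z ∈ triangle n, Φ.pushCometric g z = κ • triangleCometric n c z) ∧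
      IsTriangleDensity n (Φ.pushDensity ρ)) ∨
    (∃ c : ℝ, c < 0 ∧
      Φ.toEquiv '' Ω = square ∧
      (∀ z ∈ square, Φ.pushCometric g z = κ • squareCometric c z) ∧
      IsSquareDensity (Φ.pushDensity ρ))

theorem IsGeneral.isModel_biangle (h : IsGeneral Φ Ω g ρ κ (-1) 1 1 m n c P Q p q C)
    (hm : m ≠ 0) (hn : n ≠ 0) (hΩ : MeasurableSet Ω) (hmass : densityMeasure Ω ρ univ = 1) :
    IsModel Φ κ Ω g ρ := by
  have hS := biangle_eq_strip m n
  have hP := h.P_eq hm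
  have hQ := h.Q_eq hn
  have h1 := h.P_gt
  have h2 := h.Q_gt
  rw [hP, exponent_lt_iff hm] at h1
  rw [hQ, exponent_lt_iff hn] at h2
  refine Or.inl ⟨m, n, c, Nat.one_le_iff_ne_zero.2 hm, Nat.one_le_iff_ne_zero.2 hn,
    (biangle_c_lt hm hn).1 h.c_lt, by rw [hS, h.image_eq], isOnlyBoundedComponent_biangle hm hn,
    fun z hz => ?_, ?_⟩
  · rw [hS] at hz
    rw [h.cometric_eq z hz, ← generalCometric_biangle hm hn c hz.1]
    rfl
  by_cases hpar : Even m ∧ Even n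
  · refine Or.inr ⟨hpar.1, hpar.2, p, q, h.p_pos, h.q_pos, h2, h1, ?_⟩
    rw [hS]
    refine h.isNormalizedDensity hΩ hmass (by fun_prop) fun z _ => ?_
    rw [biangle_density_even hpar.1 hpar.2, hP, hQ]
  · have hpq := h.parity.resolve_right hpar
    refine Or.inl ⟨?_, p, h.p_pos, ?_, ?_, ?_⟩
    · by_contra ho
      rw [not_or, Nat.not_odd_iff_even, Nat.not_odd_iff_even] at ho
      exact hpar ho
    · rw [← hpq, show (2 : ℝ) / n = 2 * (1 / n) by ring] at h2; linarith
    · rw [← hpq, show (2 : ℝ) / m = 2 * (1 / m) by ring] at h1; linarith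
    · rw [hS]
      refine h.isNormalizedDensity hΩ hmass ((measurable_biangleGamma m n).pow_const _)
        fun z hz => ?_
      rw [biangle_density_odd hz, hP, hQ, ← hpq]

theorem IsGeneral.isModel_triangle (h : IsGeneral Φ Ω g ρ κ 0 1 1 n 0 c P Q p q C)
    (hn : n ≠ 0) (hΩ : MeasurableSet Ω) (hmass : densityMeasure Ω ρ univ = 1) :
    IsModel Φ κ Ω g ρ := by
  have hS := triangle_eq_strip n
  have hP := h.P_eq hn
  have h1 := h.P_gt
  have h2 := h.Q_gt
  rw [hP, exponent_lt_iff hn] at h1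
  have hQ : 0 < Q + 1 := by simp at h2; linarith
  have e : Q = Q + 1 - 1 := by ring
  refine Or.inr (Or.inl ⟨n, c, Nat.one_le_iff_ne_zero.2 hn,
    (triangle_c_lt hn).1 h.c_lt, by rw [hS, h.image_eq], isOnlyBoundedComponent_triangle hn,
    fun z hz => ?_, ?_⟩)
  · rw [hS] at hz
    rw [h.cometric_eq z hz, ← generalCometric_triangle hn c hz.1]
    rfl
  by_cases hpar : Even n
  · refine Or.inr ⟨hpar, p, q, Q + 1, h.p_pos, h.q_pos, hQ, h1, ?_⟩
    rw [hS]
    refine h.isNormalizedDensity hΩ hmass (by fun_prop) fun z _ => ?_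
    rw [triangle_density_even hpar, hP, ← e]
  · have hpq := h.parity.resolve_right fun h' => hpar h'.1
    refine Or.inl ⟨Nat.not_even_iff_odd.1 hpar, p, Q + 1, hQ, h.p_pos, ?_, ?_⟩
    · rw [← hpq, show (2 : ℝ) / n = 2 * (1 / n) by ring] at h1; linarith
    · rw [hS]
      refine h.isNormalizedDensity hΩ hmass
        (((measurable_pi_apply 0).pow_const _).mul ((measurable_triangleGamma₂ n).pow_const _))
        fun z hz => ?_
      rw [triangle_density_odd hz, hP, ← hpq, ← e]

theorem IsGeneral.isModel_square (h : IsGeneral Φ Ω g ρ κ (-1) 1 1 0 0 c P Q p q C)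
    (hΩ : MeasurableSet Ω) (hmass : densityMeasure Ω ρ univ = 1) : IsModel Φ κ Ω g ρ := by
  have hS := square_eq_strip
  have h1 := h.P_gt
  have h2 := h.Q_gt
  refine Or.inr (Or.inr ⟨c, square_c_lt.1 h.c_lt, by rw [hS, h.image_eq], fun z hz => ?_,
    P + 1, Q + 1, q, p, by simp at h1; linarith, by simp at h2; linarith, h.q_pos, h.p_pos, ?_⟩)
  · rw [hS] at hz
    rw [h.cometric_eq z hz, ← generalCometric_square c hz.1]
    rfl
  · rw [hS]
    refine h.isNormalizedDensity hΩ hmass (by fun_prop) fun z _ => ?_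
    rw [← square_density, add_sub_cancel_right, add_sub_cancel_right]

/-- The zero pattern of the two exponents decides the model; a reflection in x is needed if only the
exponent at b vanishes, because the triangle has its vertex or cusp on the right. -/
theorem IsGeneral.exists_isModel {lam : ℝ} (h : IsGeneral Φ Ω g ρ κ a b lam m n c P Q p q C)
    (hΩ : MeasurableSet Ω) (hmass : densityMeasure Ω ρ univ = 1) :
    ∃ (Φ : AdmissibleChange) (κ : ℝ), 0 < κ ∧ IsModel Φ κ Ω g ρ := by
  by_cases hm : m = 0
  · subst hm
    by_cases hn : n = 0
    · subst hn
      obtain ⟨Φ', C', h'⟩ := h.normalize (a' := -1) (b' := 1) (by norm_num)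
      exact ⟨Φ', κ, h.κ_pos, h'.isModel_square hΩ hmass⟩
    · obtain ⟨C₁, h₁⟩ := h.reflect_x
      obtain ⟨Φ', C', h'⟩ := h₁.normalize (a' := 0) (b' := 1) (by norm_num)
      exact ⟨Φ', κ, h.κ_pos, h'.isModel_triangle hn hΩ hmass⟩
  · by_cases hn : n = 0
    · subst hn
      obtain ⟨Φ', C', h'⟩ := h.normalize (a' := 0) (b' := 1) (by norm_num)
      exact ⟨Φ', κ, h.κ_pos, h'.isModel_triangle hm hΩ hmass⟩
    · obtain ⟨Φ', C', h'⟩ := h.normalize (a' := -1) (b' := 1) (by norm_num)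
      exact ⟨Φ', κ, h.κ_pos, h'.isModel_biangle hm hn hΩ hmass⟩

theorem IsModel.exists_isGeneral (h : IsModel Φ κ Ω g ρ) (hκ : 0 < κ) :
    ∃ (a b : ℝ) (m n : ℕ) (c P Q p q C : ℝ), IsGeneral Φ Ω g ρ κ a b 1 m n c P Q p q C ∧
      densityMeasure Ω ρ univ = 1 := by
  rcases h with ⟨m, n, c, hm, hn, hc, himage, -, hg, hρ⟩ | ⟨n, c, hn, hc, himage, -, hg, hρ⟩ |
    ⟨c, hc, himage, hg, p, q, r, s, hp, hq, hr, hs, hρ⟩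
  · rw [Nat.one_le_iff_ne_zero] at hm hn
    have hS := biangle_eq_strip m n
    have key : ∀ p q : ℝ, 0 < p → 0 < q → (1 : ℝ) - 2 / n < p + q → (1 : ℝ) - 2 / m < p + q →
        (p = q ∨ Even m ∧ Even n) → ∀ F : (Fin 2 → ℝ) → ℝ, Measurable F →
        (∀ z ∈ biangle m n, F z = generalDensity (-1) 1 1 m n 0 0 p q z) →
        IsNormalizedDensity (biangle m n) F (Φ.pushDensity ρ) →
        ∃ C, IsGeneral Φ Ω g ρ κ (-1) 1 1 m n c 0 0 p q C ∧ densityMeasure Ω ρ univ = 1 := by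
      intro p q hp hq h1 h2 hpar F hF hFS hN
      rw [hS] at himage hg hFS hN
      refine isGeneral_of_isNormalizedDensity (by norm_num) hκ hp hq ((exponent_lt_iff hm _).2 h2)
        ((exponent_lt_iff hn _).2 h1) (fun _ => rfl) (fun _ => rfl) hpar
        ((biangle_c_lt hm hn).2 hc) himage (fun z hz => ?_) hF hFS hN
      rw [hg z hz, generalCometric_biangle hm hn c hz.1]
    rcases hρ with ⟨ho, p, hp, h1, h2, hN⟩ | ⟨hm2, hn2, p, q, hp, hq, h1, h2, hN⟩
    · obtain ⟨C, hC⟩ := key p p hp hp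
        (by rw [show (2 : ℝ) / n = 2 * (1 / n) by ring]; linarith)
        (by rw [show (2 : ℝ) / m = 2 * (1 / m) by ring]; linarith) (Or.inl rfl) _
        ((measurable_biangleGamma m n).pow_const _)
        (fun z hz => biangle_density_odd (by rwa [hS] at hz)) hN
      exact ⟨_, _, _, _, _, _, _, _, _, C, hC⟩
    · obtain ⟨C, hC⟩ := key p q hp hq h1 h2 (Or.inr ⟨hm2, hn2⟩) _ (by fun_prop)
        (fun z _ => biangle_density_even hm2 hn2 z) hN
      exact ⟨_, _, _, _, _, _, _, _, _, C, hC⟩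
  · rw [Nat.one_le_iff_ne_zero] at hn
    have hS := triangle_eq_strip n
    have key : ∀ p q r : ℝ, 0 < p → 0 < q → 0 < r → (1 : ℝ) - 2 / n < p + q →
        (p = q ∨ Even n) → ∀ F : (Fin 2 → ℝ) → ℝ, Measurable F →
        (∀ z ∈ triangle n, F z = generalDensity 0 1 1 n 0 0 (r - 1) p q z) →
        IsNormalizedDensity (triangle n) F (Φ.pushDensity ρ) →
        ∃ C, IsGeneral Φ Ω g ρ κ 0 1 1 n 0 c 0 (r - 1) p q C ∧ densityMeasure Ω ρ univ = 1 := by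
      intro p q r hp hq hr h1 hpar F hF hFS hN
      rw [hS] at himage hg hFS hN
      refine isGeneral_of_isNormalizedDensity (by norm_num) hκ hp hq ((exponent_lt_iff hn _).2 h1)
        (by simpa using hr) (fun _ => rfl) (fun h => absurd rfl h)
        (hpar.imp_right fun h => ⟨h, Even.zero⟩)
        ((triangle_c_lt hn).2 hc) himage (fun z hz => ?_) hF hFS hN
      rw [hg z hz, generalCometric_triangle hn c hz.1]
    rcases hρ with ⟨ho, p, r, hr, hp, h1, hN⟩ | ⟨hn2, p, q, r, hp, hq, hr, h1, hN⟩
    · obtain ⟨C, hC⟩ := key p p r hp hp hr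
        (by rw [show (2 : ℝ) / n = 2 * (1 / n) by ring]; linarith) (Or.inl rfl) _
        (((measurable_pi_apply 0).pow_const _).mul ((measurable_triangleGamma₂ n).pow_const _))
        (fun z hz => triangle_density_odd (by rwa [hS] at hz)) hN
      exact ⟨_, _, _, _, _, _, _, _, _, C, hC⟩
    · obtain ⟨C, hC⟩ := key p q r hp hq hr h1 (Or.inr hn2) _ (by fun_prop)
        (fun z _ => triangle_density_even hn2 z) hN
      exact ⟨_, _, _, _, _, _, _, _, _, C, hC⟩
  · rw [square_eq_strip] at himage hg hρ
    obtain ⟨C, hC⟩ := isGeneral_of_isNormalizedDensity (P := p - 1) (Q := q - 1) (p := s) (q := r)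
      (m := 0) (n := 0) (by norm_num) hκ hs hr (by simpa using hp) (by simpa using hq)
      (fun h => absurd rfl h) (fun h => absurd rfl h) (Or.inr ⟨Even.zero, Even.zero⟩)
      (square_c_lt.2 hc) himage
      (fun z hz => by rw [hg z hz, generalCometric_square c hz.1]) (by fun_prop)
      (fun z _ => square_density z) hρ
    exact ⟨_, _, _, _, _, _, _, _, _, C, hC⟩

end Models

/-! ### Eigenbases and density of polynomials on bounded domains -/

/-- The spectral theorem for an inner product on a finite-dimensional space without a norm. -/
theorem exists_orthogonal_eigenbasis {V : Type*} [AddCommGroup V] [Module ℝ V]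
    [FiniteDimensional ℝ V] (core : InnerProductSpace.Core ℝ V) (T : V →ₗ[ℝ] V)
    (hT : ∀ x y, core.inner (T x) y = core.inner x (T y)) :
    ∃ (N : ℕ) (e : Module.Basis (Fin N) ℝ V), (∀ i j, i ≠ j → core.inner (e i) (e j) = 0) ∧
      ∀ i, ∃ θ : ℝ, T (e i) = θ • e i := by
  let _ : NormedAddCommGroup V := core.toNormedAddCommGroup
  let _ : InnerProductSpace ℝ V := InnerProductSpace.ofCore core.toCore
  have hs : T.IsSymmetric := hT
  refine ⟨_, (hs.eigenvectorBasis rfl).toBasis, fun i j hij => ?_, fun i => ⟨hs.eigenvalues rfl i,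
    ?_⟩⟩
  · rw [OrthonormalBasis.coe_toBasis]
    exact (hs.eigenvectorBasis rfl).orthonormal.2 hij
  · rw [OrthonormalBasis.coe_toBasis]
    exact hs.apply_eigenvectorBasis rfl i

theorem finiteDimensional_weightedDegreeLE {d : ℕ} {w : Fin d → ℝ} (hw : ∀ i, 0 < w i) (n : ℝ) :
    FiniteDimensional ℝ (weightedDegreeLE w n) := by
  have hfin : {k : Fin d →₀ ℕ | ∑ i, w i * (k i : ℝ) ≤ n}.Finite := by
    refine (Set.finite_Iic (Finsupp.equivFunOnFinite.symm fun i => ⌊n / w i⌋₊)).subset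
      fun k hk i => ?_
    have h1 : w i * (k i : ℝ) ≤ n := le_trans
      (Finset.single_le_sum (f := fun i => w i * (k i : ℝ))
        (fun j _ => mul_nonneg (hw j).le (Nat.cast_nonneg _)) (Finset.mem_univ i)) hk
    have h2 : (k i : ℝ) ≤ n / w i := by rwa [le_div_iff₀ (hw i), mul_comm]
    simpa using Nat.le_floor h2
  have := hfin.to_subtype
  exact Module.Finite.of_basis (MvPolynomial.basisRestrictSupport ℝ _)

section Bounded

variable {Ω : Set (Fin 2 → ℝ)} {g : (Fin 2 → ℝ) → Matrix (Fin 2) (Fin 2) ℝ}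
  {b : (Fin 2 → ℝ) → Fin 2 → ℝ} {ρ : (Fin 2 → ℝ) → ℝ}

/-- Positivity of ρ turns the vanishing integral into the vanishing of P on Ω, and a polynomial is
determined by its values on a box inside Ω. -/
theorem eq_zero_of_integral_sq_eq_zero (hΩ : IsOpen Ω) (hne : Ω.Nonempty)
    (hb : Bornology.IsBounded Ω) (hfin : IsFiniteMeasure (densityMeasure Ω ρ))
    (hρ : ContinuousOn ρ Ω) (hρ0 : ∀ z ∈ Ω, 0 < ρ z) {P : MvPolynomial (Fin 2) ℝ}
    (h : ∫ z, MvPolynomial.eval z P * MvPolynomial.eval z P ∂densityMeasure Ω ρ = 0) : P = 0 := by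
  have hc := MvPolynomial.continuous_eval P
  rw [integral_eq_zero_iff_of_nonneg (fun z => mul_self_nonneg _)
    (integrable_of_continuous_of_isBounded hΩ hb hfin (hc.mul hc))] at h
  have h1 : ∀ᵐ z ∂volume.restrict Ω, MvPolynomial.eval z P = 0 := by
    rw [densityMeasure, Filter.EventuallyEq, ae_withDensity_iff_ae_restrict'
      (hρ.aemeasurable hΩ.measurableSet).ennreal_ofReal] at h
    have h2 := (ae_restrict_iff'₀ ((hρ.aemeasurable hΩ.measurableSet).ennreal_ofReal.nullMeasurable
      (measurableSet_singleton 0).compl)).1 h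
    filter_upwards [h2, ae_restrict_mem hΩ.measurableSet] with z hz hzΩ
    exact mul_self_eq_zero.1 (hz (ENNReal.ofReal_pos.2 (hρ0 z hzΩ)).ne')
  have h2 : ∀ z ∈ Ω, MvPolynomial.eval z P = 0 :=
    Measure.eqOn_open_of_ae_eq (μ := volume) h1 hΩ hc.continuousOn continuousOn_const
  obtain ⟨z₀, hz₀⟩ := hne
  obtain ⟨ε, hε, hball⟩ := Metric.isOpen_iff.1 hΩ z₀ hz₀
  refine MvPolynomial.funext_set (fun i => Metric.ball (z₀ i) ε) (fun i => ?_) fun z hz => ?_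
  · rw [Real.ball_eq_Ioo]; exact Ioo_infinite (by linarith)
  · rw [map_zero]
    exact h2 z (hball ((ball_pi z₀ hε).symm ▸ hz))

/-- The L²(μ) product is positive definite on polynomials because ρ > 0 on a nonempty open set, and
T restricts to a symmetric endomorphism of a finite-dimensional space. -/
theorem exists_eigenbasis_of_symmetric {w : Fin 2 → ℝ} (hw : ∀ i, 0 < w i) (hΩ : IsOpen Ω)
    (hne : Ω.Nonempty) (hb : Bornology.IsBounded Ω) (hfin : IsFiniteMeasure (densityMeasure Ω ρ))
    (hρ : ContinuousOn ρ Ω) (hρ0 : ∀ z ∈ Ω, 0 < ρ z) (n : ℝ)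
    (T : MvPolynomial (Fin 2) ℝ →ₗ[ℝ] MvPolynomial (Fin 2) ℝ)
    (hTn : ∀ P ∈ weightedDegreeLE w n, T P ∈ weightedDegreeLE w n)
    (hT : ∀ P, ∀ z ∈ Ω, diffusionOp g b P z = MvPolynomial.eval z (T P))
    (hsymm : ∀ P R : MvPolynomial (Fin 2) ℝ,
      ∫ z, MvPolynomial.eval z (T P) * MvPolynomial.eval z R ∂densityMeasure Ω ρ =
        ∫ z, MvPolynomial.eval z P * MvPolynomial.eval z (T R) ∂densityMeasure Ω ρ) :
    ∃ (N : ℕ) (e : Module.Basis (Fin N) ℝ (weightedDegreeLE w n)),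
    (∀ i j, i ≠ j → ∫ z, MvPolynomial.eval z (e i : MvPolynomial (Fin 2) ℝ) *
        MvPolynomial.eval z (e j : MvPolynomial (Fin 2) ℝ) ∂(densityMeasure Ω ρ) = 0) ∧
    ∀ i, ∃ θ : ℝ, ∀ z ∈ Ω, diffusionOp g b (e i : MvPolynomial (Fin 2) ℝ) z =
      θ * MvPolynomial.eval z (e i : MvPolynomial (Fin 2) ℝ) := by
  have := finiteDimensional_weightedDegreeLE hw n
  have hint : ∀ P R : MvPolynomial (Fin 2) ℝ, Integrable
      (fun z => MvPolynomial.eval z P * MvPolynomial.eval z R) (densityMeasure Ω ρ) := fun P R =>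
    integrable_of_continuous_of_isBounded hΩ hb hfin
      ((MvPolynomial.continuous_eval P).mul (MvPolynomial.continuous_eval R))
  let core : InnerProductSpace.Core ℝ (weightedDegreeLE w n) :=
    { inner := fun P R => ∫ z, MvPolynomial.eval z (P : MvPolynomial (Fin 2) ℝ) *
        MvPolynomial.eval z (R : MvPolynomial (Fin 2) ℝ) ∂densityMeasure Ω ρ
      conj_inner_symm := fun P R => by simp only [mul_comm, conj_trivial]
      re_inner_nonneg := fun P => integral_nonneg fun z => mul_self_nonneg _
      add_left := fun P Q R => by
        simp only [Submodule.coe_add, map_add, add_mul]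
        exact integral_add (hint _ _) (hint _ _)
      smul_left := fun P R c => by
        simp only [Submodule.coe_smul, MvPolynomial.smul_eval, mul_assoc, integral_const_mul,
          conj_trivial]
      definite := fun P hP => Subtype.ext
        (eq_zero_of_integral_sq_eq_zero hΩ hne hb hfin hρ hρ0 hP) }
  obtain ⟨N, e, he, hθ⟩ := exists_orthogonal_eigenbasis core (T.restrict hTn)
    fun P R => hsymm P R
  refine ⟨N, e, he, fun i => ?_⟩
  obtain ⟨θ, h⟩ := hθ i
  refine ⟨θ, fun z hz => ?_⟩
  have h' := congrArg (fun P : weightedDegreeLE w n =>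
    MvPolynomial.eval z (P : MvPolynomial (Fin 2) ℝ)) h
  rw [hT _ z hz]
  simpa [MvPolynomial.smul_eval] using h'

theorem exists_mvPolynomial_near_of_isCompact {d : ℕ} {f : (Fin d → ℝ) → ℝ} (hf : Continuous f)
    {K : Set (Fin d → ℝ)} (hK : IsCompact K) {ε : ℝ} (hε : 0 < ε) :
    ∃ P : MvPolynomial (Fin d) ℝ, ∀ z ∈ K, |f z - MvPolynomial.eval z P| < ε := by
  let ev : MvPolynomial (Fin d) ℝ →ₐ[ℝ] C(Fin d → ℝ, ℝ) :=
    MvPolynomial.aeval fun i => ⟨fun z => z i, continuous_apply i⟩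
  have hev : ∀ P z, ev P z = MvPolynomial.eval z P := by
    intro P z
    induction P using MvPolynomial.induction_on with
    | C c => simp [ev]
    | add P Q hP hQ => rw [map_add, map_add, ContinuousMap.add_apply, hP, hQ]
    | mul_X P i hP => rw [map_mul, map_mul, ContinuousMap.mul_apply, hP]; simp [ev]
  have hsep : ev.range.SeparatesPoints := by
    intro x y hxy
    obtain ⟨i, hi⟩ := Function.ne_iff.1 hxy
    exact ⟨_, ⟨ev (MvPolynomial.X i), ⟨_, rfl⟩, rfl⟩, by simpa [hev] using hi⟩
  obtain ⟨_, ⟨P, rfl⟩, hP⟩ :=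
    ContinuousMap.exists_mem_subalgebra_near_continuous_of_isCompact_of_separatesPoints hsep
      ⟨f, hf⟩ hK hε
  refine ⟨P, fun z hz => ?_⟩
  have := hP z hz
  rw [Real.norm_eq_abs, abs_sub_comm] at this
  simpa [hev] using this

/-- First approximate in L² by a continuous function of compact support, then that function
uniformly on the compact closure of Ω by a polynomial; μ being finite, the uniform error controls
the L² error. -/
theorem exists_mvPolynomial_eLpNorm_sub_lt (hΩ : IsOpen Ω) (hb : Bornology.IsBounded Ω)
    (hfin : IsFiniteMeasure (densityMeasure Ω ρ)) {f : (Fin 2 → ℝ) → ℝ}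
    (hf : MemLp f 2 (densityMeasure Ω ρ)) {ε : ENNReal} (hε : 0 < ε) :
    ∃ P : MvPolynomial (Fin 2) ℝ,
      eLpNorm (fun z => f z - MvPolynomial.eval z P) 2 (densityMeasure Ω ρ) < ε := by
  rcases eq_or_ne ε ⊤ with rfl | hε'
  · refine ⟨0, ?_⟩
    simpa using hf.2
  set μ := densityMeasure Ω ρ
  obtain ⟨h, -, hfh, hh, -⟩ := hf.exists_hasCompactSupport_eLpNorm_sub_le (by norm_num)
    (ENNReal.half_pos hε.ne').ne'
  have hM : μ univ ^ (2 : ENNReal).toReal⁻¹ ≠ ⊤ :=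
    ENNReal.rpow_ne_top_of_nonneg (by simp) (measure_ne_top _ _)
  obtain ⟨δ, hδ, hδε⟩ : ∃ δ : ℝ, 0 < δ ∧
      μ univ ^ (2 : ENNReal).toReal⁻¹ * ENNReal.ofReal δ < ε / 2 := by
    obtain ⟨δ, hδ, h1⟩ := ENNReal.exists_nnreal_pos_mul_lt hM (ENNReal.half_pos hε.ne').ne'
    exact ⟨δ, hδ, by rwa [ENNReal.ofReal_coe_nnreal, mul_comm]⟩
  obtain ⟨P, hP⟩ := exists_mvPolynomial_near_of_isCompact hh hb.isCompact_closure hδ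
  refine ⟨P, ?_⟩
  have e : (fun z => f z - MvPolynomial.eval z P) =
      (f - h) + fun z => h z - MvPolynomial.eval z P := by
    ext z; simp
  have hPc := MvPolynomial.continuous_eval P
  rw [e]
  calc _ ≤ eLpNorm (f - h) 2 μ + eLpNorm (fun z => h z - MvPolynomial.eval z P) 2 μ :=
        eLpNorm_add_le (hf.1.sub hh.aestronglyMeasurable) (hh.sub hPc).aestronglyMeasurable
          (by norm_num)
    _ < ε / 2 + ε / 2 := ENNReal.add_lt_add_of_le_of_lt
        (ne_top_of_le_ne_top (ENNReal.div_ne_top hε' (by norm_num)) hfh) hfh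
        (lt_of_le_of_lt (eLpNorm_le_of_ae_bound ?_) hδε)
    _ = ε := ENNReal.add_halves ε
  filter_upwards [ae_mem_densityMeasure hΩ] with z hz
  exact (hP z (subset_closure hz)).le

end Bounded

/-! ### Integration by parts on strips -/

theorem hasDerivAt_mvPolynomial_eval_comp {d : ℕ} (φ : MvPolynomial (Fin d) ℝ)
    {γ : ℝ → Fin d → ℝ} {γ' : Fin d → ℝ} {x : ℝ} (hγ : ∀ i, HasDerivAt (fun x => γ x i) (γ' i) x) :
    HasDerivAt (fun x => MvPolynomial.eval (γ x) φ)
      (∑ i, γ' i * MvPolynomial.eval (γ x) (MvPolynomial.pderiv i φ)) x := by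
  induction φ using MvPolynomial.induction_on with
  | C c => simpa using hasDerivAt_const x c
  | add P Q hP hQ =>
    simp only [map_add, mul_add, Finset.sum_add_distrib]
    exact hP.add hQ
  | mul_X P k hP =>
    have h := hP.mul (hγ k)
    have e : (fun x => MvPolynomial.eval (γ x) (P * MvPolynomial.X k)) =
        (fun x => MvPolynomial.eval (γ x) P) * fun x => γ x k := by
      ext x; simp
    rw [e]
    refine h.congr_deriv ?_
    simp only [Derivation.leibniz, MvPolynomial.pderiv_X, smul_eq_mul, map_add, map_mul,
      MvPolynomial.eval_X, mul_add, Finset.sum_add_distrib, Finset.sum_mul]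
    rw [add_comm]
    congr 1
    · rw [Finset.sum_eq_single k (fun i _ hi => by simp [hi.symm])
        (fun h => absurd (Finset.mem_univ k) h)]
      simp [mul_comm]
    · exact Finset.sum_congr rfl fun i _ => by ring

section Product

variable {a b a' b' : ℝ}

theorem integrable_prod_Ioo_mul {k K : ℝ → ℝ} {Ψ : ℝ × ℝ → ℝ} (hk : IntegrableOn k (Ioo a b))
    (hK : IntegrableOn K (Ioo a' b')) (hΨ : Continuous Ψ) :
    Integrable (fun z : ℝ × ℝ => k z.1 * K z.2 * Ψ z)
      ((volume.restrict (Ioo a b)).prod (volume.restrict (Ioo a' b'))) := by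
  obtain ⟨B, hB⟩ := (isCompact_Icc (a := a) (b := b)).prod (isCompact_Icc (a := a') (b := b'))
    |>.exists_bound_of_continuousOn hΨ.continuousOn
  refine (Integrable.mul_prod hk hK).mul_bdd (c := B) hΨ.aestronglyMeasurable ?_
  rw [Measure.prod_restrict]
  refine (ae_restrict_iff' (measurableSet_Ioo.prod measurableSet_Ioo)).2 (ae_of_all _ fun z hz => ?_)
  exact hB z ⟨Ioo_subset_Icc_self hz.1, Ioo_subset_Icc_self hz.2⟩

/-- The expression `F` is controlled only inside the interval, where real powers can be
differentiated. Its continuous extension `E` carries the boundary values for the fundamental theorem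
of calculus. -/
theorem setIntegral_deriv_eq_zero (hab : a < b) {F f E : ℝ → ℝ}
    (hF : ∀ x ∈ Ioo a b, HasDerivAt F (f x) x) (hE : Continuous E) (ha : E a = 0) (hb : E b = 0)
    (hFE : EqOn F E (Ioo a b)) (hf : IntegrableOn f (Ioo a b)) : ∫ x in Ioo a b, f x = 0 := by
  have h1 : ∀ x ∈ Ioo a b, HasDerivAt E (f x) x := fun x hx =>
    (hF x hx).congr_of_eventuallyEq (by
      filter_upwards [Ioo_mem_nhds hx.1 hx.2] with y hy using (hFE hy).symm)
  rw [← integral_Ioc_eq_integral_Ioo, ← intervalIntegral.integral_of_le hab.le,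
    intervalIntegral.integral_eq_sub_of_hasDerivAt_of_tendsto hab h1
      ((intervalIntegrable_iff_integrableOn_Ioo_of_le hab.le).2 hf)
      hE.continuousWithinAt hE.continuousWithinAt, ha, hb, sub_zero]

/-- Fubini with x inside. The nonvanishing of K(u) allows it to be divided out, so that the
one-dimensional statement applies to f(·, u) for almost every u. -/
theorem integral_prod_deriv_left_eq_zero (hab : a < b) {F f E : ℝ → ℝ → ℝ} {K : ℝ → ℝ}
    (hK : ∀ u ∈ Ioo a' b', K u ≠ 0)
    (hF : ∀ u ∈ Ioo a' b', ∀ x ∈ Ioo a b, HasDerivAt (fun x => F x u) (f x u) x)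
    (hE : ∀ u, Continuous fun x => E x u) (ha : ∀ u, E a u = 0) (hb : ∀ u, E b u = 0)
    (hFE : ∀ u ∈ Ioo a' b', ∀ x ∈ Ioo a b, F x u = E x u)
    (hf : Integrable (fun z : ℝ × ℝ => K z.2 * f z.1 z.2)
      ((volume.restrict (Ioo a b)).prod (volume.restrict (Ioo a' b')))) :
    ∫ z, K z.2 * f z.1 z.2 ∂((volume.restrict (Ioo a b)).prod (volume.restrict (Ioo a' b'))) = 0 := by
  rw [integral_prod_symm _ hf]
  refine integral_eq_zero_of_ae ?_
  filter_upwards [hf.prod_left_ae, ae_restrict_mem measurableSet_Ioo] with u hu hmem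
  rw [integral_const_mul, setIntegral_deriv_eq_zero hab (hF u hmem) (hE u) (ha u) (hb u)
    (hFE u hmem), mul_zero]
  · rfl
  · have := hu.const_mul (K u)⁻¹
    simpa only [IntegrableOn, inv_mul_cancel_left₀ (hK u hmem)] using this

end Product

theorem integral_densityMeasure_strip {a b : ℝ} {s t w W : ℝ → ℝ} (hs : Measurable s)
    (ht : Measurable t)
    (hs0 : ∀ x ∈ Ioo a b, 0 < s x) (hw : Measurable w) (hw0 : ∀ x ∈ Ioo a b, 0 ≤ w x)
    (hW : Measurable W) (hW0 : ∀ x ∈ Ioo (-1 : ℝ) 1, 0 ≤ W x) {ρ : (Fin 2 → ℝ) → ℝ}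
    (hρ : ∀ z ∈ strip a b s t, ρ z = w (z 0) * W ((z 1 - t (z 0)) / s (z 0)) / s (z 0))
    {f : (Fin 2 → ℝ) → ℝ} (hf : Measurable f) :
    ∫ z, f z ∂densityMeasure (strip a b s t) ρ =
      ∫ z : ℝ × ℝ, w z.1 * W z.2 * f (stripMap s t z)
        ∂((volume.restrict (Ioo a b)).prod (volume.restrict (Ioo (-1) 1))) := by
  rw [densityMeasure_strip hs ht hs0 hw hw0 hW hρ,
    integral_map (measurable_stripMap hs ht).aemeasurable hf.aestronglyMeasurable,
    prod_withDensity hw.ennreal_ofReal hW.ennreal_ofReal,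
    integral_withDensity_eq_integral_toReal_smul
      (show Measurable fun z : ℝ × ℝ => ENNReal.ofReal (w z.1) * ENNReal.ofReal (W z.2) from
        (hw.ennreal_ofReal.comp measurable_fst).mul (hW.ennreal_ofReal.comp measurable_snd))
      (ae_of_all _ fun z => ENNReal.mul_lt_top ENNReal.ofReal_lt_top ENNReal.ofReal_lt_top)]
  refine integral_congr_ae ?_
  rw [Measure.prod_restrict]
  refine (ae_restrict_iff' (measurableSet_Ioo.prod measurableSet_Ioo)).2 (ae_of_all _ fun z hz => ?_)
  simp only [ENNReal.toReal_mul, ENNReal.toReal_ofReal (hw0 _ hz.1),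
    ENNReal.toReal_ofReal (hW0 _ hz.2), smul_eq_mul]

namespace StripSolution

variable {Ω : Set (Fin 2 → ℝ)} {g : (Fin 2 → ℝ) → Matrix (Fin 2) (Fin 2) ℝ}
    {b : (Fin 2 → ℝ) → Fin 2 → ℝ} {ρ : (Fin 2 → ℝ) → ℝ} {G l r p q β d T : Polynomial ℝ}
    {a c xl xr κ e₁ e₂ M N lam p' q' C : ℝ} {t : ℝ → ℝ}

theorem integral_eq (S : StripSolution Ω g b ρ G l r p q β d a c xl xr κ e₁ e₂ M N lam p' q' C t)
    {f : (Fin 2 → ℝ) → ℝ} (hf : Measurable f) :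
    ∫ z, f z ∂densityMeasure Ω ρ =
      ∫ z : ℝ × ℝ, C * jac xl xr M N z.1 * jac (-1) 1 (q' - 1) (p' - 1) z.2 *
        f (stripMap (fun x => lam * jac xl xr e₁ e₂ x) t z)
        ∂((volume.restrict (Ioo xl xr)).prod (volume.restrict (Ioo (-1) 1))) := by
  have hρ := S.density_eq
  rw [S.eq_strip] at hρ
  rw [S.eq_strip]
  exact integral_densityMeasure_strip (s := fun x => lam * jac xl xr e₁ e₂ x)
    (w := fun x => C * jac xl xr M N x)
    (W := jac (-1) 1 (q' - 1) (p' - 1))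
    (measurable_const.mul measurable_jac) S.measurable_t
    (fun x hx => mul_pos S.lam_pos (jac_pos hx)) (measurable_const.mul measurable_jac)
    (fun x hx => (mul_pos S.C_pos (jac_pos hx)).le) measurable_jac (fun x hx => (jac_pos hx).le)
    (fun z hz => by rw [hρ z hz]; ring) hf

/-- The logarithmic derivative of the half-width of the strip times the two densities in `x`. -/
noncomputable def slopeWeight (xl xr e₁ e₂ M N lam x : ℝ) : ℝ :=
  lam * (e₂ * jac xl xr (M + e₁) (N + e₂ - 1) x - e₁ * jac xl xr (M + e₁ - 1) (N + e₂) x)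

/-- Thus `slopeWeight` equals w s' inside the interval. Its two terms are kept apart so that a
lowered exponent occurs only together with the coefficient e₁ or e₂, and disappears if that
coefficient is zero. -/
theorem slopeWeight_mul
    (S : StripSolution Ω g b ρ G l r p q β d a c xl xr κ e₁ e₂ M N lam p' q' C t) {x : ℝ}
    (hx : x ∈ Ioo xl xr) : slopeWeight xl xr e₁ e₂ M N lam x * G.eval x =
      jac xl xr M N x * l.eval x * (lam * jac xl xr e₁ e₂ x) := by
  have h1 : jac xl xr (M + e₁) (N + e₂) x = jac xl xr (M + e₁) (N + e₂ - 1) x * (x - xl) := by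
    unfold jac
    rw [mul_assoc, ← Real.rpow_add_one (sub_pos.2 hx.1).ne', sub_add_cancel]
  have h2 : jac xl xr (M + e₁) (N + e₂) x = jac xl xr (M + e₁ - 1) (N + e₂) x * (xr - x) := by
    unfold jac
    rw [mul_right_comm, ← Real.rpow_add_one (sub_pos.2 hx.2).ne', sub_add_cancel]
  have h3 := jac_mul (P := M) (Q := N) (P' := e₁) (Q' := e₂) hx
  rw [S.G_eq, S.l_eq]
  unfold slopeWeight
  linear_combination (-(lam * κ * e₂ * (xr - x))) * h1 + lam * κ * e₁ * (x - xl) * h2 -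
    lam * κ * (e₂ * (xr - x) - e₁ * (x - xl)) * h3

/-- Each term either has coefficient zero or has its lowered exponent above -1, by the assumption at
that end. -/
theorem integrableOn_slopeWeight
    (S : StripSolution Ω g b ρ G l r p q β d a c xl xr κ e₁ e₂ M N lam p' q' C t)
    (he₁ : 0 ≤ e₁) (he₂ : 0 ≤ e₂) (h₁ : e₁ = 0 ∨ 0 < M + e₁) (h₂ : e₂ = 0 ∨ 0 < N + e₂) :
    IntegrableOn (slopeWeight xl xr e₁ e₂ M N lam) (Ioo xl xr) := by
  have hM := S.M_gt
  have hN := S.N_gt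
  have key : ∀ {e P Q : ℝ}, (e = 0 ∨ -1 < P ∧ -1 < Q) →
      IntegrableOn (fun x => e * jac xl xr P Q x) (Ioo xl xr) := by
    rintro e P Q (rfl | h)
    · simp
    · exact ((integrableOn_jac_iff S.lt).2 h).const_mul e
  exact ((key (h₂.imp_right fun h => ⟨by linarith, by linarith⟩)).sub
    (key (h₁.imp_right fun h => ⟨by linarith, by linarith⟩))).const_mul lam

theorem eval_derivative_center (S : StripSolution Ω g b ρ G l r p q β d a c xl xr κ e₁ e₂ M N lam p'
    q' C fun x => T.eval x) {x : ℝ} (hx : x ∈ Ioo xl xr) :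
    G.eval x * T.derivative.eval x = l.eval x * T.eval x + r.eval x := by
  rw [(T.hasDerivAt x).unique (S.hasDerivAt_t x hx), mul_div_cancel₀ _ (S.G_pos hx).ne']

theorem hasDerivAt_eval_stripMap_left (S : StripSolution Ω g b ρ G l r p q β d a c xl xr κ e₁ e₂ M N
    lam p' q' C t) (φ : MvPolynomial (Fin 2) ℝ) {x : ℝ} (hx : x ∈ Ioo xl xr) (u : ℝ) :
    HasDerivAt (fun x => (lam * jac xl xr e₁ e₂ x) * u + t x)
      ((l.eval x * ((lam * jac xl xr e₁ e₂ x) * u + t x) + r.eval x) / G.eval x) x ∧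
    HasDerivAt (fun x => MvPolynomial.eval (stripMap (fun x => lam * jac xl xr e₁ e₂ x) t (x, u)) φ)
      (MvPolynomial.eval (stripMap (fun x => lam * jac xl xr e₁ e₂ x) t (x, u))
          (MvPolynomial.pderiv 0 φ) +
        (l.eval x * ((lam * jac xl xr e₁ e₂ x) * u + t x) + r.eval x) / G.eval x *
        MvPolynomial.eval (stripMap (fun x => lam * jac xl xr e₁ e₂ x) t (x, u))
          (MvPolynomial.pderiv 1 φ)) x := by
  have h1 : HasDerivAt (fun x => (lam * jac xl xr e₁ e₂ x) * u + t x)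
      ((l.eval x * ((lam * jac xl xr e₁ e₂ x) * u + t x) + r.eval x) / G.eval x) x :=
    (((S.hasDerivAt_s hx).mul_const u).add (S.hasDerivAt_t x hx)).congr_deriv (by ring)
  refine ⟨h1, ?_⟩
  have h := hasDerivAt_mvPolynomial_eval_comp φ (x := x)
    (γ := fun x => stripMap (fun x => lam * jac xl xr e₁ e₂ x) t (x, u))
    (γ' := ![1, (l.eval x * ((lam * jac xl xr e₁ e₂ x) * u + t x) + r.eval x) / G.eval x])
    (fun i => by
      fin_cases i
      · exact hasDerivAt_id x
      · exact h1)
  simpa [Fin.sum_univ_two] using h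

theorem hasDerivAt_eval_stripMap_right {s : ℝ → ℝ} (φ : MvPolynomial (Fin 2) ℝ) (x u : ℝ) :
    HasDerivAt (fun u => MvPolynomial.eval (stripMap s t (x, u)) φ)
      (s x * MvPolynomial.eval (stripMap s t (x, u)) (MvPolynomial.pderiv 1 φ)) u := by
  have h := hasDerivAt_mvPolynomial_eval_comp φ (x := u) (γ := fun u => stripMap s t (x, u))
    (γ' := ![0, s x]) (fun i => by
      fin_cases i
      · exact hasDerivAt_const u x
      · exact (((hasDerivAt_id u).const_mul (s x)).add_const (t x)).congr_deriv (mul_one _))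
  simpa [Fin.sum_univ_two] using h

theorem continuous_stripMap {s t : ℝ → ℝ} (hs : Continuous s) (ht : Continuous t) :
    Continuous (stripMap s t) := by
  refine continuous_pi fun i => ?_
  fin_cases i
  · exact continuous_fst
  · exact ((hs.comp continuous_fst).mul continuous_snd).add (ht.comp continuous_fst)

theorem jac_left_eq_zero {a b P Q : ℝ} (hQ : Q ≠ 0) : jac a b P Q a = 0 := by
  simp [jac, hQ]

theorem jac_right_eq_zero {a b P Q : ℝ} (hP : P ≠ 0) : jac a b P Q b = 0 := by
  simp [jac, hP]

theorem jac_succ {a b P Q x : ℝ} (hx : x ∈ Ioo a b) :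
    jac a b (P + 1) (Q + 1) x = (b - x) * (x - a) * jac a b P Q x := by
  unfold jac
  rw [Real.rpow_add_one (sub_pos.2 hx.2).ne', Real.rpow_add_one (sub_pos.2 hx.1).ne']
  ring

/-- In (x, u) the field ∇x is G ∂ₓ, so the integrand times the density is the transverse weight
times the x-derivative of C G w φ. Inside the interval G w is κ times a Jacobi weight with exponents
M + 1, N + 1 > 0, so the boundary values vanish. -/
theorem integral_first_coordinate (S : StripSolution Ω g b ρ G l r p q β d a c xl xr κ e₁ e₂ M N lam
    p' q' C fun x => T.eval x) (he₁ : 0 ≤ e₁) (he₂ : 0 ≤ e₂) (φ : MvPolynomial (Fin 2) ℝ) :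
    ∫ z, (β.eval (z 0) * MvPolynomial.eval z φ +
      G.eval (z 0) * MvPolynomial.eval z (MvPolynomial.pderiv 0 φ) +
      (l.eval (z 0) * z 1 + r.eval (z 0)) * MvPolynomial.eval z (MvPolynomial.pderiv 1 φ))
      ∂densityMeasure Ω ρ = 0 := by
  have hsc : Continuous fun x => lam * jac xl xr e₁ e₂ x :=
    continuous_const.mul (continuous_jac he₁ he₂)
  set s : ℝ → ℝ := fun x => lam * jac xl xr e₁ e₂ x with hs
  have hSc : Continuous (stripMap s fun x => T.eval x) := continuous_stripMap hsc T.continuous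
  have hev : ∀ ψ : MvPolynomial (Fin 2) ℝ,
      Continuous fun z => MvPolynomial.eval (stripMap s (fun x => T.eval x) z) ψ := fun ψ =>
    (MvPolynomial.continuous_eval ψ).comp hSc
  have h0 : Continuous fun z : Fin 2 → ℝ => z 0 := continuous_apply 0
  have h1 : Continuous fun z : Fin 2 → ℝ => z 1 := continuous_apply 1
  have hM := S.M_gt
  have hN := S.N_gt
  let Ψ : (Fin 2 → ℝ) → ℝ := fun z => β.eval (z 0) * MvPolynomial.eval z φ +
      G.eval (z 0) * MvPolynomial.eval z (MvPolynomial.pderiv 0 φ) +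
      (l.eval (z 0) * z 1 + r.eval (z 0)) * MvPolynomial.eval z (MvPolynomial.pderiv 1 φ)
  have hΨ : Continuous Ψ := (((β.continuous.comp h0).mul (MvPolynomial.continuous_eval _)).add
    ((G.continuous.comp h0).mul (MvPolynomial.continuous_eval _))).add
    ((((l.continuous.comp h0).mul h1).add (r.continuous.comp h0)).mul
      (MvPolynomial.continuous_eval _))
  rw [S.integral_eq (f := Ψ) hΨ.measurable]
  have hint := integrable_prod_Ioo_mul (a := xl) (b := xr) (a' := -1) (b' := 1)
    (((integrableOn_jac_iff S.lt).2 ⟨hM, hN⟩).const_mul C)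
    ((integrableOn_jac_iff (a := -1) (b := 1) (P := q' - 1) (Q := p' - 1) (by norm_num)).2
      ⟨by linarith [S.q_pos], by linarith [S.p_pos]⟩) (hΨ.comp hSc)
  have e : ∀ z : ℝ × ℝ, C * jac xl xr M N z.1 * jac (-1) 1 (q' - 1) (p' - 1) z.2 *
      Ψ (stripMap s (fun x => T.eval x) z) = jac (-1) 1 (q' - 1) (p' - 1) z.2 *
      (C * jac xl xr M N z.1 * Ψ (stripMap s (fun x => T.eval x) (z.1, z.2))) := fun z => by ring
  have hint' := hint.congr (ae_of_all _ e)
  rw [integral_congr_ae (ae_of_all _ e)]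
  refine integral_prod_deriv_left_eq_zero S.lt
    (F := fun x u => C * (G.eval x * jac xl xr M N x) *
      MvPolynomial.eval (stripMap s (fun x => T.eval x) (x, u)) φ)
    (E := fun x u => C * (κ * jac xl xr (M + 1) (N + 1) x) *
      MvPolynomial.eval (stripMap s (fun x => T.eval x) (x, u)) φ)
    (f := fun x u => C * jac xl xr M N x * Ψ (stripMap s (fun x => T.eval x) (x, u)))
    (fun u hu => (jac_pos hu).ne') (fun u hu x hx => ?_) (fun u => ?_) (fun u => ?_) (fun u => ?_)
    (fun u hu x hx => ?_) hint'
  · have hG := (S.G_pos hx).ne'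
    refine ((((G.hasDerivAt x).mul (S.hasDerivAt_w hx)).const_mul C).mul
      (S.hasDerivAt_eval_stripMap_left φ hx u).2).congr_deriv ?_
    simp only [Ψ, stripMap, hs, Pi.mul_apply, Matrix.cons_val_zero, Matrix.cons_val_one]
    field_simp
    ring
  · exact (continuous_const.mul (continuous_const.mul (continuous_jac (by linarith)
      (by linarith)))).mul ((hev φ).comp (Continuous.prodMk_left u))
  · simp only [jac_left_eq_zero (by linarith : N + 1 ≠ 0)]; ring
  · simp only [jac_right_eq_zero (by linarith : M + 1 ≠ 0)]; ring
  · simp only [jac_succ hx, S.G_eq]; ring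

/-- In (x, u) the field ∇y has an x-component g¹² and a u-component, so the integrand is the sum of
two total derivatives: the x-derivative of g¹² w φ times the transverse weight, and the u-derivative
of (1 - u²) W φ times k(x). Here k = l w s' - a s w, that is, -(a G - l²) s w / G. The conditions at
the ends make k integrable and the first flux vanish there. -/
theorem integral_second_coordinate (S : StripSolution Ω g b ρ G l r p q β d a c xl xr κ e₁ e₂ M N lam
    p' q' C fun x => T.eval x) (he₁ : 0 ≤ e₁) (he₂ : 0 ≤ e₂) (h₁ : e₁ = 0 ∨ 0 < M + e₁)
    (h₂ : e₂ = 0 ∨ 0 < N + e₂) (φ : MvPolynomial (Fin 2) ℝ) :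
    ∫ z, ((c * z 1 + d.eval (z 0)) * MvPolynomial.eval z φ +
      (l.eval (z 0) * z 1 + r.eval (z 0)) * MvPolynomial.eval z (MvPolynomial.pderiv 0 φ) +
      (a * z 1 ^ 2 + p.eval (z 0) * z 1 + q.eval (z 0)) *
        MvPolynomial.eval z (MvPolynomial.pderiv 1 φ)) ∂densityMeasure Ω ρ = 0 := by
  have hsc : Continuous fun x => lam * jac xl xr e₁ e₂ x :=
    continuous_const.mul (continuous_jac he₁ he₂)
  set s : ℝ → ℝ := fun x => lam * jac xl xr e₁ e₂ x with hs
  set t : ℝ → ℝ := fun x => T.eval x with ht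
  have hSc : Continuous (stripMap s t) := continuous_stripMap hsc T.continuous
  have hev : ∀ ψ : MvPolynomial (Fin 2) ℝ,
      Continuous fun z => MvPolynomial.eval (stripMap s t z) ψ := fun ψ =>
    (MvPolynomial.continuous_eval ψ).comp hSc
  have h0 : Continuous fun z : Fin 2 → ℝ => z 0 := continuous_apply 0
  have h1 : Continuous fun z : Fin 2 → ℝ => z 1 := continuous_apply 1
  have hf : ∀ f : Polynomial ℝ, Continuous fun z : ℝ × ℝ => f.eval z.1 := fun f =>
    f.continuous.comp continuous_fst
  have hM := S.M_gt
  have hN := S.N_gt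
  have hp := S.p_pos
  have hq := S.q_pos
  set w : ℝ → ℝ := jac xl xr M N with hw
  set W : ℝ → ℝ := jac (-1) 1 (q' - 1) (p' - 1) with hW
  set ℓ : ℝ → ℝ := slopeWeight xl xr e₁ e₂ M N lam with hℓ
  have hwi : IntegrableOn w (Ioo xl xr) := (integrableOn_jac_iff S.lt).2 ⟨hM, hN⟩
  have hWi : IntegrableOn W (Ioo (-1) 1) :=
    (integrableOn_jac_iff (by norm_num)).2 ⟨by linarith, by linarith⟩
  have hℓi : IntegrableOn ℓ (Ioo xl xr) := S.integrableOn_slopeWeight he₁ he₂ h₁ h₂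
  -- the factors of the two total derivatives
  let h : ℝ × ℝ → ℝ := fun z => l.eval z.1 * (s z.1 * z.2 + t z.1) + r.eval z.1
  have hh : Continuous h :=
    ((hf l).mul (((hsc.comp continuous_fst).mul continuous_snd).add (hf T))).add (hf r)
  let ev : MvPolynomial (Fin 2) ℝ → ℝ × ℝ → ℝ := fun ψ z => MvPolynomial.eval (stripMap s t z) ψ
  let D : ℝ × ℝ → ℝ := fun z =>
    (l.eval z.1 + β.eval z.1 - G.derivative.eval z.1) * ev φ z + h z * ev (MvPolynomial.pderiv 1 φ) z
  have hD : Continuous D := ((((hf l).add (hf β)).sub (hf _)).mul (hev φ)).add (hh.mul (hev _))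
  let Ψ₁ : ℝ × ℝ → ℝ := fun z =>
    (l.derivative.eval z.1 * (s z.1 * z.2 + t z.1) + r.derivative.eval z.1) * ev φ z +
      h z * ev (MvPolynomial.pderiv 0 φ) z + T.derivative.eval z.1 * D z
  have hΨ₁ : Continuous Ψ₁ := (((((hf _).mul (((hsc.comp continuous_fst).mul continuous_snd).add
    (hf T))).add (hf _)).mul (hev φ)).add (hh.mul (hev _))).add ((hf _).mul hD)
  let Ψ₂ : ℝ × ℝ → ℝ := fun z => z.2 * D z
  have hΨ₂ : Continuous Ψ₂ := continuous_snd.mul hD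
  let Ψ₃ : ℝ × ℝ → ℝ := fun z => (p' - q' - (p' + q') * z.2) * ev φ z +
    (1 - z.2) * (1 + z.2) * (s z.1 * ev (MvPolynomial.pderiv 1 φ) z)
  have hΨ₃ : Continuous Ψ₃ := ((continuous_const.sub (continuous_const.mul continuous_snd)).mul
    (hev φ)).add (((continuous_const.sub continuous_snd).mul
      (continuous_const.add continuous_snd)).mul ((hsc.comp continuous_fst).mul (hev _)))
  let k : ℝ → ℝ := fun x => l.eval x * ℓ x - a * (s x * w x)
  have hki : IntegrableOn k (Ioo xl xr) := by
    have hI : ∀ (f v : ℝ → ℝ), Continuous f → IntegrableOn v (Ioo xl xr) →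
        IntegrableOn (fun x => f x * v x) (Ioo xl xr) := by
      intro f v hf hv
      obtain ⟨B, hB⟩ := isCompact_Icc.exists_bound_of_continuousOn
        (hf.continuousOn (s := Icc xl xr))
      exact hv.bdd_mul (c := B) hf.aestronglyMeasurable
        ((ae_restrict_iff' measurableSet_Ioo).2 (ae_of_all _ fun x hx => hB x
          (Ioo_subset_Icc_self hx)))
    exact (hI _ _ l.continuous hℓi).sub ((hI _ _ hsc hwi).const_mul a)
  set μ := (volume.restrict (Ioo xl xr)).prod (volume.restrict (Ioo (-1 : ℝ) 1)) with hμ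
  -- the total derivative in `x`
  have hint₁ : Integrable (fun z : ℝ × ℝ => W z.2 * (w z.1 * Ψ₁ (z.1, z.2) + ℓ z.1 * Ψ₂ (z.1, z.2)))
      μ := by
    refine ((integrable_prod_Ioo_mul hwi hWi hΨ₁).add
      (integrable_prod_Ioo_mul hℓi hWi hΨ₂)).congr (ae_of_all _ fun z => ?_)
    simp only [Pi.add_apply]
    ring
  have hzero₁ : ∫ z : ℝ × ℝ, W z.2 * (w z.1 * Ψ₁ (z.1, z.2) + ℓ z.1 * Ψ₂ (z.1, z.2)) ∂μ = 0 := by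
    -- By G T' = l T + r one has g¹² = l s u + G T'. Hence the flux g¹² w extends continuously to
    -- the ends, by means of Jacobi weights with raised exponents.
    refine integral_prod_deriv_left_eq_zero S.lt
      (F := fun x u => h (x, u) * w x * ev φ (x, u))
      (E := fun x u => (κ * jac xl xr (M + 1) (N + 1) x * T.derivative.eval x +
        u * (κ * lam * (e₂ * jac xl xr (M + e₁ + 1) (N + e₂) x -
          e₁ * jac xl xr (M + e₁) (N + e₂ + 1) x))) * ev φ (x, u))
      (f := fun x u => w x * Ψ₁ (x, u) + ℓ x * Ψ₂ (x, u))
      (fun u hu => (jac_pos hu).ne') (fun u hu x hx => ?_) (fun u => ?_) (fun u => ?_) (fun u => ?_)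
      (fun u hu x hx => ?_) hint₁
    · have hG := (S.G_pos hx).ne'
      have hT := S.eval_derivative_center hx
      have hl := S.slopeWeight_mul hx
      obtain ⟨hY, hφ⟩ := S.hasDerivAt_eval_stripMap_left φ hx u
      refine (((((l.hasDerivAt x).mul hY).add (r.hasDerivAt x)).mul (S.hasDerivAt_w hx)).mul
        hφ).congr_deriv ?_
      have hℓx : ℓ x = w x * l.eval x * s x / G.eval x := eq_div_of_mul_eq hG hl
      have hTx : T.derivative.eval x = (l.eval x * t x + r.eval x) / G.eval x :=
        eq_div_of_mul_eq hG (by rw [mul_comm]; exact hT)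
      simp only [Pi.mul_apply, Pi.add_apply, Ψ₁, Ψ₂, D, h, ev, hℓx, hTx]
      field_simp
      ring
    · have hc : ∀ {e P Q : ℝ}, (e = 0 ∨ 0 ≤ P ∧ 0 ≤ Q) →
          Continuous fun x => e * jac xl xr P Q x := by
        rintro e P Q (rfl | h)
        · simpa using continuous_const
        · exact continuous_const.mul (continuous_jac h.1 h.2)
      refine (((hc (Or.inr ⟨by linarith, by linarith⟩)).mul T.derivative.continuous).add
        (continuous_const.mul (continuous_const.mul ((hc (h₂.imp_right fun h =>
          ⟨by linarith, h.le⟩)).sub (hc (h₁.imp_right fun h => ⟨h.le, by linarith⟩)))))).mul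
        ((hev φ).comp (Continuous.prodMk_left u))
    · have h3 : e₂ * jac xl xr (M + e₁ + 1) (N + e₂) xl = 0 := by
        rcases h₂ with h | h
        · rw [h, zero_mul]
        · rw [jac_left_eq_zero h.ne', mul_zero]
      simp only [h3, jac_left_eq_zero (by linarith : N + 1 ≠ 0),
        jac_left_eq_zero (by linarith : N + e₂ + 1 ≠ 0)]
      ring
    · have h3 : e₁ * jac xl xr (M + e₁) (N + e₂ + 1) xr = 0 := by
        rcases h₁ with h | h
        · rw [h, zero_mul]
        · rw [jac_right_eq_zero h.ne', mul_zero]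
      simp only [h3, jac_right_eq_zero (by linarith : M + 1 ≠ 0),
        jac_right_eq_zero (by linarith : M + e₁ + 1 ≠ 0)]
      ring
    · have hT := S.eval_derivative_center hx
      have hj := jac_mul (P := M) (Q := N) (P' := e₁) (Q' := e₂) hx
      have hj1 : jac xl xr (M + e₁ + 1) (N + e₂) x = (xr - x) * jac xl xr (M + e₁) (N + e₂) x := by
        unfold jac
        rw [Real.rpow_add_one (sub_pos.2 hx.2).ne']; ring
      have hj2 : jac xl xr (M + e₁) (N + e₂ + 1) x = (x - xl) * jac xl xr (M + e₁) (N + e₂) x := by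
        unfold jac
        rw [Real.rpow_add_one (sub_pos.2 hx.1).ne']; ring
      simp only [h, jac_succ hx, hj1, hj2, ← hj, hs, hw, ht]
      rw [S.G_eq] at hT
      have hl := S.l_eq x
      linear_combination (-(jac xl xr M N x * ev φ (x, u))) * hT +
        lam * jac xl xr e₁ e₂ x * u * jac xl xr M N x * ev φ (x, u) * hl
  -- the total derivative in `u`
  have hint₂ : Integrable (fun z : ℝ × ℝ => k z.1 * (W z.2 * Ψ₃ (z.1, z.2))) μ :=
    (integrable_prod_Ioo_mul hki hWi hΨ₃).congr (ae_of_all _ fun z => by ring)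
  have hzero₂ : ∫ z : ℝ × ℝ, k z.1 * (W z.2 * Ψ₃ (z.1, z.2)) ∂μ = 0 := by
    rw [integral_prod _ hint₂]
    refine integral_eq_zero_of_ae ?_
    filter_upwards with x
    have hin : IntegrableOn (fun u => W u * Ψ₃ (x, u)) (Ioo (-1) 1) := by
      obtain ⟨B, hB⟩ := isCompact_Icc.exists_bound_of_continuousOn
        ((hΨ₃.comp (Continuous.prodMk_right x)).continuousOn (s := Icc (-1 : ℝ) 1))
      exact hWi.mul_bdd (c := B) (hΨ₃.comp (Continuous.prodMk_right x)).aestronglyMeasurable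
        ((ae_restrict_iff' measurableSet_Ioo).2 (ae_of_all _ fun x hx => hB x
          (Ioo_subset_Icc_self hx)))
    have := setIntegral_deriv_eq_zero (a := -1) (b := 1) (by norm_num)
      (F := fun u => jac (-1) 1 q' p' u * ev φ (x, u))
      (E := fun u => jac (-1) 1 q' p' u * ev φ (x, u)) (f := fun u => W u * Ψ₃ (x, u))
      (fun u hu => ?_)
      ((continuous_jac hq.le hp.le).mul ((hev φ).comp (Continuous.prodMk_right x)))
      (by simp only [jac_left_eq_zero hp.ne', zero_mul])
      (by simp only [jac_right_eq_zero hq.ne', zero_mul]) (fun u _ => rfl) hin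
    · simp only [integral_const_mul, this, mul_zero, Pi.zero_apply]
    · have e := jac_succ (P := q' - 1) (Q := p' - 1) hu
      rw [sub_add_cancel, sub_add_cancel] at e
      have hu1 := (sub_pos.2 hu.1).ne'
      have hu2 := (sub_pos.2 hu.2).ne'
      refine ((hasDerivAt_jac hu).mul
        (hasDerivAt_eval_stripMap_right (s := s) (t := t) φ x u)).congr_deriv ?_
      simp only [e, Ψ₃, ev, hW]
      field_simp
      ring
  let f : (Fin 2 → ℝ) → ℝ := fun z => (c * z 1 + d.eval (z 0)) * MvPolynomial.eval z φ +
      (l.eval (z 0) * z 1 + r.eval (z 0)) * MvPolynomial.eval z (MvPolynomial.pderiv 0 φ) +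
      (a * z 1 ^ 2 + p.eval (z 0) * z 1 + q.eval (z 0)) *
        MvPolynomial.eval z (MvPolynomial.pderiv 1 φ)
  have hfc : Continuous f :=
    ((((continuous_const.mul h1).add (d.continuous.comp h0)).mul
      (MvPolynomial.continuous_eval _)).add
      (((((l.continuous.comp h0).mul h1).add (r.continuous.comp h0)).mul
      (MvPolynomial.continuous_eval _)))).add
      ((((continuous_const.mul (h1.pow 2)).add ((p.continuous.comp h0).mul h1)).add
      (q.continuous.comp h0)).mul (MvPolynomial.continuous_eval _))
  rw [S.integral_eq (f := f) hfc.measurable]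
  -- After multiplication by G the integrand is split by the fibre equation, for the terms in φ, and
  -- by the determinant formula, for those in ∂_yφ; `slopeWeight` replaces w l s / G.
  have e : ∀ᵐ z : ℝ × ℝ ∂μ, C * w z.1 * W z.2 * f (stripMap s t z) =
      C * (W z.2 * (w z.1 * Ψ₁ (z.1, z.2) + ℓ z.1 * Ψ₂ (z.1, z.2)) +
        k z.1 * (W z.2 * Ψ₃ (z.1, z.2))) := by
    rw [hμ, Measure.prod_restrict]
    refine (ae_restrict_iff' (measurableSet_Ioo.prod measurableSet_Ioo)).2
      (ae_of_all _ fun z hz => ?_)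
    obtain ⟨x, u⟩ := z
    have hx : x ∈ Ioo xl xr := hz.1
    have hG := (S.G_pos hx).ne'
    have hT := S.eval_derivative_center hx
    have hl := S.slopeWeight_mul hx
    have hfib := S.fibre_eq x hx (s x * u + t x)
    have hdet := S.det_eq x hx (s x * u + t x)
    unfold fibreFun at hfib
    unfold detFun at hdet
    refine mul_left_cancel₀ hG ?_
    simp only [f, k, Ψ₁, Ψ₂, Ψ₃, D, h, ev, stripMap, Matrix.cons_val_zero, Matrix.cons_val_one]
    set φ₀ := MvPolynomial.eval ![x, s x * u + t x] φ
    set φ₁ := MvPolynomial.eval ![x, s x * u + t x] (MvPolynomial.pderiv 0 φ)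
    set φ₂ := MvPolynomial.eval ![x, s x * u + t x] (MvPolynomial.pderiv 1 φ)
    set η := l.eval x * (s x * u + t x) + r.eval x
    set δ := (l.eval x + β.eval x - G.derivative.eval x) * φ₀ + η * φ₂ with hδ
    linear_combination C * w x * W u * φ₀ * hfib + C * w x * W u * φ₂ * hdet -
      C * W u * (u * δ + l.eval x * ((p' - q' - (p' + q') * u) * φ₀ +
        (1 - u) * (1 + u) * (s x * φ₂))) * hl - C * w x * W u * δ * hT
  rw [integral_congr_ae e, integral_const_mul, integral_add hint₁ hint₂, hzero₁, hzero₂, add_zero,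
    mul_zero]

end StripSolution

section ToStrip

variable {Ω : Set (Fin 2 → ℝ)} {g : (Fin 2 → ℝ) → Matrix (Fin 2) (Fin 2) ℝ}
  {B : (Fin 2 → ℝ) → Fin 2 → ℝ} {ρ : (Fin 2 → ℝ) → ℝ} {κ a b lam : ℝ} {m n : ℕ}
  {c P Q p q C : ℝ} {T : Polynomial ℝ}

/-! ### From the common form to a strip -/

theorem shear_mem_strip_iff {s : ℝ → ℝ} {z : Fin 2 → ℝ} :
    (shear T).toEquiv z ∈ strip a b s (fun _ => 0) ↔ z ∈ strip a b s fun x => T.eval x := by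
  simp [strip, shear, AdmissibleChange.toEquiv, sub_eq_add_neg]

theorem IsGeneral.eq_strip (h : IsGeneral (shear T) Ω g ρ κ a b lam m n c P Q p q C) :
    Ω = strip a b (fun x => lam * jac a b (m / 2) (n / 2) x) fun x => T.eval x := by
  ext z
  rw [← shear_mem_strip_iff, ← h.image_eq, (shear T).toEquiv.injective.mem_set_image]

theorem IsGeneral.cometric_shear (h : IsGeneral (shear T) Ω g ρ κ a b lam m n c P Q p q C)
    {z : Fin 2 → ℝ} (hz : z ∈ Ω) :
    g z 0 0 = κ * ((b - z 0) * (z 0 - a)) ∧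
    g z 0 1 = T.derivative.eval (z 0) * g z 0 0 +
      κ * (halfSlope a b m n (z 0) * (z 1 - T.eval (z 0))) ∧
    g z 1 0 = T.derivative.eval (z 0) * g z 0 0 +
      κ * (halfSlope a b m n (z 0) * (z 1 - T.eval (z 0))) ∧
    g z 1 1 = T.derivative.eval (z 0) * (g z 0 1 + g z 1 0) -
      T.derivative.eval (z 0) ^ 2 * g z 0 0 +
      κ * ((lam * jac a b (m / 2) (n / 2) (z 0)) ^ 2 * halfSlope a b m n (z 0) ^ 2 /
        ((b - z 0) * (z 0 - a)) -
        c * ((lam * jac a b (m / 2) (n / 2) (z 0)) ^ 2 - (z 1 - T.eval (z 0)) ^ 2)) := by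
  have hz' := h.eq_strip ▸ hz
  have h1 := h.cometric_eq _ (shear_mem_strip_iff.2 hz')
  rw [(shear T).pushCometric_eq g ((shear T).toEquiv.symm_apply_apply z)] at h1
  have e0 : (shear T).toEquiv z 0 = z 0 := by simp [shear, AdmissibleChange.toEquiv]
  have e1 : (shear T).toEquiv z 1 = z 1 - T.eval (z 0) := by
    simp [shear, AdmissibleChange.toEquiv, sub_eq_add_neg]
  rw [e0, e1] at h1
  have h00 := congrFun (congrFun h1 0) 0
  have h01 := congrFun (congrFun h1 0) 1
  have h10 := congrFun (congrFun h1 1) 0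
  have h11 := congrFun (congrFun h1 1) 1
  simp [shear] at h00 h01 h10 h11
  refine ⟨by linarith, by linarith, by linarith, by linarith⟩

theorem IsGeneral.density_shear (h : IsGeneral (shear T) Ω g ρ κ a b lam m n c P Q p q C)
    {z : Fin 2 → ℝ} (hz : z ∈ Ω) :
    ρ z = C * lam ^ (p + q - 1) * (jac a b (P + m / 2 * (p + q - 1)) (Q + n / 2 * (p + q - 1)) (z 0) *
      jac (-1) 1 (q - 1) (p - 1) ((z 1 - T.eval (z 0)) / (lam * jac a b (m / 2) (n / 2) (z 0))) /
        (lam * jac a b (m / 2) (n / 2) (z 0))) := by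
  have hz' := h.eq_strip ▸ hz
  have h1 := h.density_eq _ (shear_mem_strip_iff.2 hz')
  have e0 : (shear T).toEquiv z 0 = z 0 := by simp [shear, AdmissibleChange.toEquiv]
  have e1 : (shear T).toEquiv z 1 = z 1 - T.eval (z 0) := by
    simp [shear, AdmissibleChange.toEquiv, sub_eq_add_neg]
  rw [e0, e1, AdmissibleChange.pushDensity, Equiv.symm_apply_apply] at h1
  simp only [shear, mul_one, abs_one, div_one] at h1
  have h2 : lam ^ (p + q - 1) * lam ^ (-(p + q - 1)) = 1 := by
    rw [← Real.rpow_add h.lam_pos, add_neg_cancel, Real.rpow_zero]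
  rw [jac_mul_jac_div h.lam_pos hz'.1 hz'.2, add_sub_cancel_right, add_sub_cancel_right, h1]
  linear_combination (-(C * (jac a b P Q (z 0) *
      ((lam * jac a b (m / 2) (n / 2) (z 0) + (z 1 - T.eval (z 0))) ^ (p - 1) *
        (lam * jac a b (m / 2) (n / 2) (z 0) - (z 1 - T.eval (z 0))) ^ (q - 1))))) * h2

theorem mul_eval_derivative_of_eqOn {F : Polynomial ℝ} {f : ℝ → ℝ} {f' x : ℝ}
    (hx : x ∈ Ioo a b) (hF : ∀ y ∈ Ioo a b, F.eval y = f y) (hf : HasDerivAt f f' x) :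
    F.derivative.eval x = f' :=
  ((F.hasDerivAt x).congr_of_eventuallyEq (by
    filter_upwards [Ioo_mem_nhds hx.1 hx.2] with y hy using (hF y hy).symm)).unique hf

-- The task is to exhibit polynomial coefficients. The square S₂ of the half-width is a polynomial,
-- and so is S = (p - q) s: it is zero if p = q, and otherwise the exponents are even. The quotients
-- by G hidden in g²² and in the drift are removed by G S₂' = 2 l S₂ and G S' = l S. The drift
-- itself is recovered from the divergence form, on dividing by ρ > 0 and, for its second component,
-- also by G > 0.
open Polynomial in
theorem IsGeneral.exists_stripSolution (h : IsGeneral (shear T) Ω g ρ κ a b lam m n c P Q p q C)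
    (hdiv : HasDivergenceForm Ω g B ρ) :
    ∃ (G l r p₂ q₂ β d : Polynomial ℝ) (a' c' M N C' : ℝ),
      StripSolution Ω g B ρ G l r p₂ q₂ β d a' c' a b κ (m / 2) (n / 2) M N lam p q C'
        (fun x => T.eval x) ∧
      ((m : ℝ) / 2 = 0 ∨ 0 < M + m / 2) ∧ ((n : ℝ) / 2 = 0 ∨ 0 < N + n / 2) := by
  set M := P + m / 2 * (p + q - 1) with hM
  set N := Q + n / 2 * (p + q - 1) with hN
  set s : ℝ → ℝ := fun x => lam * jac a b (m / 2) (n / 2) x with hs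
  have hp := h.p_pos
  have hq := h.q_pos
  have hκ := h.κ_pos
  have hmP : (m : ℝ) * P = 0 := by
    rcases eq_or_ne m 0 with hm | hm
    · simp [hm]
    · simp [h.P_eq hm]
  have hnQ : (n : ℝ) * Q = 0 := by
    rcases eq_or_ne n 0 with hn | hn
    · simp [hn]
    · simp [h.Q_eq hn]
  set G : ℝ[X] := Polynomial.C κ * ((Polynomial.C b - X) * (X - Polynomial.C a)) with hGd
  set l : ℝ[X] := Polynomial.C κ * (Polynomial.C ((n : ℝ) / 2) * (Polynomial.C b - X) -
    Polynomial.C ((m : ℝ) / 2) * (X - Polynomial.C a)) with hld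
  set β : ℝ[X] := Polynomial.C κ * (Polynomial.C (N + 1) * (Polynomial.C b - X) -
    Polynomial.C (M + 1) * (X - Polynomial.C a)) with hβd
  have hG : ∀ x, G.eval x = κ * ((b - x) * (x - a)) := fun x => by simp [hGd]
  have hl : ∀ x, l.eval x = κ * ((n : ℝ) / 2 * (b - x) - (m : ℝ) / 2 * (x - a)) :=
    fun x => by simp [hld]
  have hl' : ∀ x, l.derivative.eval x = -κ * ((n : ℝ) / 2 + (m : ℝ) / 2) :=
    fun x => by simp [hld]; ring
  have hβ : ∀ x, β.eval x = κ * ((N + 1) * (b - x) - (M + 1) * (x - a)) := fun x => by simp [hβd]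
  have hGpos : ∀ x ∈ Ioo a b, 0 < G.eval x := fun x hx => by
    rw [hG]; exact mul_pos hκ (mul_pos (sub_pos.2 hx.2) (sub_pos.2 hx.1))
  have hspos : ∀ x ∈ Ioo a b, 0 < s x := fun x hx => mul_pos h.lam_pos (jac_pos hx)
  have hsd : ∀ x ∈ Ioo a b, HasDerivAt s (l.eval x / G.eval x * s x) x := fun x hx => by
    refine ((hasDerivAt_jac hx).const_mul lam).congr_deriv ?_
    rw [hl, hG]
    have h1 := (sub_pos.2 hx.1).ne'
    have h2 := (sub_pos.2 hx.2).ne'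
    simp only [hs]
    field_simp
    ring
  have hwd : ∀ x ∈ Ioo a b, HasDerivAt (jac a b M N)
      ((β.eval x - G.derivative.eval x) / G.eval x * jac a b M N x) x := fun x hx => by
    refine (hasDerivAt_jac hx).congr_deriv ?_
    rw [hβ, hG, derivative_eval_of_eq hG]
    have h1 := (sub_pos.2 hx.1).ne'
    have h2 := (sub_pos.2 hx.2).ne'
    field_simp
    ring
  -- the square of the half-width
  obtain ⟨S₂, hS₂⟩ : ∃ S₂ : ℝ[X], ∀ x ∈ Ioo a b, S₂.eval x = s x ^ 2 :=
    ⟨Polynomial.C (lam ^ 2) * ((Polynomial.C b - X) ^ m * (X - Polynomial.C a) ^ n), fun x hx => by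
      simp [hs, mul_pow, jac_half_sq hx]⟩
  have hS₂' : ∀ x ∈ Ioo a b, G.eval x * S₂.derivative.eval x = 2 * l.eval x * s x ^ 2 :=
    fun x hx => by
      rw [mul_eval_derivative_of_eqOn hx hS₂ ((hsd x hx).pow 2)]
      have := (hGpos x hx).ne'
      field_simp
      simp
      ring
  -- the half-width, up to a factor
  obtain ⟨S, hS⟩ : ∃ S : ℝ[X], ∀ x ∈ Ioo a b, S.eval x = (p - q) * s x := by
    rcases h.parity with hpq | ⟨hm, hn⟩
    · exact ⟨0, fun x _ => by simp [hpq]⟩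
    · exact ⟨Polynomial.C ((p - q) * lam) * ((Polynomial.C b - X) ^ (m / 2) *
        (X - Polynomial.C a) ^ (n / 2)), fun x _ => by
          simp [hs, jac_half_of_even hm hn, mul_assoc]⟩
  have hS' : ∀ x ∈ Ioo a b, G.eval x * S.derivative.eval x = l.eval x * ((p - q) * s x) :=
    fun x hx => by
      rw [mul_eval_derivative_of_eqOn hx hS ((hsd x hx).const_mul (p - q))]
      have := (hGpos x hx).ne'
      field_simp
  set a' : ℝ := κ * c
  -- Obtained from the coefficient of y in the fibre equation. The relations m P = 0 and n Q = 0
  -- remove the terms that are not divisible by G.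
  set c' : ℝ := -κ * (n * P + m * Q) / 2 - κ * (n / 2 + m / 2) + (p + q) * a' with hc'
  set r : ℝ[X] := G * derivative T - l * T with hr
  set p₂ : ℝ[X] := Polynomial.C 2 * (l * derivative T - Polynomial.C a' * T) with hp₂
  set q₂ : ℝ[X] := Polynomial.C a' * T ^ 2 - Polynomial.C 2 * l * T * derivative T +
    G * derivative T ^ 2 - Polynomial.C a' * S₂ + Polynomial.C (1 / 2) * l * derivative S₂ with hq₂
  set d : ℝ[X] := -Polynomial.C c' * T + β * derivative T + G * derivative (derivative T) -
    (Polynomial.C a' * S - l * derivative S) with hd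
  have hΩ := h.eq_strip
  have htd : ∀ x ∈ Ioo a b, HasDerivAt (fun x => T.eval x)
      ((l.eval x * T.eval x + r.eval x) / G.eval x) x := fun x hx => by
    refine (T.hasDerivAt x).congr_deriv ?_
    have := (hGpos x hx).ne'
    simp only [hr, eval_sub, eval_mul]
    field_simp
    ring
  have hdet : ∀ x ∈ Ioo a b, ∀ y, detFun G l r p₂ q₂ a' x y =
      (a' * G.eval x - l.eval x ^ 2) * ((y - T.eval x) ^ 2 - s x ^ 2) := fun x hx y => by
    have h1 := hS₂ x hx
    have h2 := hS₂' x hx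
    simp only [detFun, hr, hp₂, hq₂, eval_add, eval_sub, eval_mul, eval_C, eval_pow]
    linear_combination (-(a' * G.eval x)) * h1 + (1 / 2) * l.eval x * h2
  have hfib : ∀ x ∈ Ioo a b, ∀ y, fibreFun G l r β d c' x y =
      -(a' * G.eval x - l.eval x ^ 2) * ((p - q) * s x - (p + q) * (y - T.eval x)) :=
    fun x hx y => by
    have h1 := hS x hx
    have h2 := hS' x hx
    simp only [fibreFun, hr, hd, eval_add, eval_sub, eval_mul, eval_C, eval_neg, derivative_mul,
      derivative_sub]
    have h3 : G.eval x * c' + (G.derivative.eval x - β.eval x - l.eval x) * l.eval x -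
        G.eval x * l.derivative.eval x = (p + q) * (a' * G.eval x - l.eval x ^ 2) := by
      rw [hG, derivative_eval_of_eq hG, hβ, hl, hl', hc', hM, hN]
      linear_combination (-(κ ^ 2 / 2 * (x - a) ^ 2)) * hmP - (κ ^ 2 / 2 * (b - x) ^ 2) * hnQ
    linear_combination (y - T.eval x) * h3 - a' * G.eval x * h1 + l.eval x * h2
  have g00 : ∀ z ∈ Ω, g z 0 0 = G.eval (z 0) := fun z hz => by
    rw [(h.cometric_shear hz).1, hG]
  have g01 : ∀ z ∈ Ω, g z 0 1 = l.eval (z 0) * z 1 + r.eval (z 0) := fun z hz => by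
    rw [(h.cometric_shear hz).2.1, g00 z hz]
    simp only [hr, eval_sub, eval_mul, hl, halfSlope]
    ring
  have g10 : ∀ z ∈ Ω, g z 1 0 = l.eval (z 0) * z 1 + r.eval (z 0) := fun z hz => by
    rw [(h.cometric_shear hz).2.2.1, g00 z hz]
    simp only [hr, eval_sub, eval_mul, hl, halfSlope]
    ring
  have g11 : ∀ z ∈ Ω, g z 1 1 = a' * z 1 ^ 2 + p₂.eval (z 0) * z 1 + q₂.eval (z 0) := fun z hz => by
    have hx : z 0 ∈ Ioo a b := (hΩ ▸ hz).1
    rw [(h.cometric_shear hz).2.2.2, g00 z hz, g01 z hz, g10 z hz]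
    have h1 := hS₂ _ hx
    have h2 : S₂.derivative.eval (z 0) = 2 * l.eval (z 0) * s (z 0) ^ 2 / G.eval (z 0) :=
      eq_div_of_mul_eq (hGpos _ hx).ne' (by rw [mul_comm]; exact hS₂' _ hx)
    have h3 : κ * ((lam * jac a b (m / 2) (n / 2) (z 0)) ^ 2 * halfSlope a b m n (z 0) ^ 2 /
        ((b - z 0) * (z 0 - a))) = l.eval (z 0) ^ 2 * s (z 0) ^ 2 / G.eval (z 0) := by
      have h1 := (sub_pos.2 hx.1).ne'
      have h2 := (sub_pos.2 hx.2).ne'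
      rw [hl, hG, halfSlope]
      simp only [hs]
      field_simp
    simp only [hr, hp₂, hq₂, eval_add, eval_sub, eval_mul, eval_C, eval_pow, h1, h2]
    rw [mul_sub κ, h3]
    ring
  have hρ : ∀ z ∈ Ω, ρ z = C * lam ^ (p + q - 1) * (jac a b M N (z 0) *
      jac (-1) 1 (q - 1) (p - 1) ((z 1 - T.eval (z 0)) / s (z 0)) / s (z 0)) :=
    fun z hz => h.density_shear hz
  have hC' : 0 < C * lam ^ (p + q - 1) := mul_pos h.C_pos (Real.rpow_pos_of_pos h.lam_pos _)
  have hρpos : ∀ z ∈ Ω, 0 < ρ z := fun z hz => by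
    have hz' := hΩ ▸ hz
    rw [hρ z hz]
    exact mul_pos hC' (div_pos (mul_pos (jac_pos hz'.1) (jac_pos (mem_Ioo_of_mem_strip hspos hz')))
      (hspos _ hz'.1))
  have hsum : ∀ z ∈ Ω, _ := fun z hz => sum_fderiv_strip hGpos hspos hsd htd hwd
    (hΩ ▸ g00) (hΩ ▸ g01) (hΩ ▸ g10) (hΩ ▸ g11) (hΩ ▸ hρ) hdet (hΩ ▸ hz)
  refine ⟨G, l, r, p₂, q₂, β, d, a', c', M, N, C * lam ^ (p + q - 1), ⟨h.lt, hκ, h.lam_pos, hp, hq,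
    hC', h.P_gt, h.Q_gt, hG, hl, hβ, T.continuous.measurable, htd, hΩ, g00, g01, g10, g11,
    fun z hz => ?_, fun z hz => ?_, fun x hx => ?_, hdet, hfib, hρ⟩, ?_, ?_⟩
  · refine mul_left_cancel₀ (hρpos z hz).ne' ?_
    rw [hdiv z hz 0, (hsum z hz).1]
  · have hx : z 0 ∈ Ioo a b := (hΩ ▸ hz).1
    refine mul_left_cancel₀ (mul_pos (hGpos _ hx) (hρpos z hz)).ne' ?_
    have h1 := (hsum z hz).2
    rw [← hdiv z hz 1] at h1
    have h3 := hfib _ hx (z 1)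
    unfold fibreFun at h3
    linear_combination h1 - ρ z * h3
  · have h1 := mul_lt_mul_of_pos_left (h.c_lt x hx) (sq_pos_of_pos hκ)
    rw [hG, hl]
    unfold halfSlope at h1
    linear_combination h1
  · rcases eq_or_ne m 0 with hm | hm
    · exact Or.inl (by simp [hm])
    · refine Or.inr ?_
      have : (0 : ℝ) < m := by positivity
      rw [hM, h.P_eq hm, show 0 + (m : ℝ) / 2 * (p + q - 1) + m / 2 = m / 2 * (p + q) by ring]
      positivity
  · rcases eq_or_ne n 0 with hn | hn
    · exact Or.inl (by simp [hn])
    · refine Or.inr ?_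
      have : (0 : ℝ) < n := by positivity
      rw [hN, h.Q_eq hn, show 0 + (n : ℝ) / 2 * (p + q - 1) + n / 2 = n / 2 * (p + q) by ring]
      positivity

end ToStrip

section Degree

variable {d : ℕ} {w : Fin d → ℝ} {n k : ℝ} {P R : MvPolynomial (Fin d) ℝ}

/-! ### Operators with polynomial coefficients -/

theorem mul_mem_weightedDegreeLE (hP : P ∈ weightedDegreeLE w n) (hR : R ∈ weightedDegreeLE w k) :
    P * R ∈ weightedDegreeLE w (n + k) := by
  rw [mem_weightedDegreeLE] at *
  intro e he
  obtain ⟨e₁, h₁, e₂, h₂, rfl⟩ := Finset.mem_add.1 (MvPolynomial.support_mul P R he)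
  have := add_le_add (hP e₁ h₁) (hR e₂ h₂)
  simpa [mul_add, Finset.sum_add_distrib] using this

theorem pderiv_mem_weightedDegreeLE (hP : P ∈ weightedDegreeLE w n) (i : Fin d) :
    MvPolynomial.pderiv i P ∈ weightedDegreeLE w (n - w i) := by
  rw [mem_weightedDegreeLE] at *
  intro e he
  have h1 : e + Finsupp.single i 1 ∈ P.support := by
    by_contra h
    rw [MvPolynomial.notMem_support_iff] at h
    rw [MvPolynomial.mem_support_iff, MvPolynomial.coeff_pderiv, h] at he
    simp at he
  have h2 := hP _ h1
  simp only [Finsupp.add_apply, Nat.cast_add, mul_add, Finset.sum_add_distrib] at h2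
  have h3 : ∑ j, w j * ((Finsupp.single i 1 : Fin d →₀ ℕ) j : ℝ) = w i := by
    rw [Finset.sum_eq_single i (fun j _ hj => by simp [hj.symm])
      (fun h => absurd (Finset.mem_univ i) h)]
    simp
  linarith

/-- The differential operator with polynomial coefficients `A i j` and `B i`. -/
noncomputable def polynomialOp (A : Fin d → Fin d → MvPolynomial (Fin d) ℝ)
    (B : Fin d → MvPolynomial (Fin d) ℝ) :
    MvPolynomial (Fin d) ℝ →ₗ[ℝ] MvPolynomial (Fin d) ℝ :=
  (∑ i, ∑ j, LinearMap.mulLeft ℝ (A i j) ∘ₗ (MvPolynomial.pderiv i).toLinearMap ∘ₗ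
      (MvPolynomial.pderiv j).toLinearMap) +
    ∑ i, LinearMap.mulLeft ℝ (B i) ∘ₗ (MvPolynomial.pderiv i).toLinearMap

variable {A : Fin d → Fin d → MvPolynomial (Fin d) ℝ} {B : Fin d → MvPolynomial (Fin d) ℝ}

theorem polynomialOp_apply (P : MvPolynomial (Fin d) ℝ) : polynomialOp A B P =
    (∑ i, ∑ j, A i j * MvPolynomial.pderiv i (MvPolynomial.pderiv j P)) +
      ∑ i, B i * MvPolynomial.pderiv i P := by
  simp [polynomialOp]

theorem polynomialOp_mem (hA : ∀ i j, A i j ∈ weightedDegreeLE w (w i + w j))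
    (hB : ∀ i, B i ∈ weightedDegreeLE w (w i)) (hP : P ∈ weightedDegreeLE w n) :
    polynomialOp A B P ∈ weightedDegreeLE w n := by
  rw [polynomialOp_apply]
  refine Submodule.add_mem _ (Submodule.sum_mem _ fun i _ => Submodule.sum_mem _ fun j _ => ?_)
    (Submodule.sum_mem _ fun i _ => ?_)
  · have := mul_mem_weightedDegreeLE (hA i j)
      (pderiv_mem_weightedDegreeLE (pderiv_mem_weightedDegreeLE hP j) i)
    rwa [show w i + w j + (n - w j - w i) = n by ring] at this
  · have := mul_mem_weightedDegreeLE (hB i) (pderiv_mem_weightedDegreeLE hP i)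
    rwa [add_sub_cancel] at this

/-- An operator whose coordinate functions satisfy the integration by parts formula is
symmetric. -/
theorem integral_polynomialOp_symm {μ : Measure (Fin d → ℝ)}
    (hint : ∀ P : MvPolynomial (Fin d) ℝ, Integrable (fun z => MvPolynomial.eval z P) μ)
    (hA : ∀ i j, A i j = A j i)
    (h : ∀ i (φ : MvPolynomial (Fin d) ℝ),
      ∫ z, MvPolynomial.eval z (B i * φ + ∑ j, A i j * MvPolynomial.pderiv j φ) ∂μ = 0)
    (P R : MvPolynomial (Fin d) ℝ) :
    ∫ z, MvPolynomial.eval z (polynomialOp A B P) * MvPolynomial.eval z R ∂μ =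
      ∫ z, MvPolynomial.eval z P * MvPolynomial.eval z (polynomialOp A B R) ∂μ := by
  -- Γ is the carré du champ. Applying the coordinate identities to φ = (∂ᵢP) R and summing over i
  -- gives ∫ (LP) R = -∫ Γ(P, R), which is symmetric in P and R.
  let Γ : MvPolynomial (Fin d) ℝ → MvPolynomial (Fin d) ℝ → MvPolynomial (Fin d) ℝ := fun P R =>
    ∑ i, ∑ j, A i j * (MvPolynomial.pderiv i P * MvPolynomial.pderiv j R)
  have hΓ : ∀ P R, Γ P R = Γ R P := fun P R => by
    simp only [Γ]
    rw [Finset.sum_comm]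
    refine Finset.sum_congr rfl fun i _ => Finset.sum_congr rfl fun j _ => ?_
    rw [hA j i, mul_comm (MvPolynomial.pderiv j P)]
  have key : ∀ P R : MvPolynomial (Fin d) ℝ,
      ∫ z, MvPolynomial.eval z (polynomialOp A B P) * MvPolynomial.eval z R ∂μ =
        -∫ z, MvPolynomial.eval z (Γ P R) ∂μ := by
    intro P R
    have e : polynomialOp A B P * R + Γ P R = ∑ i, (B i * (MvPolynomial.pderiv i P * R) +
        ∑ j, A i j * MvPolynomial.pderiv j (MvPolynomial.pderiv i P * R)) := by
      have e1 : ∑ i, ∑ j, A i j * MvPolynomial.pderiv i (MvPolynomial.pderiv j P) =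
          ∑ i, ∑ j, A i j * MvPolynomial.pderiv j (MvPolynomial.pderiv i P) := by
        rw [Finset.sum_comm]
        exact Finset.sum_congr rfl fun i _ => Finset.sum_congr rfl fun j _ => by rw [hA j i]
      simp only [polynomialOp_apply, e1, Γ, Derivation.leibniz, smul_eq_mul, mul_add,
        Finset.sum_add_distrib, add_mul, Finset.sum_mul]
      have e2 : ∀ i j, A i j * (R * MvPolynomial.pderiv j (MvPolynomial.pderiv i P)) =
        A i j * MvPolynomial.pderiv j (MvPolynomial.pderiv i P) * R := fun i j => by ring
      have e3 : ∀ i, B i * (MvPolynomial.pderiv i P * R) = B i * MvPolynomial.pderiv i P * R :=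
        fun i => by ring
      simp only [e2, e3]
      abel
    rw [eq_neg_iff_add_eq_zero]
    simp only [← map_mul]
    rw [← integral_add (hint _) (hint _)]
    simp only [← map_add]
    rw [e]
    simp only [map_sum (MvPolynomial.eval _)]
    rw [integral_finsetSum _ fun i _ => hint _]
    exact Finset.sum_eq_zero fun i _ => h i _
  rw [key, hΓ, ← key R P]
  simp only [mul_comm]

end Degree

/-! ### Verification of the DOP property on a strip -/

theorem aeval_mul_X_pow_mem {w n : ℝ} (f : Polynomial ℝ) (k : ℕ) (h : f.natDegree + w * k ≤ n) :
    Polynomial.aeval (MvPolynomial.X 0) f * MvPolynomial.X 1 ^ k ∈ weightedDegreeLE ![1, w] n := by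
  rw [Polynomial.aeval_eq_sum_range, Finset.sum_mul]
  refine Submodule.sum_mem _ fun i hi => ?_
  rw [smul_mul_assoc]
  refine Submodule.smul_mem _ _ (X_pow_mul_X_pow_mem i k (le_trans ?_ h))
  have : (i : ℝ) ≤ f.natDegree := by exact_mod_cast Finset.mem_range_succ_iff.1 hi
  linarith

theorem posDef_of_det_pos {M : Matrix (Fin 2) (Fin 2) ℝ} (h : M 1 0 = M 0 1) (h0 : 0 < M 0 0)
    (hdet : 0 < M 0 0 * M 1 1 - M 0 1 ^ 2) : M.PosDef := by
  refine Matrix.PosDef.of_dotProduct_mulVec_pos ?_ fun x hx => ?_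
  · ext i j
    fin_cases i <;> fin_cases j <;> simp [h]
  · have e : star x ⬝ᵥ M.mulVec x = M 0 0 * x 0 ^ 2 + 2 * M 0 1 * (x 0 * x 1) + M 1 1 * x 1 ^ 2 := by
      simp [dotProduct, Matrix.mulVec, Fin.sum_univ_two, h]
      ring
    rw [e]
    refine pos_of_mul_pos_right (a := M 0 0) ?_ h0.le
    have e2 : M 0 0 * (M 0 0 * x 0 ^ 2 + 2 * M 0 1 * (x 0 * x 1) + M 1 1 * x 1 ^ 2) =
        (M 0 0 * x 0 + M 0 1 * x 1) ^ 2 + (M 0 0 * M 1 1 - M 0 1 ^ 2) * x 1 ^ 2 := by ring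
    rw [e2]
    rcases eq_or_ne (x 1) 0 with h1 | h1
    · have h2 : x 0 ≠ 0 := fun h2 => hx (by ext i; fin_cases i <;> simp [h1, h2])
      rw [h1]
      have : 0 < (M 0 0 * x 0) ^ 2 := by positivity
      linarith
    · have : 0 < (M 0 0 * M 1 1 - M 0 1 ^ 2) * x 1 ^ 2 := by positivity
      nlinarith [sq_nonneg (M 0 0 * x 0 + M 0 1 * x 1)]

namespace StripSolution

variable {Ω : Set (Fin 2 → ℝ)} {g : (Fin 2 → ℝ) → Matrix (Fin 2) (Fin 2) ℝ}
    {b : (Fin 2 → ℝ) → Fin 2 → ℝ} {ρ : (Fin 2 → ℝ) → ℝ} {G l r p q β d T : Polynomial ℝ}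
    {a c xl xr κ e₁ e₂ M N lam p' q' C : ℝ}

open Polynomial in
theorem natDegree_le (S : StripSolution Ω g b ρ G l r p q β d a c xl xr κ e₁ e₂ M N lam
    p' q' C fun x => T.eval x) :
    G.natDegree ≤ 2 ∧ l.natDegree ≤ 1 ∧ β.natDegree ≤ 1 := by
  have hG : G = Polynomial.C κ * ((Polynomial.C xr - X) * (X - Polynomial.C xl)) :=
    Polynomial.funext fun x => by simp [S.G_eq]
  have hl : l = Polynomial.C κ * (Polynomial.C e₂ * (Polynomial.C xr - X) -
      Polynomial.C e₁ * (X - Polynomial.C xl)) := Polynomial.funext fun x => by simp [S.l_eq]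
  have hβ : β = Polynomial.C κ * (Polynomial.C (N + 1) * (Polynomial.C xr - X) -
      Polynomial.C (M + 1) * (X - Polynomial.C xl)) := Polynomial.funext fun x => by simp [S.β_eq]
  refine ⟨?_, ?_, ?_⟩
  · rw [hG]; compute_degree
  · rw [hl]; compute_degree
  · rw [hβ]; compute_degree

theorem isOneInftyDOPSolution (S : StripSolution Ω g b ρ G l r p q β d a c xl xr κ e₁ e₂ M N lam
    p' q' C fun x => T.eval x) (he₁ : 0 ≤ e₁) (he₂ : 0 ≤ e₂) (h₁ : e₁ = 0 ∨ 0 < M + e₁)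
    (h₂ : e₂ = 0 ∨ 0 < N + e₂) (hmass : densityMeasure Ω ρ univ = 1) :
    IsOneInftyDOPSolution Ω g b ρ ∧ Bornology.IsBounded Ω := by
  have hsc : Continuous fun x => lam * jac xl xr e₁ e₂ x :=
    continuous_const.mul (continuous_jac he₁ he₂)
  set s : ℝ → ℝ := fun x => lam * jac xl xr e₁ e₂ x with hs
  set t : ℝ → ℝ := fun x => T.eval x with ht
  have htc : Continuous t := T.continuous
  have hΩs : Ω = strip xl xr s t := S.eq_strip
  have hspos : ∀ x ∈ Ioo xl xr, 0 < s x := fun x hx => mul_pos S.lam_pos (jac_pos hx)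
  have hopen : IsOpen Ω := hΩs ▸ isOpen_strip hsc.continuousOn htc.continuousOn
  have hconn : IsConnected Ω := hΩs ▸ isConnected_strip S.lt hsc.continuousOn htc.continuousOn hspos
  have hbdd : Bornology.IsBounded Ω := hΩs ▸ isBounded_strip hsc.continuousOn htc.continuousOn
  have hprob : IsProbabilityMeasure (densityMeasure Ω ρ) := ⟨hmass⟩
  have hfin : IsFiniteMeasure (densityMeasure Ω ρ) := inferInstance
  have h0 : Continuous fun z : Fin 2 → ℝ => z 0 := continuous_apply 0
  have h1 : Continuous fun z : Fin 2 → ℝ => z 1 := continuous_apply 1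
  have hxI : ∀ z ∈ Ω, z 0 ∈ Ioo xl xr := fun z hz => (hΩs ▸ hz).1
  have huI : ∀ z ∈ Ω, (z 1 - t (z 0)) / s (z 0) ∈ Ioo (-1 : ℝ) 1 := fun z hz =>
    mem_Ioo_of_mem_strip hspos (hΩs ▸ hz)
  have hρc : ContinuousOn ρ Ω := by
    refine ContinuousOn.congr ?_ S.density_eq
    have hne : ∀ z ∈ Ω, s (z 0) ≠ 0 := fun z hz => (hspos _ (hxI z hz)).ne'
    exact continuousOn_const.mul (((continuousOn_jac.comp h0.continuousOn hxI).mul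
      (continuousOn_jac.comp ((h1.sub (htc.comp h0)).continuousOn.div (hsc.comp h0).continuousOn hne)
        huI)).div (hsc.comp h0).continuousOn hne)
  have hρ0 : ∀ z ∈ Ω, 0 < ρ z := fun z hz => by
    rw [S.density_eq z hz]
    exact mul_pos S.C_pos (div_pos (mul_pos (jac_pos (hxI z hz)) (jac_pos (huI z hz)))
      (hspos _ (hxI z hz)))
  -- the coefficients as polynomials in two variables
  let em : Polynomial ℝ → MvPolynomial (Fin 2) ℝ := fun f => Polynomial.aeval (MvPolynomial.X 0) f
  have hem : ∀ f z, MvPolynomial.eval z (em f) = f.eval (z 0) := fun f z => by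
    simpa using (pderiv_aeval_X_mul_pow f 0 z).1
  let Y : MvPolynomial (Fin 2) ℝ := MvPolynomial.X 1
  let A : Fin 2 → Fin 2 → MvPolynomial (Fin 2) ℝ :=
    ![![em G * Y ^ 0, em l * Y ^ 1 + em r * Y ^ 0], ![em l * Y ^ 1 + em r * Y ^ 0,
      em (Polynomial.C a) * Y ^ 2 + em p * Y ^ 1 + em q * Y ^ 0]]
  let B : Fin 2 → MvPolynomial (Fin 2) ℝ :=
    ![em β * Y ^ 0, em (Polynomial.C c) * Y ^ 1 + em d * Y ^ 0]
  have hA : ∀ i j, A i j = A j i := fun i j => by fin_cases i <;> fin_cases j <;> rfl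
  have hgA : ∀ z ∈ Ω, ∀ i j, g z i j = MvPolynomial.eval z (A i j) := fun z hz i j => by
    fin_cases i <;> fin_cases j <;>
      simp [A, Y, hem, S.g00 z hz, S.g01 z hz, S.g10 z hz, S.g11 z hz]
  have hbB : ∀ z ∈ Ω, ∀ i, b z i = MvPolynomial.eval z (B i) := fun z hz i => by
    fin_cases i <;> simp [B, Y, hem, S.b0 z hz, S.b1 z hz]
  obtain ⟨hG2, hl1, hβ1⟩ := S.natDegree_le
  -- Any w > 2 that dominates the degrees of r, p, q and d serves: these polynomials in x then fit
  -- into the weights 1 + w, w, 2w and w allowed for their entries.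
  set w : ℝ := 3 + r.natDegree + p.natDegree + q.natDegree + d.natDegree with hw
  have hG2' : (G.natDegree : ℝ) ≤ 2 := by exact_mod_cast hG2
  have hl1' : (l.natDegree : ℝ) ≤ 1 := by exact_mod_cast hl1
  have hβ1' : (β.natDegree : ℝ) ≤ 1 := by exact_mod_cast hβ1
  have n1 : (0 : ℝ) ≤ r.natDegree := Nat.cast_nonneg _
  have n2 : (0 : ℝ) ≤ p.natDegree := Nat.cast_nonneg _
  have n3 : (0 : ℝ) ≤ q.natDegree := Nat.cast_nonneg _
  have n4 : (0 : ℝ) ≤ d.natDegree := Nat.cast_nonneg _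
  have hAmem : ∀ i j, A i j ∈ weightedDegreeLE ![1, w] (![1, w] i + ![1, w] j) := fun i j => by
    have h01 : em l * Y ^ 1 + em r * Y ^ 0 ∈ weightedDegreeLE ![1, w] (1 + w) :=
      Submodule.add_mem _ (aeval_mul_X_pow_mem l 1 (by push_cast; linarith))
        (aeval_mul_X_pow_mem r 0 (by push_cast; linarith))
    fin_cases i <;> fin_cases j
    · exact aeval_mul_X_pow_mem G 0 (by simp; linarith)
    · exact h01
    · have := add_comm w 1 ▸ h01
      exact this
    · exact Submodule.add_mem _ (Submodule.add_mem _
        (aeval_mul_X_pow_mem (Polynomial.C a) 2 (by simp; linarith))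
        (aeval_mul_X_pow_mem p 1 (by simp; linarith)))
        (aeval_mul_X_pow_mem q 0 (by simp; linarith))
  have hBmem : ∀ i, B i ∈ weightedDegreeLE ![1, w] (![1, w] i) := fun i => by
    fin_cases i
    · exact aeval_mul_X_pow_mem β 0 (by simp; linarith)
    · exact Submodule.add_mem _ (aeval_mul_X_pow_mem (Polynomial.C c) 1 (by simp))
        (aeval_mul_X_pow_mem d 0 (by simp; linarith))
  have hint : ∀ P : MvPolynomial (Fin 2) ℝ,
      Integrable (fun z => MvPolynomial.eval z P) (densityMeasure Ω ρ) := fun P =>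
    integrable_of_continuous_of_isBounded hopen hbdd hfin (MvPolynomial.continuous_eval P)
  have hids : ∀ i (φ : MvPolynomial (Fin 2) ℝ),
      ∫ z, MvPolynomial.eval z (B i * φ + ∑ j, A i j * MvPolynomial.pderiv j φ)
        ∂densityMeasure Ω ρ = 0 := fun i φ => by
    fin_cases i
    · rw [← S.integral_first_coordinate he₁ he₂ φ]
      refine integral_congr_ae (ae_of_all _ fun z => ?_)
      simp [A, B, Y, hem, Fin.sum_univ_two]
      ring
    · rw [← S.integral_second_coordinate he₁ he₂ h₁ h₂ φ]
      refine integral_congr_ae (ae_of_all _ fun z => ?_)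
      simp [A, B, Y, hem, Fin.sum_univ_two]
      ring
  have hwpos : ∀ i, 0 < (![1, w] : Fin 2 → ℝ) i := fun i => by
    fin_cases i
    · exact one_pos
    · show 0 < w
      linarith
  refine ⟨⟨w, by linarith, ⟨hwpos, hopen, hconn, ?_, ?_, ?_, fun z hz => ?_, hρc,
    fun z hz => (hρ0 z hz).le, hprob, fun P => ?_, fun f hf ε hε => ?_, fun n => ?_⟩⟩, hbdd⟩
  · rw [hΩs]; exact interior_closure_strip hsc htc
  · exact continuousOn_pi.2 fun i => continuousOn_pi.2 fun j =>
      (MvPolynomial.continuous_eval _).continuousOn.congr fun z hz => hgA z hz i j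
  · exact continuousOn_pi.2 fun i =>
      (MvPolynomial.continuous_eval _).continuousOn.congr fun z hz => hbB z hz i
  · refine posDef_of_det_pos ((S.g10 z hz).trans (S.g01 z hz).symm) ?_ ?_
    · rw [S.g00 z hz]; exact S.G_pos (hxI z hz)
    · have h3 := S.det_eq _ (hxI z hz) (z 1)
      have h4 := S.leadingCoeff_neg _ (hxI z hz)
      have h5 : (z 1 - t (z 0)) ^ 2 < s (z 0) ^ 2 :=
        sq_lt_sq.2 ((hΩs ▸ hz).2.trans_le (le_abs_self _))
      unfold detFun at h3
      rw [S.g00 z hz, S.g01 z hz, S.g11 z hz, h3]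
      exact mul_pos_of_neg_of_neg h4 (sub_neg.2 h5)
  · obtain ⟨K, hK⟩ := hbdd.isCompact_closure.exists_bound_of_continuousOn
      (MvPolynomial.continuous_eval P).continuousOn
    refine MemLp.of_bound (MvPolynomial.continuous_eval P).aestronglyMeasurable K ?_
    filter_upwards [ae_mem_densityMeasure hopen] with z hz using hK z (subset_closure hz)
  · exact exists_mvPolynomial_eLpNorm_sub_lt hopen hbdd hfin hf hε
  · refine exists_eigenbasis_of_symmetric hwpos hopen hconn.nonempty hbdd hfin hρc hρ0 n
      (polynomialOp A B) (fun P hP => polynomialOp_mem hAmem hBmem hP) (fun P z hz => ?_)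
      (integral_polynomialOp_symm hint hA hids)
    rw [polynomialOp_apply, diffusionOp]
    simp only [map_add, map_sum, map_mul, hgA z hz, hbB z hz]

end StripSolution

end WeightedDOP

theorem theorem6p2 (Ω : Set (Fin 2 → ℝ)) (g : (Fin 2 → ℝ) → Matrix (Fin 2) (Fin 2) ℝ)
    (b : (Fin 2 → ℝ) → Fin 2 → ℝ) (ρ : (Fin 2 → ℝ) → ℝ) :
    (IsOneInftyDOPSolution Ω g b ρ ∧ Bornology.IsBounded Ω) ↔
      HasDivergenceForm Ω g b ρ ∧
      ∃ (Φ : AdmissibleChange) (κ : ℝ), 0 < κ ∧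
        ((∃ (m n : ℕ) (c : ℝ), 1 ≤ m ∧ 1 ≤ n ∧ c < 0 ∧
            Φ.toEquiv '' Ω = biangle m n ∧
            IsOnlyBoundedComponent (biangle m n) (biangleGamma m n) ∧
            (∀ z ∈ biangle m n, Φ.pushCometric g z = κ • biangleCometric m n c z) ∧
            IsBiangleDensity m n (Φ.pushDensity ρ)) ∨
          (∃ (n : ℕ) (c : ℝ), 1 ≤ n ∧ c ≤ 0 ∧
            Φ.toEquiv '' Ω = triangle n ∧
            IsOnlyBoundedComponent (triangle n) (triangleGamma n) ∧
            (∀ z ∈ triangle n, Φ.pushCometric g z = κ • triangleCometric n c z) ∧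
            IsTriangleDensity n (Φ.pushDensity ρ)) ∨
          (∃ c : ℝ, c < 0 ∧
            Φ.toEquiv '' Ω = square ∧
            (∀ z ∈ square, Φ.pushCometric g z = κ • squareCometric c z) ∧
            IsSquareDensity (Φ.pushDensity ρ))) := by
  constructor
  · rintro ⟨h, hb⟩
    obtain ⟨G, l, r, p, q, β, d, a, c, S⟩ :=
      WeightedDOP.IsOneInftyDOPSolution.exists_planeSolution h hb
    obtain ⟨xl, xr, κ, e₁, e₂, M, N, lam, p', q', C, t, S'⟩ := S.exists_stripSolution
    obtain ⟨T, m, n, P, Q, C', hgen⟩ := S'.exists_isGeneral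
    obtain ⟨w, -, hw⟩ := h
    exact ⟨S'.hasDivergenceForm, hgen.exists_isModel hw.isOpen.measurableSet
      hw.isProbabilityMeasure.measure_univ⟩
  · rintro ⟨hdiv, Φ, κ, hκ, hmodel⟩
    obtain ⟨a, b, m, n, c, P, Q, p, q, C, hgen, hmass⟩ :=
      WeightedDOP.IsModel.exists_isGeneral hmodel hκ
    obtain ⟨T, a, b, lam, m, n, P, Q, p, q, C, hgen⟩ := hgen.exists_shear
    -- The models prescribe only the cometric and the density; the divergence form determines the
    -- drift.
    obtain ⟨G, l, r, p₂, q₂, β, d, a', c', M, N, C', S, h₁, h₂⟩ := hgen.exists_stripSolution hdiv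
    exact S.isOneInftyDOPSolution (by positivity) (by positivity) h₁ h₂ hmass
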